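/- **Theorem 4.1.** Let $G$ be a complex affine algebraic group with Lie algebra $\mathfrak g$, let $Z\in\mathfrak g$ be semisimple, and let $f\in[Z,\mathfrak g]$ (that is, the component of $f$ in the centraliser of $Z$, with respect to $\mathfrak g=\mathfrak g^Z\oplus[Z,\mathfrak g]$, is zero). Consider the connection $\nabla=d-\left(\frac{Z}{t^2}+\frac{f}{t}\right)dt$ on the trivial principal $G$-bundle over $\mathbb P^1$. *Stokes factors.* The Stokes rays of $\nabla$ are the rays $\mathbb R_{>0}\zeta$, where $\zeta$ is a non-zero eigenvalue of $\operatorname{ad}(Z)$ on $\mathfrak g$; any other ray is admissible. For a ray $r$ let $\mathbb H_r=\{uv: u\in r,\ \Re v>0\}$. For $r$ admissible, $Y_r:\mathbb H_r\to G$ denotes the holomorphic solution of $\frac{dY_r}{dt}=\left(\frac{Z}{t^2}+\frac{f}{t}\right)Y_r$ such that $Y_r\,e^{Z/t}\to1$ as $t\to0$ in $\mathbb H_r$. Let $\ell$ be a Stokes ray, and let $r_+$ (resp. $r_-$) be a small clockwise (resp. anticlockwise) perturbation of $\ell$, by an angle in $(0,\pi/2)$, such that the closed convex sector bounded by $r_\pm$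 contains no Stokes ray other than $\ell$. The Stokes factor $S_\ell\in G$ is the element with $Y_{r_+}(t)=Y_{r_-}(t)\,S_\ell$ for $t\in\mathbb H_{r_+}\cap\mathbb H_{r_-}$. *Roots.* Let $H\subset G$ be a torus whose Lie algebra $\mathfrak h$ contains $Z$, let $\mathfrak g=\mathfrak g_0\oplus\bigoplus_{\alpha\in\Phi}\mathfrak g_\alpha$ with $\Phi\subset\mathfrak h^*\setminus\{0\}$ be the root space decomposition, let $f_\alpha\in\mathfrak g_\alpha$ be the components of $f$, write $Z(\alpha)=\alpha(Z)$, and set $\Phi^Z=\{\alpha\in\Phi: Z(\alpha)\ne0\}$. *The functions $M_n$.* For $n\ge1$ and $z_1,\dots,z_n\in\mathbb C^*$ put $s_i=z_1+\cdots+z_i$ and $$M_n(z_1,\dots,z_n)=(-1)^{n-1}\,2\pi i\int_C\frac{dt}{t-s_1}\circ\cdots\circ\frac{dt}{t-s_{n-1}},\qquad M_1=2\pi i,$$ where $\int_C\omega_1\circ\cdots\circ\omega_k=\int_{0\le u_1\le\cdots\le u_k\le1}C^*\omega_1(u_1)\cdots C^*\omega_k(u_k)$ is the iterated integral and $C$ is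 the line segment from $0$ to $s_n$, perturbed by small clockwise arcs around the points $s_i\in(0,s_n)$. Then, for every Stokes ray $\ell$, the Stokes factor $S_\ell$ exists, is unique and does not depend on the choice of $r_\pm$, and $$S_\ell=1+\sum_{n\ge1}\ \sum_{\substack{\alpha_1,\dots,\alpha_n\in\Phi^Z\\ Z(\alpha_1+\cdots+\alpha_n)\in\ell}}M_n(Z(\alpha_1),\dots,Z(\alpha_n))\,f_{\alpha_1}\cdots f_{\alpha_n},$$ where the equality holds in every finite-dimensional rational representation of $G$ and the sum over $n$ is absolutely convergent. -/

import Mathlib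

open scoped Topology

noncomputable section

namespace StokesFactors

variable {N : ℕ}

/-! ### Complex affine algebraic groups, realised as Zariski closed subgroups of `GL_N(ℂ)` -/

/-- The value at a matrix `A` of a polynomial in the `N²` matrix entries. -/
def polyEval (p : MvPolynomial (Fin N × Fin N) ℂ) (A : Matrix (Fin N) (Fin N) ℂ) : ℂ :=
  MvPolynomial.eval (fun ij => A ij.1 ij.2) p

/-- A linear algebraic group: a subgroup of `GL_N(ℂ)` cut out by polynomial equations in the
matrix entries. -/
structure AlgGroup (N : ℕ) where
  toSubgroup : Subgroup (Matrix.GeneralLinearGroup (Fin N) ℂ)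
  isZariskiClosed : ∃ P : Set (MvPolynomial (Fin N × Fin N) ℂ),
    ∀ g : Matrix.GeneralLinearGroup (Fin N) ℂ,
      g ∈ toSubgroup ↔ ∀ p ∈ P, polyEval p (g : Matrix (Fin N) (Fin N) ℂ) = 0

/-- The underlying matrix of an element of an algebraic group. -/
def AlgGroup.mat {G : AlgGroup N} (g : G.toSubgroup) : Matrix (Fin N) (Fin N) ℂ :=
  ((g : Matrix.GeneralLinearGroup (Fin N) ℂ) : Matrix (Fin N) (Fin N) ℂ)

/-- The Lie algebra of `G`: the Zariski tangent space at `1`, that is, the matrices `X` such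
that the differential at `1` of every polynomial vanishing on `G` is zero on `X`. -/
def lieAlg (G : AlgGroup N) : Submodule ℂ (Matrix (Fin N) (Fin N) ℂ) where
  carrier := {X | ∀ p : MvPolynomial (Fin N × Fin N) ℂ,
    (∀ g : G.toSubgroup, polyEval p (AlgGroup.mat g) = 0) →
      ∑ ij : Fin N × Fin N, polyEval (MvPolynomial.pderiv ij p) 1 * X ij.1 ij.2 = 0}
  zero_mem' := by intro p _; simp
  add_mem' := by
    intro X Y hX hY p hp
    have h1 := hX p hp
    have h2 := hY p hp
    simp only [Matrix.add_apply, mul_add, Finset.sum_add_distrib, h1, h2, add_zero]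
  smul_mem' := by
    intro c X hX p hp
    have h1 := hX p hp
    simp only [Matrix.smul_apply, smul_eq_mul, mul_left_comm _ c, ← Finset.mul_sum, h1, mul_zero]

/-- A regular function on `G`: an element of `ℂ[x_ij, det⁻¹]` restricted to `G`. -/
def IsRegular (G : AlgGroup N) (φ : G.toSubgroup → ℂ) : Prop :=
  ∃ (p : MvPolynomial (Fin N × Fin N) ℂ) (k : ℕ), ∀ g : G.toSubgroup,
    (AlgGroup.mat g).det ^ k * φ g = polyEval p (AlgGroup.mat g)

/-- A finite-dimensional rational representation of `G`, on `ℂ^m`. -/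
structure RationalRep (G : AlgGroup N) (m : ℕ) where
  toHom : G.toSubgroup →* Matrix.GeneralLinearGroup (Fin m) ℂ
  isRegular : ∀ i j, IsRegular G
    (fun g => (toHom g : Matrix (Fin m) (Fin m) ℂ) i j)

/-- `H` is a torus: it is isomorphic, as an algebraic group, to some `(ℂ^*)^k`. -/
def IsTorus (H : AlgGroup N) : Prop :=
  ∃ (k : ℕ) (e : (Fin k → ℂˣ) ≃* H.toSubgroup),
    (∀ i j, ∃ (p : MvPolynomial (Fin k) ℂ) (d : ℕ), ∀ x : Fin k → ℂˣ,
      (∏ a, (x a : ℂ)) ^ d * AlgGroup.mat (e x) i j =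
        MvPolynomial.eval (fun a => (x a : ℂ)) p) ∧
    ∀ a, IsRegular H (fun h => (e.symm h a : ℂ))

/-! ### The exponential map of `G` -/

theorem hasDerivAt_polyEval (p : MvPolynomial (Fin N × Fin N) ℂ)
    (γ : ℂ → Matrix (Fin N) (Fin N) ℂ) (γ' : Matrix (Fin N) (Fin N) ℂ) (s : ℂ)
    (h : ∀ i j, HasDerivAt (fun u => γ u i j) (γ' i j) s) :
    HasDerivAt (fun u => polyEval p (γ u))
      (∑ ij : Fin N × Fin N, polyEval (MvPolynomial.pderiv ij p) (γ s) * γ' ij.1 ij.2) s := by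
  induction p using MvPolynomial.induction_on with
  | C a => simpa [polyEval] using hasDerivAt_const s a
  | add p q hp hq =>
    have := hp.add hq
    simpa [polyEval, Pi.add_def, add_mul, Finset.sum_add_distrib] using this
  | mul_X p ij hp =>
    have := hp.mul (h ij.1 ij.2)
    refine (this.congr_deriv ?_).congr_of_eventuallyEq (Filter.Eventually.of_forall ?_)
    · have key : ∀ x : Fin N × Fin N,
          polyEval (MvPolynomial.pderiv x (p * MvPolynomial.X ij)) (γ s) * γ' x.1 x.2 =
          polyEval (MvPolynomial.pderiv x p) (γ s) * γ' x.1 x.2 * γ s ij.1 ij.2 +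
            (if x = ij then polyEval p (γ s) * γ' ij.1 ij.2 else 0) := by
        intro x
        by_cases hx : x = ij
        · subst hx
          simp [polyEval, Derivation.leibniz]
          ring
        · simp [polyEval, Derivation.leibniz, MvPolynomial.pderiv_X_of_ne (Ne.symm hx), hx]
          ring
      simp only [key, Finset.sum_add_distrib, Finset.sum_ite_eq', Finset.mem_univ, if_true,
        Finset.sum_mul]
    · intro u; simp [polyEval]

/-- The derivation `p ↦ (g ↦ dp_g(g X))` of the polynomial ring. -/
def leftInvDeriv (X : Matrix (Fin N) (Fin N) ℂ) (p : MvPolynomial (Fin N × Fin N) ℂ) :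
    MvPolynomial (Fin N × Fin N) ℂ :=
  ∑ ij : Fin N × Fin N, MvPolynomial.pderiv ij p *
    ∑ k, MvPolynomial.X (ij.1, k) * MvPolynomial.C (X k ij.2)

theorem polyEval_leftInvDeriv (X : Matrix (Fin N) (Fin N) ℂ)
    (p : MvPolynomial (Fin N × Fin N) ℂ) (A : Matrix (Fin N) (Fin N) ℂ) :
    polyEval (leftInvDeriv X p) A =
      ∑ ij : Fin N × Fin N, polyEval (MvPolynomial.pderiv ij p) A * (A * X) ij.1 ij.2 := by
  simp [leftInvDeriv, polyEval, Matrix.mul_apply]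

theorem leftInvDeriv_vanish (G : AlgGroup N) (X : lieAlg G)
    (p : MvPolynomial (Fin N × Fin N) ℂ)
    (hp : ∀ g : G.toSubgroup, polyEval p (AlgGroup.mat g) = 0) (g : G.toSubgroup) :
    polyEval (leftInvDeriv (X : Matrix (Fin N) (Fin N) ℂ) p) (AlgGroup.mat g) = 0 := by
  set q : MvPolynomial (Fin N × Fin N) ℂ := MvPolynomial.bind₁
    (fun ij => ∑ k, MvPolynomial.C (AlgGroup.mat g ij.1 k) * MvPolynomial.X (k, ij.2)) p with hq
  have hqe : ∀ A, polyEval q A = polyEval p (AlgGroup.mat g * A) := by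
    intro A
    simp only [polyEval, hq]
    rw [← MvPolynomial.aeval_eq_eval, ← MvPolynomial.aeval_eq_eval, MvPolynomial.aeval_bind₁]
    congr 2
    funext ij
    simp [Matrix.mul_apply]
  have h0 := X.2 q (fun g' => by
    rw [hqe]
    have := hp (g * g')
    simpa [AlgGroup.mat] using this)
  have hγ : ∀ i j, HasDerivAt
      (fun u : ℂ => (1 + u • (X : Matrix (Fin N) (Fin N) ℂ)) i j)
      ((X : Matrix (Fin N) (Fin N) ℂ) i j) 0 := by
    intro i j
    have := ((hasDerivAt_id (0 : ℂ)).mul_const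
      ((X : Matrix (Fin N) (Fin N) ℂ) i j)).const_add ((1 : Matrix (Fin N) (Fin N) ℂ) i j)
    simpa using this
  have hγ2 : ∀ i j, HasDerivAt
      (fun u : ℂ => (AlgGroup.mat g * (1 + u • (X : Matrix (Fin N) (Fin N) ℂ))) i j)
      ((AlgGroup.mat g * (X : Matrix (Fin N) (Fin N) ℂ)) i j) 0 := by
    intro i j
    simp only [Matrix.mul_apply]
    exact HasDerivAt.fun_sum fun k _ => (hγ k j).const_mul _
  have d1 := hasDerivAt_polyEval q _ _ 0 hγ
  have d2 := hasDerivAt_polyEval p _ _ 0 hγ2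
  simp only [hqe] at d1
  have := d1.unique d2
  simp only [zero_smul, add_zero, mul_one] at this
  rw [polyEval_leftInvDeriv, ← this]
  exact h0

theorem hasDerivAt_exp_entry (X : Matrix (Fin N) (Fin N) ℂ) (s : ℂ) (i j : Fin N) :
    HasDerivAt (fun u : ℂ => NormedSpace.exp (u • X) i j) ((NormedSpace.exp (s • X) * X) i j) s := by
  let _ : NormedRing (Matrix (Fin N) (Fin N) ℂ) := Matrix.linftyOpNormedRing
  let _ : NormedAlgebra ℂ (Matrix (Fin N) (Fin N) ℂ) := Matrix.linftyOpNormedAlgebra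
  have h := hasDerivAt_exp_smul_const (𝕂 := ℂ) X s
  have h2 := ((Matrix.entryLinearMap ℂ ℂ i j).toContinuousLinearMap.hasFDerivAt).comp_hasDerivAt s h
  exact h2

theorem exp_smul_vanish (G : AlgGroup N) (X : lieAlg G) (s : ℂ)
    (p : MvPolynomial (Fin N × Fin N) ℂ)
    (hp : ∀ g : G.toSubgroup, polyEval p (AlgGroup.mat g) = 0) :
    polyEval p (NormedSpace.exp (s • (X : Matrix (Fin N) (Fin N) ℂ))) = 0 := by
  set E : ℂ → Matrix (Fin N) (Fin N) ℂ :=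
    fun u => NormedSpace.exp (u • (X : Matrix (Fin N) (Fin N) ℂ)) with hE
  have hd : ∀ (q : MvPolynomial (Fin N × Fin N) ℂ) (u : ℂ),
      HasDerivAt (fun v => polyEval q (E v))
        (polyEval (leftInvDeriv (X : Matrix (Fin N) (Fin N) ℂ) q) (E u)) u := by
    intro q u
    rw [polyEval_leftInvDeriv]
    exact hasDerivAt_polyEval q E _ u (fun i j => hasDerivAt_exp_entry _ u i j)
  have hv : ∀ (k : ℕ) (q : MvPolynomial (Fin N × Fin N) ℂ),
      (∀ g : G.toSubgroup, polyEval q (AlgGroup.mat g) = 0) →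
      iteratedDeriv k (fun v => polyEval q (E v)) 0 = 0 := by
    intro k
    induction k with
    | zero =>
      intro q hq
      have := hq 1
      simpa [hE, AlgGroup.mat, NormedSpace.exp_zero] using this
    | succ k ih =>
      intro q hq
      rw [iteratedDeriv_succ']
      have : deriv (fun v => polyEval q (E v)) =
          fun v => polyEval (leftInvDeriv (X : Matrix (Fin N) (Fin N) ℂ) q) (E v) :=
        funext fun u => (hd q u).deriv
      rw [this]
      exact ih _ (leftInvDeriv_vanish G X q hq)
  have hdiff : Differentiable ℂ (fun v => polyEval p (E v)) :=
    fun u => (hd p u).differentiableAt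
  have ht := Complex.taylorSeries_eq_of_entire' (c := 0) (z := s) hdiff
  simp only [hv _ p hp, mul_zero, zero_mul, tsum_zero] at ht
  exact ht.symm

/-- The one-parameter subgroup `s ↦ exp(sX)` of `G` generated by `X ∈ 𝔤`. -/
def expG {G : AlgGroup N} (X : lieAlg G) (s : ℂ) : G.toSubgroup :=
  ⟨(Matrix.isUnit_exp (s • (X : Matrix (Fin N) (Fin N) ℂ))).unit, by
    obtain ⟨P, hP⟩ := G.isZariskiClosed
    rw [hP]
    intro p hp
    exact exp_smul_vanish G X s p (fun g => (hP g).1 g.2 p hp)⟩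

theorem mat_expG {G : AlgGroup N} (X : lieAlg G) (s : ℂ) :
    AlgGroup.mat (expG X s) = NormedSpace.exp (s • (X : Matrix (Fin N) (Fin N) ℂ)) := rfl

/-- The action of `X ∈ 𝔤` in a rational representation: the derivative at `s = 0` of
`ρ(exp(sX))`. -/
def RationalRep.diff {G : AlgGroup N} {m : ℕ} (ρ : RationalRep G m) (X : lieAlg G) :
    Matrix (Fin m) (Fin m) ℂ :=
  Matrix.of fun i j =>
    deriv (fun s : ℂ => (ρ.toHom (expG X s) : Matrix (Fin m) (Fin m) ℂ) i j) 0

/-! ### Roots -/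

/-- The weight space `𝔤_α` of the adjoint action of `𝔥 = Lie(H)` on `𝔤`, for `α ∈ 𝔥^*`. -/
def rootSpace (G H : AlgGroup N) (α : Module.Dual ℂ (lieAlg H)) : Submodule ℂ (lieAlg G) where
  carrier := {X | ∀ h : lieAlg H,
    (h : Matrix (Fin N) (Fin N) ℂ) * (X : Matrix (Fin N) (Fin N) ℂ) -
      (X : Matrix (Fin N) (Fin N) ℂ) * (h : Matrix (Fin N) (Fin N) ℂ) =
      α h • (X : Matrix (Fin N) (Fin N) ℂ)}
  zero_mem' := by intro h; simp
  add_mem' := by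
    intro X Y hX hY h
    have h1 := hX h
    have h2 := hY h
    simp only [Submodule.coe_add, mul_add, add_mul, smul_add, ← h1, ← h2]
    abel
  smul_mem' := by
    intro c X hX h
    have h1 := hX h
    simp only [Submodule.coe_smul, mul_smul_comm, smul_mul_assoc, ← smul_sub, h1]
    rw [smul_comm]

/-- The roots `Φ(G, H) ⊂ 𝔥^*`. -/
def roots (G H : AlgGroup N) : Set (Module.Dual ℂ (lieAlg H)) :=
  {α | α ≠ 0 ∧ rootSpace G H α ≠ ⊥}

/-- `Φ^Z = {α ∈ Φ | Z(α) ≠ 0}`, for `Z ∈ 𝔥`. Here `Z(α)` denotes `α(Z)`. -/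
def rootsZ (G H : AlgGroup N) (Z : lieAlg H) : Set (Module.Dual ℂ (lieAlg H)) :=
  {α | α ∈ roots G H ∧ α Z ≠ 0}

/-- `c` is the decomposition `X = ∑_α X_α` of `X ∈ 𝔤` along the weight spaces of `𝔥`
(including `𝔤_0`). -/
def IsRootDecomposition (G H : AlgGroup N) (X : lieAlg G)
    (c : Module.Dual ℂ (lieAlg H) →₀ lieAlg G) : Prop :=
  (∀ α, c α ∈ rootSpace G H α) ∧ (c.sum fun _ Y => Y) = X

open Classical in
/-- The component `X_α ∈ 𝔤_α` of `X ∈ 𝔤`. -/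
def rootComponent (G H : AlgGroup N) (X : lieAlg G) (α : Module.Dual ℂ (lieAlg H)) : lieAlg G :=
  if h : ∃ c, IsRootDecomposition G H X c then h.choose α else 0

/-! ### Rays, canonical solutions and Stokes factors of `d - (Z/t² + f/t) dt` -/

/-- The ray `ℝ_{>0} u`, for `u ≠ 0`. -/
def ray (u : ℂ) : Set ℂ := {z | ∃ c : ℝ, 0 < c ∧ z = c * u}

/-- The Stokes rays: `ℝ_{>0} ζ` for `ζ` a non-zero eigenvalue of `ad(Z)` on `𝔤`. -/
def IsStokesRay (G : AlgGroup N) (Z : lieAlg G) (r : Set ℂ) : Prop :=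
  ∃ ζ : ℂ, ζ ≠ 0 ∧ r = ray ζ ∧ ∃ X : lieAlg G, X ≠ 0 ∧
    (Z : Matrix (Fin N) (Fin N) ℂ) * (X : Matrix (Fin N) (Fin N) ℂ) -
      (X : Matrix (Fin N) (Fin N) ℂ) * (Z : Matrix (Fin N) (Fin N) ℂ) =
      ζ • (X : Matrix (Fin N) (Fin N) ℂ)

/-- `r` rotated anticlockwise by the angle `θ`. -/
def rotate (θ : ℝ) (r : Set ℂ) : Set ℂ := (fun z => Complex.exp (θ * Complex.I) * z) '' r

/-- The open half-plane `ℍ_r` centred on the ray `r`. -/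
def halfPlane (r : Set ℂ) : Set ℂ := {z | ∃ u ∈ r, ∃ v : ℂ, 0 < v.re ∧ z = u * v}

/-- `Y`, restricted to `ℍ_r`, is a holomorphic `G`-valued solution of
`dY/dt = (Z/t² + f/t) Y` with `Y e^{Z/t} → 1` as `t → 0` in `ℍ_r`. -/
def IsCanonicalSolution (G : AlgGroup N) (Z f : lieAlg G) (r : Set ℂ)
    (Y : ℂ → G.toSubgroup) : Prop :=
  (∀ t ∈ halfPlane r, ∀ i j,
    HasDerivAt (fun u => AlgGroup.mat (Y u) i j)
      ((((t ^ 2)⁻¹ • (Z : Matrix (Fin N) (Fin N) ℂ) + t⁻¹ • (f : Matrix (Fin N) (Fin N) ℂ)) *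
        AlgGroup.mat (Y t)) i j) t) ∧
  Filter.Tendsto
    (fun t => AlgGroup.mat (Y t) * NormedSpace.exp (t⁻¹ • (Z : Matrix (Fin N) (Fin N) ℂ)))
    (𝓝[halfPlane r] 0) (𝓝 1)

/-- `S` is the Stokes factor of the ray `ℓ`: for some small clockwise, respectively
anticlockwise, perturbations `r₊` and `r₋` of `ℓ` such that the closed sector they bound
contains no Stokes ray other than `ℓ`, there are canonical solutions on `ℍ_{r₊}` and `ℍ_{r₋}`
with `Y_{r₊} = Y_{r₋} S` on `ℍ_{r₊} ∩ ℍ_{r₋}`. -/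
def IsStokesFactor (G : AlgGroup N) (Z f : lieAlg G) (ℓ : Set ℂ) (S : G.toSubgroup) : Prop :=
  ∃ θp ∈ Set.Ioo 0 (Real.pi / 2), ∃ θm ∈ Set.Ioo 0 (Real.pi / 2),
    (∀ θ ∈ Set.Icc (-θp) θm, θ ≠ 0 → ¬ IsStokesRay G Z (rotate θ ℓ)) ∧
    ∃ Yp Ym : ℂ → G.toSubgroup,
      IsCanonicalSolution G Z f (rotate (-θp) ℓ) Yp ∧
      IsCanonicalSolution G Z f (rotate θm ℓ) Ym ∧
      ∀ t ∈ halfPlane (rotate (-θp) ℓ) ∩ halfPlane (rotate θm ℓ), Yp t = Ym t * S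

/-! ### The functions `M_n` -/

/-- The iterated integral `∫ ω_1 ∘ ⋯ ∘ ω_k` of the forms `ω_j = dw / (w - p_j)` along the
restriction of `γ` to `[0, x]`, that is, the integral of `∏ γ'(u_j) / (γ(u_j) - p_j)` over
`0 ≤ u_1 ≤ ⋯ ≤ u_k ≤ x`; the points are indexed from `0`, so `p_j` is `p (j - 1)`. -/
def iteratedIntegral (γ : ℝ → ℂ) (p : ℕ → ℂ) : ℕ → ℝ → ℂ
  | 0, _ => 1
  | k + 1, x => ∫ u in (0 : ℝ)..x, deriv γ u / (γ u - p k) * iteratedIntegral γ p k u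

/-- `s_j = z_1 + ⋯ + z_j`. -/
def partialSum {n : ℕ} (z : Fin n → ℂ) (j : ℕ) : ℂ :=
  ∑ i : Fin n, if (i : ℕ) < j then z i else 0

open Classical in
/-- The quotients `s_j / s_n`, `1 ≤ j ≤ n - 1`, that lie in the open interval `(0, 1)`. -/
def interiorPoints {n : ℕ} (z : Fin n → ℂ) : Finset ℝ :=
  (((Finset.Ico 1 n).image fun j => partialSum z j / partialSum z n).filter
    fun w => w.im = 0 ∧ 0 < w.re ∧ w.re < 1).image Complex.re

/-- The segment from `0` to `s_n`, in which a neighbourhood of each `s_j ∈ (0, s_n)` is replaced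
by the clockwise half-circle of radius `ε |s_n|` centred at `s_j` (for `ε` small; recall that
`Real.sqrt` vanishes on negative numbers). -/
def perturbedSegment {n : ℕ} (z : Fin n → ℂ) (ε x : ℝ) : ℂ :=
  partialSum z n *
    (x + Complex.I * ((∑ a ∈ interiorPoints z, Real.sqrt (ε ^ 2 - (x - a) ^ 2) : ℝ) : ℂ))

/-- The function
`M_n(z_1, …, z_n) = (-1)^{n-1} 2πi ∫_C dt / (t - s_1) ∘ ⋯ ∘ dt / (t - s_{n-1})`, for `n ≥ 1`,
where `C` is the segment from `0` to `s_n` perturbed by arbitrarily small clockwise arcs around the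
`s_j ∈ (0, s_n)`. In particular `M_1 = 2πi`. -/
def M (n : ℕ) (z : Fin n → ℂ) : ℂ :=
  (-1) ^ (n - 1) * (2 * Real.pi * Complex.I) *
    Filter.limUnder (𝓝[>] (0 : ℝ)) fun ε =>
      iteratedIntegral (perturbedSegment z ε) (fun k => partialSum z (k + 1)) (n - 1) 1

/-- The degree `n` term of the series for the Stokes factor of `ℓ`, in the representation `ρ`:
the sum, over `α_1, …, α_n ∈ Φ^Z` with `Z(α_1 + ⋯ + α_n) ∈ ℓ`, of
`M_n(Z(α_1), …, Z(α_n)) ρ(f_{α_1}) ⋯ ρ(f_{α_n})`. -/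
def stokesTerm {G H : AlgGroup N} (Z : lieAlg H) (f : lieAlg G) (ℓ : Set ℂ) {m : ℕ}
    (ρ : RationalRep G m) (n : ℕ) : Matrix (Fin m) (Fin m) ℂ :=
  ∑ᶠ α ∈ {α : Fin n → rootsZ G H Z | (∑ i, (α i : Module.Dual ℂ (lieAlg H))) Z ∈ ℓ},
    M n (fun i => (α i : Module.Dual ℂ (lieAlg H)) Z) •
      (List.ofFn fun i => ρ.diff (rootComponent G H f (α i))).prod

end StokesFactors

end

set_option linter.unusedSectionVars false

noncomputable section

namespace StokesFactors

open MeasureTheory Set Filter Metric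
open scoped Topology BoundedContinuousFunction MatrixGroups ComplexConjugate Real
open Complex (exp I norm_real ofReal_one norm_le_abs_re_add_abs_im add_im ofReal_re ofReal_im
  re_ofReal_mul im_ofReal_mul sub_re ofReal_zero abs_re_le_norm exp_zero exp_add
  normSq_eq_norm_sq)
open Real (norm_eq_abs one_le_rpow_of_pos_of_le_one_of_nonpos rpow_le_rpow_of_nonpos rpow_nonneg
  pi_pos tan arctan)
open Finset (mul_sum sum_add_distrib sum_eq_single sum_mul sum_sub_distrib sum_congr sum_le_sum
  smul_sum mem_filter sum_comm sum_insert)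
open Matrix (one_apply_ne of_apply mul_diagonal diagonal_mul diagonal_apply_ne
  isUnit_iff_isUnit_det)
open MvPolynomial (pderiv derivation_ext smul_eq_C_mul derivation_C monomial eval)
open ContinuousLinearMap (le_opNorm proj)
open Function (comp_def)
open AlgGroup (mat)

notation "Mat(" ι ")" => Matrix ι ι ℂ

notation "Mat[" n "]" => Matrix (Fin n) (Fin n) ℂ

notation "Poly[" n "]" => MvPolynomial (Fin n × Fin n) ℂ

notation "Dual[" H "]" => Module.Dual ℂ (lieAlg H)

/-- A sign, regarded as a real number. -/
abbrev IsSign (κ : ℝ) : Prop := κ = 1 ∨ κ = -1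

theorem IsSign.mul_self {κ : ℝ} (hκ : IsSign κ) : κ * κ = 1 := by
  rcases hκ with h | h <;> rw [h] <;> norm_num

theorem IsSign.abs_eq_one {κ : ℝ} (hκ : IsSign κ) : |κ| = 1 := by
  rcases hκ with h | h <;> rw [h] <;> norm_num

section Engine

/-- Differentiation of an integral depending holomorphically on a parameter, under a bound on the
integrand alone. -/
theorem hasDerivAt_integral_of_holomorphic {α E : Type*} [MeasurableSpace α]
    [NormedAddCommGroup E] [NormedSpace ℂ E] [CompleteSpace E] {μ : Measure α}
    {F : ℂ → α → E} {w₀ : ℂ} {ρ : ℝ} (hρ : 0 < ρ) {b : α → ℝ}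
    (hmeas : ∀ w ∈ ball w₀ ρ, AEStronglyMeasurable (F w) μ)
    (hdiff : ∀ᵐ a ∂μ, DifferentiableOn ℂ (fun w => F w a) (ball w₀ ρ))
    (hb : ∀ᵐ a ∂μ, ∀ w ∈ ball w₀ ρ, ‖F w a‖ ≤ b a) (hbi : Integrable b μ) :
    Integrable (fun a => deriv (fun w => F w a) w₀) μ ∧
      HasDerivAt (fun w => ∫ a, F w a ∂μ) (∫ a, deriv (fun w => F w a) w₀ ∂μ) w₀ := by
  have h0 : w₀ ∈ ball w₀ ρ := mem_ball_self hρ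
  have hda : ∀ᵐ a ∂μ, ∀ w ∈ ball w₀ (ρ / 2),
      HasDerivAt (fun w => F w a) (deriv (fun w => F w a) w) w := by
    filter_upwards [hdiff] with a ha w hw
    exact ((ha w (ball_subset_ball (by linarith) hw)).differentiableAt
      (isOpen_ball.mem_nhds (ball_subset_ball (by linarith) hw))).hasDerivAt
  refine hasDerivAt_integral_of_dominated_loc_of_deriv_le (bound := fun a => b a / (ρ / 4))
    (s := ball w₀ (ρ / 2)) (ball_mem_nhds _ (by linarith)) ?_ ?_ ?_ ?_ (hbi.div_const _) hda
  · filter_upwards [ball_mem_nhds w₀ hρ] with w hw using hmeas w hw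
  · exact hbi.mono' (hmeas w₀ h0) (hb.mono fun a ha => ha w₀ h0)
  · set h : ℕ → ℂ := fun n => ((ρ / 2 / ((n : ℝ) + 1) : ℝ) : ℂ) with hh
    have hpos : ∀ n : ℕ, 0 < ρ / 2 / ((n : ℝ) + 1) := fun n => by positivity
    have hlim : Tendsto (fun n : ℕ => ρ / 2 / ((n : ℝ) + 1)) atTop (𝓝 0) :=
      tendsto_const_nhds.div_atTop
        (tendsto_atTop_add_const_right _ _ tendsto_natCast_atTop_atTop)
    have hball : ∀ n, w₀ + h n ∈ ball w₀ ρ := by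
      intro n
      rw [mem_ball, dist_eq_norm, add_sub_cancel_left, hh]
      simp only [norm_real, norm_eq_abs, abs_of_pos (hpos n)]
      have : ρ / 2 / ((n : ℝ) + 1) ≤ ρ / 2 :=
        div_le_self (by linarith) (by have := n.cast_nonneg (α := ℝ); linarith)
      linarith
    refine aestronglyMeasurable_of_tendsto_ae (u := atTop)
      (f := fun n a => (h n)⁻¹ • (F (w₀ + h n) a - F w₀ a)) ?_ ?_
    · intro n
      exact ((hmeas _ (hball n)).sub (hmeas _ h0)).const_smul _
    · filter_upwards [hda] with a ha
      have h1 := (ha w₀ (mem_ball_self (by linarith))).tendsto_slope_zero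
      refine h1.comp ?_
      rw [tendsto_nhdsWithin_iff]
      refine ⟨?_, Eventually.of_forall fun n => ?_⟩
      · have := (Complex.continuous_ofReal.tendsto 0).comp hlim
        simpa [hh, comp_def] using this
      · simp only [hh, mem_compl_iff, mem_singleton_iff, Complex.ofReal_eq_zero]
        exact (hpos n).ne'
  · filter_upwards [hdiff, hb] with a ha hba w hw
    have hw' : dist w w₀ < ρ / 2 := hw
    have hsub : closedBall w (ρ / 4) ⊆ ball w₀ ρ := by
      intro z hz
      have hz' : dist z w ≤ ρ / 4 := hz
      have := dist_triangle z w w₀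
      rw [mem_ball]; linarith
    refine Complex.norm_deriv_le_of_forall_mem_sphere_norm_le (by linarith) ?_ ?_
    · exact (ha.mono hsub).diffContOnCl_ball subset_rfl
    · intro z hz
      exact hba z (hsub (sphere_subset_closedBall hz))

variable {𝔸 : Type*} [NormedRing 𝔸] [NormedAlgebra ℂ 𝔸] [CompleteSpace 𝔸]

/-- The Picard iterates of `Q' = A Q`, `Q c = 1`, along segments issued from `c` and
parametrised by `s ↦ c + s² (w - c)`. -/
def picardIterate (A : ℂ → 𝔸) (c : ℂ) : ℕ → ℂ → 𝔸
  | 0, _ => 1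
  | n + 1, w => ∫ s in (0 : ℝ)..1, (2 * s * (w - c) : ℂ) •
      (A (c + (s : ℂ) ^ 2 * (w - c)) * picardIterate A c n (c + (s : ℂ) ^ 2 * (w - c)))

/-- `‖A‖` grows at most like `K / √t` at the centre `c` of the segment from `c` to `w`. -/
def RadialBound (A : ℂ → 𝔸) (c w : ℂ) (K : ℝ) : Prop :=
  ∀ t ∈ Ioc (0 : ℝ) 1, ‖A (c + t * (w - c))‖ * √t ≤ K

theorem RadialBound.nonneg {A : ℂ → 𝔸} {c w : ℂ} {K : ℝ} (h : RadialBound A c w K) : 0 ≤ K :=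
  le_trans (by positivity) (h 1 (by simp))

theorem RadialBound.scale {A : ℂ → 𝔸} {c w : ℂ} {K : ℝ} (h : RadialBound A c w K) {s : ℝ}
    (hs : s ∈ Ioc (0 : ℝ) 1) : RadialBound A c (c + (s : ℂ) ^ 2 * (w - c)) (K / s) := by
  intro t ht
  have h1 := h (t * s ^ 2) ⟨mul_pos ht.1 (pow_pos hs.1 2),
    mul_le_one₀ ht.2 (sq_nonneg s) (pow_le_one₀ hs.1.le hs.2)⟩
  rw [Real.sqrt_mul ht.1.le, Real.sqrt_sq hs.1.le] at h1
  rw [le_div_iff₀ hs.1]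
  refine le_of_eq_of_le ?_ h1
  push_cast
  rw [add_sub_cancel_left, mul_assoc (t : ℂ), mul_assoc]

theorem RadialBound.norm_le {A : ℂ → 𝔸} {c w : ℂ} {K : ℝ} (h : RadialBound A c w K) :
    ‖A w‖ ≤ K := by simpa using h 1 (by simp)

variable {A : ℂ → 𝔸} {c : ℂ} {U : Set ℂ}

theorem norm_picard_integrand_le {w : ℂ} {K : ℝ} {n : ℕ} (hw : RadialBound A c w K)
    (hB : ∀ s ∈ Ioc (0 : ℝ) 1, ‖picardIterate A c n (c + (s : ℂ) ^ 2 * (w - c))‖ ≤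
      (2 * (K / s) * ‖c + (s : ℂ) ^ 2 * (w - c) - c‖) ^ n / n.factorial)
    {s : ℝ} (hs : s ∈ Ioc (0 : ℝ) 1) : ‖(2 * s * (w - c) : ℂ) •
      (A (c + (s : ℂ) ^ 2 * (w - c)) * picardIterate A c n (c + (s : ℂ) ^ 2 * (w - c)))‖ ≤
      (2 * K * ‖w - c‖) ^ (n + 1) / n.factorial * s ^ n := by
  have h1 := hB s hs
  have h2 := (hw.scale hs).norm_le
  have hs0 := hs.1
  have hK := hw.nonneg
  have e1 : 2 * (K / s) * ‖c + (s : ℂ) ^ 2 * (w - c) - c‖ = 2 * K * ‖w - c‖ * s := by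
    rw [add_sub_cancel_left, norm_mul, norm_pow, norm_real, norm_eq_abs,
      abs_of_pos hs0]
    field_simp
  rw [e1] at h1
  rw [norm_smul]
  have e2 : ‖(2 * s * (w - c) : ℂ)‖ = 2 * s * ‖w - c‖ := by
    simp [abs_of_pos hs0]
  rw [e2]
  calc 2 * s * ‖w - c‖ * ‖A (c + (s : ℂ) ^ 2 * (w - c)) *
        picardIterate A c n (c + (s : ℂ) ^ 2 * (w - c))‖
      ≤ 2 * s * ‖w - c‖ * (K / s * ((2 * K * ‖w - c‖ * s) ^ n / n.factorial)) := by
        gcongr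
        exact (norm_mul_le _ _).trans (mul_le_mul h2 h1 (norm_nonneg _) (by positivity))
    _ = _ := by
        rw [mul_pow _ s n, pow_succ (2 * K * ‖w - c‖)]
        field_simp

theorem norm_picardIterate_le (h1 : ‖(1 : 𝔸)‖ ≤ 1) (n : ℕ) :
    ∀ {w : ℂ} {K : ℝ}, RadialBound A c w K →
      ‖picardIterate A c n w‖ ≤ (2 * K * ‖w - c‖) ^ n / n.factorial := by
  induction n with
  | zero => intro w K _; simpa [picardIterate] using h1
  | succ n ih =>
    intro w K hw
    have hK := hw.nonneg
    rw [picardIterate]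
    have := intervalIntegral.norm_integral_le_of_norm_le (a := (0 : ℝ)) (b := 1) (μ := volume)
      (f := fun s : ℝ => (2 * s * (w - c) : ℂ) •
        (A (c + (s : ℂ) ^ 2 * (w - c)) * picardIterate A c n (c + (s : ℂ) ^ 2 * (w - c))))
      (g := fun s => (2 * K * ‖w - c‖) ^ (n + 1) / n.factorial * s ^ n) zero_le_one
      (Eventually.of_forall fun s hs =>
        norm_picard_integrand_le hw (fun s hs => ih (hw.scale hs)) hs)
      ((continuous_const.mul (continuous_pow n)).intervalIntegrable _ _)
    refine this.trans (le_of_eq ?_)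
    rw [intervalIntegral.integral_const_mul, integral_pow, Nat.factorial_succ]
    push_cast
    field_simp
    simp

/-- The hypotheses under which the equation `Q' = A Q` is solved from the (possibly singular)
point `c` on the domain `U`, star-shaped about `c`. -/
structure StarDomain (A : ℂ → 𝔸) (c : ℂ) (U : Set ℂ) : Prop where
  isOpen : IsOpen U
  star : ∀ w ∈ U, ∀ t ∈ Ioc (0 : ℝ) 1, c + t * (w - c) ∈ U
  diff : DifferentiableOn ℂ A U
  bound : ∀ w₀ ∈ U, ∃ ρ > 0, ∃ K, ∀ w ∈ ball w₀ ρ, RadialBound A c w K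

theorem StarDomain.sq_mem (h : StarDomain A c U) {w : ℂ} (hw : w ∈ U) {s : ℝ}
    (hs : s ∈ Ioc (0 : ℝ) 1) : c + (s : ℂ) ^ 2 * (w - c) ∈ U := by
  have := h.star w hw (s ^ 2) ⟨pow_pos hs.1 2, pow_le_one₀ hs.1.le hs.2⟩
  simpa using this

theorem hasDerivAt_picardIterate (hS : StarDomain A c U) (h1 : ‖(1 : 𝔸)‖ ≤ 1) (n : ℕ) {w₀ : ℂ}
    (hw₀ : w₀ ∈ U) (hd : DifferentiableOn ℂ (picardIterate A c n) U) :
    HasDerivAt (picardIterate A c (n + 1)) (A w₀ * picardIterate A c n w₀) w₀ := by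
  obtain ⟨ρ₁, hρ₁, K, hK⟩ := hS.bound w₀ hw₀
  obtain ⟨ρ₂, hρ₂, hU⟩ := Metric.isOpen_iff.1 hS.isOpen w₀ hw₀
  set ρ := min ρ₁ ρ₂ with hρdef
  have hρ : 0 < ρ := lt_min hρ₁ hρ₂
  have hKρ : ∀ w ∈ ball w₀ ρ, RadialBound A c w K := fun w hw =>
    hK w (ball_subset_ball (min_le_left _ _) hw)
  have hUρ : ball w₀ ρ ⊆ U := (ball_subset_ball (min_le_right _ _)).trans hU
  have hK0 := (hKρ w₀ (mem_ball_self hρ)).nonneg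
  set g : ℂ → 𝔸 := fun w => A w * picardIterate A c n w with hg
  have hgd : DifferentiableOn ℂ g U := hS.diff.mul hd
  set F : ℂ → ℝ → 𝔸 := fun w s => (2 * s * (w - c) : ℂ) • g (c + (s : ℂ) ^ 2 * (w - c)) with hF
  have hgat : ∀ w ∈ U, HasDerivAt g (deriv g w) w := fun w hw =>
    ((hgd w hw).differentiableAt (hS.isOpen.mem_nhds hw)).hasDerivAt
  have hFderiv : ∀ s ∈ Ioc (0 : ℝ) 1, ∀ w ∈ U, HasDerivAt (fun w => F w s)
      ((2 * s * (w - c) : ℂ) • ((s : ℂ) ^ 2 • deriv g (c + (s : ℂ) ^ 2 * (w - c))) +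
        (2 * s : ℂ) • g (c + (s : ℂ) ^ 2 * (w - c))) w := by
    intro s hs w hw
    have e1 : HasDerivAt (fun w : ℂ => c + (s : ℂ) ^ 2 * (w - c)) ((s : ℂ) ^ 2) w := by
      simpa using (((hasDerivAt_id w).sub_const c).const_mul ((s : ℂ) ^ 2)).const_add c
    have e2 := (hgat _ (hS.sq_mem hw hs)).scomp w e1
    have e3 : HasDerivAt (fun w : ℂ => (2 * s * (w - c) : ℂ)) (2 * s : ℂ) w := by
      simpa using ((hasDerivAt_id w).sub_const c).const_mul (2 * s : ℂ)
    exact e3.smul e2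
  have hcurve : ∀ w ∈ U, ContinuousOn (fun s : ℝ => g (c + (s : ℂ) ^ 2 * (w - c))) (Ioc 0 1) := by
    intro w hw
    refine hgd.continuousOn.comp (by fun_prop) fun s hs => hS.sq_mem hw hs
  set M : ℝ := (2 * K * (‖w₀ - c‖ + ρ)) ^ (n + 1) / n.factorial with hM
  have hbound : ∀ s ∈ Ioc (0 : ℝ) 1, ∀ w ∈ ball w₀ ρ, ‖F w s‖ ≤ M := by
    intro s hs w hw
    have hww : ‖w - c‖ ≤ ‖w₀ - c‖ + ρ := by
      have : dist w w₀ < ρ := hw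
      rw [dist_eq_norm] at this
      calc ‖w - c‖ = ‖(w - w₀) + (w₀ - c)‖ := by congr 1; ring
        _ ≤ ‖w - w₀‖ + ‖w₀ - c‖ := norm_add_le _ _
        _ ≤ _ := by linarith
    refine (norm_picard_integrand_le (hKρ w hw)
      (fun s hs => norm_picardIterate_le h1 n ((hKρ w hw).scale hs)) hs).trans ?_
    have : s ^ n ≤ 1 := pow_le_one₀ hs.1.le hs.2
    calc _ ≤ (2 * K * ‖w - c‖) ^ (n + 1) / n.factorial * 1 := by gcongr
      _ ≤ M := by rw [mul_one, hM]; gcongr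
  have hvol : ∀ᵐ s ∂(volume.restrict (Ioc (0 : ℝ) 1)), s ∈ Ioc (0 : ℝ) 1 :=
    ae_restrict_mem measurableSet_Ioc
  obtain ⟨hInt, hder⟩ := hasDerivAt_integral_of_holomorphic (μ := volume.restrict (Ioc (0 : ℝ) 1))
    (F := F) (w₀ := w₀) hρ (b := fun _ => M)
    (fun w hw => ContinuousOn.aestronglyMeasurable
      (ContinuousOn.smul (by fun_prop) (hcurve w (hUρ hw))) measurableSet_Ioc)
    (hvol.mono fun s hs w hw =>
      (hFderiv s hs w (hUρ hw)).differentiableAt.differentiableWithinAt)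
    (hvol.mono fun s hs => hbound s hs) (integrable_const _)
  have hFI : (picardIterate A c (n + 1)) = fun w => ∫ s in Ioc (0 : ℝ) 1, F w s := by
    funext w
    rw [picardIterate, intervalIntegral.integral_of_le zero_le_one]
  rw [hFI]
  refine hder.congr_deriv (Eq.symm ?_)
  rw [← intervalIntegral.integral_of_le zero_le_one]
  have hlim1 : Tendsto (fun s : ℝ => (s : ℂ) ^ 2 • g (c + (s : ℂ) ^ 2 * (w₀ - c)))
      (𝓝[<] 1) (𝓝 (g w₀)) := by
    have hc : ContinuousAt (fun s : ℝ => g (c + (s : ℂ) ^ 2 * (w₀ - c))) 1 := by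
      have h2 : ContinuousAt g (c + ((1 : ℝ) : ℂ) ^ 2 * (w₀ - c)) := by
        have := (hgat w₀ hw₀).continuousAt
        simpa using this
      exact ContinuousAt.comp (f := fun s : ℝ => c + (s : ℂ) ^ 2 * (w₀ - c)) h2 (by fun_prop)
    have h3 : ContinuousAt (fun s : ℝ => (s : ℂ) ^ 2 • g (c + (s : ℂ) ^ 2 * (w₀ - c))) 1 :=
      ContinuousAt.smul (by fun_prop) hc
    have := h3.tendsto
    simp only [ofReal_one, one_pow, one_mul, add_sub_cancel, one_smul] at this
    exact this.mono_left nhdsWithin_le_nhds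
  have hlim0 : Tendsto (fun s : ℝ => (s : ℂ) ^ 2 • g (c + (s : ℂ) ^ 2 * (w₀ - c)))
      (𝓝[>] 0) (𝓝 0) := by
    have hw0 := hKρ w₀ (mem_ball_self hρ)
    have hb : ∀ᶠ s : ℝ in 𝓝[>] 0, ‖(s : ℂ) ^ 2 • g (c + (s : ℂ) ^ 2 * (w₀ - c))‖ ≤
        s * (K * ((2 * K * ‖w₀ - c‖) ^ n / n.factorial)) := by
      filter_upwards [Ioc_mem_nhdsGT (zero_lt_one (α := ℝ))] with s hs
      have hs0 := hs.1
      have e1 := (hw0.scale hs).norm_le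
      have e2 := norm_picardIterate_le h1 n (hw0.scale hs)
      have e3 : (2 * (K / s) * ‖c + (s : ℂ) ^ 2 * (w₀ - c) - c‖) ^ n / n.factorial ≤
          (2 * K * ‖w₀ - c‖) ^ n / n.factorial := by
        have : 2 * (K / s) * ‖c + (s : ℂ) ^ 2 * (w₀ - c) - c‖ = 2 * K * ‖w₀ - c‖ * s := by
          rw [add_sub_cancel_left, norm_mul, norm_pow, norm_real, norm_eq_abs,
            abs_of_pos hs0]
          field_simp
        rw [this]
        have h4 : 2 * K * ‖w₀ - c‖ * s ≤ 2 * K * ‖w₀ - c‖ :=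
          mul_le_of_le_one_right (by positivity) hs.2
        gcongr
      rw [norm_smul, norm_pow, norm_real, norm_eq_abs, abs_of_pos hs0]
      calc s ^ 2 * ‖g (c + (s : ℂ) ^ 2 * (w₀ - c))‖
          ≤ s ^ 2 * (K / s * ((2 * K * ‖w₀ - c‖) ^ n / n.factorial)) := by
            gcongr
            exact (norm_mul_le _ _).trans
              (mul_le_mul e1 (e2.trans e3) (norm_nonneg _) (by positivity))
        _ = _ := by field_simp
    refine squeeze_zero_norm' hb ?_
    have : Tendsto (fun s : ℝ => s * (K * ((2 * K * ‖w₀ - c‖) ^ n / n.factorial))) (𝓝 0)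
        (𝓝 (0 * (K * ((2 * K * ‖w₀ - c‖) ^ n / n.factorial)))) :=
      tendsto_id.mul_const _
    rw [zero_mul] at this
    exact this.mono_left nhdsWithin_le_nhds
  have hcong : ∀ s ∈ Ioc (0 : ℝ) 1, deriv (fun w => F w s) w₀ =
      (2 * s * (w₀ - c) : ℂ) • ((s : ℂ) ^ 2 • deriv g (c + (s : ℂ) ^ 2 * (w₀ - c))) +
        (2 * s : ℂ) • g (c + (s : ℂ) ^ 2 * (w₀ - c)) := fun s hs => (hFderiv s hs w₀ hw₀).deriv
  have := intervalIntegral.integral_eq_sub_of_hasDerivAt_of_tendsto (a := (0 : ℝ)) (b := 1)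
    (f := fun s : ℝ => (s : ℂ) ^ 2 • g (c + (s : ℂ) ^ 2 * (w₀ - c)))
    (f' := fun s => deriv (fun w => F w s) w₀) zero_lt_one ?_ ?_ hlim0 hlim1
  · rw [this, sub_zero]
  · intro s hs
    have hs' : s ∈ Ioc (0 : ℝ) 1 := ⟨hs.1, hs.2.le⟩
    rw [hcong s hs']
    have e0 : HasDerivAt (fun s : ℝ => (s : ℂ) ^ 2) (2 * s : ℂ) s := by
      simpa using (hasDerivAt_pow 2 s).ofReal_comp
    have e1 : HasDerivAt (fun s : ℝ => c + (s : ℂ) ^ 2 * (w₀ - c)) (2 * s * (w₀ - c) : ℂ) s := by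
      simpa using (e0.mul_const (w₀ - c)).const_add c
    have e2 := (hgat _ (hS.sq_mem hw₀ hs')).scomp s e1
    have e3 := e0.smul e2
    rw [smul_comm] at e3
    exact e3
  · rw [intervalIntegrable_iff_integrableOn_Ioc_of_le zero_le_one]
    exact hInt

/-- Solution of the linear equation `Q' = A Q` on a star-shaped domain, where `A` may have an
integrable singularity at the centre. -/
theorem StarDomain.exists_solution (hS : StarDomain A c U) (h1 : ‖(1 : 𝔸)‖ ≤ 1) :
    ∃ Q : ℂ → 𝔸, (∀ w ∈ U, HasDerivAt Q (A w * Q w) w) ∧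
      ∀ w K, RadialBound A c w K → ‖Q w - 1‖ ≤ Real.exp (2 * K * ‖w - c‖) - 1 := by
  have hder : ∀ n, ∀ w ∈ U,
      HasDerivAt (picardIterate A c (n + 1)) (A w * picardIterate A c n w) w := by
    intro n
    induction n with
    | zero =>
      intro w hw
      exact hasDerivAt_picardIterate hS h1 0 hw (differentiableOn_const _)
    | succ n ih =>
      intro w hw
      exact hasDerivAt_picardIterate hS h1 (n + 1) hw
        fun w hw => (ih w hw).differentiableAt.differentiableWithinAt
  have hsum : ∀ w K, RadialBound A c w K → Summable fun n => picardIterate A c n w := by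
    intro w K hw
    exact Summable.of_norm_bounded (Real.summable_pow_div_factorial (2 * K * ‖w - c‖))
      fun n => norm_picardIterate_le h1 n hw
  refine ⟨fun w => 1 + ∑' n, picardIterate A c (n + 1) w, ?_, ?_⟩
  · intro w₀ hw₀
    obtain ⟨ρ₁, hρ₁, K, hK⟩ := hS.bound w₀ hw₀
    obtain ⟨ρ₂, hρ₂, hU⟩ := Metric.isOpen_iff.1 hS.isOpen w₀ hw₀
    have hρ : 0 < min ρ₁ ρ₂ := lt_min hρ₁ hρ₂
    have hKρ : ∀ w ∈ ball w₀ (min ρ₁ ρ₂), RadialBound A c w K := fun w hw =>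
      hK w (ball_subset_ball (min_le_left _ _) hw)
    have hw0 := hKρ w₀ (mem_ball_self hρ)
    have hK0 := hw0.nonneg
    have key := hasDerivAt_tsum_of_isPreconnected
      (u := fun n => K * ((2 * K * (‖w₀ - c‖ + min ρ₁ ρ₂)) ^ n / n.factorial))
      (g := fun n w => picardIterate A c (n + 1) w)
      (g' := fun n w => A w * picardIterate A c n w)
      ((Real.summable_pow_div_factorial _).mul_left K) isOpen_ball
      (convex_ball w₀ (min ρ₁ ρ₂)).isPreconnected
      (fun n w hw => hder n w (hU (ball_subset_ball (min_le_right _ _) hw)))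
      (fun n w hw => ?_) (mem_ball_self hρ)
      ((summable_nat_add_iff 1).2 (hsum w₀ K hw0)) (mem_ball_self hρ)
    · refine (key.const_add 1).congr_deriv ?_
      rw [(hsum w₀ K hw0).tsum_mul_left, (hsum w₀ K hw0).tsum_eq_zero_add]
      rfl
    · have hww : ‖w - c‖ ≤ ‖w₀ - c‖ + min ρ₁ ρ₂ := by
        have : dist w w₀ < min ρ₁ ρ₂ := hw
        rw [dist_eq_norm] at this
        calc ‖w - c‖ = ‖(w - w₀) + (w₀ - c)‖ := by congr 1; ring
          _ ≤ ‖w - w₀‖ + ‖w₀ - c‖ := norm_add_le _ _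
          _ ≤ _ := by linarith
      refine (norm_mul_le _ _).trans (mul_le_mul (hKρ w hw).norm_le ?_ (norm_nonneg _) hK0)
      refine (norm_picardIterate_le h1 n (hKρ w hw)).trans ?_
      gcongr
  · intro w K hw
    rw [add_sub_cancel_left]
    have hs := Real.summable_pow_div_factorial (2 * K * ‖w - c‖)
    have e : Real.exp (2 * K * ‖w - c‖) - 1 =
        ∑' n : ℕ, (2 * K * ‖w - c‖) ^ (n + 1) / (n + 1).factorial := by
      rw [Real.exp_eq_exp_ℝ, NormedSpace.exp_eq_tsum_div]
      simp only
      rw [hs.tsum_eq_zero_add]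
      simp
    rw [e]
    exact tsum_of_norm_bounded ((summable_nat_add_iff 1).2 hs).hasSum
      fun n => norm_picardIterate_le h1 (n + 1) hw

end Engine

section Sector

/-- The branch of the logarithm that is real on the positive reals and whose cut is the half line
`-κ i ℝ_{≥ 0}`, for `κ = ±1`. -/
def sideLog (κ : ℝ) (w : ℂ) : ℂ :=
  Complex.log (-(I * κ) * w) + I * κ * (π / 2)

/-- The open sector adjacent to the positive reals, above them if `κ = 1` and below if `κ = -1`. -/
def sector (κ η : ℝ) : Set ℂ := {w | 0 < w.re ∧ 0 < κ * w.im ∧ κ * w.im < η * w.re}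

/-- The union of `sector κ η` and the positive reals. -/
def raySector (κ η : ℝ) : Set ℂ := {w | 0 < w.re ∧ 0 ≤ κ * w.im ∧ κ * w.im < η * w.re}

/-- The complement of the half line `p - κ i ℝ_{≥ 0}`. -/
def slitAt (κ : ℝ) (p : ℂ) : Set ℂ := {w | -(I * κ) * (w - p) ∈ Complex.slitPlane}

theorem sector_subset {κ η : ℝ} : sector κ η ⊆ raySector κ η :=
  fun _ hw => ⟨hw.1, hw.2.1.le, hw.2.2⟩

theorem mem_slitAt {κ : ℝ} (hκ : IsSign κ) {p w : ℂ} (h : 0 ≤ κ * (w - p).im)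
    (hne : w ≠ p) : w ∈ slitAt κ p := by
  simp only [slitAt, mem_ofPred_eq, Complex.mem_slitPlane_iff]
  have e1 : (-(I * κ) * (w - p)).re = κ * (w - p).im := by simp
  have e2 : (-(I * κ) * (w - p)).im = -(κ * (w - p).re) := by simp
  rw [e1, e2]
  rcases h.lt_or_eq with h | h
  · exact Or.inl h
  · right
    have hκ0 : κ ≠ 0 := by rcases hκ with h | h <;> rw [h] <;> norm_num
    have him : (w - p).im = 0 := by
      rcases mul_eq_zero.1 h.symm with h | h
      · exact absurd h hκ0
      · exact h
    have hre : (w - p).re ≠ 0 := fun hre => hne (sub_eq_zero.1 (Complex.ext hre him))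
    exact neg_ne_zero.2 (mul_ne_zero hκ0 hre)

theorem isOpen_slitAt (κ : ℝ) (p : ℂ) : IsOpen (slitAt κ p) :=
  Complex.isOpen_slitPlane.preimage (by fun_prop)

theorem ne_of_mem_slitAt {κ : ℝ} {p w : ℂ} (h : w ∈ slitAt κ p) : w ≠ p := by
  rintro rfl
  simp [slitAt] at h

theorem hasDerivAt_sideLog {κ : ℝ} (hκ : IsSign κ) {p w : ℂ} (h : w ∈ slitAt κ p) :
    HasDerivAt (fun w => sideLog κ (w - p)) (w - p)⁻¹ w := by
  have hκ0 : (κ : ℂ) ≠ 0 := by rcases hκ with h | h <;> rw [h] <;> norm_num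
  have h1 : HasDerivAt (fun w : ℂ => -(I * κ) * (w - p)) (-(I * κ)) w := by
    simpa using ((hasDerivAt_id w).sub_const p).const_mul (-(I * κ))
  have h2 := (h1.clog h).add_const (I * κ * (π / 2))
  refine h2.congr_deriv ?_
  have := sub_ne_zero.2 (ne_of_mem_slitAt h)
  field_simp

theorem norm_sideLog_le {κ : ℝ} (hκ : IsSign κ) {w : ℂ} (h0 : 0 < ‖w‖) (h1 : ‖w‖ ≤ 1) :
    ‖sideLog κ w‖ ≤ 13 * ‖w‖ ^ (-(1 / 8) : ℝ) := by
  have hκ1 := hκ.abs_eq_one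
  set x := ‖w‖ with hx
  have hn : ‖-(I * κ) * w‖ = x := by simp [hκ1, hx]
  have hpow : 1 ≤ x ^ (-(1 / 8) : ℝ) := one_le_rpow_of_pos_of_le_one_of_nonpos h0 h1 (by norm_num)
  have hlog : |Real.log x| ≤ 8 * x ^ (-(1 / 8) : ℝ) := by
    have h2 := (Real.abs_log_mul_self_rpow_lt x (1 / 8) h0 h1 (by norm_num)).le
    rw [abs_mul, abs_of_pos (Real.rpow_pos_of_pos h0 _)] at h2
    rw [Real.rpow_neg h0.le, ← div_eq_mul_inv, le_div_iff₀ (Real.rpow_pos_of_pos h0 _)]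
    linarith
  have hb : ‖Complex.log (-(I * κ) * w)‖ ≤ |Real.log x| + π := by
    refine (norm_le_abs_re_add_abs_im _).trans ?_
    rw [Complex.log_re, Complex.log_im, hn]
    gcongr
    exact Complex.abs_arg_le_pi _
  have hc : ‖I * κ * (π / 2 : ℂ)‖ = π / 2 := by
    simp [hκ1, abs_of_pos pi_pos]
  have hpi := Real.pi_lt_d2
  calc ‖sideLog κ w‖ ≤ |Real.log x| + π + π / 2 :=
        (norm_add_le _ _).trans (add_le_add hb hc.le)
    _ ≤ 8 * x ^ (-(1 / 8) : ℝ) + 5 := by linarith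
    _ ≤ _ := by linarith

theorem sideLog_pos {κ : ℝ} (hκ : IsSign κ) {x : ℝ} (hx : 0 < x) : sideLog κ x = Real.log x := by
  have hx' : (x : ℂ) ≠ 0 := by exact_mod_cast hx.ne'
  have e : -(I * κ) * (x : ℂ) = (x : ℂ) * (-(I * κ)) := by ring
  rw [sideLog, e, Complex.log_ofReal_mul hx (by
    rcases hκ with h | h <;> simp [h])]
  rcases hκ with h | h
  · rw [h]; simp [Complex.log_neg_I]; ring
  · rw [h]; simp [Complex.log_I]; ring

theorem sideLog_neg {κ : ℝ} (hκ : IsSign κ) {x : ℝ} (hx : x < 0) :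
    sideLog κ x = Real.log (-x) + I * κ * π := by
  have e : -(I * κ) * (x : ℂ) = ((-x : ℝ) : ℂ) * (I * κ) := by
    push_cast; ring
  rw [sideLog, e, Complex.log_ofReal_mul (by linarith) (by
    rcases hκ with h | h <;> simp [h])]
  rcases hκ with h | h
  · rw [h]; simp [Complex.log_I]; ring
  · rw [h]; simp [Complex.log_neg_I]; ring

theorem convex_raySector (κ η : ℝ) : Convex ℝ (raySector κ η) := by
  intro x hx y hy a b ha hb hab
  simp only [raySector, mem_ofPred_eq, Complex.add_re, add_im, Complex.real_smul,
    Complex.mul_re, Complex.mul_im, ofReal_re, ofReal_im, zero_mul, sub_zero,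
    add_zero] at *
  obtain ⟨hx1, hx2, hx3⟩ := hx
  obtain ⟨hy1, hy2, hy3⟩ := hy
  rcases ha.eq_or_lt with rfl | ha
  · simp only [zero_add] at hab; subst hab; simp [hy1, hy2, hy3]
  · refine ⟨by positivity, ?_, ?_⟩
    · have := mul_nonneg ha.le hx2
      have := mul_nonneg hb hy2
      nlinarith
    · have := mul_lt_mul_of_pos_left hx3 ha
      have := mul_le_mul_of_nonneg_left hy3.le hb
      nlinarith

/-- A point of the segment from a point of the sector with its ray to a point of the open sector,
other than the first end, is in the open sector. -/
theorem combo_mem_sector {κ η : ℝ} {c w : ℂ} (hc : c ∈ sector κ η) (hw : w ∈ raySector κ η)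
    {a b : ℝ} (ha : 0 < a) (hb : 0 ≤ b) : (a : ℂ) * c + b * w ∈ sector κ η := by
  obtain ⟨hx1, hx2, hx3⟩ := hc
  obtain ⟨hy1, hy2, hy3⟩ := hw
  simp only [sector, mem_ofPred_eq, Complex.add_re, add_im,
    Complex.mul_re, Complex.mul_im, ofReal_re, ofReal_im, zero_mul, sub_zero,
    add_zero]
  refine ⟨by positivity, ?_, ?_⟩
  · have := mul_pos ha hx2
    have := mul_nonneg hb hy2
    nlinarith
  · have := mul_lt_mul_of_pos_left hx3 ha
    have := mul_le_mul_of_nonneg_left hy3.le hb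
    nlinarith

theorem eq_of_hasDerivAt_zero_segment {E : Type*} [NormedAddCommGroup E] [NormedSpace ℂ E]
    {f : ℂ → E} {a b : ℂ} (h : ∀ w ∈ segment ℝ a b, HasDerivAt f 0 w) : f a = f b := by
  have := (convex_segment (𝕜 := ℝ) a b).norm_image_sub_le_of_norm_hasDerivWithin_le (C := 0)
    (f := f) (f' := fun _ => 0) (fun w hw => (h w hw).hasDerivWithinAt) (by simp)
    (right_mem_segment ℝ a b) (left_mem_segment ℝ a b)
  simpa [sub_eq_zero] using this

end Sector

section Fuchsian

variable {E : Type*} [NormedAddCommGroup E] [NormedSpace ℂ E]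

/-- The coefficient `∑_p R_p / (w - p)` of a Fuchsian system. -/
def fuchs (P : Finset ℂ) (R : ℂ → E →L[ℂ] E) (w : ℂ) : E →L[ℂ] E :=
  ∑ p ∈ P, (w - p)⁻¹ • R p

theorem differentiableAt_fuchs (P : Finset ℂ) (R : ℂ → E →L[ℂ] E) {w : ℂ} (hw : w ∉ P) :
    DifferentiableAt ℂ (fuchs P R) w := by
  refine DifferentiableAt.fun_sum fun p hp => ?_
  have : w - p ≠ 0 := sub_ne_zero.2 fun h => hw (h ▸ hp)
  exact ((differentiableAt_id.sub_const p).inv this).smul_const (R p)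

theorem fuchs_eq (P : Finset ℂ) (R : ℂ → E →L[ℂ] E) (hR0 : ∀ p ∉ P, R p = 0) (p w : ℂ) :
    fuchs P R w = (w - p)⁻¹ • R p + fuchs (P.erase p) R w := by
  by_cases hp : p ∈ P
  · exact (Finset.add_sum_erase P (fun q => (w - q)⁻¹ • R q) hp).symm
  · rw [hR0 p hp, smul_zero, zero_add, Finset.erase_eq_of_notMem hp]

/-- The coefficient of the equation satisfied by `(1 - log(w - p) R_p) Ψ`. -/
def gaugedCoeff (P : Finset ℂ) (R : ℂ → E →L[ℂ] E) (κ : ℝ) (p w : ℂ) : E →L[ℂ] E :=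
  (1 - sideLog κ (w - p) • R p) * fuchs (P.erase p) R w * (1 + sideLog κ (w - p) • R p)

theorem norm_one_le_clm : ‖(1 : E →L[ℂ] E)‖ ≤ 1 := ContinuousLinearMap.norm_id_le

theorem exists_gaugedCoeff_bound (P : Finset ℂ) (R : ℂ → E →L[ℂ] E) {κ : ℝ}
    (hκ : IsSign κ) (p : ℂ) :
    ∃ δ > 0, δ ≤ 1 ∧ (∀ q ∈ P, q ∈ ball p δ → q = p) ∧ ∃ C > 0, ∀ w ∈ ball p δ, w ≠ p →
      ‖gaugedCoeff P R κ p w‖ ≤ C * ‖w - p‖ ^ (-(1 / 4) : ℝ) := by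
  have hcont : ContinuousAt (fuchs (P.erase p) R) p :=
    (differentiableAt_fuchs _ _ (Finset.notMem_erase p P)).continuousAt
  obtain ⟨δ₁, hδ₁, h₁⟩ := Metric.continuousAt_iff.1 hcont 1 one_pos
  have hfin : (↑(P.erase p) : Set ℂ)ᶜ ∈ 𝓝 p :=
    (P.erase p).finite_toSet.isClosed.isOpen_compl.mem_nhds (by simp)
  obtain ⟨δ₂, hδ₂, h₂⟩ := Metric.mem_nhds_iff.1 hfin
  set M := ‖fuchs (P.erase p) R p‖ + 1 with hM
  refine ⟨min (min δ₁ δ₂) 1, by positivity, min_le_right _ _, ?_,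
    (1 + 13 * ‖R p‖) * M * (1 + 13 * ‖R p‖), by positivity, ?_⟩
  · intro q hq hqb
    by_contra hne
    have := h₂ (ball_subset_ball ((min_le_left _ _).trans (min_le_right _ _)) hqb)
    exact this (by simp [hne, hq])
  · intro w hw hne
    have hw1 : ‖w - p‖ < δ₁ := by
      have := ball_subset_ball ((min_le_left _ _).trans (min_le_left _ _)) hw
      rwa [mem_ball, dist_eq_norm] at this
    have hw2 : ‖w - p‖ ≤ 1 := by
      have := ball_subset_ball (min_le_right _ _) hw
      rw [mem_ball, dist_eq_norm] at this
      exact this.le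
    have hx : 0 < ‖w - p‖ := norm_pos_iff.2 (sub_ne_zero.2 hne)
    set x := ‖w - p‖
    have hB : ‖fuchs (P.erase p) R w‖ ≤ M := by
      have := h₁ (x := w) (by rwa [dist_eq_norm])
      rw [dist_eq_norm] at this
      have h3 := norm_sub_norm_le (fuchs (P.erase p) R w) (fuchs (P.erase p) R p)
      linarith
    have hpow : 1 ≤ x ^ (-(1 / 8) : ℝ) :=
      one_le_rpow_of_pos_of_le_one_of_nonpos hx hw2 (by norm_num)
    have hL : ‖sideLog κ (w - p) • R p‖ ≤ 13 * ‖R p‖ * x ^ (-(1 / 8) : ℝ) := by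
      rw [norm_smul]
      have := mul_le_mul_of_nonneg_right (norm_sideLog_le hκ hx hw2) (norm_nonneg (R p))
      linarith
    have h1 : ‖1 - sideLog κ (w - p) • R p‖ ≤ (1 + 13 * ‖R p‖) * x ^ (-(1 / 8) : ℝ) := by
      refine (norm_sub_le _ _).trans ?_
      have := norm_one_le_clm (E := E)
      linarith
    have h2 : ‖1 + sideLog κ (w - p) • R p‖ ≤ (1 + 13 * ‖R p‖) * x ^ (-(1 / 8) : ℝ) := by
      refine (norm_add_le _ _).trans ?_
      have := norm_one_le_clm (E := E)
      linarith
    have hpp : x ^ (-(1 / 8) : ℝ) * x ^ (-(1 / 8) : ℝ) = x ^ (-(1 / 4) : ℝ) := by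
      rw [← Real.rpow_add hx]; norm_num
    calc ‖gaugedCoeff P R κ p w‖
        ≤ ‖1 - sideLog κ (w - p) • R p‖ * ‖fuchs (P.erase p) R w‖ *
          ‖1 + sideLog κ (w - p) • R p‖ :=
          (norm_mul_le _ _).trans (mul_le_mul_of_nonneg_right (norm_mul_le _ _) (norm_nonneg _))
      _ ≤ ((1 + 13 * ‖R p‖) * x ^ (-(1 / 8) : ℝ)) * M *
          ((1 + 13 * ‖R p‖) * x ^ (-(1 / 8) : ℝ)) := by gcongr
      _ = _ := by rw [← hpp]; ring

variable [CompleteSpace E]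

/-- Near a pole `p` with `R_p² = 0`, the system has an invertible solution `T` with
`(1 - log(w - p) R_p) T → 1`. -/
theorem exists_local_solution (P : Finset ℂ) (R : ℂ → E →L[ℂ] E) (hR0 : ∀ p ∉ P, R p = 0)
    (hR2 : ∀ p, R p * R p = 0) {κ : ℝ} (hκ : IsSign κ) (p : ℂ) :
    ∃ δ > 0, δ ≤ 1 ∧ (∀ q ∈ P, q ∈ ball p δ → q = p) ∧ ∃ C ≥ 0, ∃ T Ti : ℂ → E →L[ℂ] E,
      (∀ w ∈ ball p δ, w ≠ p → Ti w * T w = 1 ∧ T w * Ti w = 1 ∧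
        ‖(1 - sideLog κ (w - p) • R p) * T w - 1‖ ≤ C * ‖w - p‖ ^ (3 / 4 : ℝ) ∧
        ∀ x, ‖Ti w x‖ ≤ 2 * ‖x - sideLog κ (w - p) • R p x‖) ∧ ∀ w ∈ ball p δ, w ∈ slitAt κ p →
        HasDerivAt T (fuchs P R w * T w) w ∧ HasDerivAt Ti (-(Ti w * fuchs P R w)) w := by
  obtain ⟨δ₁, hδ₁, hδ₁1, hpole, C, hC, hbd⟩ := exists_gaugedCoeff_bound P R hκ p
  obtain ⟨δ₂, hδ₂, hδ₂'⟩ : ∃ δ₂ > 0, ∀ x : ℝ, 0 < x → x < δ₂ →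
      4 * C * x ^ (3 / 4 : ℝ) ≤ 1 / 2 := by
    have hc : ContinuousAt (fun x : ℝ => 4 * C * x ^ (3 / 4 : ℝ)) 0 :=
      continuousAt_const.mul (Real.continuousAt_rpow_const _ _ (Or.inr (by norm_num)))
    obtain ⟨δ, hδ, h⟩ := Metric.continuousAt_iff.1 hc (1 / 2) (by norm_num)
    refine ⟨δ, hδ, fun x hx hxδ => ?_⟩
    have := h (x := x) (by rw [Real.dist_eq, sub_zero, abs_of_pos hx]; exact hxδ)
    rw [Real.zero_rpow (by norm_num), mul_zero, Real.dist_eq, sub_zero] at this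
    exact (le_abs_self _).trans this.le
  set δ := min δ₁ δ₂ with hδdef
  have hδ : 0 < δ := lt_min hδ₁ hδ₂
  set At := gaugedCoeff P R κ p with hAt
  have hrb : ∀ w ∈ ball p δ, w ≠ p → RadialBound At p w (C * ‖w - p‖ ^ (-(1 / 4) : ℝ)) := by
    intro w hw hne t ht
    have ht0 := ht.1
    have hx : 0 < ‖w - p‖ := norm_pos_iff.2 (sub_ne_zero.2 hne)
    have htn : ‖p + t * (w - p) - p‖ = t * ‖w - p‖ := by
      rw [add_sub_cancel_left, norm_mul, norm_real, norm_eq_abs, abs_of_pos ht0]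
    have hmem : p + t * (w - p) ∈ ball p δ₁ := by
      rw [mem_ball, dist_eq_norm, htn]
      have : ‖w - p‖ < δ := by rwa [mem_ball, dist_eq_norm] at hw
      calc t * ‖w - p‖ ≤ 1 * ‖w - p‖ := by gcongr; exact ht.2
        _ < δ₁ := by rw [one_mul]; exact this.trans_le (min_le_left _ _)
    have hne' : p + t * (w - p) ≠ p := by
      intro h
      have : t * ‖w - p‖ = 0 := by rw [← htn, h, sub_self, norm_zero]
      exact absurd this (by positivity)
    have h1 := hbd _ hmem hne'
    rw [htn, Real.mul_rpow ht0.le hx.le] at h1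
    have h2 : t ^ (-(1 / 4) : ℝ) * √t ≤ 1 := by
      rw [Real.sqrt_eq_rpow, ← Real.rpow_add ht0]
      exact Real.rpow_le_one ht0.le ht.2 (by norm_num)
    calc ‖At (p + t * (w - p))‖ * √t
        ≤ (C * (t ^ (-(1 / 4) : ℝ) * ‖w - p‖ ^ (-(1 / 4) : ℝ))) * √t := by gcongr
      _ = C * ‖w - p‖ ^ (-(1 / 4) : ℝ) * (t ^ (-(1 / 4) : ℝ) * √t) := by ring
      _ ≤ C * ‖w - p‖ ^ (-(1 / 4) : ℝ) * 1 := by gcongr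
      _ = _ := mul_one _
  have hdAt : ∀ w ∈ ball p δ, w ∈ slitAt κ p → DifferentiableAt ℂ At w := by
    intro w hw hs
    have hnotin : w ∉ P.erase p := by
      intro h
      rw [Finset.mem_erase] at h
      exact h.1 (hpole w h.2 (ball_subset_ball (min_le_left _ _) hw))
    have hl : DifferentiableAt ℂ (fun w => sideLog κ (w - p) • R p) w :=
      (hasDerivAt_sideLog hκ hs).differentiableAt.smul_const _
    exact ((hl.const_sub 1).mul (differentiableAt_fuchs _ _ hnotin)).mul (hl.const_add 1)
  have hstar : StarDomain At p (ball p δ ∩ slitAt κ p) := by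
    refine ⟨isOpen_ball.inter (isOpen_slitAt _ _), ?_, ?_, ?_⟩
    · rintro w ⟨hw, hs⟩ t ⟨ht0, ht1⟩
      constructor
      · rw [mem_ball, dist_eq_norm] at hw ⊢
        rw [add_sub_cancel_left, norm_mul, norm_real, norm_eq_abs, abs_of_pos ht0]
        exact lt_of_le_of_lt (mul_le_of_le_one_left (norm_nonneg _) ht1) hw
      · simp only [slitAt, mem_ofPred_eq, add_sub_cancel_left] at hs ⊢
        rw [show -(I * κ) * (t * (w - p)) = t * (-(I * κ) * (w - p)) by ring]
        rw [Complex.mem_slitPlane_iff] at hs ⊢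
        rw [re_ofReal_mul, im_ofReal_mul]
        rcases hs with h | h
        · exact Or.inl (mul_pos ht0 h)
        · exact Or.inr (mul_ne_zero ht0.ne' h)
    · intro w hw
      exact (hdAt w hw.1 hw.2).differentiableWithinAt
    · rintro w₀ ⟨hw₀, hs₀⟩
      have hx₀ : 0 < ‖w₀ - p‖ := norm_pos_iff.2 (sub_ne_zero.2 (ne_of_mem_slitAt hs₀))
      obtain ⟨ρ, hρ, hsub⟩ := Metric.isOpen_iff.1 isOpen_ball w₀ hw₀
      refine ⟨min ρ (‖w₀ - p‖ / 2), lt_min hρ (by linarith),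
        C * (‖w₀ - p‖ / 2) ^ (-(1 / 4) : ℝ), fun w hw => ?_⟩
      have hwb := hsub (ball_subset_ball (min_le_left _ _) hw)
      have hww : ‖w₀ - p‖ / 2 ≤ ‖w - p‖ := by
        have h1 := ball_subset_ball (min_le_right _ _) hw
        rw [mem_ball, dist_comm, dist_eq_norm] at h1
        have h2 : ‖w₀ - p‖ ≤ ‖w₀ - w‖ + ‖w - p‖ := by
          have := norm_add_le (w₀ - w) (w - p)
          simpa using this
        linarith
      have hne : w ≠ p := by
        rintro rfl
        rw [sub_self, norm_zero] at hww
        linarith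
      intro t ht
      refine (hrb w hwb hne t ht).trans (mul_le_mul_of_nonneg_left ?_ hC.le)
      exact rpow_le_rpow_of_nonpos (by linarith) hww (by norm_num)
  obtain ⟨Q, hQ, hQb⟩ := hstar.exists_solution norm_one_le_clm
  have hQ1 : ∀ w ∈ ball p δ, w ≠ p → ‖Q w - 1‖ ≤ 4 * C * ‖w - p‖ ^ (3 / 4 : ℝ) ∧
      ‖Q w - 1‖ ≤ 1 / 2 := by
    intro w hw hne
    have hx : 0 < ‖w - p‖ := norm_pos_iff.2 (sub_ne_zero.2 hne)
    have h1 := hQb w _ (hrb w hw hne)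
    have e : 2 * (C * ‖w - p‖ ^ (-(1 / 4) : ℝ)) * ‖w - p‖ = 2 * C * ‖w - p‖ ^ (3 / 4 : ℝ) := by
      have : ‖w - p‖ ^ (3 / 4 : ℝ) = ‖w - p‖ ^ (-(1 / 4) : ℝ) * ‖w - p‖ := by
        conv_rhs => rw [← Real.rpow_add_one hx.ne']
        norm_num
      rw [this]; ring
    rw [e] at h1
    have hxδ : ‖w - p‖ < δ₂ := by
      rw [mem_ball, dist_eq_norm] at hw
      exact hw.trans_le (min_le_right _ _)
    have h2 := hδ₂' _ hx hxδ
    set y := 2 * C * ‖w - p‖ ^ (3 / 4 : ℝ) with hy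
    have hy0 : 0 ≤ y := by positivity
    have h3 : Real.exp y - 1 ≤ 2 * y := by
      have := Real.abs_exp_sub_one_le (x := y) (by rw [abs_of_nonneg hy0]; linarith)
      rw [abs_of_nonneg hy0] at this
      exact (le_abs_self _).trans this
    constructor <;> linarith
  have hunit : ∀ w ∈ ball p δ, w ≠ p → IsUnit (Q w) := by
    intro w hw hne
    have h1 := (hQ1 w hw hne).2
    have : Q w = 1 - (1 - Q w) := by abel
    rw [this]
    exact isUnit_one_sub_of_norm_lt_one (by rw [norm_sub_rev]; linarith)
  set L : ℂ → E →L[ℂ] E := fun w => sideLog κ (w - p) • R p with hL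
  have hLL : ∀ w, L w * L w = 0 := fun w => by
    simp only [hL, smul_mul_smul_comm, hR2, smul_zero]
  have hinv1 : ∀ w, (1 - L w) * (1 + L w) = 1 := fun w => by
    have := hLL w
    rw [sub_mul, one_mul, mul_add, mul_one, this]; abel
  have hinv2 : ∀ w, (1 + L w) * (1 - L w) = 1 := fun w => by
    have := hLL w
    rw [add_mul, one_mul, mul_sub, mul_one, this]; abel
  refine ⟨δ, hδ, (min_le_left _ _).trans hδ₁1,
    fun q hq hqb => hpole q hq (ball_subset_ball (min_le_left _ _) hqb),
    4 * C, by positivity, fun w => (1 + L w) * Q w,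
    fun w => Ring.inverse (Q w) * (1 - L w), ?_, ?_⟩
  · intro w hw hne
    have hu := hunit w hw hne
    refine ⟨?_, ?_, ?_, ?_⟩
    · calc Ring.inverse (Q w) * (1 - L w) * ((1 + L w) * Q w)
          = Ring.inverse (Q w) * ((1 - L w) * (1 + L w)) * Q w := by noncomm_ring
        _ = 1 := by rw [hinv1, mul_one, Ring.inverse_mul_cancel _ hu]
    · calc (1 + L w) * Q w * (Ring.inverse (Q w) * (1 - L w))
          = (1 + L w) * (Q w * Ring.inverse (Q w)) * (1 - L w) := by noncomm_ring
        _ = 1 := by rw [Ring.mul_inverse_cancel _ hu, mul_one, hinv2]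
    · have : (1 - sideLog κ (w - p) • R p) * ((1 + L w) * Q w) = Q w := by
        rw [← mul_assoc]
        change (1 - L w) * (1 + L w) * Q w = Q w
        rw [hinv1, one_mul]
      rw [this]
      exact (hQ1 w hw hne).1
    · intro x
      set y := x - sideLog κ (w - p) • R p x with hy
      have e : (Ring.inverse (Q w) * (1 - L w)) x = Ring.inverse (Q w) y := by
        simp [hy, hL]
      rw [e]
      set z := Ring.inverse (Q w) y with hz
      have e2 : Q w z = y := by
        have : (Q w * Ring.inverse (Q w)) y = y := by rw [Ring.mul_inverse_cancel _ hu]; rfl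
        exact this
      have e3 : z = y - (Q w - 1) z := by
        simp [e2]
      have h4 : ‖z‖ ≤ ‖y‖ + 1 / 2 * ‖z‖ := by
        calc ‖z‖ = ‖y - (Q w - 1) z‖ := by rw [← e3]
          _ ≤ ‖y‖ + ‖(Q w - 1) z‖ := norm_sub_le _ _
          _ ≤ ‖y‖ + ‖Q w - 1‖ * ‖z‖ := by gcongr; exact (Q w - 1).le_opNorm z
          _ ≤ _ := by gcongr; exact (hQ1 w hw hne).2
      linarith
  · intro w hw hs
    have hne := ne_of_mem_slitAt hs
    have hu := hunit w hw hne
    have hQw := hQ w ⟨hw, hs⟩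
    have hLw : HasDerivAt L ((w - p)⁻¹ • R p) w := (hasDerivAt_sideLog hκ hs).smul_const (R p)
    have hRL : R p * L w = 0 := by simp only [hL, mul_smul_comm, hR2, smul_zero]
    have hLR : L w * R p = 0 := by simp only [hL, smul_mul_assoc, hR2, smul_zero]
    have hfe := fuchs_eq P R hR0 p w
    have hAtw : At w = (1 - L w) * fuchs (P.erase p) R w * (1 + L w) := rfl
    constructor
    · refine ((hLw.const_add 1).mul hQw).congr_deriv ?_
      rw [hfe, hAtw]
      set B := fuchs (P.erase p) R w
      have e1 : (1 + L w) * ((1 - L w) * B * (1 + L w) * Q w) = B * ((1 + L w) * Q w) := by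
        calc _ = ((1 + L w) * (1 - L w)) * (B * ((1 + L w) * Q w)) := by noncomm_ring
          _ = _ := by rw [hinv2, one_mul]
      have e2 : (w - p)⁻¹ • R p * ((1 + L w) * Q w) = (w - p)⁻¹ • R p * Q w := by
        rw [← mul_assoc, mul_add, mul_one, smul_mul_assoc _ (R p) (L w), hRL, smul_zero, add_zero]
      rw [e1]
      change _ = ((w - p)⁻¹ • R p + B) * ((1 + L w) * Q w)
      rw [add_mul ((w - p)⁻¹ • R p), e2]
    · obtain ⟨u, hu'⟩ := hu
      have hri : HasDerivAt (fun w => Ring.inverse (Q w))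
          (-(Ring.inverse (Q w) * (At w * Q w) * Ring.inverse (Q w))) w := by
        have h1 := hasFDerivAt_ringInverse (𝕜 := ℂ) u
        rw [hu'] at h1
        have h2 := h1.comp_hasDerivAt w hQw
        refine h2.congr_deriv ?_
        simp [← hu', mul_assoc]
      have hri' : HasDerivAt (fun w => Ring.inverse (Q w)) (-(Ring.inverse (Q w) * At w)) w := by
        refine hri.congr_deriv ?_
        rw [mul_assoc, mul_assoc, Ring.mul_inverse_cancel _ ⟨u, hu'⟩, mul_one]
      refine (hri'.mul (hLw.const_sub 1)).congr_deriv ?_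
      rw [hfe, hAtw]
      set B := fuchs (P.erase p) R w
      set Qi := Ring.inverse (Q w)
      have e1 : -(Qi * ((1 - L w) * B * (1 + L w))) * (1 - L w) = -(Qi * (1 - L w) * B) := by
        calc _ = -(Qi * (1 - L w) * B * ((1 + L w) * (1 - L w))) := by noncomm_ring
          _ = _ := by rw [hinv2, mul_one]
      have e2 : Qi * (1 - L w) * ((w - p)⁻¹ • R p) = Qi * ((w - p)⁻¹ • R p) := by
        rw [mul_assoc, sub_mul, one_mul, mul_smul_comm, hLR, smul_zero, sub_zero]
      rw [e1, mul_add, e2]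
      noncomm_ring

end Fuchsian

section SectorSolution

variable {E : Type*} [NormedAddCommGroup E] [NormedSpace ℂ E]

/-- `Ψ` is the solution of the Fuchsian system on a sector adjacent to the positive reals, and on
the positive reals minus the poles, with the value `v` at `0`; at the poles on the positive reals
it has only logarithmic singularities. -/
structure SectorSolution (P : Finset ℂ) (R : ℂ → E →L[ℂ] E) (κ η : ℝ) (v : E) (Ψ : ℂ → E) :
    Prop where
  deriv : ∀ w ∈ raySector κ η, w ∉ P → HasDerivAt Ψ (fuchs P R w (Ψ w)) w
  base : Tendsto (fun w => Ψ w - sideLog κ w • R 0 (Ψ w)) (𝓝[raySector κ η] 0) (𝓝 v)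
  base_bound : ∃ C, ∃ δ > 0, ∀ w ∈ raySector κ η, ‖w‖ < δ → ‖Ψ w - v‖ ≤ C * √‖w‖
  pole : ∀ p : ℝ, 0 < p → ∃ Θ, Tendsto (fun w => Ψ w - sideLog κ (w - p) • R p (Ψ w))
    (𝓝[raySector κ η \ {(p : ℂ)}] p) (𝓝 Θ)

theorem SectorSolution.map {F : Type*} [NormedAddCommGroup F] [NormedSpace ℂ F]
    {P : Finset ℂ} {R : ℂ → E →L[ℂ] E} {R' : ℂ → F →L[ℂ] F} {κ η : ℝ} {v : E} {Ψ : ℂ → E}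
    (h : SectorSolution P R κ η v Ψ) (g : E →L[ℂ] F) (hg : ∀ p x, g (R p x) = R' p (g x)) :
    SectorSolution P R' κ η (g v) (fun w => g (Ψ w)) := by
  have e : ∀ (z : ℂ) p x, g (x - z • R p x) = g x - z • R' p (g x) := by
    intro z p x; rw [map_sub, map_smul, hg]
  refine ⟨fun w hw hP => ?_, ?_, ?_, fun p hp => ?_⟩
  · refine (g.hasFDerivAt.comp_hasDerivAt w (h.deriv w hw hP)).congr_deriv ?_
    simp [fuchs, hg]
  · have := (g.continuous.tendsto v).comp h.base
    simpa only [comp_def, e] using this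
  · obtain ⟨C, δ, hδ, hb⟩ := h.base_bound
    refine ⟨‖g‖ * C, δ, hδ, fun w hw hwδ => ?_⟩
    rw [← map_sub, mul_assoc]
    exact (g.le_opNorm _).trans (mul_le_mul_of_nonneg_left (hb w hw hwδ) (norm_nonneg _))
  · obtain ⟨Θ, hΘ⟩ := h.pole p hp
    refine ⟨g Θ, ?_⟩
    have := (g.continuous.tendsto Θ).comp hΘ
    simpa only [comp_def, e] using this

theorem hasDerivAt_comp_ofReal {f : ℂ → E} {f' : E} {x : ℝ} (h : HasDerivAt f f' (x : ℂ)) :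
    HasDerivAt (fun y : ℝ => f y) f' x := by
  simpa [comp_def] using h.scomp x (Complex.ofRealCLM.hasDerivAt (x := x))

variable [CompleteSpace E]

/-- The plane minus the half lines issued from the poles in the direction opposite to `c`. -/
def slitComplement (P : Finset ℂ) (c : ℂ) : Set ℂ :=
  {w | ∀ q ∈ P, ¬ (((w - c) / (q - c)).im = 0 ∧ 1 ≤ ((w - c) / (q - c)).re)}

theorem isOpen_slitComplement (P : Finset ℂ) (c : ℂ) : IsOpen (slitComplement P c) := by
  have : slitComplement P c = ⋂ q ∈ P,
      {w | ((w - c) / (q - c)).im = 0 ∧ 1 ≤ ((w - c) / (q - c)).re}ᶜ := by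
    ext w; simp [slitComplement]
  rw [this]
  refine isOpen_biInter_finset fun q _ => IsClosed.isOpen_compl (self := ?_)
  have h1 : Continuous fun w : ℂ => (w - c) / (q - c) := by fun_prop
  exact (isClosed_eq (Complex.continuous_im.comp h1) continuous_const).inter
    (isClosed_le continuous_const (Complex.continuous_re.comp h1))

theorem center_mem_slitComplement (P : Finset ℂ) (c : ℂ) : c ∈ slitComplement P c := by
  intro q _ h
  rw [sub_self, zero_div] at h
  have := h.2
  norm_num at this

theorem star_slitComplement (P : Finset ℂ) (c : ℂ) {w : ℂ} (hw : w ∈ slitComplement P c) {t : ℝ}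
    (ht : t ∈ Icc (0 : ℝ) 1) : c + t * (w - c) ∈ slitComplement P c := by
  rcases ht.1.eq_or_lt with rfl | ht0
  · simpa using center_mem_slitComplement P c
  intro q hq h
  apply hw q hq
  rw [add_sub_cancel_left, mul_div_assoc, im_ofReal_mul, re_ofReal_mul] at h
  refine ⟨(mul_eq_zero.1 h.1).resolve_left ht0.ne', ?_⟩
  by_contra hlt
  push Not at hlt
  have h2 := h.2
  rcases le_or_gt ((w - c) / (q - c)).re 0 with h0 | h0
  · nlinarith [mul_nonpos_of_nonneg_of_nonpos ht0.le h0]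
  · nlinarith [ht.2]

theorem notMem_of_mem_slitComplement {P : Finset ℂ} {c w : ℂ} (hc : c ∉ P)
    (hw : w ∈ slitComplement P c) : w ∉ P := by
  intro hP
  apply hw w hP
  have : w - c ≠ 0 := sub_ne_zero.2 fun h => hc (h ▸ hP)
  rw [div_self this]
  simp

theorem mem_slitComplement {P : Finset ℂ} {κ η : ℝ} (hP : ∀ p ∈ P, p ∉ sector κ η) {c w : ℂ}
    (hc : c ∈ sector κ η) (hw : w ∈ raySector κ η) (hwP : w ∉ P) : w ∈ slitComplement P c := by
  rintro q hq ⟨him, hre⟩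
  set r := ((w - c) / (q - c)).re with hr
  have hqc : q - c ≠ 0 := sub_ne_zero.2 fun h => hP q hq (h ▸ hc)
  have hz : (w - c) / (q - c) = r := Complex.ext (by simp [hr]) (by simp [him])
  have hr0 : (r : ℂ) ≠ 0 := by exact_mod_cast (by linarith : r ≠ 0)
  have hw' : w - c = r * (q - c) := by rw [← hz]; field_simp
  have hq' : q = ((1 - 1 / r : ℝ) : ℂ) * c + ((1 / r : ℝ) : ℂ) * w := by
    have : w = c + r * (q - c) := by rw [← hw']; ring
    rw [this]; push_cast; field_simp; ring
  rcases hre.eq_or_lt with h1 | h1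
  · apply hwP
    have : w = q := by
      have : w - c = q - c := by rw [hw', ← h1]; simp
      exact sub_left_injective this
    exact this ▸ hq
  · apply hP q hq
    rw [hq']
    refine combo_mem_sector hc hw ?_ (by positivity)
    have : 1 / r < 1 := (div_lt_one (by linarith)).2 h1
    linarith

theorem exists_global_solution (P : Finset ℂ) (R : ℂ → E →L[ℂ] E) {c : ℂ} (hc : c ∉ P) :
    ∃ Q : ℂ → E →L[ℂ] E, (∀ w ∈ slitComplement P c, HasDerivAt Q (fuchs P R w * Q w) w) ∧
      Q c = 1 := by
  set U := slitComplement P c with hU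
  have hdiff : DifferentiableOn ℂ (fuchs P R) U := fun w hw =>
    (differentiableAt_fuchs P R (notMem_of_mem_slitComplement hc hw)).differentiableWithinAt
  have hstar : StarDomain (fuchs P R) c U := by
    refine ⟨isOpen_slitComplement P c,
      fun w hw t ht => star_slitComplement P c hw ⟨ht.1.le, ht.2⟩, hdiff, ?_⟩
    intro w₀ hw₀
    obtain ⟨ρ, hρ, hsub⟩ := Metric.nhds_basis_closedBall.mem_iff.1
      ((isOpen_slitComplement P c).mem_nhds hw₀)
    have hcomp : IsCompact (closedBall w₀ ρ ×ˢ Icc (0 : ℝ) 1) :=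
      (isCompact_closedBall w₀ ρ).prod isCompact_Icc
    obtain ⟨K, hK⟩ := hcomp.exists_bound_of_continuousOn
      (f := fun x : ℂ × ℝ => fuchs P R (c + x.2 * (x.1 - c)))
      (hdiff.continuousOn.comp (by fun_prop)
        fun x hx => star_slitComplement P c (hsub hx.1) hx.2)
    refine ⟨ρ, hρ, K, fun w hw t ht => ?_⟩
    have h1 := hK (w, t) ⟨ball_subset_closedBall hw, ht.1.le, ht.2⟩
    have h2 : √t ≤ 1 := Real.sqrt_le_one.2 ht.2
    exact (mul_le_of_le_one_right (norm_nonneg _) h2).trans h1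
  obtain ⟨Q, hQ, hQb⟩ := hstar.exists_solution norm_one_le_clm
  refine ⟨Q, hQ, ?_⟩
  obtain ⟨ρ, hρ, K, hK⟩ := hstar.bound c (center_mem_slitComplement P c)
  have := hQb c K (hK c (mem_ball_self hρ))
  simpa [sub_eq_zero] using this

/-- A solution on the part of the sector near `p` is obtained from the local solution. -/
theorem local_solution_const {P : Finset ℂ} {R : ℂ → E →L[ℂ] E} {κ η : ℝ}
    (hκ : IsSign κ) {p : ℝ} {δ : ℝ}
    (hpole : ∀ q ∈ P, q ∈ ball (p : ℂ) δ → q = p) {T Ti : ℂ → E →L[ℂ] E}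
    (hinv : ∀ w ∈ ball (p : ℂ) δ, w ≠ p → T w * Ti w = 1)
    (hTi : ∀ w ∈ ball (p : ℂ) δ, w ∈ slitAt κ p → HasDerivAt Ti (-(Ti w * fuchs P R w)) w)
    {Ψ : ℂ → E} (hΨ : ∀ w ∈ raySector κ η, w ∉ P → HasDerivAt Ψ (fuchs P R w (Ψ w)) w)
    {c : ℂ} (hc : c ∈ sector κ η) (hcb : c ∈ ball (p : ℂ) δ) {w : ℂ}
    (hw : w ∈ raySector κ η) (hwb : w ∈ ball (p : ℂ) δ) (hwp : w ≠ p) : Ψ w = T w (Ti c (Ψ c)) := by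
  have hseg : ∀ z ∈ segment ℝ w c, z ∈ raySector κ η ∧ z ∈ ball (p : ℂ) δ ∧ z ≠ p := by
    intro z hz
    refine ⟨(convex_raySector κ η).segment_subset hw (sector_subset hc) hz,
      (convex_ball _ _).segment_subset hwb hcb hz, ?_⟩
    obtain ⟨a, b, ha, hb, hab, rfl⟩ := hz
    rcases hb.eq_or_lt with rfl | hb
    · rw [add_zero] at hab
      subst hab
      simpa using hwp
    · intro h
      have h2 := combo_mem_sector hc hw hb ha
      have h3 := congrArg Complex.im h
      simp only [Complex.real_smul] at h3
      rw [add_comm] at h2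
      have := h2.2.1
      rw [h3] at this
      simp at this
  have hder : ∀ z ∈ segment ℝ w c, HasDerivAt (fun z => Ti z (Ψ z)) 0 z := by
    intro z hz
    obtain ⟨h1, h2, h3⟩ := hseg z hz
    have hslit : z ∈ slitAt κ p := mem_slitAt hκ (by simpa using h1.2.1) h3
    have hP : z ∉ P := fun h => h3 (hpole z h h2)
    refine ((hTi z h2 hslit).clm_apply (hΨ z h1 hP)).congr_deriv ?_
    simp
  have h4 := eq_of_hasDerivAt_zero_segment hder
  rw [← h4]
  have := congrArg (fun A : E →L[ℂ] E => A (Ψ w)) (hinv w hwb hwp)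
  exact this.symm

theorem exists_sectorSolution (P : Finset ℂ) (R : ℂ → E →L[ℂ] E) (hR0 : ∀ p ∉ P, R p = 0)
    (hR2 : ∀ p, R p * R p = 0) {κ η : ℝ} (hκ : IsSign κ) (hη : 0 < η)
    (hP : ∀ p ∈ P, p ∉ sector κ η) {v : E} (hv : R 0 v = 0) : ∃ Ψ, SectorSolution P R κ η v Ψ := by
  have hκκ := hκ.mul_self
  have hnear : ∀ p : ℝ, 0 ≤ p → ∀ δ > 0, ∃ c ∈ sector κ η, c ∈ ball (p : ℂ) δ := by
    intro p hp δ hδ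
    set ε := δ / (2 * (1 + η)) with hε
    have hε0 : 0 < ε := by positivity
    refine ⟨⟨p + ε, κ * (η * ε / 2)⟩, ⟨?_, ?_, ?_⟩, ?_⟩
    · simp only; linarith
    · simp only; rw [← mul_assoc, hκκ]; positivity
    · simp only; rw [← mul_assoc, hκκ]; nlinarith [mul_nonneg hη.le hp, mul_pos hη hε0]
    · rw [mem_ball, dist_eq_norm]
      have hκ1 := hκ.abs_eq_one
      refine (norm_le_abs_re_add_abs_im _).trans_lt ?_
      simp only [sub_re, ofReal_re, Complex.sub_im, ofReal_im, sub_zero,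
        add_sub_cancel_left, abs_mul, hκ1, one_mul, abs_div, abs_of_pos hε0, abs_of_pos hη,
        abs_two]
      have : ε * (2 * (1 + η)) = δ := by rw [hε]; field_simp
      nlinarith [mul_pos hη hε0]
  obtain ⟨δ, hδ, hδ1, hpole, C, hC, T, Ti, hT, hT'⟩ :=
    exists_local_solution P R hR0 hR2 hκ ((0 : ℝ) : ℂ)
  obtain ⟨c, hc, hcb⟩ := hnear 0 le_rfl δ hδ
  have hcne : c ≠ ((0 : ℝ) : ℂ) := by
    rintro rfl
    have := hc.1
    simp at this
  obtain ⟨Q, hQ, hQc⟩ := exists_global_solution P R (fun h => hP c h hc)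
  set Ψ : ℂ → E := fun w => Q w (T c v) with hΨdef
  have hΨ : ∀ w ∈ raySector κ η, w ∉ P → HasDerivAt Ψ (fuchs P R w (Ψ w)) w := by
    intro w hw hwP
    have := (hQ w (mem_slitComplement hP hc hw hwP)).clm_apply (hasDerivAt_const w (T c v))
    simpa using this
  have hΨ0 : ∀ w ∈ raySector κ η, w ∈ ball ((0 : ℝ) : ℂ) δ → Ψ w = T w v := by
    intro w hw hwb
    have hwne : w ≠ ((0 : ℝ) : ℂ) := by
      rintro rfl
      have := hw.1
      simp at this
    rw [local_solution_const hκ hpole (fun w hw hne => (hT w hw hne).2.1)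
      (fun w hw hs => (hT' w hw hs).2) hΨ hc hcb hw hwb hwne]
    have e : Ti c (T c v) = v := by
      have := congrArg (fun A : E →L[ℂ] E => A v) (hT c hcb hcne).1
      exact this
    simp only [hΨdef, hQc]
    exact congrArg (T w) e
  have hlim : ∀ (p : ℝ) (δ' C' : ℝ) (T' : ℂ → E →L[ℂ] E) (θ : E) (S : Set ℂ), 0 < δ' →
      S ⊆ raySector κ η \ {(p : ℂ)} →
      (∀ w ∈ S, w ∈ ball (p : ℂ) δ' → Ψ w = T' w θ) →
      (∀ w ∈ ball (p : ℂ) δ', w ≠ p →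
        ‖(1 - sideLog κ (w - p) • R p) * T' w - 1‖ ≤ C' * ‖w - p‖ ^ (3 / 4 : ℝ)) →
      Tendsto (fun w => Ψ w - sideLog κ (w - p) • R p (Ψ w)) (𝓝[S] p) (𝓝 θ) := by
    intro p δ' C' T' θ S hδ' hS hΨT hT'b
    rw [tendsto_iff_norm_sub_tendsto_zero]
    have hz : Tendsto (fun w : ℂ => C' * ‖w - p‖ ^ (3 / 4 : ℝ) * ‖θ‖) (𝓝[S] p) (𝓝 0) := by
      have h1 : ContinuousAt (fun w : ℂ => C' * ‖w - p‖ ^ (3 / 4 : ℝ) * ‖θ‖) p := by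
        refine (continuousAt_const.mul ?_).mul continuousAt_const
        exact ContinuousAt.rpow_const (by fun_prop) (Or.inr (by norm_num))
      have h2 := h1.tendsto
      simp only [sub_self, norm_zero] at h2
      rw [Real.zero_rpow (by norm_num), mul_zero, zero_mul] at h2
      exact h2.mono_left nhdsWithin_le_nhds
    refine squeeze_zero' (Eventually.of_forall fun _ => norm_nonneg _) ?_ hz
    filter_upwards [self_mem_nhdsWithin, mem_nhdsWithin_of_mem_nhds (ball_mem_nhds (p : ℂ) hδ')]
      with w hw hwb
    have hb := hT'b w hwb (hS hw).2
    rw [hΨT w hw hwb]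
    have e : T' w θ - sideLog κ (w - p) • R p (T' w θ) - θ =
        ((1 - sideLog κ (w - p) • R p) * T' w - 1) θ := by simp
    rw [e]
    exact (le_opNorm _ _).trans (mul_le_mul_of_nonneg_right hb (norm_nonneg _))
  have hsub0 : raySector κ η ⊆ raySector κ η \ {((0 : ℝ) : ℂ)} := by
    intro w hw
    refine ⟨hw, ?_⟩
    rintro rfl
    have := hw.1
    simp at this
  refine ⟨Ψ, hΨ, ?_, ?_, ?_⟩
  · have := hlim 0 δ C T v (raySector κ η) hδ hsub0 hΨ0
      (fun w hw hne => (hT w hw hne).2.2.1)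
    simpa using this
  · refine ⟨(1 + 13 * ‖R 0‖) * C * ‖v‖, δ, hδ, fun w hw hwδ => ?_⟩
    have hwb : w ∈ ball ((0 : ℝ) : ℂ) δ := by simpa [mem_ball, dist_eq_norm] using hwδ
    have hwne := (hsub0 hw).2
    have hx : 0 < ‖w‖ := by
      rw [norm_pos_iff]
      intro h
      apply hwne
      rw [h]; simp
    have hx1 : ‖w‖ ≤ 1 := hwδ.le.trans hδ1
    have h1 := (hT w hwb hwne).2.2.1
    rw [hΨ0 w hw hwb]
    simp only [ofReal_zero, sub_zero] at h1
    set L := sideLog κ w • R 0 with hL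
    have hLL : L * L = 0 := by simp [hL, hR2]
    have hLv : L v = 0 := by simp [hL, hv]
    have e : T w v - v = (1 + L) (((1 - L) * T w - 1) v) := by
      have e1 : (1 + L) * (1 - L) = 1 := by
        rw [add_mul, one_mul, mul_sub, mul_one, hLL]; abel
      have e2 : (1 + L) (((1 - L) * T w - 1) v) = ((1 + L) * (1 - L)) (T w v) - (1 + L) v := by
        simp
        abel
      rw [e2, e1]
      simp [hLv]
    have hLn : ‖1 + L‖ ≤ (1 + 13 * ‖R 0‖) * ‖w‖ ^ (-(1 / 8) : ℝ) := by
      have hpow : 1 ≤ ‖w‖ ^ (-(1 / 8) : ℝ) :=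
        one_le_rpow_of_pos_of_le_one_of_nonpos hx hx1 (by norm_num)
      have h3 : ‖L‖ ≤ 13 * ‖w‖ ^ (-(1 / 8) : ℝ) * ‖R 0‖ := by
        rw [hL, norm_smul]
        exact mul_le_mul_of_nonneg_right (norm_sideLog_le hκ hx hx1) (norm_nonneg _)
      have h4 := norm_one_le_clm (E := E)
      have h5 := norm_add_le (1 : E →L[ℂ] E) L
      nlinarith
    rw [e]
    calc ‖(1 + L) (((1 - L) * T w - 1) v)‖
        ≤ ‖1 + L‖ * (‖(1 - L) * T w - 1‖ * ‖v‖) :=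
          (le_opNorm _ _).trans
            (mul_le_mul_of_nonneg_left (le_opNorm _ _) (norm_nonneg _))
      _ ≤ ((1 + 13 * ‖R 0‖) * ‖w‖ ^ (-(1 / 8) : ℝ)) * ((C * ‖w‖ ^ (3 / 4 : ℝ)) * ‖v‖) := by
          gcongr
      _ = (1 + 13 * ‖R 0‖) * C * ‖v‖ * ‖w‖ ^ (5 / 8 : ℝ) := by
          have : ‖w‖ ^ (5 / 8 : ℝ) = ‖w‖ ^ (-(1 / 8) : ℝ) * ‖w‖ ^ (3 / 4 : ℝ) := by
            rw [← Real.rpow_add hx]; norm_num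
          rw [this]; ring
      _ ≤ (1 + 13 * ‖R 0‖) * C * ‖v‖ * √‖w‖ := by
          rw [Real.sqrt_eq_rpow]
          refine mul_le_mul_of_nonneg_left ?_ (by positivity)
          exact Real.rpow_le_rpow_of_exponent_ge hx hx1 (by norm_num)
  · intro p hp
    obtain ⟨δ', hδ', -, hpole', C', hC', T', Ti', hT₁, hT₂⟩ :=
      exists_local_solution P R hR0 hR2 hκ (p : ℂ)
    obtain ⟨c', hc', hcb'⟩ := hnear p hp.le δ' hδ'
    refine ⟨Ti' c' (Ψ c'), hlim p δ' C' T' _ _ hδ' subset_rfl ?_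
      (fun w hw hne => (hT₁ w hw hne).2.2.1)⟩
    intro w hw hwb
    exact local_solution_const hκ hpole' (fun w hw hne => (hT₁ w hw hne).2.1)
      (fun w hw hs => (hT₂ w hw hs).2) hΨ hc' hcb' hw.1 hwb hw.2

/-- A solution on an interval on the right of `p` for which `(1 - log(x - p) R_p) D` tends to zero
vanishes near `p`. -/
theorem eventually_eq_zero_of_tendsto (P : Finset ℂ) (R : ℂ → E →L[ℂ] E)
    (hR0 : ∀ p ∉ P, R p = 0) (hR2 : ∀ p, R p * R p = 0) (p : ℝ) {D : ℂ → E}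
    (hD : ∀ᶠ x : ℝ in 𝓝[>] p, HasDerivAt D (fuchs P R x (D x)) x)
    (h0 : Tendsto (fun x : ℝ => D x - (Real.log (x - p) : ℂ) • R p (D x)) (𝓝[>] p) (𝓝 0)) :
    ∀ᶠ x : ℝ in 𝓝[>] p, D x = 0 := by
  obtain ⟨δ, hδ, -, hpole, C, hC, T, Ti, hT, hT'⟩ :=
    exists_local_solution P R hR0 hR2 (κ := 1) (Or.inl rfl) (p : ℂ)
  obtain ⟨b, hb, hDb⟩ := (mem_nhdsGT_iff_exists_Ioo_subset).1 hD
  simp only [mem_Ioi] at hb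
  set b' := min b (p + δ) with hb'
  have hpb' : p < b' := lt_min hb (by linarith)
  have hmem : ∀ x ∈ Ioo p b', (x : ℂ) ∈ ball (p : ℂ) δ ∧ (x : ℂ) ≠ p ∧ (x : ℂ) ∈ slitAt 1 p := by
    intro x hx
    have h1 : (x : ℂ) ≠ p := by exact_mod_cast hx.1.ne'
    refine ⟨?_, h1, mem_slitAt (Or.inl rfl) (by simp) h1⟩
    rw [mem_ball, dist_eq_norm, ← Complex.ofReal_sub, norm_real, norm_eq_abs,
      abs_of_pos (by linarith [hx.1])]
    have := hx.2.trans_le (min_le_right _ _)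
    linarith
  set G : ℝ → E := fun x => Ti x (D x) with hG
  have hder : ∀ x ∈ Ioo p b', HasDerivAt G 0 x := by
    intro x hx
    obtain ⟨h1, h2, h3⟩ := hmem x hx
    have h4 : HasDerivAt D (fuchs P R x (D x)) x :=
      hDb ⟨hx.1, hx.2.trans_le (min_le_left _ _)⟩
    have h5 := ((hT' x h1 h3).2.clm_apply h4)
    have h6 : HasDerivAt (fun z : ℂ => Ti z (D z)) 0 (x : ℂ) := h5.congr_deriv (by simp)
    exact hasDerivAt_comp_ofReal h6
  have hconst : ∀ x ∈ Ioo p b', ∀ y ∈ Ioo p b', G x = G y := by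
    intro x hx y hy
    have := (convex_Ioo p b').norm_image_sub_le_of_norm_hasDerivWithin_le (C := 0)
      (f := G) (f' := fun _ => 0) (fun z hz => (hder z hz).hasDerivWithinAt) (by simp) hy hx
    simpa [sub_eq_zero] using this
  have hGlim : Tendsto G (𝓝[>] p) (𝓝 0) := by
    have h1 : Tendsto (fun x : ℝ => 2 * ‖D x - (Real.log (x - p) : ℂ) • R p (D x)‖) (𝓝[>] p)
        (𝓝 0) := by
      have := (tendsto_zero_iff_norm_tendsto_zero.1 h0).const_mul 2
      simpa using this
    refine squeeze_zero_norm' ?_ h1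
    filter_upwards [Ioo_mem_nhdsGT hpb'] with x hx
    obtain ⟨h2, h3, -⟩ := hmem x hx
    have h4 := (hT x h2 h3).2.2.2 (D x)
    rw [← Complex.ofReal_sub, sideLog_pos (Or.inl rfl) (by linarith [hx.1])] at h4
    exact h4
  filter_upwards [Ioo_mem_nhdsGT hpb'] with x hx
  have hGx : G x = 0 := by
    refine tendsto_nhds_unique ?_ hGlim
    refine (tendsto_congr' ?_).2 (tendsto_const_nhds (x := G x))
    filter_upwards [Ioo_mem_nhdsGT hpb'] with y hy using hconst y hy x hx
  obtain ⟨h2, h3, -⟩ := hmem x hx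
  have h4 := congrArg (fun A : E →L[ℂ] E => A (D x)) (hT x h2 h3).2.1
  have h5 : T x (Ti x (D x)) = D x := h4
  rw [← h5]
  change T x (G x) = 0
  rw [hGx, map_zero]

end SectorSolution

section Graded

variable {F : Type*} [NormedAddCommGroup F] [NormedSpace ℂ F]

/-- The operator `b ↦ (0, 2 T b₀, 2 T b₁, …)` on bounded sequences. -/
def shiftMap (T : F →L[ℂ] F) : (ℕ →ᵇ F) →L[ℂ] (ℕ →ᵇ F) :=
  LinearMap.mkContinuous
    { toFun := fun b => BoundedContinuousFunction.ofNormedAddCommGroupDiscrete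
        (fun n => Nat.casesOn n 0 fun k => (2 : ℂ) • T (b k)) (2 * ‖T‖ * ‖b‖) (by
          intro n
          cases n with
          | zero =>
            change ‖(0 : F)‖ ≤ _
            rw [norm_zero]
            positivity
          | succ k =>
            simp only [norm_smul, Complex.norm_ofNat, mul_assoc]
            gcongr
            exact T.le_of_opNorm_le_of_le le_rfl (b.norm_coe_le_norm k))
      map_add' := by
        intro b c
        ext n
        cases n <;> simp
      map_smul' := by
        intro a b
        ext n
        cases n
        · simp
        · rename_i k
          change (2 : ℂ) • T (a • b k) = a • (2 : ℂ) • T (b k)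
          rw [map_smul, smul_comm] }
    (2 * ‖T‖) (by
      intro b
      rw [BoundedContinuousFunction.norm_le (by positivity)]
      intro n
      cases n with
      | zero => simp; positivity
      | succ k =>
        simp only [LinearMap.coe_mk, AddHom.coe_mk,
          BoundedContinuousFunction.coe_ofNormedAddCommGroupDiscrete, norm_smul,
          Complex.norm_ofNat, mul_assoc]
        gcongr
        exact T.le_of_opNorm_le_of_le le_rfl (b.norm_coe_le_norm k))

@[simp]
theorem shiftMap_zero_apply (T : F →L[ℂ] F) (b : ℕ →ᵇ F) : shiftMap T b 0 = 0 := rfl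

@[simp]
theorem shiftMap_succ_apply (T : F →L[ℂ] F) (b : ℕ →ᵇ F) (n : ℕ) :
    shiftMap T b (n + 1) = (2 : ℂ) • T (b n) := rfl

/-- The coefficient `2⁻ⁿ bₙ`. -/
def coeffMap (n : ℕ) : (ℕ →ᵇ F) →L[ℂ] F :=
  ((1 / 2 : ℂ) ^ n) • BoundedContinuousFunction.evalCLM ℂ n

theorem coeffMap_apply (n : ℕ) (b : ℕ →ᵇ F) : coeffMap n b = ((1 / 2 : ℂ) ^ n) • b n := rfl

theorem norm_coeffMap_le (n : ℕ) (b : ℕ →ᵇ F) : ‖coeffMap n b‖ ≤ (1 / 2) ^ n * ‖b‖ := by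
  rw [coeffMap_apply, norm_smul, norm_pow]
  have : ‖(1 / 2 : ℂ)‖ = 1 / 2 := by simp
  rw [this]
  gcongr
  exact b.norm_coe_le_norm n

theorem coeffMap_zero_shift (T : F →L[ℂ] F) (b : ℕ →ᵇ F) : coeffMap 0 (shiftMap T b) = 0 := by
  simp [coeffMap_apply]

theorem coeffMap_succ_shift (T : F →L[ℂ] F) (b : ℕ →ᵇ F) (n : ℕ) :
    coeffMap (n + 1) (shiftMap T b) = T (coeffMap n b) := by
  simp only [coeffMap_apply, shiftMap_succ_apply, smul_smul, map_smul]
  congr 1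
  rw [pow_succ]; ring

theorem summable_norm_coeffMap (b : ℕ →ᵇ F) : Summable fun n => ‖coeffMap n b‖ :=
  Summable.of_nonneg_of_le (fun _ => norm_nonneg _) (fun n => norm_coeffMap_le n b)
    ((summable_geometric_of_lt_one (by norm_num) (by norm_num)).mul_right _)

variable [CompleteSpace F]

/-- The sum `∑ 2⁻ⁿ bₙ`. -/
def sumMap : (ℕ →ᵇ F) →L[ℂ] F :=
  LinearMap.mkContinuous
    { toFun := fun b => ∑' n, coeffMap n b
      map_add' := by
        intro b c
        simp only [map_add]
        exact (summable_norm_coeffMap b).of_norm.tsum_add (summable_norm_coeffMap c).of_norm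
      map_smul' := by
        intro a b
        simp only [map_smul, RingHom.id_apply]
        exact (summable_norm_coeffMap b).of_norm.tsum_const_smul a }
    2 (by
      intro b
      have h := (hasSum_geometric_of_lt_one (r := (1 / 2 : ℝ)) (by norm_num) (by norm_num)).mul_right
        ‖b‖
      have := tsum_of_norm_bounded h fun n => norm_coeffMap_le n b
      refine this.trans (le_of_eq ?_)
      norm_num)

theorem hasSum_sumMap (b : ℕ →ᵇ F) : HasSum (fun n => coeffMap n b) (sumMap b) :=
  (summable_norm_coeffMap b).of_norm.hasSum

theorem sumMap_shift (T : F →L[ℂ] F) (b : ℕ →ᵇ F) : sumMap (shiftMap T b) = T (sumMap b) := by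
  have h1 : HasSum (fun n => T (coeffMap n b)) (T (sumMap b)) := T.hasSum (hasSum_sumMap b)
  have h2 : HasSum (fun n => coeffMap (n + 1) (shiftMap T b)) (T (sumMap b)) := by
    simpa only [coeffMap_succ_shift] using h1
  have h3 : HasSum (fun n => coeffMap n (shiftMap T b)) (T (sumMap b)) := by
    rw [← hasSum_nat_add_iff' 1]
    simpa [coeffMap_zero_shift] using h2
  exact (hasSum_sumMap (shiftMap T b)).unique h3

/-- `Φ` is the expansion of a sector solution in the degree in the residues. -/
structure GradedSolution (P : Finset ℂ) (R : ℂ → F →L[ℂ] F) (κ η : ℝ) (v : F) (Ψ : ℂ → F)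
    (Φ : ℕ → ℂ → F) : Prop where
  sol : SectorSolution P R κ η v Ψ
  deriv_zero : ∀ w ∈ raySector κ η, w ∉ P → HasDerivAt (Φ 0) 0 w
  deriv_succ : ∀ n, ∀ w ∈ raySector κ η, w ∉ P → HasDerivAt (Φ (n + 1)) (fuchs P R w (Φ n w)) w
  base_zero : Tendsto (Φ 0) (𝓝[raySector κ η] 0) (𝓝 v)
  base_succ : ∀ n, Tendsto (Φ (n + 1)) (𝓝[raySector κ η] 0) (𝓝 0)
  pole : ∀ p : ℝ, 0 < p → ∃ Θ : F, ∃ Θs : ℕ → F,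
    Tendsto (fun w => Ψ w - sideLog κ (w - p) • R p (Ψ w)) (𝓝[raySector κ η \ {(p : ℂ)}] p) (𝓝 Θ) ∧
    Tendsto (Φ 0) (𝓝[raySector κ η \ {(p : ℂ)}] p) (𝓝 (Θs 0)) ∧
    (∀ n, Tendsto (fun w => Φ (n + 1) w - sideLog κ (w - p) • R p (Φ n w))
      (𝓝[raySector κ η \ {(p : ℂ)}] p) (𝓝 (Θs (n + 1)))) ∧ Summable (fun n => ‖Θs n‖) ∧ HasSum Θs Θ

theorem SectorSolution.tendsto_base {P : Finset ℂ} {R : ℂ → F →L[ℂ] F} {κ η : ℝ} {v : F}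
    {Ψ : ℂ → F} (h : SectorSolution P R κ η v Ψ) : Tendsto Ψ (𝓝[raySector κ η] 0) (𝓝 v) := by
  obtain ⟨C, δ, hδ, hb⟩ := h.base_bound
  rw [tendsto_iff_norm_sub_tendsto_zero]
  have hz : Tendsto (fun w : ℂ => C * √‖w‖) (𝓝[raySector κ η] 0) (𝓝 0) := by
    have : ContinuousAt (fun w : ℂ => C * √‖w‖) 0 := by fun_prop
    have h2 := this.tendsto
    simp only [norm_zero, Real.sqrt_zero, mul_zero] at h2
    exact h2.mono_left nhdsWithin_le_nhds
  refine squeeze_zero' (Eventually.of_forall fun _ => norm_nonneg _) ?_ hz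
  filter_upwards [self_mem_nhdsWithin, mem_nhdsWithin_of_mem_nhds (ball_mem_nhds (0 : ℂ) hδ)]
    with w hw hwb
  exact hb w hw (by simpa using hwb)

theorem exists_gradedSolution (P : Finset ℂ) (R : ℂ → F →L[ℂ] F) (hR0 : ∀ p ∉ P, R p = 0)
    (hR2 : ∀ p, R p * R p = 0) {κ η : ℝ} (hκ : IsSign κ) (hη : 0 < η)
    (hP : ∀ p ∈ P, p ∉ sector κ η) {v : F} (hv : R 0 v = 0) :
    ∃ Ψ Φ, GradedSolution P R κ η v Ψ Φ := by
  set R' : ℂ → (ℕ →ᵇ F) →L[ℂ] (ℕ →ᵇ F) := fun p => shiftMap (R p) with hR'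
  set v' : ℕ →ᵇ F := BoundedContinuousFunction.ofNormedAddCommGroupDiscrete
    (fun n => if n = 0 then v else 0) ‖v‖ (by intro n; split_ifs <;> simp) with hv'
  have hv'0 : v' 0 = v := rfl
  have hv's : ∀ n, v' (n + 1) = 0 := fun n => rfl
  have h0' : ∀ p ∉ P, R' p = 0 := by
    intro p hp
    ext b n
    cases n <;> simp [hR', hR0 p hp]
  have h2' : ∀ p, R' p * R' p = 0 := by
    intro p
    have hRR : ∀ x, R p (R p x) = 0 := fun x => by
      have := congrArg (fun A : F →L[ℂ] F => A x) (hR2 p)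
      exact this
    ext b n
    rcases n with _ | _ | n <;> simp [hR', hRR]
  have hv'' : R' 0 v' = 0 := by
    ext n
    rcases n with _ | _ | n <;> simp [hR', hv'0, hv's, hv]
  obtain ⟨b, hb⟩ := exists_sectorSolution P R' h0' h2' hκ hη hP hv''
  have hsv : sumMap v' = v := by
    have h1 : HasSum (fun n => coeffMap n v') v := by
      have := hasSum_ite_eq (0 : ℕ) v
      convert this using 2 with n
      cases n <;> simp [coeffMap_apply, hv'0, hv's]
    exact (hasSum_sumMap v').unique h1
  have hfz : ∀ w x, coeffMap 0 (fuchs P R' w x) = 0 := by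
    intro w x
    simp [fuchs, hR', coeffMap_zero_shift]
  have hfs : ∀ n w x, coeffMap (n + 1) (fuchs P R' w x) = fuchs P R w (coeffMap n x) := by
    intro n w x
    simp [fuchs, hR', coeffMap_succ_shift]
  refine ⟨fun w => sumMap (b w), fun n w => coeffMap n (b w), ?_, ?_, ?_, ?_, ?_, ?_⟩
  · have := hb.map sumMap (R' := R) (fun p x => sumMap_shift (R p) x)
    rwa [hsv] at this
  · intro w hw hwP
    exact ((coeffMap 0).hasFDerivAt.comp_hasDerivAt w (hb.deriv w hw hwP)).congr_deriv (hfz _ _)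
  · intro n w hw hwP
    exact ((coeffMap (n + 1)).hasFDerivAt.comp_hasDerivAt w
      (hb.deriv w hw hwP)).congr_deriv (hfs _ _ _)
  · have := ((coeffMap 0).continuous.tendsto v').comp hb.tendsto_base
    simpa [comp_def, coeffMap_apply, hv'0] using this
  · intro n
    have := ((coeffMap (n + 1)).continuous.tendsto v').comp hb.tendsto_base
    simpa [comp_def, coeffMap_apply (n + 1) v', hv's] using this
  · intro p hp
    obtain ⟨Θ, hΘ⟩ := hb.pole p hp
    refine ⟨sumMap Θ, fun n => coeffMap n Θ, ?_, ?_, ?_, summable_norm_coeffMap Θ,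
      hasSum_sumMap Θ⟩
    · have := (sumMap.continuous.tendsto Θ).comp hΘ
      simpa only [comp_def, map_sub, map_smul, hR', sumMap_shift] using this
    · have := ((coeffMap 0).continuous.tendsto Θ).comp hΘ
      simpa only [comp_def, map_sub, map_smul, hR', coeffMap_zero_shift, smul_zero,
        sub_zero] using this
    · intro n
      have := ((coeffMap (n + 1)).continuous.tendsto Θ).comp hΘ
      simpa only [comp_def, map_sub, map_smul, hR', coeffMap_succ_shift] using this

end Graded

section Rows

variable {ι : Type*} [Fintype ι] [DecidableEq ι]

/-- The poles of the Fuchsian system attached to the row `i`. -/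
def rowPoles (lam : ι → ℂ) (i : ι) : Finset ℂ :=
  Finset.univ.image fun k => lam i - lam k

/-- The residues of the Fuchsian system attached to the row `i`. -/
def rowResidue (lam : ι → ℂ) (f : Mat(ι)) (i : ι) (p : ℂ) : (ι → ℂ) →L[ℂ] (ι → ℂ) :=
  LinearMap.toContinuousLinearMap
    { toFun := fun ψ k => if lam i - lam k = p then -∑ l, ψ l * f l k else 0
      map_add' := by
        intro x y
        funext k
        simp only [Pi.add_apply, add_mul, sum_add_distrib]
        split_ifs
        · ring
        · simp
      map_smul' := by
        intro c x
        funext k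
        simp only [Pi.smul_apply, smul_eq_mul, RingHom.id_apply, mul_assoc, ← mul_sum]
        split_ifs
        · ring
        · simp }

theorem rowResidue_apply (lam : ι → ℂ) (f : Mat(ι)) (i : ι) (p : ℂ) (ψ : ι → ℂ) (k : ι) :
    rowResidue lam f i p ψ k = if lam i - lam k = p then -∑ l, ψ l * f l k else 0 := rfl

theorem rowResidue_of_notMem (lam : ι → ℂ) (f : Mat(ι)) (i : ι) :
    ∀ p ∉ rowPoles lam i, rowResidue lam f i p = 0 := by
  intro p hp
  ext ψ k
  rw [rowResidue_apply, if_neg]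
  · rfl
  · intro h
    exact hp (Finset.mem_image.2 ⟨k, Finset.mem_univ k, h⟩)

theorem rowResidue_mul_self (lam : ι → ℂ) (f : Mat(ι))
    (hf : ∀ a b, lam a = lam b → f a b = 0) (i : ι) (p : ℂ) :
    rowResidue lam f i p * rowResidue lam f i p = 0 := by
  ext ψ k
  change rowResidue lam f i p (rowResidue lam f i p ψ) k = 0
  rw [rowResidue_apply]
  split_ifs with h
  · rw [neg_eq_zero]
    refine Finset.sum_eq_zero fun l _ => ?_
    rw [rowResidue_apply]
    split_ifs with h'
    · rw [hf l k (by linear_combination h - h'), mul_zero]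
    · rw [zero_mul]
  · rfl

theorem rowResidue_zero_base (lam : ι → ℂ) (f : Mat(ι))
    (hf : ∀ a b, lam a = lam b → f a b = 0) (i : ι) : rowResidue lam f i 0 (Pi.single i 1) = 0 := by
  funext k
  rw [rowResidue_apply]
  split_ifs with h
  · simp [Pi.single_apply, hf i k (by linear_combination h)]
  · rfl

theorem fuchs_row_apply (lam : ι → ℂ) (f : Mat(ι)) (i : ι) (w : ℂ) (ψ : ι → ℂ) (k : ι) :
    fuchs (rowPoles lam i) (rowResidue lam f i) w ψ k =
      -(w - (lam i - lam k))⁻¹ * ∑ l, ψ l * f l k := by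
  rw [fuchs]
  simp only [sum_apply, _root_.smul_apply, Finset.sum_apply, Pi.smul_apply,
    rowResidue_apply, smul_eq_mul]
  rw [sum_eq_single (lam i - lam k)]
  · rw [if_pos rfl]; ring
  · intro q _ hq
    rw [if_neg hq.symm, mul_zero]
  · intro h
    exact absurd (Finset.mem_image.2 ⟨k, Finset.mem_univ k, rfl⟩) h

end Rows

section Growth

variable {E : Type*} [NormedAddCommGroup E] [NormedSpace ℂ E]

/-- The weight `1 + ∑_p |w - p|^{-1/2}`, over the non-zero poles. -/
def poleWeight (P : Finset ℂ) (w : ℂ) : ℝ :=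
  1 + ∑ p ∈ P.erase 0, ‖w - p‖ ^ (-(1 / 2) : ℝ)

theorem one_le_poleWeight (P : Finset ℂ) (w : ℂ) : 1 ≤ poleWeight P w := by
  have : 0 ≤ ∑ p ∈ P.erase 0, ‖w - p‖ ^ (-(1 / 2) : ℝ) :=
    Finset.sum_nonneg fun p _ => rpow_nonneg (norm_nonneg _) _
  rw [poleWeight]; linarith

theorem isCompact_closedSector {κ η ρ : ℝ} (hκ : IsSign κ) :
    IsCompact {w : ℂ | 0 ≤ w.re ∧ w.re ≤ ρ ∧ 0 ≤ κ * w.im ∧ κ * w.im ≤ η * w.re} := by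
  have hκ1 := hκ.abs_eq_one
  refine Metric.isCompact_of_isClosed_isBounded ?_ ?_
  · refine (isClosed_le continuous_const Complex.continuous_re).inter
      ((isClosed_le Complex.continuous_re continuous_const).inter
      ((isClosed_le continuous_const (continuous_const.mul Complex.continuous_im)).inter
      (isClosed_le (continuous_const.mul Complex.continuous_im)
        (continuous_const.mul Complex.continuous_re))))
  · refine (Metric.isBounded_iff_subset_closedBall 0).2 ⟨ρ + |η| * ρ, fun w hw => ?_⟩
    obtain ⟨h1, h2, h3, h4⟩ := hw
    rw [mem_closedBall, dist_zero_right]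
    refine (norm_le_abs_re_add_abs_im w).trans ?_
    have h5 : |w.im| = κ * w.im := by
      rw [← abs_of_nonneg h3, abs_mul, hκ1, one_mul]
    rw [h5, abs_of_nonneg h1]
    have : η * w.re ≤ |η| * ρ :=
      mul_le_mul (le_abs_self η) h2 h1 (abs_nonneg η)
    linarith

theorem SectorSolution.bound_compact {P : Finset ℂ} {R : ℂ → E →L[ℂ] E} {κ η : ℝ} {v : E}
    {Ψ : ℂ → E} [CompleteSpace E] (h : SectorSolution P R κ η v Ψ) (hκ : IsSign κ)
    (hP : ∀ p ∈ P, p ∉ sector κ η) (hR2 : ∀ p, R p * R p = 0) {η' : ℝ} (hη' : η' < η) (ρ : ℝ) :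
    ∃ C, ∀ w ∈ raySector κ η, κ * w.im ≤ η' * w.re → w.re ≤ ρ → w ∉ P →
      ‖Ψ w‖ ≤ C * poleWeight P w := by
  set K : Set ℂ := {w : ℂ | 0 ≤ w.re ∧ w.re ≤ ρ ∧ 0 ≤ κ * w.im ∧ κ * w.im ≤ η' * w.re}
  have hK : IsCompact K := isCompact_closedSector hκ
  have hκ0 : κ ≠ 0 := by rcases hκ with h | h <;> rw [h] <;> norm_num
  have key : ∃ C, ∀ w ∈ K, w ∈ raySector κ η → w ∉ P → ‖Ψ w‖ ≤ C * poleWeight P w := by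
    refine hK.induction_on (p := fun s => ∃ C, ∀ w ∈ s, w ∈ raySector κ η → w ∉ P →
      ‖Ψ w‖ ≤ C * poleWeight P w) ⟨0, by simp⟩ ?_ ?_ ?_
    · rintro s t hst ⟨C, hC⟩
      exact ⟨C, fun w hw => hC w (hst hw)⟩
    · rintro s t ⟨C, hC⟩ ⟨C', hC'⟩
      refine ⟨max C C', fun w hw h1 h2 => ?_⟩
      have h3 := zero_le_one.trans (one_le_poleWeight P w)
      rcases hw with hw | hw
      · exact (hC w hw h1 h2).trans (mul_le_mul_of_nonneg_right (le_max_left _ _) h3)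
      · exact (hC' w hw h1 h2).trans (mul_le_mul_of_nonneg_right (le_max_right _ _) h3)
    · intro x hx
      have hsimple : ∀ (y : E), Tendsto Ψ (𝓝[raySector κ η] x) (𝓝 y) →
          ∃ t ∈ 𝓝[K] x, ∃ C, ∀ w ∈ t, w ∈ raySector κ η → w ∉ P →
            ‖Ψ w‖ ≤ C * poleWeight P w := by
        intro y hy
        have h1 : ∀ᶠ w in 𝓝[raySector κ η] x, ‖Ψ w‖ ≤ ‖y‖ + 1 :=
          hy.norm.eventually (ge_mem_nhds (by linarith))
        rw [eventually_nhdsWithin_iff] at h1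
        refine ⟨_, mem_nhdsWithin_of_mem_nhds h1, ‖y‖ + 1, fun w hw hws _ => ?_⟩
        exact (hw hws).trans (le_mul_of_one_le_right (by positivity) (one_le_poleWeight P w))
      obtain ⟨h1, h2, h3, h4⟩ := hx
      rcases h1.eq_or_lt with hre | hre
      · have hx0 : x = 0 := by
          rw [← hre, mul_zero] at h4
          have := (mul_eq_zero.1 (le_antisymm h4 h3)).resolve_left hκ0
          exact Complex.ext hre.symm this
        subst hx0
        exact hsimple v h.tendsto_base
      have hxs : x ∈ raySector κ η :=
        ⟨hre, h3, h4.trans_lt (mul_lt_mul_of_pos_right hη' hre)⟩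
      by_cases hxP : x ∈ P
      · have him : x.im = 0 := by
          have : ¬ 0 < κ * x.im := fun hpos => hP x hxP ⟨hre, hpos, hxs.2.2⟩
          exact (mul_eq_zero.1 (le_antisymm (not_lt.1 this) h3)).resolve_left hκ0
        have hxr : x = (x.re : ℂ) := Complex.ext (by simp) (by simp [him])
        obtain ⟨Θ, hΘ⟩ := h.pole x.re hre
        rw [← hxr] at hΘ
        have hev : ∀ᶠ w in 𝓝[raySector κ η \ {x}] x,
            ‖Ψ w - sideLog κ (w - x) • R x (Ψ w)‖ ≤ ‖Θ‖ + 1 :=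
          hΘ.norm.eventually (ge_mem_nhds (by linarith))
        rw [eventually_nhdsWithin_iff] at hev
        refine ⟨_, mem_nhdsWithin_of_mem_nhds (inter_mem hev (ball_mem_nhds x one_pos)),
          (1 + 13 * ‖R x‖) * (‖Θ‖ + 1), ?_⟩
        rintro w ⟨hw1, hw2⟩ hws hwP
        have hwx : w ≠ x := fun e => hwP (e ▸ hxP)
        have h5 := hw1 ⟨hws, hwx⟩
        have hn0 : 0 < ‖w - x‖ := norm_pos_iff.2 (sub_ne_zero.2 hwx)
        have hn1 : ‖w - x‖ ≤ 1 := by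
          rw [mem_ball, dist_eq_norm] at hw2; exact hw2.le
        set L := sideLog κ (w - x) • R x with hL
        have hLL : L * L = 0 := by simp [hL, hR2]
        set y := Ψ w - sideLog κ (w - x) • R x (Ψ w) with hy
        have e : Ψ w = (1 + L) y := by
          have e1 : (1 + L) * (1 - L) = 1 := by
            rw [add_mul, one_mul, mul_sub, mul_one, hLL]; abel
          have e2 : y = (1 - L) (Ψ w) := by simp [hy, hL]
          rw [e2]
          have := congrArg (fun A : E →L[ℂ] E => A (Ψ w)) e1
          exact this.symm
        have hpow : 1 ≤ ‖w - x‖ ^ (-(1 / 8) : ℝ) :=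
          one_le_rpow_of_pos_of_le_one_of_nonpos hn0 hn1 (by norm_num)
        have hLn : ‖1 + L‖ ≤ (1 + 13 * ‖R x‖) * ‖w - x‖ ^ (-(1 / 8) : ℝ) := by
          have h3 : ‖L‖ ≤ 13 * ‖w - x‖ ^ (-(1 / 8) : ℝ) * ‖R x‖ := by
            rw [hL, norm_smul]
            exact mul_le_mul_of_nonneg_right (norm_sideLog_le hκ hn0 hn1) (norm_nonneg _)
          have h4 := norm_one_le_clm (E := E)
          have h5 := norm_add_le (1 : E →L[ℂ] E) L
          nlinarith
        have hpw : ‖w - x‖ ^ (-(1 / 8) : ℝ) ≤ poleWeight P w := by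
          have h6 : ‖w - x‖ ^ (-(1 / 8) : ℝ) ≤ ‖w - x‖ ^ (-(1 / 2) : ℝ) :=
            Real.rpow_le_rpow_of_exponent_ge hn0 hn1 (by norm_num)
          have hx0 : x ≠ 0 := by rintro rfl; simp at hre
          have h7 := Finset.single_le_sum (f := fun p => ‖w - p‖ ^ (-(1 / 2) : ℝ))
            (fun p _ => rpow_nonneg (norm_nonneg _) _) (Finset.mem_erase.2 ⟨hx0, hxP⟩)
          rw [poleWeight]; linarith
        rw [e]
        calc ‖(1 + L) y‖ ≤ ‖1 + L‖ * ‖y‖ := le_opNorm _ _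
          _ ≤ ((1 + 13 * ‖R x‖) * ‖w - x‖ ^ (-(1 / 8) : ℝ)) * (‖Θ‖ + 1) := by gcongr
          _ ≤ ((1 + 13 * ‖R x‖) * poleWeight P w) * (‖Θ‖ + 1) := by gcongr
          _ = _ := by ring
      · exact hsimple (Ψ x) ((h.deriv x hxs hxP).continuousAt.tendsto.mono_left
          nhdsWithin_le_nhds)
  obtain ⟨C, hC⟩ := key
  exact ⟨C, fun w hw h1 h2 h3 => hC w ⟨hw.1.le, h2, hw.2.1, h1⟩ hw h3⟩

theorem norm_fuchs_le (P : Finset ℂ) (R : ℂ → E →L[ℂ] E) {ρ : ℝ} (hρ : 0 < ρ) {w : ℂ}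
    (hw : ∀ p ∈ P, ρ ≤ ‖w - p‖) : ‖fuchs P R w‖ ≤ (∑ p ∈ P, ‖R p‖) / ρ := by
  rw [fuchs, Finset.sum_div]
  refine norm_sum_le_of_le _ fun p hp => ?_
  rw [norm_smul, norm_inv, mul_comm, ← div_eq_mul_inv]
  exact div_le_div_of_nonneg_left (norm_nonneg _) hρ (hw p hp)

/-- A sector solution has integrable singularities and subexponential growth. -/
theorem SectorSolution.bound {P : Finset ℂ} {R : ℂ → E →L[ℂ] E} {κ η : ℝ} {v : E}
    {Ψ : ℂ → E} [CompleteSpace E] (h : SectorSolution P R κ η v Ψ) (hκ : IsSign κ)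
    (hP : ∀ p ∈ P, p ∉ sector κ η) (hR2 : ∀ p, R p * R p = 0) {η' : ℝ} (hη0 : 0 ≤ η')
    (hη' : η' < η) {δ : ℝ} (hδ : 0 < δ) :
    ∃ C, 0 ≤ C ∧ ∀ w ∈ raySector κ η, κ * w.im ≤ η' * w.re → w ∉ P →
      ‖Ψ w‖ ≤ C * poleWeight P w * Real.exp (δ * w.re) := by
  have hκ1 := hκ.abs_eq_one
  set m := ∑ p ∈ P, ‖R p‖ with hm
  have hm0 : 0 ≤ m := Finset.sum_nonneg fun _ _ => norm_nonneg _
  set d := 1 + (1 + η') * m / δ with hd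
  have hd1 : 1 ≤ d := by rw [hd]; have : 0 ≤ (1 + η') * m / δ := by positivity
                         linarith
  set ρ := d + ∑ p ∈ P, ‖p‖ with hρ
  have hfar : ∀ w : ℂ, ρ ≤ w.re → ∀ p ∈ P, d ≤ ‖w - p‖ := by
    intro w hw p hp
    have h1 : ‖p‖ ≤ ∑ p ∈ P, ‖p‖ := Finset.single_le_sum (f := fun p : ℂ => ‖p‖)
      (fun _ _ => norm_nonneg _) hp
    have h2 := abs_re_le_norm (w - p)
    have h3 := abs_re_le_norm p
    have h4 := le_abs_self (w - p).re
    have h5 := le_abs_self p.re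
    rw [sub_re] at h2 h4
    linarith
  obtain ⟨C₀, hC₀⟩ := h.bound_compact hκ hP hR2 hη' ρ
  set C := max C₀ 0 with hC
  have hC0 : 0 ≤ C := le_max_right _ _
  have hCb : ∀ w ∈ raySector κ η, κ * w.im ≤ η' * w.re → w.re ≤ ρ → w ∉ P →
      ‖Ψ w‖ ≤ C * poleWeight P w := fun w h1 h2 h3 h4 =>
    (hC₀ w h1 h2 h3 h4).trans (mul_le_mul_of_nonneg_right (le_max_left _ _)
      (zero_le_one.trans (one_le_poleWeight P w)))
  set A : ℝ := 1 + (P.erase 0).card with hA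
  have hA1 : 1 ≤ A := by rw [hA]; simp
  refine ⟨C * A, by positivity, fun w hw h1 hwP => ?_⟩
  have hN := one_le_poleWeight P w
  have hre := hw.1
  rcases le_or_gt w.re ρ with hle | hgt
  · refine (hCb w hw h1 hle hwP).trans ?_
    have : 1 ≤ Real.exp (δ * w.re) := Real.one_le_exp (by positivity)
    calc C * poleWeight P w = C * 1 * poleWeight P w * 1 := by ring
      _ ≤ C * A * poleWeight P w * Real.exp (δ * w.re) := by gcongr
  · set u : ℂ := w / w.re with hu
    have hre' : (w.re : ℂ) ≠ 0 := by exact_mod_cast hre.ne'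
    have hur : u.re = 1 := by
      rw [hu, Complex.div_ofReal_re, div_self hre.ne']
    have hui : κ * u.im = κ * w.im / w.re := by
      rw [hu, Complex.div_ofReal_im]; ring
    have hui0 : 0 ≤ κ * u.im := by rw [hui]; exact div_nonneg hw.2.1 hre.le
    have hui1 : κ * u.im ≤ η' := by rw [hui, div_le_iff₀ hre]; exact h1
    have hun : ‖u‖ ≤ 1 + η' := by
      refine (norm_le_abs_re_add_abs_im u).trans ?_
      have h5 : |u.im| = κ * u.im := by rw [← abs_of_nonneg hui0, abs_mul, hκ1, one_mul]
      rw [hur, h5, abs_one]; linarith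
    have hρ0 : 0 < ρ := by
      have : 0 ≤ ∑ p ∈ P, ‖p‖ := Finset.sum_nonneg fun _ _ => norm_nonneg _
      linarith
    have hmem : ∀ s : ℝ, 0 < s → u * s ∈ raySector κ η ∧
        κ * (u * s).im ≤ η' * (u * s).re ∧ (u * s).re = s := by
      intro s hs
      have e1 : (u * s).re = s := by simp [hur]
      have e2 : (u * s).im = u.im * s := by simp [mul_comm]
      have e3 : κ * (u * s).im ≤ η' * (u * s).re := by
        rw [e1, e2, ← mul_assoc]; exact mul_le_mul_of_nonneg_right hui1 hs.le
      refine ⟨⟨by rw [e1]; exact hs, ?_, e3.trans_lt ?_⟩, e3, e1⟩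
      · rw [e2, ← mul_assoc]; exact mul_nonneg hui0 hs.le
      · rw [e1]; exact mul_lt_mul_of_pos_right hη' hs
    have hnP : ∀ s : ℝ, ρ ≤ s → u * s ∉ P := by
      intro s hs hP'
      have h3 := hfar (u * s) (by rw [(hmem s (by linarith)).2.2]; exact hs) _ hP'
      rw [sub_self, norm_zero] at h3
      linarith
    have hder : ∀ s : ℝ, ρ ≤ s → HasDerivAt (fun s : ℝ => Ψ (u * s))
        (u • fuchs P R (u * s) (Ψ (u * s))) s := by
      intro s hs
      have h3 := h.deriv _ (hmem s (by linarith)).1 (hnP s hs)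
      have h4 : HasDerivAt (fun s : ℝ => u * s) u s := by
        simpa using (Complex.ofRealCLM.hasDerivAt (x := s)).const_mul u
      exact h3.scomp s h4
    have hgr := norm_le_gronwallBound_of_norm_deriv_right_le (f := fun s : ℝ => Ψ (u * s))
      (f' := fun s : ℝ => u • fuchs P R (u * s) (Ψ (u * s))) (δ := C * A) (K := δ) (ε := 0)
      (a := ρ) (b := w.re)
      (fun s hs => (hder s hs.1).continuousAt.continuousWithinAt)
      (fun s hs => (hder s hs.1).hasDerivWithinAt) ?_ ?_ w.re ⟨hgt.le, le_rfl⟩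
    · have e : u * w.re = w := by rw [hu]; field_simp
      simp only [e] at hgr
      rw [gronwallBound_ε0] at hgr
      refine hgr.trans ?_
      have : Real.exp (δ * (w.re - ρ)) ≤ Real.exp (δ * w.re) :=
        Real.exp_le_exp.2 (by nlinarith)
      calc C * A * Real.exp (δ * (w.re - ρ)) ≤ C * A * 1 * Real.exp (δ * w.re) := by
            rw [mul_one]; gcongr
        _ ≤ _ := by gcongr
    · have h3 := hmem ρ hρ0
      refine (hCb _ h3.1 h3.2.1 h3.2.2.le (hnP ρ le_rfl)).trans ?_
      refine mul_le_mul_of_nonneg_left ?_ hC0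
      rw [poleWeight, hA]
      gcongr
      rw [← nsmul_one]
      refine Finset.sum_le_card_nsmul _ _ _ fun p hp => ?_
      refine Real.rpow_le_one_of_one_le_of_nonpos ?_ (by norm_num)
      exact hd1.trans (hfar _ h3.2.2.ge p (Finset.mem_of_mem_erase hp))
    · intro s hs
      have h3 : ‖fuchs P R (u * s)‖ ≤ m / d := norm_fuchs_le P R (by linarith)
        (hfar _ (by rw [(hmem s (by linarith [hs.1])).2.2]; exact hs.1))
      have h4 : (1 + η') * (m / d) ≤ δ := by
        rw [← mul_div_assoc, div_le_iff₀ (by linarith), hd]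
        have : δ * (1 + (1 + η') * m / δ) = δ + (1 + η') * m := by field_simp
        rw [this]; linarith
      rw [norm_smul, add_zero]
      calc ‖u‖ * ‖fuchs P R (u * s) (Ψ (u * s))‖
          ≤ (1 + η') * (m / d * ‖Ψ (u * s)‖) := by
            gcongr
            exact (le_opNorm _ _).trans (by gcongr)
        _ = (1 + η') * (m / d) * ‖Ψ (u * s)‖ := by ring
        _ ≤ _ := by gcongr

end Growth

section Laplace

variable {F : Type*} [NormedAddCommGroup F] [NormedSpace ℂ F] [CompleteSpace F]

/-- The normalised Laplace transform `ξ ∫_0^∞ e^{-ξσ} g(σ) dσ`. -/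
def laplace (g : ℝ → F) (ξ : ℂ) : F :=
  ξ • ∫ σ in Ioi (0 : ℝ), exp (-ξ * σ) • g σ

/-- Growth slower than every exponential. -/
def Subexp (g : ℝ → F) : Prop := ∀ δ > 0, ∃ C, ∀ σ > 0, ‖g σ‖ ≤ C * Real.exp (δ * σ)

theorem norm_exp_neg_mul (ξ : ℂ) (σ : ℝ) : ‖exp (-ξ * σ)‖ = Real.exp (-(ξ.re * σ)) := by
  rw [Complex.norm_exp]; simp

theorem integrableOn_exp_neg {a : ℝ} (ha : 0 < a) :
    IntegrableOn (fun σ : ℝ => Real.exp (-(a * σ))) (Ioi 0) := by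
  have := integrableOn_exp_mul_Ioi (a := -a) (by linarith) 0
  simpa using this

theorem Subexp.integrable_bound {g : ℝ → F} (hg : Subexp g) {a : ℝ} (ha : 0 < a) :
    ∃ C, ∀ σ > 0, Real.exp (-(a * σ)) * ‖g σ‖ ≤ C * Real.exp (-(a / 2 * σ)) := by
  obtain ⟨C, hC⟩ := hg (a / 2) (by linarith)
  refine ⟨C, fun σ hσ => ?_⟩
  calc Real.exp (-(a * σ)) * ‖g σ‖ ≤ Real.exp (-(a * σ)) * (C * Real.exp (a / 2 * σ)) := by
        gcongr; exact hC σ hσ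
    _ = C * (Real.exp (-(a * σ)) * Real.exp (a / 2 * σ)) := by ring
    _ = _ := by rw [← Real.exp_add]; congr 2; ring

theorem Subexp.integrable {g : ℝ → F} (hg : Subexp g) (hc : ContinuousOn g (Ioi 0)) {ξ : ℂ}
    (hξ : 0 < ξ.re) : IntegrableOn (fun σ : ℝ => exp (-ξ * σ) • g σ) (Ioi 0) := by
  obtain ⟨C, hC⟩ := hg.integrable_bound hξ
  refine Integrable.mono' ((integrableOn_exp_neg (half_pos hξ)).const_mul C) ?_ ?_
  · exact (ContinuousOn.smul (by fun_prop) hc).aestronglyMeasurable measurableSet_Ioi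
  · filter_upwards [ae_restrict_mem measurableSet_Ioi] with σ hσ
    rw [norm_smul, norm_exp_neg_mul]
    exact hC σ hσ

theorem Subexp.hasDerivAt {g : ℝ → F} (hg : Subexp g) (hc : ContinuousOn g (Ioi 0)) {ξ : ℂ}
    (hξ : 0 < ξ.re) : IntegrableOn (fun σ : ℝ => (-(σ : ℂ) * exp (-ξ * σ)) • g σ) (Ioi 0) ∧
    HasDerivAt (fun ξ : ℂ => ∫ σ in Ioi (0 : ℝ), exp (-ξ * σ) • g σ)
      (∫ σ in Ioi (0 : ℝ), (-(σ : ℂ) * exp (-ξ * σ)) • g σ) ξ := by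
  obtain ⟨C, hC⟩ := hg.integrable_bound (half_pos hξ)
  have hd : ∀ (σ : ℝ) (ξ : ℂ), HasDerivAt (fun ξ : ℂ => exp (-ξ * σ) • g σ)
      ((-(σ : ℂ) * exp (-ξ * σ)) • g σ) ξ := by
    intro σ ξ
    have h1 : HasDerivAt (fun ξ : ℂ => -ξ * σ) (-(σ : ℂ)) ξ := by
      simpa using ((hasDerivAt_id ξ).neg).mul_const (σ : ℂ)
    have := (h1.cexp).smul_const (g σ)
    rwa [mul_comm] at this
  have key := hasDerivAt_integral_of_holomorphic (μ := volume.restrict (Ioi (0 : ℝ)))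
    (F := fun (ξ : ℂ) (σ : ℝ) => exp (-ξ * σ) • g σ) (w₀ := ξ) (half_pos hξ)
    (b := fun σ => C * Real.exp (-(ξ.re / 2 / 2 * σ)))
    (fun w _ => (ContinuousOn.smul (by fun_prop) hc).aestronglyMeasurable measurableSet_Ioi)
    (Eventually.of_forall fun σ w _ => (hd σ w).differentiableAt.differentiableWithinAt)
    (by
      filter_upwards [ae_restrict_mem measurableSet_Ioi] with σ hσ w hw
      have hσ' : 0 < σ := hσ
      rw [norm_smul, norm_exp_neg_mul]
      refine le_trans ?_ (hC σ hσ)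
      gcongr
      rw [mem_ball, dist_eq_norm] at hw
      have h1 := abs_re_le_norm (w - ξ)
      have h2 := neg_abs_le (w - ξ).re
      rw [sub_re] at h1 h2
      linarith)
    ((integrableOn_exp_neg (half_pos (half_pos hξ))).const_mul C)
  simp only [(hd _ _).deriv] at key
  exact key

theorem integral_cexp_neg {ξ : ℂ} (hξ : 0 < ξ.re) : ∫ σ in Ioi (0 : ℝ), exp (-ξ * σ) = ξ⁻¹ := by
  rw [integral_exp_mul_complex_Ioi (by simpa using hξ)]
  simp

/-- The Laplace transform tends to the value at `0` when `ξ → ∞` non-tangentially. -/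
theorem Subexp.tendsto_laplace {g : ℝ → F} (hg : Subexp g) (hc : ContinuousOn g (Ioi 0)) {v : F}
    (hv : Tendsto g (𝓝[>] 0) (𝓝 v)) {α : Type*} {l : Filter α} [l.IsCountablyGenerated]
    {ξ : α → ℂ} {c : ℝ} (hc0 : 0 < c) (hξ : Tendsto (fun x => ‖ξ x‖) l atTop)
    (hre : ∀ᶠ x in l, c * ‖ξ x‖ ≤ (ξ x).re) : Tendsto (fun x => laplace g (ξ x)) l (𝓝 v) := by
  obtain ⟨C, hC⟩ := hg (c / 2) (by linarith)
  have h1 : ∀ᶠ x in l, 1 ≤ ‖ξ x‖ := hξ.eventually_ge_atTop 1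
  have hform : ∀ᶠ x in l, laplace g (ξ x) - v = ∫ s in Ioi (0 : ℝ),
      ((ξ x / ‖ξ x‖) * exp (-(ξ x / ‖ξ x‖) * s)) • (g (‖ξ x‖⁻¹ * s) - v) := by
    filter_upwards [h1, hre] with x hx1 hx2
    set τ := ‖ξ x‖ with hτ
    have hτ0 : 0 < τ := by linarith
    have hτc : (τ : ℂ) ≠ 0 := by exact_mod_cast hτ0.ne'
    set ω := ξ x / τ with hω
    have hωre : 0 < ω.re := by
      rw [hω, Complex.div_ofReal_re]
      exact div_pos (lt_of_lt_of_le (by positivity) hx2) hτ0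
    have hξre : 0 < (ξ x).re := lt_of_lt_of_le (by positivity) hx2
    have hint1 : IntegrableOn (fun s : ℝ => (ω * exp (-ω * s)) • g (τ⁻¹ * s)) (Ioi 0) := by
      have h2 := hg.integrable hc hξre
      have h3 := (integrableOn_Ioi_comp_mul_left_iff
        (fun σ : ℝ => exp (-(ξ x) * σ) • g σ) 0 (inv_pos.2 hτ0)).2 (by simpa using h2)
      have h4 := Integrable.smul ω h3
      refine h4.congr (Eventually.of_forall fun s => ?_)
      simp only [Pi.smul_apply, smul_smul]
      congr 3
      rw [hω]; push_cast; field_simp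
    have hint2 : IntegrableOn (fun s : ℝ => (ω * exp (-ω * s)) • v) (Ioi 0) := by
      have h2 := integrableOn_exp_mul_complex_Ioi (a := -ω) (by simpa using hωre) 0
      exact (h2.const_mul ω).smul_const v
    simp only [smul_sub]
    rw [integral_sub hint1 hint2]
    congr 1
    · have h2 := integral_comp_mul_left_Ioi
        (fun σ : ℝ => exp (-(ξ x) * σ) • g σ) 0 (inv_pos.2 hτ0)
      rw [mul_zero, inv_inv] at h2
      simp only [mul_smul]
      rw [integral_smul]
      have h3 : ∀ s : ℝ, exp (-ω * s) = exp (-(ξ x) * ((τ⁻¹ * s : ℝ) : ℂ)) := by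
        intro s; congr 1; rw [hω]; push_cast; field_simp
      simp only [h3]
      rw [h2, laplace, ← Complex.coe_smul, smul_smul, hω, div_mul_cancel₀ _ hτc]
    · simp only [mul_smul]
      rw [integral_smul, integral_smul_const, integral_cexp_neg hωre, smul_smul,
        mul_inv_cancel₀ (by rintro h; rw [h] at hωre; simp at hωre), one_smul]
  rw [tendsto_iff_norm_sub_tendsto_zero]
  suffices h : Tendsto (fun x => ∫ s in Ioi (0 : ℝ),
      ((ξ x / ‖ξ x‖) * exp (-(ξ x / ‖ξ x‖) * s)) • (g (‖ξ x‖⁻¹ * s) - v)) l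
      (𝓝 (∫ _ in Ioi (0 : ℝ), (0 : F))) by
    rw [integral_zero] at h
    refine (tendsto_zero_iff_norm_tendsto_zero.1 h).congr' ?_
    filter_upwards [hform] with x hx
    rw [hx]
  refine tendsto_integral_filter_of_dominated_convergence
    (fun s => Real.exp (-(c / 2 * s)) * (|C| + ‖v‖)) ?_ ?_ ?_ ?_
  · filter_upwards [h1] with x hx
    have hτ0 : 0 < ‖ξ x‖ := by linarith
    refine ContinuousOn.aestronglyMeasurable ?_ measurableSet_Ioi
    refine ContinuousOn.smul (by fun_prop) (ContinuousOn.sub ?_ continuousOn_const)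
    exact hc.comp (by fun_prop) fun s hs => mul_pos (inv_pos.2 hτ0) hs
  · filter_upwards [h1, hre] with x hx1 hx2
    filter_upwards [ae_restrict_mem measurableSet_Ioi] with s hs
    have hs0 : 0 < s := hs
    set τ := ‖ξ x‖ with hτ
    have hτ0 : 0 < τ := by linarith
    have hωn : ‖ξ x / τ‖ = 1 := by
      rw [norm_div, norm_real, norm_eq_abs, abs_of_pos hτ0, ← hτ, div_self hτ0.ne']
    have hωre : c ≤ (ξ x / τ).re := by
      rw [Complex.div_ofReal_re, le_div_iff₀ hτ0]; exact hx2
    have hτs : τ⁻¹ * s ≤ s := mul_le_of_le_one_left hs0.le (inv_le_one_of_one_le₀ hx1)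
    have hgs : ‖g (τ⁻¹ * s)‖ ≤ |C| * Real.exp (c / 2 * s) := by
      refine (hC _ (mul_pos (inv_pos.2 hτ0) hs0)).trans ?_
      gcongr
      exact le_abs_self C
    rw [norm_smul, norm_mul, hωn, one_mul, norm_exp_neg_mul]
    have he1 : 1 ≤ Real.exp (c / 2 * s) := Real.one_le_exp (by positivity)
    calc Real.exp (-((ξ x / τ).re * s)) * ‖g (τ⁻¹ * s) - v‖
        ≤ Real.exp (-(c * s)) * (|C| * Real.exp (c / 2 * s) + ‖v‖ * Real.exp (c / 2 * s)) := by
          gcongr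
          refine (norm_sub_le _ _).trans (add_le_add hgs ?_)
          exact le_mul_of_one_le_right (norm_nonneg _) he1
      _ = (Real.exp (-(c * s)) * Real.exp (c / 2 * s)) * (|C| + ‖v‖) := by ring
      _ = _ := by rw [← Real.exp_add]; congr 2; ring
  · exact (integrableOn_exp_neg (half_pos hc0)).mul_const _
  · filter_upwards [ae_restrict_mem measurableSet_Ioi] with s hs
    have hs0 : 0 < s := hs
    have hlim : Tendsto (fun x => g (‖ξ x‖⁻¹ * s) - v) l (𝓝 0) := by
      have h2 : Tendsto (fun x => ‖ξ x‖⁻¹ * s) l (𝓝[>] 0) := by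
        rw [tendsto_nhdsWithin_iff]
        constructor
        · have := (tendsto_inv_atTop_zero.comp hξ).mul_const s
          simpa using this
        · filter_upwards [h1] with x hx
          exact mul_pos (inv_pos.2 (by linarith)) hs0
      have := (hv.comp h2).sub_const v
      simpa using this
    rw [tendsto_zero_iff_norm_tendsto_zero] at hlim ⊢
    refine squeeze_zero' (Eventually.of_forall fun _ => norm_nonneg _) ?_ hlim
    filter_upwards [h1, hre] with x hx1 hx2
    set τ := ‖ξ x‖ with hτ
    have hτ0 : 0 < τ := by linarith
    have hωn : ‖ξ x / τ‖ = 1 := by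
      rw [norm_div, norm_real, norm_eq_abs, abs_of_pos hτ0, ← hτ, div_self hτ0.ne']
    have hωre : 0 ≤ (ξ x / τ).re := by
      rw [Complex.div_ofReal_re]
      exact div_nonneg (le_trans (by positivity) hx2) hτ0.le
    rw [norm_smul, norm_mul, hωn, one_mul, norm_exp_neg_mul]
    refine mul_le_of_le_one_left (norm_nonneg _) (Real.exp_le_one_iff.2 ?_)
    have := mul_nonneg hωre hs0.le
    linarith

end Laplace

section RowLaplace

variable {ι : Type*} [Fintype ι] [DecidableEq ι]

/-- The Laplace transform of a row solution satisfies the transformed equation. -/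
theorem hasDerivAt_laplace_row {lam : ι → ℂ} {f : Mat(ι)} {i : ι} {u : ℂ} (hu : u ≠ 0)
    {g : ℝ → ι → ℂ} (hg : Subexp g) (hv : Tendsto g (𝓝[>] 0) (𝓝 (Pi.single i 1)))
    (hP : ∀ σ : ℝ, 0 < σ → u * σ ∉ rowPoles lam i) (hd : ∀ σ : ℝ, 0 < σ →
      HasDerivAt g (u • fuchs (rowPoles lam i) (rowResidue lam f i) (u * σ) (g σ)) σ)
    {ξ : ℂ} (hξ : 0 < ξ.re) (k : ι) : HasDerivAt (fun ξ => laplace g ξ k)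
      (ξ⁻¹ * ∑ l, laplace g ξ l * f l k - (lam i - lam k) / u * laplace g ξ k) ξ := by
  have hc : ContinuousOn g (Ioi 0) := fun σ hσ => (hd σ hσ).continuousAt.continuousWithinAt
  have hξ0 : ξ ≠ 0 := by rintro rfl; simp at hξ
  obtain ⟨hInt', hder⟩ := hg.hasDerivAt hc hξ
  have hInt := hg.integrable hc hξ
  set s := lam i - lam k with hs
  set G := ∫ σ in Ioi (0 : ℝ), exp (-ξ * σ) • g σ with hG
  set G' := ∫ σ in Ioi (0 : ℝ), (-(σ : ℂ) * exp (-ξ * σ)) • g σ with hG'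
  have happ : ∀ l, G l = ∫ σ in Ioi (0 : ℝ), exp (-ξ * σ) * g σ l := fun l =>
    ((proj (R := ℂ) (φ := fun _ : ι => ℂ) l).integral_comp_comm hInt).symm
  have happ' : ∀ l, G' l = ∫ σ in Ioi (0 : ℝ), -(σ : ℂ) * exp (-ξ * σ) * g σ l := fun l =>
    ((proj (R := ℂ) (φ := fun _ : ι => ℂ) l).integral_comp_comm hInt').symm
  have hintl : ∀ l, IntegrableOn (fun σ : ℝ => exp (-ξ * σ) * g σ l) (Ioi 0) := fun l =>
    (proj (R := ℂ) (φ := fun _ : ι => ℂ) l).integrable_comp hInt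
  have hintl' : ∀ l, IntegrableOn (fun σ : ℝ => -(σ : ℂ) * exp (-ξ * σ) * g σ l)
      (Ioi 0) := fun l =>
    (proj (R := ℂ) (φ := fun _ : ι => ℂ) l).integrable_comp hInt'
  set h : ℝ → ℂ := fun σ => if σ = 0 then 0 else exp (-ξ * σ) * (u * σ - s) * g σ k with hh
  set h' : ℝ → ℂ := fun σ => ξ * u * (-(σ : ℂ) * exp (-ξ * σ) * g σ k) +
    (ξ * s + u) * (exp (-ξ * σ) * g σ k) -
    u * ∑ l, exp (-ξ * σ) * g σ l * f l k with hh'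
  have hhd : ∀ σ ∈ Ioi (0 : ℝ), HasDerivAt h (h' σ) σ := by
    intro σ hσ
    have hσ0 : (0 : ℝ) < σ := hσ
    have e1 : HasDerivAt (fun σ : ℝ => exp (-ξ * σ)) (exp (-ξ * σ) * (-ξ)) σ := by
      have : HasDerivAt (fun σ : ℝ => -ξ * (σ : ℂ)) (-ξ) σ := by
        simpa using (Complex.ofRealCLM.hasDerivAt (x := σ)).const_mul (-ξ)
      exact this.cexp
    have e2 : HasDerivAt (fun σ : ℝ => u * (σ : ℂ) - s) u σ := by
      simpa using ((Complex.ofRealCLM.hasDerivAt (x := σ)).const_mul u).sub_const s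
    have e3 := (hasDerivAt_pi.1 (hd σ hσ0)) k
    simp only [Pi.smul_apply, fuchs_row_apply, smul_eq_mul] at e3
    have e4 := (e1.mul e2).mul e3
    have hne : u * σ - s ≠ 0 := by
      intro h0
      exact hP σ hσ0 (Finset.mem_image.2 ⟨k, Finset.mem_univ k, (sub_eq_zero.1 h0).symm⟩)
    have e5 : h =ᶠ[𝓝 σ] fun σ => exp (-ξ * σ) * (u * σ - s) * g σ k := by
      filter_upwards [Ioi_mem_nhds hσ0] with x hx
      simp only [hh]
      rw [if_neg (ne_of_gt hx)]
    refine (e4.congr_of_eventuallyEq e5).congr_deriv ?_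
    simp only [hh', mul_assoc, ← mul_sum, Pi.mul_apply]
    rw [← hs]
    have hinv : (u * σ - s) * (u * σ - s)⁻¹ = 1 := mul_inv_cancel₀ hne
    linear_combination (-(exp (-ξ * σ)) * u * ∑ l, g σ l * f l k) * hinv
  have hsk : s * (Pi.single i 1 : ι → ℂ) k = 0 := by
    by_cases hik : k = i
    · subst hik; simp [hs]
    · simp [hik]
  have hcont : ContinuousWithinAt h (Ici 0) 0 := by
    rw [ContinuousWithinAt]
    have h0 : h 0 = 0 := by simp [hh]
    rw [h0, ← Ioi_insert, nhdsWithin_insert, tendsto_sup]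
    refine ⟨by rw [tendsto_pure_left]; intro s hs; rw [h0]; exact mem_of_mem_nhds hs, ?_⟩
    have e1 : Tendsto (fun σ : ℝ => g σ k) (𝓝[>] 0) (𝓝 ((Pi.single i 1 : ι → ℂ) k)) :=
      (tendsto_pi_nhds.1 hv) k
    have e2 : Tendsto (fun σ : ℝ => exp (-ξ * σ) * (u * σ - s)) (𝓝[>] 0)
        (𝓝 (exp (-ξ * (0 : ℝ)) * (u * (0 : ℝ) - s))) := by
      have : Continuous fun σ : ℝ => exp (-ξ * σ) * (u * σ - s) := by fun_prop
      exact (this.tendsto 0).mono_left nhdsWithin_le_nhds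
    have e3 := e2.mul e1
    have e4 : exp (-ξ * (0 : ℝ)) * (u * (0 : ℝ) - s) * (Pi.single i 1 : ι → ℂ) k = 0 := by
      simp only [ofReal_zero, mul_zero, exp_zero, one_mul, zero_sub, neg_mul, hsk,
        neg_zero]
    rw [e4] at e3
    refine e3.congr' ?_
    filter_upwards [self_mem_nhdsWithin] with x hx
    simp only [hh]
    rw [if_neg (ne_of_gt hx)]
  have hint_h' : IntegrableOn h' (Ioi 0) := by
    refine (((hintl' k).const_mul _).add ((hintl k).const_mul _)).sub (Integrable.const_mul ?_ u)
    exact integrable_finsetSum _ fun l _ => (hintl l).mul_const _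
  have hinfty : Tendsto h atTop (𝓝 0) := by
    obtain ⟨C, hC⟩ := hg.integrable_bound hξ
    have hb : ∀ᶠ σ : ℝ in atTop, ‖h σ‖ ≤ (‖u‖ + ‖s‖) * |C| * (σ * Real.exp (-(ξ.re / 2) * σ)) := by
      filter_upwards [eventually_ge_atTop (1 : ℝ)] with σ hσ
      have hσ0 : 0 < σ := by linarith
      simp only [hh]
      rw [if_neg hσ0.ne', norm_mul, norm_mul, norm_exp_neg_mul]
      have h1 : ‖u * σ - s‖ ≤ (‖u‖ + ‖s‖) * σ := by
        refine (norm_sub_le _ _).trans ?_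
        rw [norm_mul, norm_real, norm_eq_abs, abs_of_pos hσ0]
        nlinarith [norm_nonneg s, norm_nonneg u]
      have h2 : Real.exp (-(ξ.re * σ)) * ‖g σ k‖ ≤ |C| * Real.exp (-(ξ.re / 2 * σ)) := by
        refine le_trans ?_ ((hC σ hσ0).trans
          (mul_le_mul_of_nonneg_right (le_abs_self C) (Real.exp_pos _).le))
        gcongr
        exact norm_le_pi_norm (g σ) k
      calc Real.exp (-(ξ.re * σ)) * ‖u * σ - s‖ * ‖g σ k‖
          = ‖u * σ - s‖ * (Real.exp (-(ξ.re * σ)) * ‖g σ k‖) := by ring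
        _ ≤ ((‖u‖ + ‖s‖) * σ) * (|C| * Real.exp (-(ξ.re / 2 * σ))) := by gcongr
        _ = _ := by rw [neg_mul]; ring
    refine squeeze_zero_norm' hb ?_
    have := (tendsto_rpow_mul_exp_neg_mul_atTop_nhds_zero 1 (ξ.re / 2) (by linarith)).const_mul
      ((‖u‖ + ‖s‖) * |C|)
    simpa using this
  have hibp := integral_Ioi_of_hasDerivAt_of_tendsto hcont hhd hint_h' hinfty
  have hval : ∫ σ in Ioi (0 : ℝ), h' σ =
      ξ * u * G' k + (ξ * s + u) * G k - u * ∑ l, G l * f l k := by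
    have i1 : IntegrableOn (fun σ : ℝ => ξ * u * (-(σ : ℂ) * exp (-ξ * σ) * g σ k))
      (Ioi 0) := (hintl' k).const_mul _
    have i2 : IntegrableOn (fun σ : ℝ => (ξ * s + u) * (exp (-ξ * σ) * g σ k)) (Ioi 0) :=
      (hintl k).const_mul _
    have i3 : IntegrableOn (fun σ : ℝ => ∑ l, exp (-ξ * σ) * g σ l * f l k) (Ioi 0) :=
      integrable_finsetSum _ fun l _ => (hintl l).mul_const _
    have i12 : IntegrableOn (fun σ : ℝ => ξ * u * (-(σ : ℂ) * exp (-ξ * σ) * g σ k) +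
      (ξ * s + u) * (exp (-ξ * σ) * g σ k)) (Ioi 0) := i1.add i2
    have i4 : IntegrableOn (fun σ : ℝ => u * ∑ l, exp (-ξ * σ) * g σ l * f l k) (Ioi 0) :=
      i3.const_mul u
    simp only [hh']
    rw [integral_sub i12 i4, integral_add i1 i2, integral_const_mul, integral_const_mul,
      integral_const_mul, integral_finsetSum _ fun l _ => (hintl l).mul_const _]
    simp only [integral_mul_const, happ, happ']
  have hrel : ξ * u * G' k + (ξ * s + u) * G k - u * ∑ l, G l * f l k = 0 := by
    rw [← hval, hibp]; simp [hh]
  have hfin : HasDerivAt (fun ξ => laplace g ξ k) (1 * G k + ξ * G' k) ξ := by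
    have e1 := (hasDerivAt_pi.1 hder) k
    exact (hasDerivAt_id ξ).mul e1
  refine hfin.congr_deriv ?_
  have e2 : ∀ l, laplace g ξ l = ξ * G l := fun l => rfl
  simp only [e2, mul_assoc, ← mul_sum]
  field_simp
  linear_combination hrel

end RowLaplace

section HalfPlane

/-- The open half plane `Re (t / u) > 0`. -/
def halfAt (u : ℂ) : Set ℂ := {t | 0 < (t * conj u).re}

theorem mem_halfAt {u t : ℂ} : t ∈ halfAt u ↔ 0 < t.re * u.re + t.im * u.im := by
  simp [halfAt]

theorem convex_halfAt (u : ℂ) : Convex ℝ (halfAt u) := by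
  intro x hx y hy a b ha hb hab
  rw [mem_halfAt] at *
  simp only [Complex.add_re, add_im, Complex.real_smul, re_ofReal_mul,
    im_ofReal_mul]
  rcases eq_or_lt_of_le ha with h | h
  · have : b = 1 := by linarith
    subst this; rw [← h]; simpa using hy
  · have := mul_pos h hx
    have := mul_nonneg hb hy.le
    nlinarith

theorem isOpen_halfAt (u : ℂ) : IsOpen (halfAt u) :=
  isOpen_lt continuous_const (Complex.continuous_re.comp (continuous_id.mul continuous_const))

theorem ne_zero_of_mem_halfAt {u t : ℂ} (h : t ∈ halfAt u) : t ≠ 0 := by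
  rintro rfl; simp [halfAt] at h

theorem ofReal_mul_mem_halfAt {u t : ℂ} (h : t ∈ halfAt u) {τ : ℝ} (hτ : 0 < τ) :
    (τ : ℂ) * t ∈ halfAt u := by
  rw [mem_halfAt] at *
  simp only [re_ofReal_mul, im_ofReal_mul]
  have := mul_pos hτ h
  nlinarith

theorem re_div_eq {u t : ℂ} : (u / t).re = (t * conj u).re / ‖t‖ ^ 2 := by
  rw [Complex.div_re, ← normSq_eq_norm_sq]
  simp; ring

end HalfPlane

section Systems

variable {ι : Type*} [Fintype ι] [DecidableEq ι]

/-- `X' = -X (Λ / t² + f / t)` on `U`, with `Λ` diagonal. -/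
def RowEquation (lam : ι → ℂ) (f : Mat(ι)) (U : Set ℂ) (X : ℂ → Mat(ι)) : Prop :=
  ∀ t ∈ U, ∀ i k, HasDerivAt (fun t => X t i k)
    (-(X t i k * (lam k / t ^ 2) + (X t * f) i k / t)) t

/-- `Y' = (Λ / t² + f / t) Y` on `U`, with `Λ` diagonal. -/
def ColEquation {o : Type*} (lam : ι → ℂ) (f : Mat(ι)) (U : Set ℂ) (Y : ℂ → Matrix ι o ℂ) : Prop :=
  ∀ t ∈ U, ∀ i k, HasDerivAt (fun t => Y t i k)
    (lam i / t ^ 2 * Y t i k + (f * Y t) i k / t) t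

/-- `e^{-Λ / t} X → 1` along the filter `l`. -/
def RowAsymptotic (lam : ι → ℂ) (l : Filter ℂ) (X : ℂ → Mat(ι)) : Prop :=
  ∀ i k, Tendsto (fun t => exp (-(lam i / t)) * X t i k) l
    (𝓝 ((1 : Mat(ι)) i k))

/-- `Y e^{Λ / t} → 1` along the filter `l`. -/
def ColAsymptotic (lam : ι → ℂ) (l : Filter ℂ) (Y : ℂ → Mat(ι)) : Prop :=
  ∀ i k, Tendsto (fun t => Y t i k * exp (lam k / t)) l (𝓝 ((1 : Mat(ι)) i k))

/-- The filter of `t = τ d`, `τ → 0⁺`. -/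
def radial (d : ℂ) : Filter ℂ := map (fun τ : ℝ => (τ : ℂ) * d) (𝓝[>] 0)

instance (d : ℂ) : (radial d).NeBot := by unfold radial; infer_instance

theorem RowEquation.mul_col {o : Type*} {lam : ι → ℂ} {f : Mat(ι)} {U : Set ℂ}
    {X : ℂ → Mat(ι)} {Y : ℂ → Matrix ι o ℂ} (hX : RowEquation lam f U X)
    (hY : ColEquation lam f U Y) {t : ℂ} (ht : t ∈ U) (i : ι) (k : o) :
    HasDerivAt (fun t => (X t * Y t) i k) 0 t := by
  have h : HasDerivAt (fun t => (X t * Y t) i k)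
      (∑ j, (-(X t i j * (lam j / t ^ 2) + (X t * f) i j / t) * Y t j k +
        X t i j * (lam j / t ^ 2 * Y t j k + (f * Y t) j k / t))) t := by
    simp only [Matrix.mul_apply]
    exact HasDerivAt.fun_sum fun j _ => (hX t ht i j).mul (hY t ht j k)
  refine h.congr_deriv ?_
  have h1 : ∑ j, (X t * f) i j * Y t j k = ∑ j, X t i j * (f * Y t) j k := by
    have := congrFun (congrFun (Matrix.mul_assoc (X t) f (Y t)) i) k
    simpa only [Matrix.mul_apply] using this
  have h2 : ∀ j, (-(X t i j * (lam j / t ^ 2) + (X t * f) i j / t) * Y t j k +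
        X t i j * (lam j / t ^ 2 * Y t j k + (f * Y t) j k / t)) =
      (X t i j * (f * Y t) j k - (X t * f) i j * Y t j k) * t⁻¹ := by
    intro j; rw [div_eq_mul_inv, div_eq_mul_inv]; ring
  simp only [h2, ← sum_mul, sum_sub_distrib, h1, sub_self, zero_mul]

theorem RowEquation.mul_col_eq {o : Type*} {lam : ι → ℂ} {f : Mat(ι)} {U : Set ℂ} (hU : Convex ℝ U)
    {X : ℂ → Mat(ι)} {Y : ℂ → Matrix ι o ℂ} (hX : RowEquation lam f U X)
    (hY : ColEquation lam f U Y) {t t' : ℂ} (ht : t ∈ U) (ht' : t' ∈ U) :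
    X t * Y t = X t' * Y t' := by
  ext i k
  exact eq_of_hasDerivAt_zero_segment (f := fun t => (X t * Y t) i k)
    fun w hw => hX.mul_col hY (hU.segment_subset ht ht' hw) i k

theorem tendsto_radial_exp {ω d : ℂ} (h : (ω * conj d).re < 0) :
    Tendsto (fun t => ‖exp (-(ω / t))‖) (radial d) atTop := by
  have hd : 0 < ‖d‖ ^ 2 := by
    have : d ≠ 0 := by rintro rfl; simp at h
    positivity
  have e : ∀ τ : ℝ, ‖exp (-(ω / ((τ : ℂ) * d)))‖ =
      Real.exp (τ⁻¹ * (-(ω * conj d).re / ‖d‖ ^ 2)) := by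
    intro τ
    rw [Complex.norm_exp]
    congr 1
    have : ω / ((τ : ℂ) * d) = ((τ⁻¹ : ℝ) : ℂ) * (ω / d) := by push_cast; rw [div_mul_eq_div_div]; ring
    rw [this, Complex.neg_re, re_ofReal_mul, Complex.div_re, ← normSq_eq_norm_sq]
    simp; ring
  rw [radial, tendsto_map'_iff]
  simp only [comp_def, e]
  refine Real.tendsto_exp_atTop.comp (Tendsto.atTop_mul_const ?_ tendsto_inv_nhdsGT_zero)
  exact div_pos (by linarith) hd

theorem eq_zero_of_tendsto_radial {ω d c : ℂ} (h : (ω * conj d).re < 0)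
    (hc : Tendsto (fun t => exp (-(ω / t)) * c) (radial d) (𝓝 0)) : c = 0 := by
  by_contra hc0
  have h1 := (tendsto_radial_exp h).atTop_mul_const (norm_pos_iff.2 hc0)
  have h2 := hc.norm
  simp only [norm_mul] at h2
  exact not_tendsto_atTop_of_tendsto_nhds h2 h1

theorem RowEquation.tendsto_mul_col {lam : ι → ℂ} {f : Mat(ι)} {U : Set ℂ} (hU : Convex ℝ U)
    (hrad : ∀ d ∈ U, ∀ τ : ℝ, 0 < τ → (τ : ℂ) * d ∈ U) {X Y : ℂ → Mat(ι)}
    (hX : RowEquation lam f U X) (hY : ColEquation lam f U Y) {d : ℂ} (hd : d ∈ U)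
    (hX' : RowAsymptotic lam (radial d) X) (hY' : ColAsymptotic lam (radial d) Y)
    {t : ℂ} (ht : t ∈ U) (a b : ι) : Tendsto
      (fun s => exp (-((lam a - lam b) / s)) * (X t * Y t) a b) (radial d)
      (𝓝 ((1 : Mat(ι)) a b)) := by
  have h1 : Tendsto (fun s => ∑ j, (exp (-(lam a / s)) * X s a j) *
      (Y s j b * exp (lam b / s))) (radial d)
      (𝓝 (∑ j, (1 : Mat(ι)) a j * (1 : Mat(ι)) j b)) :=
    tendsto_finsetSum _ fun j _ => (hX' a j).mul (hY' j b)
  have h2 : ∑ j, (1 : Mat(ι)) a j * (1 : Mat(ι)) j b = (1 : Mat(ι)) a b := by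
    rw [← Matrix.mul_apply, one_mul]
  rw [h2] at h1
  refine h1.congr' ?_
  have h3 : ∀ᶠ s in radial d, s ∈ U := by
    rw [radial, eventually_map]
    filter_upwards [self_mem_nhdsWithin] with τ hτ using hrad d hd τ hτ
  filter_upwards [h3] with s hs
  rw [hX.mul_col_eq hU hY ht hs, Matrix.mul_apply, mul_sum]
  refine sum_congr rfl fun j _ => ?_
  rw [sub_div, neg_sub, sub_eq_add_neg, exp_add]
  ring

/-- A row solution and a column solution, both normalised at `0`, are inverse to each other. -/
theorem mul_eq_one_of_asymptotic {lam : ι → ℂ} {f : Mat(ι)} {U : Set ℂ} (hU : Convex ℝ U)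
    (hrad : ∀ d ∈ U, ∀ τ : ℝ, 0 < τ → (τ : ℂ) * d ∈ U) {X Y : ℂ → Mat(ι)}
    (hX : RowEquation lam f U X) (hY : ColEquation lam f U Y)
    (hX' : ∀ d ∈ U, RowAsymptotic lam (radial d) X) (hY' : ∀ d ∈ U, ColAsymptotic lam (radial d) Y)
    (hgen : ∀ a b, lam a ≠ lam b → ∃ d ∈ U, ((lam a - lam b) * conj d).re < 0)
    {t : ℂ} (ht : t ∈ U) : X t * Y t = 1 := by
  have key := fun d hd => hX.tendsto_mul_col hU hrad hY hd (hX' d hd) (hY' d hd) ht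
  ext a b
  by_cases hab : lam a = lam b
  · have h1 := key t ht a b
    simp only [hab, sub_self, zero_div, neg_zero, exp_zero, one_mul] at h1
    exact tendsto_nhds_unique tendsto_const_nhds h1
  · obtain ⟨d, hd, hneg⟩ := hgen a b hab
    have hab' : a ≠ b := fun h => hab (by rw [h])
    have h1 := key d hd a b
    rw [one_apply_ne hab'] at h1 ⊢
    exact eq_zero_of_tendsto_radial hneg h1

end Systems

section RowSolutions

variable {ι : Type*} [Fintype ι] [DecidableEq ι]

/-- The direction `1 + i κ y`. -/
def dir (κ y : ℝ) : ℂ := ⟨1, κ * y⟩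

theorem dir_ne_zero (κ y : ℝ) : dir κ y ≠ 0 := by
  intro h; have := congrArg Complex.re h; simp [dir] at this

theorem dir_mul_mem {κ η y : ℝ} (hκ : IsSign κ) (hy : 0 ≤ y) (hyη : y < η) {σ : ℝ}
    (hσ : 0 < σ) : dir κ y * σ ∈ raySector κ η := by
  have hκκ := hκ.mul_self
  refine ⟨?_, ?_, ?_⟩ <;> simp only [dir, Complex.re_mul_ofReal, Complex.im_mul_ofReal, one_mul]
  · exact hσ
  · rw [show κ * (κ * y * σ) = (κ * κ) * (y * σ) by ring, hκκ]; positivity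
  · rw [show κ * (κ * y * σ) = (κ * κ) * (y * σ) by ring, hκκ]; nlinarith

theorem exists_ray_dist {u p : ℂ} (hu : u ≠ 0) (hp : ∀ σ : ℝ, 0 ≤ σ → u * σ ≠ p) :
    ∃ c > 0, ∀ σ : ℝ, 0 < σ → c ≤ ‖u * σ - p‖ := by
  have hun : 0 < ‖u‖ := norm_pos_iff.2 hu
  have e : ∀ σ : ℝ, ‖u * σ - p‖ = ‖u‖ * ‖(σ : ℂ) - p / u‖ := by
    intro σ; rw [← norm_mul]; congr 1; field_simp
  by_cases him : (p / u).im = 0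
  · have hre : (p / u).re < 0 := by
      by_contra hre
      apply hp (p / u).re (not_lt.1 hre)
      have : ((p / u).re : ℂ) = p / u := by apply Complex.ext <;> simp [him]
      rw [this]; field_simp
    refine ⟨‖u‖ * -(p / u).re, mul_pos hun (by linarith), fun σ hσ => ?_⟩
    rw [e]
    gcongr
    have h := abs_re_le_norm ((σ : ℂ) - p / u)
    rw [sub_re, ofReal_re] at h
    exact le_trans (by rw [abs_of_pos] <;> linarith) h
  · refine ⟨‖u‖ * |(p / u).im|, mul_pos hun (abs_pos.2 him), fun σ hσ => ?_⟩
    rw [e]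
    gcongr
    have h := Complex.abs_im_le_norm ((σ : ℂ) - p / u)
    simpa using h

theorem dir_mul_notMem {P : Finset ℂ} {κ η y : ℝ} (hκ : IsSign κ)
    (hP : ∀ p ∈ P, p ∉ sector κ η) (hy : 0 < y) (hyη : y < η) {σ : ℝ} (hσ : 0 < σ) :
    dir κ y * σ ∉ P := by
  intro h
  have hκκ := hκ.mul_self
  refine hP _ h ⟨(dir_mul_mem hκ hy.le hyη hσ).1, ?_, (dir_mul_mem hκ hy.le hyη hσ).2.2⟩
  simp only [dir, Complex.im_mul_ofReal]
  rw [show κ * (κ * y * σ) = (κ * κ) * (y * σ) by ring, hκκ]; positivity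

theorem SectorSolution.subexp {E : Type*} [NormedAddCommGroup E] [NormedSpace ℂ E]
    [CompleteSpace E] {P : Finset ℂ} {R : ℂ → E →L[ℂ] E} {κ η : ℝ} {v : E} {Ψ : ℂ → E}
    (h : SectorSolution P R κ η v Ψ) (hκ : IsSign κ)
    (hP : ∀ p ∈ P, p ∉ sector κ η) (hR2 : ∀ p, R p * R p = 0) {y : ℝ} (hy : 0 < y)
    (hyη : y < η) : Subexp fun σ : ℝ => Ψ (dir κ y * σ) := by
  have hκκ := hκ.mul_self
  intro δ hδ
  obtain ⟨C, hC0, hC⟩ := h.bound hκ hP hR2 hy.le hyη hδ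
  have hw : ∀ p ∈ P.erase 0, ∃ c, ∀ σ : ℝ, 0 < σ → ‖dir κ y * σ - p‖ ^ (-(1 / 2) : ℝ) ≤ c := by
    intro p hp
    rw [Finset.mem_erase] at hp
    obtain ⟨c, hc, hcb⟩ := exists_ray_dist (dir_ne_zero κ y) (p := p) (by
      rintro σ hσ rfl
      rcases eq_or_lt_of_le hσ with h0 | h0
      · apply hp.1; rw [← h0]; simp
      · exact dir_mul_notMem hκ hP hy hyη h0 hp.2)
    exact ⟨c ^ (-(1 / 2) : ℝ), fun σ hσ =>
      rpow_le_rpow_of_nonpos hc (hcb σ hσ) (by norm_num)⟩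
  choose! c hc using hw
  refine ⟨C * (1 + ∑ p ∈ P.erase 0, c p), fun σ hσ => ?_⟩
  refine (hC _ (dir_mul_mem hκ hy.le hyη hσ) ?_ (dir_mul_notMem hκ hP hy hyη hσ)).trans ?_
  · simp only [dir, Complex.im_mul_ofReal, Complex.re_mul_ofReal, one_mul]
    rw [show κ * (κ * y * σ) = (κ * κ) * (y * σ) by ring, hκκ, one_mul]
  · have : (dir κ y * σ).re = σ := by simp [dir]
    rw [this]
    gcongr
    exact add_le_add le_rfl (sum_le_sum fun p hp => hc p hp σ hσ)

/-- The hypotheses on the eigenvalues and on the matrix `f` with respect to the sectors adjacent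
to the positive reals. -/
structure SectorFree (lam : ι → ℂ) (f : Mat(ι)) (η : ℝ) : Prop where
  pos : 0 < η
  diag : ∀ a b, lam a = lam b → f a b = 0
  free : ∀ κ, IsSign κ → ∀ a b, lam a - lam b ∉ sector κ η

theorem SectorFree.neg_transpose {lam : ι → ℂ} {f : Mat(ι)} {η : ℝ}
    (h : SectorFree lam f η) : SectorFree (-lam) (-f.transpose) η where
  pos := h.pos
  diag := fun a b hab => by
    have := h.diag b a (by simpa using hab.symm)
    simp [this]
  free := fun κ hκ a b => by
    have := h.free κ hκ b a
    simpa [neg_add_eq_sub, sub_eq_add_neg, add_comm] using this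

theorem SectorFree.poles {lam : ι → ℂ} {f : Mat(ι)} {η : ℝ}
    (h : SectorFree lam f η) {κ : ℝ} (hκ : IsSign κ) (i : ι) :
    ∀ p ∈ rowPoles lam i, p ∉ sector κ η := by
  intro p hp
  obtain ⟨k, -, rfl⟩ := Finset.mem_image.1 hp
  exact h.free κ hκ i k

/-- A family of sector solutions of the row systems. -/
def RowFamily (lam : ι → ℂ) (f : Mat(ι)) (κ η : ℝ) (Ψ : ι → ℂ → ι → ℂ) : Prop :=
  ∀ i, SectorSolution (rowPoles lam i) (rowResidue lam f i) κ η (Pi.single i 1) (Ψ i)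

theorem SectorFree.exists_rowFamily {lam : ι → ℂ} {f : Mat(ι)} {η : ℝ}
    (h : SectorFree lam f η) {κ : ℝ} (hκ : IsSign κ) : ∃ Ψ, RowFamily lam f κ η Ψ := by
  have := fun i => exists_sectorSolution (rowPoles lam i) (rowResidue lam f i)
    (rowResidue_of_notMem lam f i) (rowResidue_mul_self lam f h.diag i) hκ h.pos (h.poles hκ i)
    (rowResidue_zero_base lam f h.diag i)
  choose Ψ hΨ using this
  exact ⟨Ψ, hΨ⟩

/-- The row solution obtained by Laplace transform along the direction `u`. -/
def laplaceRows (lam : ι → ℂ) (Ψ : ι → ℂ → ι → ℂ) (u t : ℂ) : Mat(ι) :=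
  Matrix.of fun i k => exp (lam i / t) * laplace (fun σ : ℝ => Ψ i (u * σ)) (u / t) k

/-- The non-tangential filter at `0` in the half plane `halfAt u`. -/
def nontangential (u : ℂ) (c : ℝ) : Filter ℂ :=
  𝓝[{t | t ≠ 0 ∧ c * ‖t‖ ≤ (t * conj u).re}] 0

instance (u : ℂ) (c : ℝ) : (nontangential u c).IsCountablyGenerated := by
  unfold nontangential; infer_instance

theorem radial_le_nontangential {u d : ℂ} (hd : d ∈ halfAt u) :
    ∃ c > 0, radial d ≤ nontangential u c := by
  have hd0 : 0 < ‖d‖ := norm_pos_iff.2 (ne_zero_of_mem_halfAt hd)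
  refine ⟨(d * conj u).re / ‖d‖, div_pos hd hd0, ?_⟩
  rw [nontangential, radial]
  refine tendsto_nhdsWithin_iff.2 ⟨?_, ?_⟩
  · have : Continuous fun τ : ℝ => (τ : ℂ) * d := by fun_prop
    have h := this.tendsto 0
    simp only [ofReal_zero, zero_mul] at h
    exact h.mono_left nhdsWithin_le_nhds
  · filter_upwards [self_mem_nhdsWithin] with τ hτ
    have hτ0 : (0 : ℝ) < τ := hτ
    refine ⟨mul_ne_zero (by exact_mod_cast hτ0.ne') (norm_pos_iff.1 hd0), ?_⟩
    rw [norm_mul, norm_real, norm_eq_abs, abs_of_pos hτ0, mul_assoc (τ : ℂ),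
      re_ofReal_mul]
    apply le_of_eq; field_simp

theorem RowFamily.laplace_hyp {lam : ι → ℂ} {f : Mat(ι)} {κ η : ℝ} {Ψ : ι → ℂ → ι → ℂ}
    (hΨ : RowFamily lam f κ η Ψ) (h : SectorFree lam f η) (hκ : IsSign κ) {y : ℝ}
    (hy : 0 < y) (hyη : y < η) (i : ι) : Subexp (fun σ : ℝ => Ψ i (dir κ y * σ)) ∧
    Tendsto (fun σ : ℝ => Ψ i (dir κ y * σ)) (𝓝[>] 0) (𝓝 (Pi.single i 1)) ∧
    ∀ σ : ℝ, 0 < σ → HasDerivAt (fun σ : ℝ => Ψ i (dir κ y * σ))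
      (dir κ y • fuchs (rowPoles lam i) (rowResidue lam f i) (dir κ y * σ)
        (Ψ i (dir κ y * σ))) σ := by
  refine ⟨(hΨ i).subexp hκ (h.poles hκ i) (rowResidue_mul_self lam f h.diag i) hy hyη, ?_, ?_⟩
  · refine (hΨ i).tendsto_base.comp (tendsto_nhdsWithin_iff.2 ⟨?_, ?_⟩)
    · have : Continuous fun τ : ℝ => dir κ y * (τ : ℂ) := by fun_prop
      have h := this.tendsto 0
      simp only [ofReal_zero, mul_zero] at h
      exact h.mono_left nhdsWithin_le_nhds
    · filter_upwards [self_mem_nhdsWithin] with τ hτ using dir_mul_mem hκ hy.le hyη hτ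
  · intro σ hσ
    have h1 := (hΨ i).deriv _ (dir_mul_mem hκ hy.le hyη hσ)
      (dir_mul_notMem hκ (h.poles hκ i) hy hyη hσ)
    have h2 : HasDerivAt (fun σ : ℝ => dir κ y * (σ : ℂ)) (dir κ y) σ := by
      simpa using (Complex.ofRealCLM.hasDerivAt (x := σ)).const_mul (dir κ y)
    exact h1.scomp σ h2

theorem RowFamily.rowEquation {lam : ι → ℂ} {f : Mat(ι)} {κ η : ℝ} {Ψ : ι → ℂ → ι → ℂ}
    (hΨ : RowFamily lam f κ η Ψ) (h : SectorFree lam f η) (hκ : IsSign κ) {y : ℝ}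
    (hy : 0 < y) (hyη : y < η) :
    RowEquation lam f (halfAt (dir κ y)) (laplaceRows lam Ψ (dir κ y)) := by
  intro t ht i k
  obtain ⟨h1, h2, h3⟩ := hΨ.laplace_hyp h hκ hy hyη i
  have ht0 := ne_zero_of_mem_halfAt ht
  set u := dir κ y with hu
  have hu0 : u ≠ 0 := dir_ne_zero κ y
  have hξ : 0 < (u / t).re := by
    rw [re_div_eq]; exact div_pos ht (by have := norm_pos_iff.2 ht0; positivity)
  have e1 := hasDerivAt_laplace_row (lam := lam) (f := f) hu0 h1 h2
    (fun σ hσ => dir_mul_notMem hκ (h.poles hκ i) hy hyη hσ) h3 hξ k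
  have e2 : ∀ c : ℂ, HasDerivAt (fun t : ℂ => c / t) (-c / t ^ 2) t := by
    intro c
    have := (hasDerivAt_inv ht0).const_mul c
    simp only [← div_eq_mul_inv] at this
    refine this.congr_deriv ?_
    field_simp
  have e3 := HasDerivAt.comp t e1 (e2 u)
  have e4 := ((e2 (lam i)).cexp).mul e3
  refine e4.congr_deriv ?_
  simp only [laplaceRows, Matrix.mul_apply, of_apply, Function.comp, mul_assoc,
    ← mul_sum]
  field_simp
  ring

theorem RowFamily.rowAsymptotic {lam : ι → ℂ} {f : Mat(ι)} {κ η : ℝ} {Ψ : ι → ℂ → ι → ℂ}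
    (hΨ : RowFamily lam f κ η Ψ) (h : SectorFree lam f η) (hκ : IsSign κ) {y : ℝ}
    (hy : 0 < y) (hyη : y < η) {c : ℝ} (hc : 0 < c) :
    RowAsymptotic lam (nontangential (dir κ y) c) (laplaceRows lam Ψ (dir κ y)) := by
  intro i k
  obtain ⟨h1, h2, h3⟩ := hΨ.laplace_hyp h hκ hy hyη i
  set u := dir κ y with hu
  have hu0 : 0 < ‖u‖ := norm_pos_iff.2 (dir_ne_zero κ y)
  have hmem : ∀ᶠ t in nontangential u c, t ≠ 0 ∧ c * ‖t‖ ≤ (t * conj u).re :=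
    self_mem_nhdsWithin
  have hn : Tendsto (fun t : ℂ => ‖u / t‖) (nontangential u c) atTop := by
    simp only [div_eq_mul_inv, norm_mul, norm_inv]
    refine Tendsto.const_mul_atTop hu0 ?_
    refine tendsto_inv_nhdsGT_zero.comp (tendsto_nhdsWithin_iff.2 ⟨?_, ?_⟩)
    · have := (continuous_norm (E := ℂ)).tendsto 0
      rw [norm_zero] at this
      exact this.mono_left nhdsWithin_le_nhds
    · filter_upwards [hmem] with t ht using norm_pos_iff.2 ht.1
  have key := h1.tendsto_laplace (fun σ hσ => (h3 σ hσ).continuousAt.continuousWithinAt) h2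
    (div_pos hc hu0) hn (by
      filter_upwards [hmem] with t ht
      have ht0 := norm_pos_iff.2 ht.1
      rw [re_div_eq, norm_div, le_div_iff₀ (by positivity)]
      refine le_trans (le_of_eq ?_) ht.2
      field_simp)
  have key2 := (tendsto_pi_nhds.1 key) k
  have e1 : (1 : Mat(ι)) i k = (Pi.single i 1 : ι → ℂ) k := by
    rw [Matrix.one_apply, Pi.single_apply]; simp [eq_comm]
  rw [e1]
  refine key2.congr fun t => ?_
  simp only [laplaceRows, of_apply]
  rw [← mul_assoc, ← exp_add]
  simp

end RowSolutions

section Gluing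

variable {ι : Type*} [Fintype ι] [DecidableEq ι]

theorem mem_halfAt_dir {κ y : ℝ} {t : ℂ} : t ∈ halfAt (dir κ y) ↔ 0 < t.re + y * (κ * t.im) := by
  rw [mem_halfAt]
  simp only [dir, mul_one]
  rw [show t.im * (κ * y) = y * (κ * t.im) by ring]

theorem re_mul_conj_dir (κ y : ℝ) (t : ℂ) : (t * conj (dir κ y)).re = t.re + y * (κ * t.im) := by
  simp [dir]; ring

theorem exists_direction {κ η : ℝ} (hκ : IsSign κ) {y₁ y₂ : ℝ} (h₁ : 0 < y₁) (h₂ : 0 < y₂)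
    (h₁' : y₁ < η) (h₂' : y₂ < η) {ω : ℂ} (hω : ω ≠ 0) (hω' : ω ∉ sector κ η) :
    ∃ d ∈ halfAt (dir κ y₁) ∩ halfAt (dir κ y₂), (ω * conj d).re < 0 := by
  have hκκ := hκ.mul_self
  set m := min y₁ y₂ with hm
  set M := max y₁ y₂ with hM
  have hm0 : 0 < m := lt_min h₁ h₂
  have hmM : M < η := max_lt h₁' h₂'
  have hm1 : m ≤ y₁ := min_le_left _ _
  have hm2 : m ≤ y₂ := min_le_right _ _
  have hM1 : y₁ ≤ M := le_max_left _ _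
  have hM2 : y₂ ≤ M := le_max_right _ _
  have key : ∀ a b : ℝ, 0 < a + y₁ * b → 0 < a + y₂ * b → ω.re * a + (κ * ω.im) * b < 0 →
      ∃ d ∈ halfAt (dir κ y₁) ∩ halfAt (dir κ y₂), (ω * conj d).re < 0 := by
    intro a b h1 h2 h3
    refine ⟨⟨a, κ * b⟩, ⟨?_, ?_⟩, ?_⟩
    · rw [mem_halfAt_dir]
      simp only
      rw [← mul_assoc κ, hκκ, one_mul]; exact h1
    · rw [mem_halfAt_dir]
      simp only
      rw [← mul_assoc κ, hκκ, one_mul]; exact h2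
    · simp only [Complex.mul_re, Complex.conj_re, Complex.conj_im]
      linarith
  set b' := κ * ω.im with hb'
  rcases lt_trichotomy ω.re 0 with h | h | h
  · exact key 1 0 (by linarith) (by linarith) (by linarith)
  · have hb0 : b' ≠ 0 := by
      intro h0
      apply hω
      have : ω.im = 0 := by
        rw [hb'] at h0
        rcases mul_eq_zero.1 h0 with h4 | h4
        · rw [h4] at hκκ; norm_num at hκκ
        · exact h4
      exact Complex.ext h this
    rcases lt_or_gt_of_ne hb0 with h5 | h5
    · exact key 1 1 (by linarith) (by linarith) (by rw [h]; linarith)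
    · refine key M (-(1 / 2)) (by linarith) (by linarith) (by rw [h]; linarith)
  · rcases le_or_gt b' 0 with h5 | h5
    · refine key (-m / 2) 1 (by linarith) (by linarith) ?_
      have := mul_pos h hm0
      linarith
    · have h6 : η * ω.re ≤ b' := by
        by_contra h6
        exact hω' ⟨h, h5, not_le.1 h6⟩
      refine key ((η + M) / 2) (-1) (by linarith) (by linarith) ?_
      have := mul_pos h (sub_pos.2 hmM)
      nlinarith

theorem RowEquation.colEquation {lam : ι → ℂ} {f : Mat(ι)} {U : Set ℂ}
    {X : ℂ → Mat(ι)} (h : RowEquation (-lam) (-f.transpose) U X) :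
    ColEquation lam f U fun t => (X t).transpose := by
  intro t ht i k
  refine (h t ht k i).congr_deriv ?_
  simp only [Pi.neg_apply, Matrix.mul_apply, Matrix.neg_apply, Matrix.transpose_apply, mul_neg,
    Finset.sum_neg_distrib]
  rw [sum_congr rfl fun j _ => mul_comm (X t k j) (f i j)]
  ring

theorem RowAsymptotic.colAsymptotic {lam : ι → ℂ} {l : Filter ℂ}
    {X : ℂ → Mat(ι)} (h : RowAsymptotic (-lam) l X) :
    ColAsymptotic lam l fun t => (X t).transpose := by
  intro i k
  have := h k i
  have e : (1 : Mat(ι)) i k = (1 : Mat(ι)) k i := by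
    simp [Matrix.one_apply, eq_comm]
  rw [e]
  refine this.congr fun t => ?_
  simp only [Pi.neg_apply, Matrix.transpose_apply, neg_div, neg_neg]
  rw [mul_comm]

variable {lam : ι → ℂ} {f : Mat(ι)} {κ η : ℝ} {Ψ : ι → ℂ → ι → ℂ}

theorem RowFamily.mul_transpose (hΨ : RowFamily lam f κ η Ψ) {Ψ' : ι → ℂ → ι → ℂ}
    (hΨ' : RowFamily (-lam) (-f.transpose) κ η Ψ') (h : SectorFree lam f η)
    (hκ : IsSign κ) {y₁ y₂ : ℝ} (h₁ : 0 < y₁) (h₂ : 0 < y₂)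
    (h₁' : y₁ < η) (h₂' : y₂ < η) {t : ℂ} (ht₁ : t ∈ halfAt (dir κ y₁))
    (ht₂ : t ∈ halfAt (dir κ y₂)) :
    laplaceRows lam Ψ (dir κ y₁) t * (laplaceRows (-lam) Ψ' (dir κ y₂) t).transpose = 1 := by
  refine mul_eq_one_of_asymptotic (U := halfAt (dir κ y₁) ∩ halfAt (dir κ y₂))
    ((convex_halfAt _).inter (convex_halfAt _)) ?_ (lam := lam) (f := f)
    (X := laplaceRows lam Ψ (dir κ y₁))
    (Y := fun t => (laplaceRows (-lam) Ψ' (dir κ y₂) t).transpose) ?_ ?_ ?_ ?_ ?_ ⟨ht₁, ht₂⟩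
  · exact fun d hd τ hτ => ⟨ofReal_mul_mem_halfAt hd.1 hτ, ofReal_mul_mem_halfAt hd.2 hτ⟩
  · exact fun t ht => hΨ.rowEquation h hκ h₁ h₁' t ht.1
  · exact RowEquation.colEquation
      fun t ht => hΨ'.rowEquation h.neg_transpose hκ h₂ h₂' t ht.2
  · intro d hd
    obtain ⟨c, hc, hle⟩ := radial_le_nontangential hd.1
    exact fun i k => (hΨ.rowAsymptotic h hκ h₁ h₁' hc i k).mono_left hle
  · intro d hd
    obtain ⟨c, hc, hle⟩ := radial_le_nontangential hd.2
    exact RowAsymptotic.colAsymptotic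
      fun i k => (hΨ'.rowAsymptotic h.neg_transpose hκ h₂ h₂' hc i k).mono_left hle
  · intro a b hab
    exact exists_direction hκ h₁ h₂ h₁' h₂' (sub_ne_zero.2 hab) (h.free κ hκ a b)

theorem RowFamily.laplaceRows_eq (hΨ : RowFamily lam f κ η Ψ) (h : SectorFree lam f η)
    (hκ : IsSign κ) {y₁ y₂ : ℝ} (h₁ : 0 < y₁) (h₂ : 0 < y₂)
    (h₁' : y₁ < η) (h₂' : y₂ < η) {t : ℂ} (ht₁ : t ∈ halfAt (dir κ y₁))
    (ht₂ : t ∈ halfAt (dir κ y₂)) :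
    laplaceRows lam Ψ (dir κ y₁) t = laplaceRows lam Ψ (dir κ y₂) t := by
  obtain ⟨Ψ', hΨ'⟩ := h.neg_transpose.exists_rowFamily hκ
  have e1 := hΨ.mul_transpose hΨ' h hκ h₁ h₂ h₁' h₂' ht₁ ht₂
  have e2 := hΨ.mul_transpose hΨ' h hκ h₂ h₂ h₂' h₂' ht₂ ht₂
  have e3 := mul_eq_one_comm.1 e2
  calc _ = laplaceRows lam Ψ (dir κ y₁) t * ((laplaceRows (-lam) Ψ' (dir κ y₂) t).transpose *
        laplaceRows lam Ψ (dir κ y₂) t) := by rw [e3, mul_one]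
    _ = _ := by rw [← mul_assoc, e1, one_mul]

theorem RowFamily.isUnit_laplaceRows (hΨ : RowFamily lam f κ η Ψ) (h : SectorFree lam f η)
    (hκ : IsSign κ) {y : ℝ} (h₁ : 0 < y) (h₁' : y < η) {t : ℂ}
    (ht₁ : t ∈ halfAt (dir κ y)) : IsUnit (laplaceRows lam Ψ (dir κ y) t) := by
  obtain ⟨Ψ', hΨ'⟩ := h.neg_transpose.exists_rowFamily hκ
  exact IsUnit.of_mul_eq_one _ (hΨ.mul_transpose hΨ' h hκ h₁ h₁ h₁' h₁' ht₁ ht₁)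

theorem RowFamily.rowAsymptotic_halfAt (hΨ : RowFamily lam f κ η Ψ) (h : SectorFree lam f η)
    (hκ : IsSign κ) {y : ℝ} (hy : 0 < y) (hyη : y < η) :
    RowAsymptotic lam (𝓝[halfAt (dir κ y)] 0) (laplaceRows lam Ψ (dir κ y)) := by
  have hκ1 := hκ.abs_eq_one
  set y₁ := y / 2 with hy₁
  set y₂ := (y + η) / 2 with hy₂
  set c := min 1 (min ((y₂ - y) / (1 + y)) ((y - y₁) / (1 + y))) with hc
  have hc0 : 0 < c := lt_min one_pos (lt_min (div_pos (by linarith) (by linarith))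
    (div_pos (by linarith) (by linarith)))
  have hc1 : c ≤ 1 := min_le_left _ _
  have hc2 : c * (1 + y) ≤ y₂ - y := by
    rw [← le_div_iff₀ (by linarith)]; exact (min_le_right _ _).trans (min_le_left _ _)
  have hc3 : c * (1 + y) ≤ y - y₁ := by
    rw [← le_div_iff₀ (by linarith)]; exact (min_le_right _ _).trans (min_le_right _ _)
  intro i k
  have hsub : ∀ y' : ℝ, 0 < y' → y' < η → Tendsto (fun t => exp (-(lam i / t)) *
      laplaceRows lam Ψ (dir κ y) t i k)
      (𝓝[halfAt (dir κ y) ∩ {t | t ≠ 0 ∧ c * ‖t‖ ≤ (t * conj (dir κ y')).re}] 0)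
      (𝓝 ((1 : Mat(ι)) i k)) := by
    intro y' hy' hy'η
    have h1 := hΨ.rowAsymptotic h hκ hy' hy'η hc0 i k
    refine (h1.mono_left (nhdsWithin_mono _ inter_subset_right)).congr' ?_
    filter_upwards [self_mem_nhdsWithin] with t ht
    have ht' : t ∈ halfAt (dir κ y') :=
      lt_of_lt_of_le (mul_pos hc0 (norm_pos_iff.2 ht.2.1)) ht.2.2
    rw [hΨ.laplaceRows_eq h hκ hy' hy hy'η hyη ht' ht.1]
  have hunion := (hsub y₁ (by linarith) (by linarith)).sup (hsub y₂ (by linarith) (by linarith))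
  rw [← nhdsWithin_union] at hunion
  refine hunion.mono_left (nhdsWithin_mono _ fun t ht => ?_)
  have ht0 := ne_zero_of_mem_halfAt ht
  have ht' := mem_halfAt_dir.1 ht
  set s := κ * t.im with hs
  have hsabs : |t.im| = |s| := by rw [hs, abs_mul, hκ1, one_mul]
  have hn : ‖t‖ ≤ |t.re| + |s| := by
    rw [← hsabs]; exact norm_le_abs_re_add_abs_im t
  have hre : |t.re| ≤ (t.re + y * s) + y * |s| := by
    rw [abs_le]
    have h3 := mul_le_mul_of_nonneg_left (neg_abs_le s) hy.le
    have h4 := mul_le_mul_of_nonneg_left (le_abs_self s) hy.le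
    constructor <;> linarith
  have hcn : c * ‖t‖ ≤ (t.re + y * s) + c * (1 + y) * |s| := by
    have h3 : c * ‖t‖ ≤ c * ((t.re + y * s) + (1 + y) * |s|) := by gcongr; linarith
    have h4 : c * (t.re + y * s) ≤ 1 * (t.re + y * s) := by gcongr
    linarith
  rcases le_or_gt 0 s with h5 | h5
  · right
    refine ⟨ht, ht0, ?_⟩
    rw [re_mul_conj_dir, ← hs]
    rw [abs_of_nonneg h5] at hcn
    have := mul_le_mul_of_nonneg_right hc2 h5
    linarith
  · left
    refine ⟨ht, ht0, ?_⟩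
    rw [re_mul_conj_dir, ← hs]
    rw [abs_of_neg h5] at hcn
    have := mul_le_mul_of_nonneg_right hc3 (neg_nonneg.2 h5.le)
    linarith

end Gluing

section BoundaryValues

theorem integrableOn_abs_sub_rpow (r : ℝ) :
    IntegrableOn (fun σ : ℝ => |σ - r| ^ (-(1 / 2) : ℝ)) (Ioc (r - 1) (r + 1)) := by
  have h0 : IntervalIntegrable (fun x : ℝ => x ^ (-(1 / 2) : ℝ)) volume 0 1 :=
    intervalIntegral.intervalIntegrable_rpow' (by norm_num)
  have h1 := h0.comp_sub_right r
  have h2 := (h0.comp_sub_left r).symm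
  simp only [zero_add, sub_zero] at h1 h2
  rw [add_comm 1 r, intervalIntegrable_iff_integrableOn_Ioc_of_le (by linarith)] at h1
  rw [intervalIntegrable_iff_integrableOn_Ioc_of_le (by linarith)] at h2
  have h3 := IntegrableOn.union (s := Ioc (r - 1) r) (t := Ioc r (r + 1))
    (f := fun σ : ℝ => |σ - r| ^ (-(1 / 2) : ℝ)) (μ := volume)
    (h2.congr_fun (fun x hx => by
      simp only
      rw [abs_of_nonpos (by linarith [hx.2]), neg_sub]) measurableSet_Ioc)
    (h1.congr_fun (fun x hx => by
      simp only
      rw [abs_of_pos (by linarith [hx.1])]) measurableSet_Ioc)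
  rwa [Ioc_union_Ioc_eq_Ioc (by linarith) (by linarith)] at h3

theorem integrableOn_exp_mul_abs_sub_rpow {a : ℝ} (ha : 0 < a) (r : ℝ) :
    IntegrableOn (fun σ : ℝ => Real.exp (-(a * σ)) * |σ - r| ^ (-(1 / 2) : ℝ)) (Ioi 0) := by
  have h1 : Integrable (fun σ : ℝ => (Ioc (r - 1) (r + 1)).indicator
      (fun σ => |σ - r| ^ (-(1 / 2) : ℝ)) σ) (volume.restrict (Ioi 0)) :=
    ((integrable_indicator_iff measurableSet_Ioc).2 (integrableOn_abs_sub_rpow r)).restrict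
  refine Integrable.mono' ((integrableOn_exp_neg ha).add h1) ?_ ?_
  · refine Measurable.aestronglyMeasurable ?_
    fun_prop
  · filter_upwards [ae_restrict_mem measurableSet_Ioi] with σ hσ
    have hσ0 : (0 : ℝ) < σ := hσ
    have hp : 0 ≤ |σ - r| ^ (-(1 / 2) : ℝ) := rpow_nonneg (abs_nonneg _) _
    rw [Real.norm_of_nonneg (mul_nonneg (Real.exp_pos _).le hp), Pi.add_apply]
    by_cases hm : σ ∈ Ioc (r - 1) (r + 1)
    · rw [indicator_of_mem hm]
      have : Real.exp (-(a * σ)) ≤ 1 := Real.exp_le_one_iff.2 (by nlinarith)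
      have h3 := mul_le_mul_of_nonneg_right this hp
      have h4 := (Real.exp_pos (-(a * σ))).le
      linarith
    · rw [indicator_of_notMem hm, add_zero]
      refine mul_le_of_le_one_right (Real.exp_pos _).le ?_
      refine Real.rpow_le_one_of_one_le_of_nonpos ?_ (by norm_num)
      by_contra h5
      rw [not_le, abs_lt] at h5
      exact hm ⟨by linarith, by linarith⟩

/-- The restriction to the reals of the weight `poleWeight`. -/
def realWeight (P : Finset ℂ) (σ : ℝ) : ℝ :=
  1 + ∑ p ∈ P.erase 0, |σ - p.re| ^ (-(1 / 2) : ℝ)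

theorem integrableOn_exp_mul_realWeight (P : Finset ℂ) {a : ℝ} (ha : 0 < a) :
    IntegrableOn (fun σ : ℝ => Real.exp (-(a * σ)) * realWeight P σ) (Ioi 0) := by
  simp only [realWeight, mul_add, mul_one, mul_sum]
  exact (integrableOn_exp_neg ha).add (integrable_finsetSum _ fun p _ =>
    integrableOn_exp_mul_abs_sub_rpow ha p.re)

theorem ae_ne_re (P : Finset ℂ) : ∀ᵐ σ : ℝ ∂volume, ∀ p ∈ P, σ ≠ p.re := by
  have : (((P.image Complex.re : Finset ℝ) : Set ℝ)ᶜ) ∈ ae (volume : Measure ℝ) :=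
    compl_mem_ae_iff.2 ((P.image Complex.re).finite_toSet.measure_zero volume)
  filter_upwards [this] with σ hσ p hp h
  exact hσ (by simp only [Finset.coe_image, mem_image, Finset.mem_coe]; exact ⟨p, hp, h.symm⟩)

variable {E : Type*} [NormedAddCommGroup E] [NormedSpace ℂ E] [CompleteSpace E]
  {P : Finset ℂ} {R : ℂ → E →L[ℂ] E} {κ η : ℝ} {v : E} {Ψ : ℂ → E}

theorem SectorSolution.bound_realWeight (h : SectorSolution P R κ η v Ψ) (hκ : IsSign κ)
    (hP : ∀ p ∈ P, p ∉ sector κ η) (hR2 : ∀ p, R p * R p = 0) {y : ℝ} (hy : 0 ≤ y)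
    (hyη : y < η) {δ : ℝ} (hδ : 0 < δ) : ∃ C, 0 ≤ C ∧ ∀ y' ∈ Icc 0 y, ∀ σ > 0, (∀ p ∈ P, σ ≠ p.re) →
      ‖Ψ (dir κ y' * σ)‖ ≤ C * realWeight P σ * Real.exp (δ * σ) := by
  have hκκ := hκ.mul_self
  obtain ⟨C, hC0, hC⟩ := h.bound hκ hP hR2 hy hyη hδ
  refine ⟨C, hC0, fun y' hy' σ hσ hne => ?_⟩
  have hre : (dir κ y' * σ).re = σ := by simp [dir]
  have hb := hC (dir κ y' * σ) (dir_mul_mem hκ hy'.1 (hy'.2.trans_lt hyη) hσ) (by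
    simp only [dir, Complex.im_mul_ofReal, Complex.re_mul_ofReal, one_mul]
    rw [show κ * (κ * y' * σ) = (κ * κ) * (y' * σ) by ring, hκκ, one_mul]
    gcongr
    exact hy'.2) (fun hmem => hne _ hmem hre.symm)
  rw [hre] at hb
  refine hb.trans ?_
  gcongr
  refine add_le_add le_rfl (sum_le_sum fun p hp => ?_)
  refine rpow_le_rpow_of_nonpos (abs_pos.2 (sub_ne_zero.2 (hne p (Finset.mem_of_mem_erase hp))))
    ?_ (by norm_num)
  have := abs_re_le_norm (dir κ y' * σ - p)
  rwa [sub_re, hre] at this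

theorem SectorSolution.continuousAt_real (h : SectorSolution P R κ η v Ψ) (hη : 0 < η) {σ : ℝ}
    (hσ : 0 < σ) (hne : ∀ p ∈ P, σ ≠ p.re) : ContinuousAt Ψ σ :=
  (h.deriv σ ⟨by simpa using hσ, by simp, by simpa using mul_pos hη hσ⟩
    (fun hmem => hne _ hmem (by simp))).continuousAt

theorem SectorSolution.integrableOn_real (h : SectorSolution P R κ η v Ψ) (hκ : IsSign κ)
    (hη : 0 < η) (hP : ∀ p ∈ P, p ∉ sector κ η) (hR2 : ∀ p, R p * R p = 0) {ξ : ℂ}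
    (hξ : 0 < ξ.re) : IntegrableOn (fun σ : ℝ => exp (-ξ * σ) • Ψ σ) (Ioi 0) := by
  obtain ⟨C, hC0, hC⟩ := h.bound_realWeight hκ hP hR2 le_rfl hη (half_pos hξ)
  refine Integrable.mono' ((integrableOn_exp_mul_realWeight P (half_pos hξ)).const_mul C) ?_ ?_
  · set T : Set ℝ := ((P.image Complex.re : Finset ℝ) : Set ℝ)
    have hT : volume T = 0 := (P.image Complex.re).finite_toSet.measure_zero volume
    have hTm : MeasurableSet T := (P.image Complex.re).finite_toSet.measurableSet
    have hae : (Ioi (0 : ℝ) \ T : Set ℝ) =ᵐ[volume] Ioi 0 := sdiff_null_ae_eq_self hT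
    rw [← Measure.restrict_congr_set hae]
    refine ContinuousOn.aestronglyMeasurable (fun σ hσ => ?_) (measurableSet_Ioi.diff hTm)
    refine ContinuousAt.continuousWithinAt (ContinuousAt.smul (by fun_prop) ?_)
    refine ContinuousAt.comp (f := fun σ : ℝ => (σ : ℂ)) ?_ (by fun_prop)
    refine h.continuousAt_real hη hσ.1 fun p hp hpe => hσ.2 ?_
    simp only [T, Finset.coe_image, mem_image, Finset.mem_coe]
    exact ⟨p, hp, hpe.symm⟩
  · filter_upwards [ae_restrict_mem measurableSet_Ioi, ae_restrict_of_ae (ae_ne_re P)] with σ hσ hne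
    have := hC 0 ⟨le_rfl, le_rfl⟩ σ hσ hne
    have hd : dir κ 0 = 1 := by apply Complex.ext <;> simp [dir]
    rw [hd, one_mul] at this
    rw [norm_smul, norm_exp_neg_mul]
    calc _ ≤ Real.exp (-(ξ.re * σ)) * (C * realWeight P σ * Real.exp (ξ.re / 2 * σ)) := by gcongr
      _ = C * ((Real.exp (-(ξ.re * σ)) * Real.exp (ξ.re / 2 * σ)) * realWeight P σ) := by ring
      _ = _ := by rw [← Real.exp_add]; congr 4; ring

/-- The Laplace transforms along directions close to the positive reals converge to the Laplace
transform of the boundary values. -/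
theorem SectorSolution.tendsto_laplace_dir (h : SectorSolution P R κ η v Ψ)
    (hκ : IsSign κ) (hP : ∀ p ∈ P, p ∉ sector κ η) (hR2 : ∀ p, R p * R p = 0) {y : ℝ}
    (hy : 0 < y) (hyη : y < η) {t : ℂ} (ht : 0 < t.re) (ht' : t ∈ halfAt (dir κ y)) :
    Tendsto (fun y' => laplace (fun σ : ℝ => Ψ (dir κ y' * σ)) (dir κ y' / t)) (𝓝[>] 0)
      (𝓝 (laplace (fun σ : ℝ => Ψ σ) (1 / t))) := by
  have ht0 : t ≠ 0 := ne_zero_of_mem_halfAt ht'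
  have hn : 0 < ‖t‖ ^ 2 := by have := norm_pos_iff.2 ht0; positivity
  set a := min t.re (t.re + y * (κ * t.im)) / ‖t‖ ^ 2 with ha
  have ha0 : 0 < a := div_pos (lt_min ht (mem_halfAt_dir.1 ht')) hn
  have hre : ∀ y' ∈ Icc 0 y, a ≤ (dir κ y' / t).re := by
    intro y' hy'
    rw [re_div_eq, re_mul_conj_dir, ha]
    gcongr
    rcases le_or_gt 0 (κ * t.im) with h5 | h5
    · exact (min_le_left _ _).trans (by have := mul_nonneg hy'.1 h5; linarith)
    · refine (min_le_right _ _).trans ?_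
      have := mul_le_mul_of_nonpos_right hy'.2 h5.le
      linarith
  obtain ⟨C, hC0, hC⟩ := h.bound_realWeight hκ hP hR2 hy.le hyη (half_pos ha0)
  have hcont : Continuous fun y' : ℝ => dir κ y' := by
    have e : (fun y' : ℝ => dir κ y') = fun y' : ℝ => 1 + ((κ * y' : ℝ) : ℂ) * I := by
      funext y'; apply Complex.ext <;> simp [dir]
    rw [e]; fun_prop
  have hd0 : dir κ 0 = 1 := by apply Complex.ext <;> simp [dir]
  have htd : Tendsto (fun y' : ℝ => dir κ y') (𝓝[>] 0) (𝓝 1) := by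
    have := hcont.tendsto 0
    rw [hd0] at this
    exact this.mono_left nhdsWithin_le_nhds
  have hev : ∀ᶠ y' : ℝ in 𝓝[>] 0, y' ∈ Ioc 0 y := by
    filter_upwards [self_mem_nhdsWithin, mem_nhdsWithin_of_mem_nhds (Iio_mem_nhds hy)] with x h1 h2
    exact ⟨h1, le_of_lt h2⟩
  unfold laplace
  refine Tendsto.smul (htd.div_const t) ?_
  refine tendsto_integral_filter_of_dominated_convergence
    (fun σ => C * (Real.exp (-(a / 2 * σ)) * realWeight P σ)) ?_ ?_ ?_ ?_
  · filter_upwards [hev] with y' hy'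
    refine ContinuousOn.aestronglyMeasurable (fun σ hσ => ?_) measurableSet_Ioi
    refine ContinuousAt.continuousWithinAt (ContinuousAt.smul (by fun_prop) ?_)
    have h1 := (h.deriv _ (dir_mul_mem hκ hy'.1.le (hy'.2.trans_lt hyη) hσ)
      (dir_mul_notMem hκ hP hy'.1 (hy'.2.trans_lt hyη) hσ)).continuousAt
    exact ContinuousAt.comp (f := fun σ : ℝ => dir κ y' * (σ : ℂ)) h1 (by fun_prop)
  · filter_upwards [hev] with y' hy'
    filter_upwards [ae_restrict_mem measurableSet_Ioi, ae_restrict_of_ae (ae_ne_re P)] with σ hσ hne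
    have hσ0 : (0 : ℝ) < σ := hσ
    rw [norm_smul, norm_exp_neg_mul]
    have h1 := hC y' ⟨hy'.1.le, hy'.2⟩ σ hσ hne
    have h2 := hre y' ⟨hy'.1.le, hy'.2⟩
    calc _ ≤ Real.exp (-(a * σ)) * (C * realWeight P σ * Real.exp (a / 2 * σ)) := by
          gcongr
      _ = C * ((Real.exp (-(a * σ)) * Real.exp (a / 2 * σ)) * realWeight P σ) := by ring
      _ = _ := by rw [← Real.exp_add]; congr 4; ring
  · exact (integrableOn_exp_mul_realWeight P (half_pos ha0)).const_mul C
  · filter_upwards [ae_restrict_mem measurableSet_Ioi, ae_restrict_of_ae (ae_ne_re P)] with σ hσ hne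
    refine Tendsto.smul ?_ ?_
    · have : Continuous fun z : ℂ => exp (-(z / t) * σ) := by fun_prop
      exact (this.tendsto 1).comp htd
    · have h1 := h.continuousAt_real (hy.trans hyη) hσ hne
      have h2 : Tendsto (fun y' : ℝ => dir κ y' * (σ : ℂ)) (𝓝[>] 0) (𝓝 (σ : ℂ)) := by
        have := htd.mul_const (σ : ℂ)
        rwa [one_mul] at this
      exact h1.tendsto.comp h2

end BoundaryValues

section RealLaplace

variable {ι : Type*} [Fintype ι] [DecidableEq ι]

theorem RowFamily.laplaceRows_eq_real {lam : ι → ℂ} {f : Mat(ι)} {κ η : ℝ}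
    {Ψ : ι → ℂ → ι → ℂ} (hΨ : RowFamily lam f κ η Ψ) (h : SectorFree lam f η)
    (hκ : IsSign κ) {y : ℝ} (hy : 0 < y) (hyη : y < η) {t : ℂ} (ht : 0 < t.re)
    (ht' : t ∈ halfAt (dir κ y)) : laplaceRows lam Ψ (dir κ y) t = laplaceRows lam Ψ 1 t := by
  ext i k
  have h1 := (hΨ i).tendsto_laplace_dir hκ (h.poles hκ i) (rowResidue_mul_self lam f h.diag i)
    hy hyη ht ht'
  have h2 := ((tendsto_pi_nhds.1 h1) k).const_mul (exp (lam i / t))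
  have h3 : Tendsto (fun y' : ℝ => laplaceRows lam Ψ (dir κ y) t i k) (𝓝[>] 0)
      (𝓝 (exp (lam i / t) * laplace (fun σ : ℝ => Ψ i σ) (1 / t) k)) := by
    refine h2.congr' ?_
    filter_upwards [self_mem_nhdsWithin, mem_nhdsWithin_of_mem_nhds (Iio_mem_nhds hy)]
      with y' hy' hy'2
    have hy'0 : 0 < y' := hy'
    have hy'y : y' < y := hy'2
    have : t ∈ halfAt (dir κ y') := by
      rw [mem_halfAt_dir] at ht' ⊢
      rcases le_or_gt 0 (κ * t.im) with h5 | h5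
      · have := mul_nonneg hy'0.le h5; linarith
      · have := mul_le_mul_of_nonpos_right hy'y.le h5.le; linarith
    rw [hΨ.laplaceRows_eq h hκ hy hy'0 hyη (hy'y.trans hyη) ht' this]
    rfl
  have h4 := tendsto_nhds_unique tendsto_const_nhds h3
  rw [h4]
  simp only [laplaceRows, of_apply, one_mul]

end RealLaplace

section Jump

variable {E : Type*} [NormedAddCommGroup E] [NormedSpace ℂ E] [CompleteSpace E] {ι : Type*}

/-- Comparison of the boundary values from above and from below: the difference is a combination
of solutions starting at the positive poles. -/
theorem boundary_jump (P : Finset ℂ) (R : ℂ → E →L[ℂ] E) (hR0 : ∀ p ∉ P, R p = 0)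
    (hR2 : ∀ p, R p * R p = 0) {ΨL ΨR : ℂ → E} {v : E} {J : Finset ι} {s : ι → ℝ} {F : ι → ℂ → E}
    {b : ι → E} {ΘL : ℝ → E}
    (hL : ∀ x : ℝ, 0 < x → (x : ℂ) ∉ P → HasDerivAt ΨL (fuchs P R x (ΨL x)) x)
    (hR : ∀ x : ℝ, 0 < x → (x : ℂ) ∉ P → HasDerivAt ΨR (fuchs P R x (ΨR x)) x)
    (hL0 : Tendsto (fun x : ℝ => ΨL x - (Real.log x : ℂ) • R 0 (ΨL x)) (𝓝[>] 0) (𝓝 v))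
    (hRb : Tendsto (fun x : ℝ => ΨR x - (Real.log x : ℂ) • R 0 (ΨR x)) (𝓝[>] 0) (𝓝 v))
    (hLp : ∀ p : ℝ, 0 < p → Tendsto (fun x : ℝ => ΨL x - sideLog 1 (x - p) • R p (ΨL x))
      (𝓝[≠] p) (𝓝 (ΘL p))) (hRp : ∀ p : ℝ, 0 < p → ∃ Θ, Tendsto
      (fun x : ℝ => ΨR x - sideLog (-1) (x - p) • R p (ΨR x)) (𝓝[≠] p) (𝓝 Θ))
    (hs : ∀ j ∈ J, 0 < s j)
    (hF : ∀ j ∈ J, ∀ x : ℝ, s j < x → (x : ℂ) ∉ P → HasDerivAt (F j) (fuchs P R x (F j x)) x)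
    (hFb : ∀ j ∈ J, Tendsto (fun x : ℝ => F j x - (Real.log (x - s j) : ℂ) • R (s j) (F j x))
      (𝓝[>] (s j)) (𝓝 (b j))) (hFp : ∀ j ∈ J, ∀ p : ℝ, s j < p → ∃ Θ, Tendsto
      (fun x : ℝ => F j x - sideLog (-1) (x - p) • R p (F j x)) (𝓝[≠] p) (𝓝 Θ))
    (hb : ∀ p : ℝ, 0 < p → ∑ j ∈ J with s j = p, b j = -((2 * π * I) • R p (ΘL p))) :
    ∀ x : ℝ, 0 < x → (x : ℂ) ∉ P → ΨL x = ΨR x + ∑ j ∈ J with s j < x, F j x := by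
  set D : Finset ι → ℂ → E := fun A w => ΨR w + ∑ j ∈ A, F j w - ΨL w with hD
  have hDderiv : ∀ A ⊆ J, ∀ x : ℝ, 0 < x → (∀ j ∈ A, s j < x) → (x : ℂ) ∉ P →
      HasDerivAt (D A) (fuchs P R x (D A x)) x := by
    intro A hA x hx hAx hxP
    have h1 : HasDerivAt (fun w => ∑ j ∈ A, F j w) (∑ j ∈ A, fuchs P R x (F j x)) x :=
      HasDerivAt.fun_sum fun j hj => hF j (hA hj) x (hAx j hj) hxP
    refine (((hR x hx hxP).add h1).sub (hL x hx hxP)).congr_deriv ?_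
    simp only [hD, map_sub, map_add, map_sum]
  -- the sets of indices are locally constant
  have hright : ∀ x : ℝ, ∀ᶠ x' : ℝ in 𝓝[>] x,
      (J.filter fun j => s j < x') = J.filter fun j => s j ≤ x := by
    intro x
    have : ∀ᶠ x' : ℝ in 𝓝[>] x, ∀ j ∈ J, (s j < x' ↔ s j ≤ x) := by
      rw [eventually_all_finset]
      intro j _
      rcases le_or_gt (s j) x with h | h
      · filter_upwards [self_mem_nhdsWithin] with x' hx'
        exact ⟨fun _ => h, fun _ => h.trans_lt hx'⟩
      · filter_upwards [mem_nhdsWithin_of_mem_nhds (Iio_mem_nhds h)] with x' hx'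
        exact ⟨fun h' => absurd h' (not_lt.2 (le_of_lt hx')), fun h' => absurd h' (not_le.2 h)⟩
    filter_upwards [this] with x' hx'
    exact Finset.filter_congr hx'
  have hleft : ∀ x : ℝ, ∀ᶠ x' : ℝ in 𝓝[<] x,
      (J.filter fun j => s j < x') = J.filter fun j => s j < x := by
    intro x
    have : ∀ᶠ x' : ℝ in 𝓝[<] x, ∀ j ∈ J, (s j < x' ↔ s j < x) := by
      rw [eventually_all_finset]
      intro j _
      rcases lt_or_ge (s j) x with h | h
      · filter_upwards [mem_nhdsWithin_of_mem_nhds (Ioi_mem_nhds h)] with x' hx'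
        exact ⟨fun _ => h, fun _ => hx'⟩
      · filter_upwards [self_mem_nhdsWithin] with x' hx'
        have : x' < x := hx'
        exact ⟨fun h' => h'.trans this, fun h' => absurd h' (not_lt.2 h)⟩
    filter_upwards [this] with x' hx'
    exact Finset.filter_congr hx'
  have hnotP : ∀ x : ℝ, ∀ᶠ x' : ℝ in 𝓝[≠] x, (x' : ℂ) ∉ P := by
    intro x
    have h1 : ∀ᶠ x' : ℝ in 𝓝[≠] x, ∀ p ∈ P, (x' : ℂ) ≠ p := by
      rw [eventually_all_finset]
      intro p _
      by_cases hp : (x : ℂ) = p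
      · filter_upwards [self_mem_nhdsWithin] with x' hx' h
        apply hx'
        have : (x' : ℂ) = x := h.trans hp.symm
        exact_mod_cast this
      · have h2 : ∀ᶠ x' : ℝ in 𝓝 x, (x' : ℂ) ≠ p :=
          (Complex.continuous_ofReal.continuousAt).eventually_ne hp
        exact h2.filter_mono nhdsWithin_le_nhds
    filter_upwards [h1] with x' hx' hmem using hx' _ hmem rfl
  have hnePos : ∀ x : ℝ, (𝓝[>] x) ≤ 𝓝[≠] x := fun x =>
    nhdsWithin_mono _ fun y hy => ne_of_gt hy
  have hneNeg : ∀ x : ℝ, (𝓝[<] x) ≤ 𝓝[≠] x := fun x =>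
    nhdsWithin_mono _ fun y hy => ne_of_lt hy
  have hposR : ∀ x : ℝ, 0 ≤ x → ∀ᶠ x' : ℝ in 𝓝[>] x, 0 < x' := by
    intro x hx
    filter_upwards [self_mem_nhdsWithin] with x' hx' using lt_of_le_of_lt hx hx'
  have hext : ∀ x : ℝ, 0 ≤ x →
      Tendsto (fun x' : ℝ => D (J.filter fun j => s j ≤ x) x' -
        (Real.log (x' - x) : ℂ) • R x (D (J.filter fun j => s j ≤ x) x')) (𝓝[>] x) (𝓝 0) →
      ∀ᶠ x' : ℝ in 𝓝[>] x, D (J.filter fun j => s j < x') x' = 0 := by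
    intro x hx hlim
    have h1 := eventually_eq_zero_of_tendsto P R hR0 hR2 x (D := D (J.filter fun j => s j ≤ x)) (by
      filter_upwards [self_mem_nhdsWithin, hposR x hx, hnePos x (hnotP x)] with x' h1 h2 h3
      exact hDderiv _ (Finset.filter_subset _ _) x' h2
        (fun j hj => ((mem_filter.1 hj).2).trans_lt h1) h3) hlim
    filter_upwards [h1, hright x] with x' h2 h3
    rw [h3]; exact h2
  have key : ∀ B : ℝ, 0 < B → ∀ x ∈ Icc 0 B, ∀ x' : ℝ, 0 < x' → x' ≤ x → (x' : ℂ) ∉ P →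
      D (J.filter fun j => s j < x') x' = 0 := by
    intro B hB
    set T : Set ℝ := {x | ∀ x' : ℝ, 0 < x' → x' ≤ x → (x' : ℂ) ∉ P →
      D (J.filter fun j => s j < x') x' = 0} with hT
    have hTdown : ∀ x ∈ T, ∀ y ≤ x, y ∈ T := fun x hx y hyx x' h1 h2 => hx x' h1 (h2.trans hyx)
    have hTlim : ∀ x : ℝ, 0 < x → (∀ y < x, y ∈ T) → x ∈ T := by
      intro x hx hlt x' h1 h2 h3
      rcases lt_or_eq_of_le h2 with h4 | h4
      · obtain ⟨y, hy1, hy2⟩ := exists_between h4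
        exact hlt y hy2 x' h1 hy1.le h3
      · subst h4
        have hc := (hDderiv (J.filter fun j => s j < x') (Finset.filter_subset _ _) x' h1
          (fun j hj => (mem_filter.1 hj).2) h3).continuousAt
        have hc2 : Tendsto (fun y : ℝ => D (J.filter fun j => s j < x') y) (𝓝[<] x')
            (𝓝 (D (J.filter fun j => s j < x') x')) :=
          (ContinuousAt.comp (f := fun y : ℝ => (y : ℂ)) hc (by fun_prop)).tendsto.mono_left
            nhdsWithin_le_nhds
        refine tendsto_nhds_unique hc2 (tendsto_const_nhds.congr' ?_)
        filter_upwards [self_mem_nhdsWithin, mem_nhdsWithin_of_mem_nhds (Ioi_mem_nhds h1),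
          hneNeg x' (hnotP x'), hleft x'] with y hy1 hy2 hy3 hy4
        rw [← hy4]
        exact (hlt y hy1 y hy2 le_rfl hy3).symm
    have hsub : Icc 0 B ⊆ T := by
      refine IsClosed.Icc_subset_of_forall_mem_nhdsWithin ?_ ?_ ?_
      · refine isClosed_of_closure_subset fun x hx => ?_
        have hxI : x ∈ Icc 0 B := isClosed_Icc.closure_subset_iff.2 inter_subset_right hx
        refine ⟨?_, hxI⟩
        rcases eq_or_lt_of_le hxI.1 with h0 | h0
        · rw [← h0]; intro x' h1 h2; linarith
        refine hTlim x h0 fun y hy => ?_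
        obtain ⟨z, hz1, hz2⟩ := mem_closure_iff.1 hx (Ioi y) isOpen_Ioi hy
        exact hTdown z hz2.1 y (le_of_lt hz1)
      · intro x' h1 h2; linarith
      · rintro x ⟨hxT, hx0, hxB⟩
        suffices h : ∀ᶠ x' : ℝ in 𝓝[>] x, D (J.filter fun j => s j < x') x' = 0 by
          obtain ⟨c, hc, hcs⟩ := (mem_nhdsGT_iff_exists_Ioo_subset).1 h
          refine (mem_nhdsGT_iff_exists_Ioo_subset).2 ⟨c, hc, fun z hz x' h1 h2 h3 => ?_⟩
          rcases le_or_gt x' x with h4 | h4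
          · exact hxT x' h1 h4 h3
          · exact hcs ⟨h4, h2.trans_lt hz.2⟩
        refine hext x hx0 ?_
        rcases eq_or_lt_of_le hx0 with h0 | h0
        · have hempty : (J.filter fun j => s j ≤ x) = ∅ := by
            refine Finset.filter_eq_empty_iff.2 fun j hj => ?_
            rw [← h0, not_le]; exact hs j hj
          rw [hempty, ← h0]
          have := hRb.sub hL0
          rw [sub_self] at this
          refine this.congr fun x' => ?_
          simp only [hD, Finset.sum_empty, add_zero, sub_zero, map_sub, smul_sub,
            ofReal_zero]
          abel
        -- a point `x > 0`
        set A := J.filter fun j => s j < x with hA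
        set A₀ := J.filter fun j => s j = x with hA₀
        have hsplit : ∀ g : ι → E, ∑ j ∈ J with s j ≤ x, g j = ∑ j ∈ A, g j + ∑ j ∈ A₀, g j := by
          intro g
          rw [hA, hA₀, Finset.sum_filter, Finset.sum_filter, Finset.sum_filter,
            ← sum_add_distrib]
          refine sum_congr rfl fun j _ => ?_
          rcases lt_trichotomy (s j) x with h | h | h
          · rw [if_pos h.le, if_pos h, if_neg h.ne, add_zero]
          · rw [if_pos h.le, if_neg h.not_lt, if_pos h, zero_add]
          · rw [if_neg (not_le.2 h), if_neg h.not_gt, if_neg h.ne', add_zero]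
        set g : ℂ → E := fun w => ΨR w + ∑ j ∈ A, F j w with hg
        have hgΘ : ∃ Θ, Tendsto (fun x' : ℝ => g x' - sideLog (-1) (x' - x) • R x (g x'))
            (𝓝[≠] x) (𝓝 Θ) := by
          obtain ⟨Θ₀, h1⟩ := hRp x h0
          have h2 : ∀ j ∈ A, ∃ Θ, Tendsto
              (fun x' : ℝ => F j x' - sideLog (-1) (x' - x) • R x (F j x')) (𝓝[≠] x) (𝓝 Θ) :=
            fun j hj => hFp j (mem_filter.1 hj).1 x (mem_filter.1 hj).2
          choose! Θ h2 using h2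
          refine ⟨Θ₀ + ∑ j ∈ A, Θ j, (h1.add (tendsto_finsetSum A h2)).congr fun x' => ?_⟩
          simp only [hg, map_add, map_sum, smul_add, smul_sum, sum_sub_distrib]
          abel
        obtain ⟨Θg, hΘg⟩ := hgΘ
        have hRR : ∀ z, R x (R x z) = 0 := fun z => by
          have := congrArg (fun T : E →L[ℂ] E => T z) (hR2 x)
          simpa using this
        -- comparison on the left
        have hrel : Θg = ΘL x + (2 * π * I) • R x (ΘL x) := by
          have h1 := (hLp x h0).mono_left (hneNeg x)
          have h2 := hΘg.mono_left (hneNeg x)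
          have h3 := h1.add (((R x).continuous.tendsto _).comp h1 |>.const_smul
            (2 * π * I))
          refine tendsto_nhds_unique h2 (h3.congr' ?_)
          filter_upwards [self_mem_nhdsWithin, mem_nhdsWithin_of_mem_nhds (Ioi_mem_nhds h0),
            hneNeg x (hnotP x), hleft x] with y hy1 hy2 hy3 hy4
          have hyx : y < x := hy1
          have h5 := hxT y hy2 hyx.le hy3
          rw [hy4] at h5
          have h6 : g y = ΨL y := sub_eq_zero.1 h5
          have e1 : ((y : ℂ) - x) = ((y - x : ℝ) : ℂ) := by push_cast; rfl
          rw [h6, e1, sideLog_neg (Or.inl rfl) (by linarith), sideLog_neg (Or.inr rfl) (by linarith)]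
          simp only [Function.comp, map_sub, map_smul, hRR, smul_zero, sub_zero]
          push_cast
          module
        -- the limit on the right
        have h1 := (hLp x h0).mono_left (hnePos x)
        have h2 := hΘg.mono_left (hnePos x)
        have h3 : Tendsto (fun x' : ℝ => ∑ j ∈ A₀, (F j x' - (Real.log (x' - x) : ℂ) •
            R x (F j x'))) (𝓝[>] x) (𝓝 (∑ j ∈ A₀, b j)) := by
          refine tendsto_finsetSum A₀ fun j hj => ?_
          have := hFb j (mem_filter.1 hj).1
          rwa [(mem_filter.1 hj).2] at this
        have h4 := (h2.add h3).sub h1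
        have e0 : Θg + ∑ j ∈ A₀, b j - ΘL x = 0 := by
          rw [hrel, hb x h0]; abel
        rw [e0] at h4
        refine h4.congr' ?_
        filter_upwards [self_mem_nhdsWithin] with y hy
        have hyx : x < y := hy
        have e1 : ((y : ℂ) - x) = ((y - x : ℝ) : ℂ) := by push_cast; rfl
        have e2 : D (J.filter fun j => s j ≤ x) y = g y + ∑ j ∈ A₀, F j y - ΨL y := by
          simp only [hD, hg, hsplit]; abel
        rw [e2, e1, sideLog_pos (Or.inl rfl) (by linarith), sideLog_pos (Or.inr rfl) (by linarith)]
        simp only [map_sub, map_add, map_sum, smul_sub, smul_add, smul_sum,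
          sum_sub_distrib]
        abel
    exact fun x hx => hsub hx
  intro x hx hxP
  have := key x hx x ⟨hx.le, le_rfl⟩ x hx le_rfl hxP
  exact (sub_eq_zero.1 this).symm

end Jump

section RowJump

variable {ι : Type*} [Fintype ι] [DecidableEq ι]

theorem mem_raySector_ofReal {κ η x : ℝ} (hη : 0 < η) (hx : 0 < x) : (x : ℂ) ∈ raySector κ η :=
  ⟨by simpa using hx, by simp, by simpa using mul_pos hη hx⟩

theorem tendsto_ofReal_sector {κ η : ℝ} (hη : 0 < η) :
    Tendsto (fun x : ℝ => (x : ℂ)) (𝓝[>] 0) (𝓝[raySector κ η] 0) := by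
  refine tendsto_nhdsWithin_iff.2 ⟨?_, ?_⟩
  · have := Complex.continuous_ofReal.tendsto 0
    rw [ofReal_zero] at this
    exact this.mono_left nhdsWithin_le_nhds
  · filter_upwards [self_mem_nhdsWithin] with x hx using mem_raySector_ofReal hη hx

theorem tendsto_ofReal_sector_pole {κ η p : ℝ} (hη : 0 < η) (hp : 0 < p) :
    Tendsto (fun x : ℝ => (x : ℂ)) (𝓝[≠] p) (𝓝[raySector κ η \ {(p : ℂ)}] p) := by
  refine tendsto_nhdsWithin_iff.2 ⟨?_, ?_⟩
  · exact (Complex.continuous_ofReal.tendsto p).mono_left nhdsWithin_le_nhds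
  · filter_upwards [self_mem_nhdsWithin, mem_nhdsWithin_of_mem_nhds (Ioi_mem_nhds hp)] with x h1 h2
    exact ⟨mem_raySector_ofReal hη h2, fun h => h1 (Complex.ofReal_injective h)⟩

theorem rowResidue_shift (lam : ι → ℂ) (f : Mat(ι)) (i j : ι) (p : ℂ) :
    rowResidue lam f j (p - (lam i - lam j)) = rowResidue lam f i p := by
  ext ψ k
  rw [rowResidue_apply, rowResidue_apply]
  have : (lam j - lam k = p - (lam i - lam j)) ↔ (lam i - lam k = p) :=
    ⟨fun h => by linear_combination h, fun h => by linear_combination h⟩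
  simp only [this]

theorem mem_rowPoles_shift (lam : ι → ℂ) (i j : ι) (p : ℂ) :
    p - (lam i - lam j) ∈ rowPoles lam j ↔ p ∈ rowPoles lam i := by
  simp only [rowPoles, Finset.mem_image, Finset.mem_univ, true_and]
  refine exists_congr fun k => ⟨fun h => by linear_combination h, fun h => by linear_combination h⟩

theorem fuchs_row_shift (lam : ι → ℂ) (f : Mat(ι)) (i j : ι) (w : ℂ) :
    fuchs (rowPoles lam j) (rowResidue lam f j) (w - (lam i - lam j)) =
      fuchs (rowPoles lam i) (rowResidue lam f i) w := by
  ext ψ k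
  rw [fuchs_row_apply, fuchs_row_apply]
  congr 3
  ring

/-- The jump data of a family of row solutions: `S i j` is given by the residue at the pole
`lam i - lam j > 0`. -/
structure IsStokesMatrix (lam : ι → ℂ) (f : Mat(ι)) (η : ℝ) (Ψ : ι → ℂ → ι → ℂ)
    (S : Mat(ι)) : Prop where
  eq_zero : ∀ i j, (∀ p : ℝ, 0 < p → lam i - lam j ≠ p) → S i j = 0
  eq_residue : ∀ i, ∀ p : ℝ, 0 < p → ∃ Θ : ι → ℂ,
    Tendsto (fun w => Ψ i w - sideLog 1 (w - p) • rowResidue lam f i p (Ψ i w))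
      (𝓝[raySector 1 η \ {(p : ℂ)}] p) (𝓝 Θ) ∧
    ∀ j, lam i - lam j = p → S i j = 2 * π * I * ∑ l, Θ l * f l j

theorem RowFamily.jump {lam : ι → ℂ} {f : Mat(ι)} {η : ℝ} (h : SectorFree lam f η)
    {ΨL ΨR : ι → ℂ → ι → ℂ} (hL : RowFamily lam f 1 η ΨL) (hR : RowFamily lam f (-1) η ΨR)
    {S : Mat(ι)} (hS : IsStokesMatrix lam f η ΨL S) (i : ι) (x : ℝ) (hx : 0 < x)
    (hxP : (x : ℂ) ∉ rowPoles lam i) :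
    ΨL i x = ΨR i x + ∑ j with (0 < (lam i - lam j).re ∧ (lam i - lam j).im = 0) ∧
      (lam i - lam j).re < x, S i j • ΨR j (x - (lam i - lam j)) := by
  have hη := h.pos
  have hres := hS.eq_residue i
  choose! Θ hΘ hSΘ using hres
  set J : Finset ι := Finset.univ.filter fun j => 0 < (lam i - lam j).re ∧ (lam i - lam j).im = 0
    with hJ
  have hsJ : ∀ j ∈ J, 0 < (lam i - lam j).re ∧ (((lam i - lam j).re : ℝ) : ℂ) = lam i - lam j := by
    intro j hj
    have := (mem_filter.1 hj).2
    exact ⟨this.1, Complex.ext (by simp) (by simpa using this.2.symm)⟩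
  have hJmem : ∀ j, ∀ p : ℝ, 0 < p → lam i - lam j = p → j ∈ J := by
    intro j p hp hjp
    refine mem_filter.2 ⟨Finset.mem_univ j, ?_⟩
    rw [hjp]; simpa using hp
  have key := boundary_jump (rowPoles lam i) (rowResidue lam f i) (rowResidue_of_notMem lam f i)
    (rowResidue_mul_self lam f h.diag i) (ΨL := ΨL i) (ΨR := ΨR i) (v := Pi.single i 1) (J := J)
    (s := fun j => (lam i - lam j).re) (F := fun j w => S i j • ΨR j (w - (lam i - lam j)))
    (b := fun j => S i j • Pi.single j 1) (ΘL := Θ)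
    (fun x hx hxP => (hL i).deriv x (mem_raySector_ofReal hη hx) hxP)
    (fun x hx hxP => (hR i).deriv x (mem_raySector_ofReal hη hx) hxP)
    (((hL i).base.comp (tendsto_ofReal_sector hη)).congr' (by
      filter_upwards [self_mem_nhdsWithin] with x hx
      simp only [Function.comp, sideLog_pos (Or.inl rfl) hx]))
    (((hR i).base.comp (tendsto_ofReal_sector hη)).congr' (by
      filter_upwards [self_mem_nhdsWithin] with x hx
      simp only [Function.comp, sideLog_pos (Or.inr rfl) hx]))
    (fun p hp => (hΘ p hp).comp (tendsto_ofReal_sector_pole hη hp))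
    (fun p hp => by
      obtain ⟨Θ', hΘ'⟩ := (hR i).pole p hp
      exact ⟨Θ', hΘ'.comp (tendsto_ofReal_sector_pole hη hp)⟩)
    (fun j hj => (hsJ j hj).1)
    (by
      intro j hj x hjx hxP
      obtain ⟨h1, h2⟩ := hsJ j hj
      have e1 : (x : ℂ) - (lam i - lam j) = ((x - (lam i - lam j).re : ℝ) : ℂ) := by
        push_cast; rw [h2]
      have h3 := (hR j).deriv ((x : ℂ) - (lam i - lam j))
        (by rw [e1]; exact mem_raySector_ofReal hη (by linarith))
        (fun h4 => hxP ((mem_rowPoles_shift lam i j x).1 h4))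
      rw [fuchs_row_shift] at h3
      have h4 := (h3.comp_sub_const (x : ℂ) (lam i - lam j)).const_smul (S i j)
      rwa [← map_smul] at h4)
    (by
      intro j hj
      obtain ⟨h1, h2⟩ := hsJ j hj
      have h3 : Tendsto (fun x : ℝ => x - (lam i - lam j).re) (𝓝[>] (lam i - lam j).re) (𝓝[>] 0) := by
        refine tendsto_nhdsWithin_iff.2 ⟨?_, ?_⟩
        · have : Continuous fun x : ℝ => x - (lam i - lam j).re := by fun_prop
          have h4 := this.tendsto (lam i - lam j).re
          rw [sub_self] at h4
          exact h4.mono_left nhdsWithin_le_nhds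
        · filter_upwards [self_mem_nhdsWithin] with x hx
          exact mem_Ioi.2 (sub_pos.2 (mem_Ioi.1 hx))
      have h4 := (((hR j).base.comp (tendsto_ofReal_sector hη)).comp h3).const_smul (S i j)
      refine h4.congr' ?_
      filter_upwards [self_mem_nhdsWithin] with x hx
      have e1 : (((x - (lam i - lam j).re : ℝ)) : ℂ) = (x : ℂ) - (lam i - lam j) := by
        push_cast; rw [h2]
      have e2 : rowResidue lam f j 0 = rowResidue lam f i (((lam i - lam j).re : ℝ) : ℂ) := by
        rw [← rowResidue_shift lam f i j, h2, sub_self]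
      simp only [Function.comp]
      rw [sideLog_pos (Or.inr rfl) (sub_pos.2 (mem_Ioi.1 hx)), e1, e2, map_smul, smul_sub, smul_comm])
    (by
      intro j hj p hjp
      obtain ⟨h1, h2⟩ := hsJ j hj
      obtain ⟨Θ', hΘ'⟩ := (hR j).pole (p - (lam i - lam j).re) (by linarith)
      refine ⟨S i j • Θ', ?_⟩
      have h3 : Tendsto (fun x : ℝ => x - (lam i - lam j).re) (𝓝[≠] p)
          (𝓝[≠] (p - (lam i - lam j).re)) := by
        refine tendsto_nhdsWithin_iff.2 ⟨?_, ?_⟩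
        · have : Continuous fun x : ℝ => x - (lam i - lam j).re := by fun_prop
          exact (this.tendsto p).mono_left nhdsWithin_le_nhds
        · filter_upwards [self_mem_nhdsWithin] with x hx h4
          apply hx
          have : x - (lam i - lam j).re = p - (lam i - lam j).re := h4
          exact sub_left_injective this
      have h4 := ((hΘ'.comp (tendsto_ofReal_sector_pole hη (by linarith))).comp h3).const_smul
        (S i j)
      refine h4.congr fun x => ?_
      have e1 : ∀ x : ℝ, (((x - (lam i - lam j).re : ℝ)) : ℂ) = (x : ℂ) - (lam i - lam j) := by
        intro x; push_cast; rw [h2]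
      simp only [Function.comp]
      rw [e1, e1, rowResidue_shift, map_smul, smul_sub, smul_comm, sub_sub_sub_cancel_right])
    (by
      intro p hp
      funext k
      simp only [Finset.sum_apply, Pi.smul_apply, Pi.neg_apply, smul_eq_mul]
      rw [rowResidue_apply]
      by_cases hk : lam i - lam k = p
      · have hkJ := hJmem k p hp hk
        rw [if_pos hk, sum_eq_single k]
        · rw [hSΘ p hp k hk]; simp
        · intro j _ hjk; simp [Ne.symm hjk]
        · intro h4
          exact absurd (mem_filter.2 ⟨hkJ, by rw [hk]; simp⟩) h4
      · rw [if_neg hk]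
        simp only [mul_zero, neg_zero]
        refine Finset.sum_eq_zero fun j hj => ?_
        rw [mem_filter] at hj
        have : j ≠ k := by
          rintro rfl
          apply hk
          rw [← (hsJ j hj.1).2, hj.2]
        simp [this.symm]) x hx hxP
  rw [key, hJ, Finset.filter_filter]

theorem integral_Ioi_shift {F : Type*} [NormedAddCommGroup F] [NormedSpace ℝ F] (g : ℝ → F)
    (s : ℝ) : ∫ σ in Ioi s, g (σ - s) = ∫ σ in Ioi 0, g σ := by
  have := (measurePreserving_sub_right volume s).setIntegral_preimage_emb
    (MeasurableEquiv.subRight s).measurableEmbedding g (Ioi 0)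
  rw [← this]
  congr 2
  ext x; simp

theorem integrableOn_Ioi_shift {F : Type*} [NormedAddCommGroup F] [NormedSpace ℝ F] {g : ℝ → F}
    (s : ℝ) (hg : IntegrableOn g (Ioi 0)) : IntegrableOn (fun σ => g (σ - s)) (Ioi s) := by
  have := ((measurePreserving_sub_right volume s).integrableOn_comp_preimage
    (MeasurableEquiv.subRight s).measurableEmbedding (f := g) (s := Ioi 0)).2 hg
  have e : (fun x : ℝ => x - s) ⁻¹' Ioi 0 = Ioi s := by ext x; simp
  rwa [e] at this

/-- The two Laplace transforms differ by the Stokes matrix. -/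
theorem RowFamily.laplaceRows_jump {lam : ι → ℂ} {f : Mat(ι)} {η : ℝ}
    (h : SectorFree lam f η) {ΨL ΨR : ι → ℂ → ι → ℂ} (hL : RowFamily lam f 1 η ΨL)
    (hR : RowFamily lam f (-1) η ΨR) {S : Mat(ι)} (hS : IsStokesMatrix lam f η ΨL S)
    {t : ℂ} (ht : 0 < t.re) : laplaceRows lam ΨL 1 t = (1 + S) * laplaceRows lam ΨR 1 t := by
  have hη := h.pos
  have ht0 : t ≠ 0 := by rintro rfl; simp at ht
  have hξ : 0 < (1 / t).re := by
    rw [re_div_eq]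
    have := norm_pos_iff.2 ht0
    exact div_pos (by simpa using ht) (by positivity)
  set ξ := 1 / t with hξdef
  have hInt : ∀ j, IntegrableOn (fun σ : ℝ => exp (-ξ * σ) • ΨR j σ) (Ioi 0) := fun j =>
    (hR j).integrableOn_real (Or.inr rfl) hη (h.poles (Or.inr rfl) j)
      (rowResidue_mul_self lam f h.diag j) hξ
  have hrow : ∀ i, exp (lam i / t) • laplace (fun σ : ℝ => ΨL i σ) ξ =
      exp (lam i / t) • laplace (fun σ : ℝ => ΨR i σ) ξ +
      ∑ j, S i j • (exp (lam j / t) • laplace (fun σ : ℝ => ΨR j σ) ξ) := by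
    intro i
    set J : Finset ι := Finset.univ.filter fun j => 0 < (lam i - lam j).re ∧ (lam i - lam j).im = 0
      with hJ
    have hsJ : ∀ j ∈ J, 0 < (lam i - lam j).re ∧
        (((lam i - lam j).re : ℝ) : ℂ) = lam i - lam j := by
      intro j hj
      have := (mem_filter.1 hj).2
      exact ⟨this.1, Complex.ext (by simp) (by simpa using this.2.symm)⟩
    set gj : ι → ℝ → ι → ℂ := fun j σ => exp (-ξ * σ) • S i j •
      ΨR j (σ - (lam i - lam j)) with hgj
    have hgj_eq : ∀ j ∈ J, ∀ σ : ℝ, gj j σ = (S i j * exp (-ξ * (lam i - lam j))) •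
        (fun τ : ℝ => exp (-ξ * τ) • ΨR j τ) (σ - (lam i - lam j).re) := by
      intro j hj σ
      have e1 : (((σ - (lam i - lam j).re : ℝ)) : ℂ) = (σ : ℂ) - (lam i - lam j) := by
        push_cast; rw [(hsJ j hj).2]
      simp only [hgj, e1, smul_smul]
      congr 1
      rw [mul_assoc, ← exp_add, mul_comm]
      congr 2; ring
    have hgint : ∀ j ∈ J, IntegrableOn (gj j) (Ioi (lam i - lam j).re) := by
      intro j hj
      have := Integrable.smul (S i j * exp (-ξ * (lam i - lam j)))
        (integrableOn_Ioi_shift (lam i - lam j).re (hInt j))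
      exact this.congr (Eventually.of_forall fun σ => (hgj_eq j hj σ).symm)
    have hgval : ∀ j ∈ J, ∫ σ in Ioi (lam i - lam j).re, gj j σ =
        (S i j * exp (-ξ * (lam i - lam j))) •
          ∫ σ in Ioi (0 : ℝ), exp (-ξ * σ) • ΨR j σ := by
      intro j hj
      rw [← integral_Ioi_shift _ (lam i - lam j).re, ← integral_smul]
      exact integral_congr_ae (Eventually.of_forall fun σ => hgj_eq j hj σ)
    have hind : ∀ j ∈ J, Integrable ((Ioi (lam i - lam j).re).indicator (gj j))
        (volume.restrict (Ioi 0)) := fun j hj =>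
      ((integrable_indicator_iff measurableSet_Ioi).2 (hgint j hj)).restrict
    have hindval : ∀ j ∈ J, ∫ σ in Ioi (0 : ℝ), (Ioi (lam i - lam j).re).indicator (gj j) σ =
        ∫ σ in Ioi (lam i - lam j).re, gj j σ := by
      intro j hj
      rw [setIntegral_indicator measurableSet_Ioi]
      congr 2
      exact inter_eq_right.2 (Ioi_subset_Ioi (hsJ j hj).1.le)
    have hsum : ∫ σ in Ioi (0 : ℝ), exp (-ξ * σ) • ΨL i σ =
        ∫ σ in Ioi (0 : ℝ), (exp (-ξ * σ) • ΨR i σ +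
          ∑ j ∈ J, (Ioi (lam i - lam j).re).indicator (gj j) σ) := by
      refine integral_congr_ae ?_
      filter_upwards [ae_restrict_mem measurableSet_Ioi,
        ae_restrict_of_ae (ae_ne_re (rowPoles lam i))] with σ hσ hne
      rw [RowFamily.jump h hL hR hS i σ hσ (fun hmem => hne _ hmem (by simp)), smul_add,
        smul_sum]
      congr 1
      rw [← Finset.filter_filter, Finset.sum_filter]
      refine sum_congr rfl fun j _ => ?_
      simp only [indicator_apply, mem_Ioi, hgj]
    rw [integral_add (hInt i) (integrable_finsetSum _ hind), integral_finsetSum _ hind] at hsum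
    have hJsum : ∑ j, S i j • (exp (lam j / t) • laplace (fun σ : ℝ => ΨR j σ) ξ) =
        ∑ j ∈ J, S i j • (exp (lam j / t) • laplace (fun σ : ℝ => ΨR j σ) ξ) := by
      symm
      refine Finset.sum_subset (Finset.subset_univ J) fun j _ hj => ?_
      rw [hS.eq_zero i j, zero_smul]
      intro p hp hjp
      exact hj (mem_filter.2 ⟨Finset.mem_univ j, by rw [hjp]; simpa using hp⟩)
    rw [hJsum]
    simp only [laplace]
    rw [hsum, smul_add, smul_add, smul_sum, smul_sum]
    congr 1
    refine sum_congr rfl fun j hj => ?_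
    rw [hindval j hj, hgval j hj, smul_smul, smul_smul, smul_smul, smul_smul]
    congr 1
    have e1 : exp (lam j / t) = exp (lam i / t) *
        exp (-ξ * (lam i - lam j)) := by
      rw [← exp_add, hξdef]; congr 1; ring
    rw [e1]; ring
  ext i k
  have := congrFun (hrow i) k
  simp only [Pi.add_apply, Pi.smul_apply, Finset.sum_apply, smul_eq_mul] at this
  rw [add_mul, one_mul, Matrix.add_apply, Matrix.mul_apply]
  simp only [laplaceRows, of_apply, one_mul]
  exact this

end RowJump

section IteratedIntegral

theorem iteratedIntegral_const_mul {s : ℂ} (hs : s ≠ 0) (γ : ℝ → ℂ) (q : ℕ → ℂ) (k : ℕ) (x : ℝ) :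
    iteratedIntegral (fun x => s * γ x) (fun k => s * q k) k x = iteratedIntegral γ q k x := by
  induction k generalizing x with
  | zero => rfl
  | succ k ih =>
    simp only [iteratedIntegral, ih]
    refine intervalIntegral.integral_congr fun u _ => ?_
    simp only [deriv_const_mul_field, ← mul_sub]
    rw [mul_div_mul_left _ _ hs]

/-- Iterated integrals along a path are computed by iterated primitives. -/
theorem iteratedIntegral_eq_primitive {γ : ℝ → ℂ} {q : ℕ → ℂ} {J : ℕ → ℂ → ℂ} {n : ℕ} {δ : ℝ}
    {Q : Set ℝ} {L : ℂ} (hδ : 0 < δ) (hδ2 : δ < 1 / 2) (hγc : Continuous γ) (hQ : Q.Countable)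
    (hγd : ∀ x ∈ Ioo (0 : ℝ) 1 \ Q, DifferentiableAt ℝ γ x)
    (hγi : IntervalIntegrable (deriv γ) volume 0 1)
    (hγ0 : ∀ x ∈ Icc 0 δ, γ x = x) (hγ1 : ∀ x ∈ Icc (1 - δ) 1, γ x = x)
    (hJ0 : ∀ x ∈ Ioo (0 : ℝ) 1, J 0 (γ x) = 1)
    (hJd : ∀ k < n, ∀ x ∈ Ioo (0 : ℝ) 1, HasDerivAt (J (k + 1)) (J k (γ x) / (γ x - q k)) (γ x))
    (hne : ∀ k < n, ∀ x ∈ Ioo (0 : ℝ) 1, γ x ≠ q k)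
    (hlim0 : ∀ k < n, Tendsto (fun x : ℝ => J (k + 1) x) (𝓝[>] 0) (𝓝 0))
    (hb0 : ∀ k < n, ∃ C, ∀ x ∈ Ioo 0 δ, ‖J k (x : ℂ) / (x - q k)‖ ≤ C * |x - 0| ^ (-(1 / 2) : ℝ))
    (hb1 : ∀ k, k + 1 = n → ∃ C, ∀ x ∈ Ioo (1 - δ) 1,
      ‖J k (x : ℂ) / (x - q k)‖ ≤ C * |x - 1| ^ (-(1 / 2) : ℝ))
    (hL : Tendsto (fun x : ℝ => J n x) (𝓝[<] 1) (𝓝 L)) : iteratedIntegral γ q n 1 = L := by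
  have hJc : ∀ k ≤ n, ∀ x ∈ Ioo (0 : ℝ) 1, ContinuousAt (fun x => J k (γ x)) x := by
    intro k hk x hx
    rcases k with _ | k
    · refine (continuousAt_const (y := (1 : ℂ))).congr ?_
      filter_upwards [Ioo_mem_nhds hx.1 hx.2] with y hy using (hJ0 y hy).symm
    · exact ContinuousAt.comp (hJd k (by omega) x hx).continuousAt hγc.continuousAt
  have hgc : ∀ k < n, ContinuousOn (fun x => J k (γ x) / (γ x - q k)) (Ioo 0 1) := fun k hk x hx =>
    (ContinuousAt.div (hJc k hk.le x hx) (by fun_prop)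
      (sub_ne_zero.2 (hne k hk x hx))).continuousWithinAt
  have hder0 : ∀ x ∈ Ioo 0 δ, deriv γ x = 1 := by
    intro x hx
    have : γ =ᶠ[𝓝 x] fun x : ℝ => (x : ℂ) := by
      filter_upwards [Ioo_mem_nhds hx.1 hx.2] with y hy using hγ0 y ⟨hy.1.le, hy.2.le⟩
    rw [this.deriv_eq]; exact (Complex.ofRealCLM.hasDerivAt (x := x)).deriv
  have hder1 : ∀ x ∈ Ioo (1 - δ) 1, deriv γ x = 1 := by
    intro x hx
    have : γ =ᶠ[𝓝 x] fun x : ℝ => (x : ℂ) := by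
      filter_upwards [Ioo_mem_nhds hx.1 hx.2] with y hy using hγ1 y ⟨hy.1.le, hy.2.le⟩
    rw [this.deriv_eq]; exact (Complex.ofRealCLM.hasDerivAt (x := x)).deriv
  set G : ℕ → ℝ → ℂ := fun k x => deriv γ x / (γ x - q k) * J k (γ x) with hG
  have hGeq : ∀ k x, G k x = deriv γ x * (J k (γ x) / (γ x - q k)) := by
    intro k x; simp only [hG]; ring
  have hiend : ∀ k < n, ∀ (a b r : ℝ), a ≤ b → Ioo a b ⊆ Ioo 0 1 → Ioc a b ⊆ Ioc (r - 1) (r + 1) →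
      (∀ x ∈ Ioo a b, deriv γ x = 1) → (∀ x ∈ Ioo a b, γ x = x) →
      (∃ C, ∀ x ∈ Ioo a b, ‖J k (x : ℂ) / (x - q k)‖ ≤ C * |x - r| ^ (-(1 / 2) : ℝ)) →
      IntervalIntegrable (G k) volume a b := by
    rintro k hk a b r hab hsub hr hd hid ⟨C, hC⟩
    rw [intervalIntegrable_iff_integrableOn_Ioo_of_le hab]
    refine Integrable.mono' (((integrableOn_abs_sub_rpow r).mono_set
      (Ioo_subset_Ioc_self.trans hr)).const_mul C) ?_ ?_
    · refine ((hgc k hk).mono hsub).congr (fun x hx => ?_) |>.aestronglyMeasurable measurableSet_Ioo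
      rw [hGeq, hd x hx, one_mul]
    · filter_upwards [ae_restrict_mem measurableSet_Ioo] with x hx
      rw [hGeq, hd x hx, one_mul, hid x hx]
      exact hC x hx
  have hi0 : ∀ k < n, IntervalIntegrable (G k) volume 0 δ := fun k hk =>
    hiend k hk 0 δ 0 hδ.le (Ioo_subset_Ioo le_rfl (by linarith))
      (Ioc_subset_Ioc (by linarith) (by linarith)) hder0
      (fun x hx => hγ0 x ⟨hx.1.le, hx.2.le⟩) (hb0 k hk)
  have hi1 : ∀ k, k + 1 = n → IntervalIntegrable (G k) volume (1 - δ) 1 := fun k hk =>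
    hiend k (by omega) (1 - δ) 1 1 (by linarith) (Ioo_subset_Ioo (by linarith) le_rfl)
      (Ioc_subset_Ioc (by linarith) (by linarith)) hder1
      (fun x hx => hγ1 x ⟨hx.1.le, hx.2.le⟩) (hb1 k hk)
  have him : ∀ k < n, ∀ a ∈ Ioo (0 : ℝ) 1, ∀ b ∈ Ioo (0 : ℝ) 1,
      IntervalIntegrable (G k) volume a b := by
    intro k hk a ha b hb
    have hsub : uIcc a b ⊆ Ioo 0 1 := (ordConnected_Ioo).uIcc_subset ha hb
    have h1 : IntervalIntegrable (deriv γ) volume a b := by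
      refine hγi.mono_set ?_
      rw [uIcc_of_le zero_le_one]
      exact hsub.trans Ioo_subset_Icc_self
    have h2 := h1.mul_continuousOn ((hgc k hk).mono hsub)
    exact h2.congr fun x _ => (hGeq k x).symm
  have hiall : ∀ k < n, ∀ x ∈ Ioo (0 : ℝ) 1, IntervalIntegrable (G k) volume 0 x := fun k hk x hx =>
    (hi0 k hk).trans (him k hk δ ⟨hδ, by linarith⟩ x hx)
  have hid1 : ∀ k, k + 1 = n → IntervalIntegrable (G k) volume 0 1 := fun k hk =>
    (hiall k (by omega) (1 - δ) ⟨by linarith, by linarith⟩).trans (hi1 k hk)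
  have hderiv : ∀ k < n, ∀ x ∈ Ioo (0 : ℝ) 1 \ Q, HasDerivAt (fun x => J (k + 1) (γ x)) (G k x) x := by
    intro k hk x hx
    refine ((hJd k hk x hx.1).scomp x (hγd x hx).hasDerivAt).congr_deriv ?_
    rw [hGeq, smul_eq_mul]
  have hval : ∀ k ≤ n, ∀ x ∈ Ioo (0 : ℝ) 1, iteratedIntegral γ q k x = J k (γ x) := by
    intro k
    induction k with
    | zero => intro _ x hx; rw [hJ0 x hx]; rfl
    | succ k ih =>
      intro hk x hx
      have hk' : k < n := by omega
      have e1 : iteratedIntegral γ q (k + 1) x = ∫ u in (0 : ℝ)..x, G k u := by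
        simp only [iteratedIntegral]
        rw [intervalIntegral.integral_of_le hx.1.le, intervalIntegral.integral_of_le hx.1.le]
        refine setIntegral_congr_fun measurableSet_Ioc fun u hu => ?_
        simp only [hG]
        rw [ih (by omega) u ⟨hu.1, hu.2.trans_lt hx.2⟩]
      set h : ℝ → ℂ := fun x => if x ≤ 0 then 0 else J (k + 1) (γ x) with hh
      have hheq : ∀ x > 0, h =ᶠ[𝓝 x] fun x => J (k + 1) (γ x) := by
        intro x hx
        filter_upwards [Ioi_mem_nhds hx] with y hy
        simp only [hh]; rw [if_neg (not_le.2 hy)]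
      have hhc : ContinuousOn h (Icc 0 x) := by
        intro y hy
        rcases eq_or_lt_of_le hy.1 with h0 | h0
        · subst h0
          have h00 : h 0 = 0 := by simp [hh]
          refine ContinuousWithinAt.mono (t := Ici 0) ?_ Icc_subset_Ici_self
          rw [ContinuousWithinAt, h00, ← Ioi_insert, nhdsWithin_insert, tendsto_sup]
          refine ⟨by rw [tendsto_pure_left]; intro s hs; rw [h00]; exact mem_of_mem_nhds hs, ?_⟩
          refine (hlim0 k hk').congr' ?_
          filter_upwards [self_mem_nhdsWithin, mem_nhdsWithin_of_mem_nhds (Iio_mem_nhds hδ)]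
            with y hy1 hy2
          simp only [hh]
          rw [if_neg (not_le.2 hy1), hγ0 y ⟨le_of_lt hy1, le_of_lt hy2⟩]
        · exact ((hJc (k + 1) hk y ⟨h0, hy.2.trans_lt hx.2⟩).congr
            (hheq y h0).symm).continuousWithinAt
      rw [e1, MeasureTheory.integral_eq_of_hasDerivAt_off_countable_of_le h (G k) hx.1.le hQ hhc
        (fun y hy => ?_) (hiall k hk' x hx)]
      · have h00 : h 0 = 0 := by simp [hh]
        rw [h00, sub_zero]
        simp only [hh]; rw [if_neg (not_le.2 hx.1)]
      · exact (hderiv k hk' y ⟨⟨hy.1.1, hy.1.2.trans hx.2⟩, hy.2⟩).congr_of_eventuallyEq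
          (hheq y hy.1.1)
  rcases n with _ | k
  · refine tendsto_nhds_unique (tendsto_const_nhds.congr' ?_) hL
    filter_upwards [Ioo_mem_nhdsLT (show 1 - δ < 1 by linarith)] with x hx
    have := hJ0 x ⟨by linarith [hx.1], hx.2⟩
    rw [hγ1 x ⟨hx.1.le, hx.2.le⟩] at this
    exact this.symm
  · have e1 : ∀ x ∈ Ioc (0 : ℝ) 1, iteratedIntegral γ q (k + 1) x = ∫ u in (0 : ℝ)..x, G k u := by
      intro x hx
      simp only [iteratedIntegral]
      rw [intervalIntegral.integral_of_le hx.1.le, intervalIntegral.integral_of_le hx.1.le,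
        integral_Ioc_eq_integral_Ioo, integral_Ioc_eq_integral_Ioo]
      refine setIntegral_congr_fun measurableSet_Ioo fun u hu => ?_
      simp only [hG]
      rw [hval k (by omega) u ⟨hu.1, hu.2.trans_le hx.2⟩]
    have hcont : ContinuousWithinAt (fun x => ∫ u in (0 : ℝ)..x, G k u) (Icc 0 1) 1 := by
      refine (intervalIntegral.continuousOn_primitive_interval' (hid1 k rfl) ?_).mono ?_ 1 ?_
      · exact left_mem_uIcc
      · rw [uIcc_of_le zero_le_one]
      · exact ⟨zero_le_one, le_rfl⟩
    have ht : Tendsto (fun x => ∫ u in (0 : ℝ)..x, G k u) (𝓝[<] 1)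
        (𝓝 (∫ u in (0 : ℝ)..1, G k u)) := by
      refine hcont.tendsto.mono_left ?_
      rw [← nhdsWithin_Ioo_eq_nhdsLT (zero_lt_one' ℝ)]
      exact nhdsWithin_mono _ Ioo_subset_Icc_self
    rw [e1 1 ⟨one_pos, le_rfl⟩]
    refine tendsto_nhds_unique ht (hL.congr' ?_)
    filter_upwards [Ioo_mem_nhdsLT (show 1 - δ < 1 by linarith)] with x hx
    have hx0 : x ∈ Ioo (0 : ℝ) 1 := ⟨by linarith [hx.1], hx.2⟩
    rw [← e1 x ⟨hx0.1, hx0.2.le⟩, hval (k + 1) le_rfl x hx0, hγ1 x ⟨hx.1.le, hx.2.le⟩]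

end IteratedIntegral

section Path

/-- The segment `[0, 1]` with half circles of radius `ε` above the points of `A`. -/
def bumpPath (A : Finset ℝ) (ε x : ℝ) : ℂ :=
  x + I * ((∑ a ∈ A, √(ε ^ 2 - (x - a) ^ 2) : ℝ) : ℂ)

theorem bumpPath_re (A : Finset ℝ) (ε x : ℝ) : (bumpPath A ε x).re = x := by
  simp [bumpPath]

theorem bumpPath_im (A : Finset ℝ) (ε x : ℝ) :
    (bumpPath A ε x).im = ∑ a ∈ A, √(ε ^ 2 - (x - a) ^ 2) := by
  simp only [bumpPath, add_im, ofReal_im, zero_add, Complex.mul_im, Complex.I_re,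
    Complex.I_im, ofReal_re, zero_mul, one_mul]

theorem bumpPath_eq_self {A : Finset ℝ} {ε x : ℝ} (h : ∀ a ∈ A, ε ^ 2 ≤ (x - a) ^ 2) :
    bumpPath A ε x = x := by
  rw [bumpPath, Finset.sum_eq_zero fun a ha => Real.sqrt_eq_zero_of_nonpos (by linarith [h a ha])]
  simp

theorem continuous_bumpPath (A : Finset ℝ) (ε : ℝ) : Continuous (bumpPath A ε) := by
  unfold bumpPath; fun_prop

theorem hasDerivAt_bump {ε a x : ℝ} (hx : (x - a) ^ 2 ≠ ε ^ 2) :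
    HasDerivAt (fun x => √(ε ^ 2 - (x - a) ^ 2)) (-(x - a) / √(ε ^ 2 - (x - a) ^ 2)) x := by
  have h1 : HasDerivAt (fun x : ℝ => ε ^ 2 - (x - a) ^ 2) (-(2 * (x - a))) x := by
    have := ((((hasDerivAt_id x).sub_const a).pow 2).const_sub (ε ^ 2))
    simpa using this
  refine (h1.sqrt (sub_ne_zero.2 hx.symm)).congr_deriv ?_
  rw [← mul_neg, mul_div_mul_left _ _ two_ne_zero]

theorem abs_bump_deriv_le {ε : ℝ} (a x : ℝ) (hε : 0 < ε) :
    |-(x - a) / √(ε ^ 2 - (x - a) ^ 2)| ≤ ε * (ε ^ (-(1 / 2) : ℝ) *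
      (|x - (a - ε)| ^ (-(1 / 2) : ℝ) + |x - (a + ε)| ^ (-(1 / 2) : ℝ))) := by
  have hp1 : 0 ≤ |x - (a - ε)| ^ (-(1 / 2) : ℝ) := rpow_nonneg (abs_nonneg _) _
  have hp2 : 0 ≤ |x - (a + ε)| ^ (-(1 / 2) : ℝ) := rpow_nonneg (abs_nonneg _) _
  have hp0 : 0 ≤ ε ^ (-(1 / 2) : ℝ) := rpow_nonneg hε.le _
  rcases le_or_gt (ε ^ 2 - (x - a) ^ 2) 0 with h | h
  · rw [Real.sqrt_eq_zero_of_nonpos h]; simp only [div_zero, abs_zero]; positivity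
  · have hu : |x - a| < ε := by
      rw [← abs_of_pos hε]; exact sq_lt_sq.1 (by linarith)
    have hu' := abs_lt.1 hu
    have hinv : ∀ y : ℝ, 0 < y → (√y)⁻¹ = y ^ (-(1 / 2) : ℝ) := by
      intro y hy
      rw [Real.rpow_neg hy.le, ← Real.sqrt_eq_rpow]
    rw [abs_div, abs_neg, abs_of_nonneg (Real.sqrt_nonneg _), div_eq_mul_inv, hinv _ h]
    have e1 : ε ^ 2 - (x - a) ^ 2 = (x - (a - ε)) * (a + ε - x) := by ring
    have hm : (ε ^ 2 - (x - a) ^ 2) ^ (-(1 / 2) : ℝ) ≤ ε ^ (-(1 / 2) : ℝ) *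
        (|x - (a - ε)| ^ (-(1 / 2) : ℝ) + |x - (a + ε)| ^ (-(1 / 2) : ℝ)) := by
      have a1 : |x - (a - ε)| = x - (a - ε) := abs_of_pos (by linarith)
      have a2 : |x - (a + ε)| = a + ε - x := by rw [abs_of_neg (by linarith)]; ring
      have l1 : 0 < x - (a - ε) := by linarith
      have l2 : 0 < a + ε - x := by linarith
      rw [e1, Real.mul_rpow l1.le l2.le]
      rcases le_or_gt x a with hxa | hxa
      · have h3 : (a + ε - x) ^ (-(1 / 2) : ℝ) ≤ ε ^ (-(1 / 2) : ℝ) :=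
          rpow_le_rpow_of_nonpos hε (by linarith) (by norm_num)
        calc _ ≤ |x - (a - ε)| ^ (-(1 / 2) : ℝ) * ε ^ (-(1 / 2) : ℝ) := by rw [a1]; gcongr
          _ ≤ _ := by nlinarith
      · have h3 : (x - (a - ε)) ^ (-(1 / 2) : ℝ) ≤ ε ^ (-(1 / 2) : ℝ) :=
          rpow_le_rpow_of_nonpos hε (by linarith) (by norm_num)
        calc _ ≤ ε ^ (-(1 / 2) : ℝ) * |x - (a + ε)| ^ (-(1 / 2) : ℝ) := by rw [a2]; gcongr
          _ ≤ _ := by nlinarith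
    exact mul_le_mul hu.le hm (rpow_nonneg h.le _) hε.le

/-- The exceptional points of `bumpPath`. -/
def bumpEnds (A : Finset ℝ) (ε : ℝ) : Finset ℝ :=
  (A.image fun a => a - ε) ∪ A.image fun a => a + ε

theorem sq_ne_of_notMem_bumpEnds {A : Finset ℝ} {ε x : ℝ} (hx : x ∉ bumpEnds A ε) {a : ℝ}
    (ha : a ∈ A) : (x - a) ^ 2 ≠ ε ^ 2 := by
  intro h
  apply hx
  rw [bumpEnds, Finset.mem_union, Finset.mem_image, Finset.mem_image]
  rcases sq_eq_sq_iff_eq_or_eq_neg.1 h with h | h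
  · right; exact ⟨a, ha, by linarith⟩
  · left; exact ⟨a, ha, by linarith⟩

theorem hasDerivAt_bumpPath {A : Finset ℝ} {ε x : ℝ} (hx : x ∉ bumpEnds A ε) :
    HasDerivAt (bumpPath A ε)
      (1 + I * ((∑ a ∈ A, -(x - a) / √(ε ^ 2 - (x - a) ^ 2) : ℝ) : ℂ)) x := by
  have h1 : HasDerivAt (fun x => ∑ a ∈ A, √(ε ^ 2 - (x - a) ^ 2))
      (∑ a ∈ A, -(x - a) / √(ε ^ 2 - (x - a) ^ 2)) x :=
    HasDerivAt.fun_sum fun a ha => hasDerivAt_bump (sq_ne_of_notMem_bumpEnds hx ha)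
  exact (Complex.ofRealCLM.hasDerivAt (x := x)).add (h1.ofReal_comp.const_mul I)

theorem intervalIntegrable_deriv_bumpPath {A : Finset ℝ} {ε : ℝ} (hε : 0 < ε)
    (hA : ∀ a ∈ A, 0 ≤ a - ε ∧ a + ε ≤ 1) :
    IntervalIntegrable (deriv (bumpPath A ε)) volume 0 1 := by
  rw [intervalIntegrable_iff_integrableOn_Ioc_of_le zero_le_one]
  have hInt : ∀ r ∈ Icc (0 : ℝ) 1,
      IntegrableOn (fun x : ℝ => |x - r| ^ (-(1 / 2) : ℝ)) (Ioc 0 1) := fun r hr =>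
    (integrableOn_abs_sub_rpow r).mono_set
      (Ioc_subset_Ioc (by linarith [hr.2]) (by linarith [hr.1]))
  refine Integrable.mono' (g := fun x => 1 + ∑ a ∈ A, ε * (ε ^ (-(1 / 2) : ℝ) *
      (|x - (a - ε)| ^ (-(1 / 2) : ℝ) + |x - (a + ε)| ^ (-(1 / 2) : ℝ)))) ?_ ?_ ?_
  · refine Integrable.add (integrable_const _) (integrable_finsetSum _ fun a ha => ?_)
    obtain ⟨h1, h2⟩ := hA a ha
    exact (((hInt _ ⟨h1, by linarith⟩).add (hInt _ ⟨by linarith, h2⟩)).const_mul _).const_mul _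
  · exact (measurable_deriv _).aestronglyMeasurable
  · have hae : ∀ᵐ x : ℝ ∂volume, x ∉ bumpEnds A ε :=
      compl_mem_ae_iff.2 ((bumpEnds A ε).finite_toSet.measure_zero volume)
    filter_upwards [ae_restrict_of_ae hae] with x hx
    rw [(hasDerivAt_bumpPath hx).deriv]
    refine (norm_add_le _ _).trans (add_le_add (by simp) ?_)
    rw [norm_mul, Complex.norm_I, one_mul, norm_real]
    refine (Finset.abs_sum_le_sum_abs _ _).trans (sum_le_sum fun a _ => ?_)
    exact abs_bump_deriv_le a x hε

theorem bumpPath_mem_sector {A : Finset ℝ} {ε η x : ℝ} (hη : 0 < η) (hε : 0 < ε)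
    (hA : ∀ a ∈ A, A.card * ε < η * (a - ε)) (hx : 0 < x) : bumpPath A ε x ∈ raySector 1 η ∧
    (bumpPath A ε x ∉ sector 1 η → bumpPath A ε x = x ∧ x ∉ A) := by
  have him0 : 0 ≤ ∑ a ∈ A, √(ε ^ 2 - (x - a) ^ 2) := Finset.sum_nonneg fun a _ => Real.sqrt_nonneg _
  have hle : ∑ a ∈ A, √(ε ^ 2 - (x - a) ^ 2) ≤ A.card * ε := by
    rw [← nsmul_eq_mul]
    refine Finset.sum_le_card_nsmul _ _ _ fun a _ => ?_
    rw [Real.sqrt_le_left hε.le]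
    nlinarith [sq_nonneg (x - a)]
  have hlt : ∑ a ∈ A, √(ε ^ 2 - (x - a) ^ 2) < η * x := by
    rcases eq_or_lt_of_le him0 with h | h
    · rw [← h]; positivity
    · obtain ⟨a, ha, hpos⟩ := Finset.exists_ne_zero_of_sum_ne_zero h.ne'
      have h1 : 0 < ε ^ 2 - (x - a) ^ 2 := by
        by_contra h2
        exact hpos (Real.sqrt_eq_zero_of_nonpos (not_lt.1 h2))
      have h2 : |x - a| < ε := by rw [← abs_of_pos hε]; exact sq_lt_sq.1 (by linarith)
      have h3 := (abs_lt.1 h2).1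
      have h4 := hA a ha
      have h5 : η * (a - ε) ≤ η * x := by gcongr; linarith
      linarith
  refine ⟨⟨by rw [bumpPath_re]; exact hx, by rw [bumpPath_im, one_mul]; exact him0,
    by rw [bumpPath_im, bumpPath_re, one_mul]; exact hlt⟩, fun hns => ?_⟩
  have h0 : ∑ a ∈ A, √(ε ^ 2 - (x - a) ^ 2) = 0 := by
    by_contra h
    refine hns ⟨by rw [bumpPath_re]; exact hx, ?_, by rw [bumpPath_im, bumpPath_re, one_mul]; exact hlt⟩
    rw [bumpPath_im, one_mul]
    exact lt_of_le_of_ne him0 (Ne.symm h)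
  refine ⟨by rw [bumpPath, h0]; simp, fun hxA => ?_⟩
  have := (Finset.sum_eq_zero_iff_of_nonneg fun a _ => Real.sqrt_nonneg _).1 h0 x hxA
  rw [sub_self, zero_pow two_ne_zero, sub_zero, Real.sqrt_eq_zero (by positivity)] at this
  exact absurd this (by positivity)

end Path

section Primitives

theorem exists_mem_sector {κ η : ℝ} (hκ : IsSign κ) (hη : 0 < η) : (sector κ η).Nonempty := by
  have hκκ := hκ.mul_self
  refine ⟨⟨1, κ * (η / 2)⟩, one_pos, ?_, ?_⟩
  · simp only; rw [← mul_assoc, hκκ]; linarith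
  · simp only; rw [← mul_assoc, hκκ]; linarith

theorem smul_mem_sector {κ η : ℝ} {w : ℂ} (hw : w ∈ sector κ η) {τ : ℝ} (hτ : 0 < τ) :
    (τ : ℂ) * w ∈ sector κ η := by
  have := combo_mem_sector hw (sector_subset hw) hτ le_rfl
  simpa using this

/-- A function with zero derivative off the poles is determined by its limit at `0`. -/
theorem eq_of_hasDerivAt_zero_sector {E : Type*} [NormedAddCommGroup E] [NormedSpace ℂ E]
    {P : Finset ℂ} {κ η : ℝ} (hκ : IsSign κ) (hη : 0 < η) (hP : ∀ p ∈ P, p ∉ sector κ η)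
    {D : ℂ → E} {v : E} (hD : ∀ w ∈ raySector κ η, w ∉ P → HasDerivAt D 0 w)
    (hlim : Tendsto D (𝓝[raySector κ η] 0) (𝓝 v)) {w : ℂ} (hw : w ∈ raySector κ η)
    (hwP : w ∉ P) : D w = v := by
  obtain ⟨c, hc⟩ := exists_mem_sector hκ hη
  have hcP : ∀ τ : ℝ, 0 < τ → (τ : ℂ) * c ∉ P := fun τ hτ h => hP _ h (smul_mem_sector hc hτ)
  have h1 : ∀ τ : ℝ, 0 < τ → D ((τ : ℂ) * c) = D w := by
    intro τ hτ
    refine eq_of_hasDerivAt_zero_segment fun x hx => ?_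
    obtain ⟨a, b, ha, hb, hab, rfl⟩ := hx
    have e : a • ((τ : ℂ) * c) + b • w = ((a * τ : ℝ) : ℂ) * c + b * w := by
      simp only [Complex.real_smul]; push_cast; ring
    rcases eq_or_lt_of_le ha with h0 | h0
    · have hb1 : b = 1 := by linarith
      rw [e, ← h0, hb1]
      simpa using hD w hw hwP
    · have hmem : a • ((τ : ℂ) * c) + b • w ∈ sector κ η := by
        rw [e]; exact combo_mem_sector hc hw (mul_pos h0 hτ) hb
      exact hD _ (sector_subset hmem) fun h => hP _ h hmem
  have h2 : Tendsto (fun τ : ℝ => (τ : ℂ) * c) (𝓝[>] 0) (𝓝[raySector κ η] 0) := by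
    refine tendsto_nhdsWithin_iff.2 ⟨?_, ?_⟩
    · have : Continuous fun τ : ℝ => (τ : ℂ) * c := by fun_prop
      have h := this.tendsto 0
      simp only [ofReal_zero, zero_mul] at h
      exact h.mono_left nhdsWithin_le_nhds
    · filter_upwards [self_mem_nhdsWithin] with τ hτ using sector_subset (smul_mem_sector hc hτ)
  refine tendsto_nhds_unique (tendsto_const_nhds.congr' ?_) (hlim.comp h2)
  filter_upwards [self_mem_nhdsWithin] with τ hτ using (h1 τ hτ).symm

/-- `J k` is the `k`-fold iterated primitive of the forms `dw / (w - q 1), …, dw / (w - q k)`, for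
`k ≤ n`, on the sector above the positive reals, with base point `0`. -/
structure IsPrimitive (q : ℕ → ℂ) (η : ℝ) (n : ℕ) (J : ℕ → ℂ → ℂ) : Prop where
  zero : ∀ w ∈ raySector 1 η, (∀ j ≤ n, w ≠ q j) → J 0 w = 1
  deriv : ∀ k < n, ∀ w ∈ raySector 1 η, (∀ j ≤ n, w ≠ q j) →
    HasDerivAt (J (k + 1)) (J k w / (w - q (k + 1))) w
  lim : ∀ k < n, Tendsto (J (k + 1)) (𝓝[raySector 1 η] 0) (𝓝 0)

/-- The poles `q 0, …, q n` avoid the open sector, are successively distinct, and `q 0 = 0`. -/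
structure GoodPoles (q : ℕ → ℂ) (η : ℝ) (n : ℕ) : Prop where
  pos : 0 < η
  zero : q 0 = 0
  ne : ∀ k < n, q (k + 1) ≠ q k
  free : ∀ j ≤ n, q j ∉ sector 1 η

theorem IsPrimitive.unique {q q' : ℕ → ℂ} {η : ℝ} {n n' : ℕ} {J J' : ℕ → ℂ → ℂ}
    (h : IsPrimitive q η n J) (h' : IsPrimitive q' η n' J') (hq : GoodPoles q η n)
    (hq' : GoodPoles q' η n') {m : ℕ} (hm : m ≤ n) (hm' : m ≤ n') (hqq : ∀ j ≤ m, q j = q' j)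
    {w : ℂ} (hw : w ∈ raySector 1 η) (hwq : ∀ j ≤ n, w ≠ q j) (hwq' : ∀ j ≤ n', w ≠ q' j) :
    J m w = J' m w := by
  induction m generalizing w with
  | zero => rw [h.zero w hw hwq, h'.zero w hw hwq']
  | succ m ih =>
    set P : Finset ℂ := ((Finset.range (n + 1)).image q) ∪ (Finset.range (n' + 1)).image q' with hP
    have hPmem : ∀ w, w ∉ P → (∀ j ≤ n, w ≠ q j) ∧ ∀ j ≤ n', w ≠ q' j := by
      intro w hw
      simp only [hP, Finset.mem_union, Finset.mem_image, Finset.mem_range, not_or, not_exists,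
        not_and] at hw
      exact ⟨fun j hj e => hw.1 j (by omega) e.symm, fun j hj e => hw.2 j (by omega) e.symm⟩
    have hPsec : ∀ p ∈ P, p ∉ sector 1 η := by
      intro p hp
      simp only [hP, Finset.mem_union, Finset.mem_image, Finset.mem_range] at hp
      rcases hp with ⟨j, hj, rfl⟩ | ⟨j, hj, rfl⟩
      · exact hq.free j (by omega)
      · exact hq'.free j (by omega)
    have key := eq_of_hasDerivAt_zero_sector (Or.inl rfl) hq.pos hPsec
      (D := fun w => J (m + 1) w - J' (m + 1) w) (v := 0)
      (fun w hw hwP => by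
        obtain ⟨h1, h2⟩ := hPmem w hwP
        refine ((h.deriv m (by omega) w hw h1).sub (h'.deriv m (by omega) w hw h2)).congr_deriv ?_
        rw [ih (by omega) (by omega) (fun j hj => hqq j (by omega)) hw h1 h2, hqq (m + 1) le_rfl,
          sub_self])
      (by simpa using (h.lim m (by omega)).sub (h'.lim m (by omega))) hw
      (by
        simp only [hP, Finset.mem_union, Finset.mem_image, Finset.mem_range, not_or, not_exists,
          not_and]
        exact ⟨fun j hj e => hwq j (by omega) e.symm, fun j hj e => hwq' j (by omega) e.symm⟩)
    exact sub_eq_zero.1 key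

theorem IsPrimitive.scale {q : ℕ → ℂ} {η : ℝ} {n : ℕ} {J : ℕ → ℂ → ℂ}
    (h : IsPrimitive q η n J) {p : ℝ} (hp : 0 < p) :
    IsPrimitive (fun k => p * q k) η n fun k w => J k (((p⁻¹ : ℝ) : ℂ) * w) := by
  have hpc : (p : ℂ) ≠ 0 := by exact_mod_cast hp.ne'
  have hmem : ∀ w ∈ raySector 1 η, ((p⁻¹ : ℝ) : ℂ) * w ∈ raySector 1 η := by
    rintro w ⟨h1, h2, h3⟩
    have hp' := inv_pos.2 hp
    refine ⟨?_, ?_, ?_⟩ <;> simp only [re_ofReal_mul, im_ofReal_mul]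
    · positivity
    · rw [one_mul] at h2 ⊢; positivity
    · have := mul_lt_mul_of_pos_left h3 hp'
      nlinarith
  have hne : ∀ w, (∀ j ≤ n, w ≠ p * q j) → ∀ j ≤ n, ((p⁻¹ : ℝ) : ℂ) * w ≠ q j := by
    intro w hw j hj e
    apply hw j hj
    rw [← e]; push_cast; field_simp
  refine ⟨fun w hw hwq => h.zero _ (hmem w hw) (hne w hwq), fun k hk w hw hwq => ?_, fun k hk => ?_⟩
  · have h1 := h.deriv k hk _ (hmem w hw) (hne w hwq)
    have h2 : HasDerivAt (fun w : ℂ => ((p⁻¹ : ℝ) : ℂ) * w) ((p⁻¹ : ℝ) : ℂ) w := by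
      simpa using (hasDerivAt_id w).const_mul ((p⁻¹ : ℝ) : ℂ)
    refine (h1.comp w h2).congr_deriv ?_
    have e : (w - p * q (k + 1)) = p * (((p⁻¹ : ℝ) : ℂ) * w - q (k + 1)) := by
      push_cast; field_simp
    rw [e]; push_cast
    rw [div_mul_eq_mul_div, mul_comm (J k _), mul_comm (p : ℂ), ← div_div, div_eq_mul_inv _ (p : ℂ),
      div_eq_mul_inv, div_eq_mul_inv]
    ring
  · refine (h.lim k hk).comp (tendsto_nhdsWithin_iff.2 ⟨?_, ?_⟩)
    · have : Continuous fun w : ℂ => ((p⁻¹ : ℝ) : ℂ) * w := by fun_prop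
      have h := this.tendsto 0
      rw [mul_zero] at h
      exact h.mono_left nhdsWithin_le_nhds
    · filter_upwards [self_mem_nhdsWithin] with w hw using hmem w hw

/-- Iterated primitives exist; they are the components of a nilpotent row system. -/
theorem GoodPoles.exists_primitive {q : ℕ → ℂ} {η : ℝ} {n : ℕ} (hq : GoodPoles q η n) :
    ∃ J, IsPrimitive q η n J ∧
      (∃ C, ∃ δ > 0, ∀ k ≤ n, k ≠ 0 → ∀ w ∈ raySector 1 η, ‖w‖ < δ → ‖J k w‖ ≤ C * √‖w‖) ∧
      (∃ C, 0 ≤ C ∧ ∀ k ≤ n, ∀ x ∈ Ioo (0 : ℝ) 1, (∀ j ≤ n, (x : ℂ) ≠ q j) →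
        ‖J k (x : ℂ)‖ ≤ C * poleWeight ((Finset.range (n + 1)).image q) x) ∧
      (q n ≠ 1 → ∃ L, Tendsto (J n) (𝓝[raySector 1 η \ {(1 : ℂ)}] 1) (𝓝 L)) := by
  set lam : Fin (n + 1) → ℂ := fun k => -q k with hlam
  set f : Matrix (Fin (n + 1)) (Fin (n + 1)) ℂ :=
    fun l k => if (k : ℕ) = l + 1 then -1 else 0 with hf
  have hpole : ∀ k : Fin (n + 1), lam 0 - lam k = q k := by
    intro k; simp [hlam, hq.zero]
  have hPeq : rowPoles lam 0 = (Finset.range (n + 1)).image q := by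
    ext p
    simp only [rowPoles, hpole, Finset.mem_image, Finset.mem_univ, true_and, Finset.mem_range]
    exact ⟨fun ⟨k, hk⟩ => ⟨k, k.2, hk⟩, fun ⟨k, hk, e⟩ => ⟨⟨k, hk⟩, e⟩⟩
  have hdiag : ∀ a b, lam a = lam b → f a b = 0 := by
    intro a b hab
    simp only [hf]
    rw [if_neg]
    intro hb
    have h1 := hq.ne a (by omega)
    rw [← hb] at h1
    exact h1 (neg_injective hab).symm
  have hPsec : ∀ p ∈ rowPoles lam 0, p ∉ sector 1 η := by
    intro p hp
    rw [hPeq] at hp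
    obtain ⟨j, hj, rfl⟩ := Finset.mem_image.1 hp
    exact hq.free j (by rw [Finset.mem_range] at hj; omega)
  obtain ⟨Ψ, hΨ⟩ := exists_sectorSolution (rowPoles lam 0) (rowResidue lam f 0)
    (rowResidue_of_notMem lam f 0) (rowResidue_mul_self lam f hdiag 0) (Or.inl rfl) hq.pos hPsec
    (rowResidue_zero_base lam f hdiag 0)
  have hnot : ∀ w, (∀ j ≤ n, w ≠ q j) → w ∉ rowPoles lam 0 := by
    intro w hw hmem
    rw [hPeq] at hmem
    obtain ⟨j, hj, e⟩ := Finset.mem_image.1 hmem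
    exact hw j (by rw [Finset.mem_range] at hj; omega) e.symm
  have hsum : ∀ (ψ : Fin (n + 1) → ℂ) (k : ℕ) (hk : k + 1 < n + 1),
      ∑ l, ψ l * f l ⟨k + 1, hk⟩ = -ψ ⟨k, by omega⟩ := by
    intro ψ k hk
    rw [sum_eq_single ⟨k, by omega⟩]
    · simp [hf]
    · intro l _ hl
      have : ¬ (k + 1 = (l : ℕ) + 1) := fun e => hl (Fin.ext (by simp; omega))
      simp only [hf]
      rw [if_neg this, mul_zero]
    · intro h; exact absurd (Finset.mem_univ _) h
  have hsum0 : ∀ (ψ : Fin (n + 1) → ℂ), ∑ l, ψ l * f l 0 = 0 := by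
    intro ψ
    refine Finset.sum_eq_zero fun l _ => ?_
    simp [hf]
  have hlim : ∀ k, Tendsto (fun w => Ψ w k) (𝓝[raySector 1 η] 0)
      (𝓝 ((Pi.single 0 1 : Fin (n + 1) → ℂ) k)) := fun k =>
    (tendsto_pi_nhds.1 hΨ.tendsto_base) k
  refine ⟨fun k w => if h : k < n + 1 then Ψ w ⟨k, h⟩ else 0, ⟨?_, ?_, ?_⟩, ?_, ?_, ?_⟩
  · intro w hw hwq
    rw [dif_pos (Nat.succ_pos n)]
    refine eq_of_hasDerivAt_zero_sector (Or.inl rfl) hq.pos hPsec (D := fun w => Ψ w 0)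
      (fun w hw hwP => ?_) (by simpa using hlim 0) hw (hnot w hwq)
    refine (hasDerivAt_pi.1 (hΨ.deriv w hw hwP) 0).congr_deriv ?_
    rw [fuchs_row_apply, hsum0, mul_zero]
  · intro k hk w hw hwq
    have hk1 : k + 1 < n + 1 := by omega
    simp only [dif_pos hk1, dif_pos (show k < n + 1 by omega)]
    refine (hasDerivAt_pi.1 (hΨ.deriv w hw (hnot w hwq)) ⟨k + 1, hk1⟩).congr_deriv ?_
    rw [fuchs_row_apply, hsum, hpole, div_eq_inv_mul]
    ring
  · intro k hk
    have hk1 : k + 1 < n + 1 := by omega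
    simp only [dif_pos hk1]
    have := hlim ⟨k + 1, hk1⟩
    rwa [Pi.single_eq_of_ne (by simp [Fin.ext_iff])] at this
  · obtain ⟨C, δ, hδ, hb⟩ := hΨ.base_bound
    refine ⟨C, δ, hδ, fun k hk hk0 w hw hwδ => ?_⟩
    simp only [dif_pos (show k < n + 1 by omega)]
    have h1 := (norm_le_pi_norm (Ψ w - Pi.single 0 1) ⟨k, by omega⟩).trans (hb w hw hwδ)
    rwa [Pi.sub_apply, Pi.single_eq_of_ne (by simpa [Fin.ext_iff] using hk0), sub_zero] at h1
  · obtain ⟨C, hC⟩ := hΨ.bound_compact (Or.inl rfl) hPsec (rowResidue_mul_self lam f hdiag 0)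
      hq.pos 1
    refine ⟨|C|, abs_nonneg C, fun k hk x hx hxq => ?_⟩
    simp only [dif_pos (show k < n + 1 by omega)]
    have h1 := hC (x : ℂ) (mem_raySector_ofReal hq.pos hx.1) (by simp) (by simpa using hx.2.le)
      (hnot _ hxq)
    rw [hPeq] at h1
    refine (norm_le_pi_norm (Ψ x) _).trans (h1.trans ?_)
    have := zero_le_one.trans (one_le_poleWeight ((Finset.range (n + 1)).image q) x)
    gcongr
    exact le_abs_self C
  · intro hq1
    obtain ⟨Θ, hΘ⟩ := hΨ.pole 1 one_pos
    rw [ofReal_one] at hΘ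
    refine ⟨Θ ⟨n, by omega⟩, ?_⟩
    refine ((tendsto_pi_nhds.1 hΘ) ⟨n, by omega⟩).congr fun w => ?_
    simp only [dif_pos (show n < n + 1 by omega)]
    rw [Pi.sub_apply, Pi.smul_apply, rowResidue_apply, if_neg]
    · simp
    · rw [hpole]; simpa using hq1

end Primitives

section MFunction

theorem partialSum_succ {n : ℕ} (z : Fin n → ℂ) {j : ℕ} (hj : j < n) :
    partialSum z (j + 1) = partialSum z j + z ⟨j, hj⟩ := by
  simp only [partialSum]
  have : ∀ i : Fin n, (if (i : ℕ) < j + 1 then z i else 0) =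
      (if (i : ℕ) < j then z i else 0) + if i = ⟨j, hj⟩ then z i else 0 := by
    intro i
    by_cases h1 : (i : ℕ) < j
    · rw [if_pos (by omega), if_pos h1, if_neg (by simp [Fin.ext_iff]; omega), add_zero]
    · by_cases h2 : (i : ℕ) = j
      · rw [if_pos (by omega), if_neg h1, if_pos (Fin.ext h2), zero_add]
      · rw [if_neg (by omega), if_neg h1, if_neg (by simpa [Fin.ext_iff] using h2), add_zero]
  simp only [this, sum_add_distrib, Finset.sum_ite_eq', Finset.mem_univ, if_true]

theorem partialSum_zero {n : ℕ} (z : Fin n → ℂ) : partialSum z 0 = 0 := by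
  simp [partialSum]

theorem partialSum_self {n : ℕ} (z : Fin n → ℂ) : partialSum z n = ∑ i, z i := by
  simp [partialSum]

theorem eventually_weight_le {p : ℂ} :
    ∃ c, 0 ≤ c ∧ ∀ᶠ x : ℝ in 𝓝[<] 1, ‖(x : ℂ) - p‖ ^ (-(1 / 2) : ℝ) ≤
      c * |x - 1| ^ (-(1 / 2) : ℝ) := by
  by_cases hp : p = 1
  · refine ⟨1, zero_le_one, Eventually.of_forall fun x => ?_⟩
    rw [hp, one_mul, ← ofReal_one, ← Complex.ofReal_sub, norm_real,
      norm_eq_abs]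
  · set c := ‖(1 : ℂ) - p‖ / 2 with hc
    have hc0 : 0 < c := half_pos (norm_pos_iff.2 (sub_ne_zero.2 (Ne.symm hp)))
    refine ⟨c ^ (-(1 / 2) : ℝ), rpow_nonneg hc0.le _, ?_⟩
    have h1 : ∀ᶠ x : ℝ in 𝓝 1, c < ‖(x : ℂ) - p‖ := by
      have : ContinuousAt (fun x : ℝ => ‖(x : ℂ) - p‖) 1 := by fun_prop
      refine this.eventually_const_lt ?_
      beta_reduce
      rw [ofReal_one, hc]
      have := norm_pos_iff.2 (sub_ne_zero.2 (Ne.symm hp))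
      linarith
    filter_upwards [h1.filter_mono nhdsWithin_le_nhds, Ioo_mem_nhdsLT (zero_lt_one' ℝ)] with x h2 h3
    have hx1 : |x - 1| ≤ 1 := by rw [abs_le]; constructor <;> linarith [h3.1, h3.2]
    have hx0 : 0 < |x - 1| := abs_pos.2 (by linarith [h3.2])
    rw [← Real.mul_rpow hc0.le (abs_nonneg _)]
    refine rpow_le_rpow_of_nonpos (by positivity) ?_ (by norm_num)
    nlinarith

/-- The function `M` in terms of iterated primitives. -/
theorem M_eq_primitive {n : ℕ} (z : Fin (n + 1) → ℂ) (hz : ∀ i, z i ≠ 0) {η : ℝ} (hη : 0 < η)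
    (hs : partialSum z (n + 1) ≠ 0)
    (hsec : ∀ j ≤ n, partialSum z j / partialSum z (n + 1) ∉ sector 1 η) :
    ∃ J L, GoodPoles (fun j => partialSum z j / partialSum z (n + 1)) η n ∧
      IsPrimitive (fun j => partialSum z j / partialSum z (n + 1)) η n J ∧
      Tendsto (J n) (𝓝[raySector 1 η \ {(1 : ℂ)}] 1) (𝓝 L) ∧
      M (n + 1) z = (-1) ^ n * (2 * π * I) * L := by
  set s := partialSum z (n + 1) with hsdef
  set q : ℕ → ℂ := fun j => partialSum z j / s with hqdef
  have hstep : ∀ k < n + 1, q (k + 1) ≠ q k := by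
    intro k hk e
    have : partialSum z (k + 1) = partialSum z k := by
      simpa only [hqdef, div_left_inj' hs] using e
    rw [partialSum_succ z hk] at this
    exact hz _ (by simpa using this)
  have hq : GoodPoles q η n :=
    ⟨hη, by simp [hqdef, partialSum_zero], fun k hk => hstep k (by omega), hsec⟩
  have hq1 : q (n + 1) = 1 := div_self hs
  have hqn : q n ≠ 1 := by rw [← hq1]; exact (hstep n (by omega)).symm
  obtain ⟨J, hJ, ⟨C₀, δ₀, hδ₀, hb₀⟩, ⟨C₁, hC₁, hb₁⟩, hL⟩ := hq.exists_primitive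
  obtain ⟨L, hL⟩ := hL hqn
  refine ⟨J, L, hq, hJ, hL, ?_⟩
  set A := interiorPoints z with hA
  have hAmem : ∀ a ∈ A, 0 < a ∧ a < 1 := by
    intro a ha
    simp only [hA, interiorPoints, Finset.mem_image, mem_filter] at ha
    obtain ⟨w, ⟨-, h1, h2, h3⟩, rfl⟩ := ha
    exact ⟨h2, h3⟩
  have hpoleA : ∀ j ≤ n, ∀ x ∈ Ioo (0 : ℝ) 1, (x : ℂ) = q j → x ∈ A := by
    intro j hj x hx e
    have hj0 : j ≠ 0 := by
      rintro rfl
      rw [hq.zero] at e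
      exact hx.1.ne' (by exact_mod_cast e)
    simp only [hA, interiorPoints, Finset.mem_image, mem_filter]
    refine ⟨x, ⟨⟨j, Finset.mem_Ico.2 ⟨by omega, by omega⟩, e.symm⟩, by simp, by simpa using hx.1,
      by simpa using hx.2⟩, by simp⟩
  -- bounds at the end points
  have hend0 : ∀ k < n, ∃ C, ∀ᶠ x : ℝ in 𝓝[>] 0,
      ‖J k (x : ℂ) / (x - q (k + 1))‖ ≤ C * |x - 0| ^ (-(1 / 2) : ℝ) := by
    intro k hk
    have hinv : ∃ c, 0 ≤ c ∧ ∀ᶠ x : ℝ in 𝓝[>] 0, ‖((x : ℂ) - q (k + 1))⁻¹‖ ≤ c * x⁻¹ ∧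
        (k = 0 → ‖((x : ℂ) - q (k + 1))⁻¹‖ ≤ c) := by
      by_cases hq0 : q (k + 1) = 0
      · refine ⟨1, zero_le_one, ?_⟩
        filter_upwards [self_mem_nhdsWithin] with x hx
        have hx0 : (0 : ℝ) < x := hx
        rw [hq0, sub_zero, norm_inv, norm_real, norm_eq_abs, abs_of_pos hx0, one_mul]
        refine ⟨le_rfl, ?_⟩
        rintro rfl
        exact absurd (hq0.trans hq.zero.symm) (hq.ne 0 hk)
      · set c := ‖q (k + 1)‖ / 2 with hc
        have hn := norm_pos_iff.2 hq0
        have hc0 : 0 < c := half_pos hn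
        have h1 : ∀ᶠ x : ℝ in 𝓝 0, c < ‖(x : ℂ) - q (k + 1)‖ := by
          have : ContinuousAt (fun x : ℝ => ‖(x : ℂ) - q (k + 1)‖) 0 := by fun_prop
          refine this.eventually_const_lt ?_
          beta_reduce
          rw [ofReal_zero, zero_sub, norm_neg, hc]
          linarith
        refine ⟨c⁻¹, by positivity, ?_⟩
        filter_upwards [h1.filter_mono nhdsWithin_le_nhds, Ioo_mem_nhdsGT (zero_lt_one' ℝ)]
          with x h2 h3
        have h4 : ‖((x : ℂ) - q (k + 1))⁻¹‖ ≤ c⁻¹ := by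
          rw [norm_inv]; exact inv_anti₀ hc0 h2.le
        refine ⟨h4.trans ?_, fun _ => h4⟩
        exact le_mul_of_one_le_right (by positivity) ((one_le_inv₀ h3.1).2 h3.2.le)
    obtain ⟨c, hc0, hc⟩ := hinv
    rcases Nat.eq_zero_or_pos k with rfl | hk0
    · refine ⟨c, ?_⟩
      have hne : ∀ᶠ x : ℝ in 𝓝[>] 0, ∀ j ∈ Finset.range (n + 1), (x : ℂ) ≠ q j := by
        rw [eventually_all_finset]
        intro j _
        by_cases hj : q j = 0
        · filter_upwards [self_mem_nhdsWithin] with x hx e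
          rw [hj] at e
          exact (ne_of_gt hx) (by exact_mod_cast e)
        · have : ContinuousAt (fun x : ℝ => (x : ℂ)) 0 := by fun_prop
          have h2 : ∀ᶠ x : ℝ in 𝓝 0, (x : ℂ) ≠ q j :=
            this.eventually_ne (by rw [ofReal_zero]; exact Ne.symm hj)
          exact h2.filter_mono nhdsWithin_le_nhds
      filter_upwards [hc, hne, Ioo_mem_nhdsGT (zero_lt_one' ℝ)] with x h1 h2 h3
      rw [hJ.zero x (mem_raySector_ofReal hη h3.1)
        (fun j hj => h2 j (Finset.mem_range.2 (by omega))), one_div, sub_zero, abs_of_pos h3.1]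
      refine (h1.2 rfl).trans (le_mul_of_one_le_right hc0 ?_)
      exact one_le_rpow_of_pos_of_le_one_of_nonpos h3.1 h3.2.le (by norm_num)
    · refine ⟨|C₀| * c, ?_⟩
      filter_upwards [hc, Ioo_mem_nhdsGT hδ₀] with x h1 h3
      have h4 := hb₀ k hk.le hk0.ne' (x : ℂ) (mem_raySector_ofReal hη h3.1)
        (by rw [norm_real, norm_eq_abs, abs_of_pos h3.1]; exact h3.2)
      rw [norm_real, norm_eq_abs, abs_of_pos h3.1] at h4
      rw [div_eq_mul_inv, norm_mul, sub_zero, abs_of_pos h3.1]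
      have e : √x * x⁻¹ = x ^ (-(1 / 2) : ℝ) := by
        rw [Real.sqrt_eq_rpow, ← Real.rpow_neg_one x, ← Real.rpow_add h3.1]; norm_num
      calc _ ≤ (|C₀| * √x) * (c * x⁻¹) := by
            gcongr
            · exact h4.trans (by gcongr; exact le_abs_self C₀)
            · exact h1.1
        _ = |C₀| * c * (√x * x⁻¹) := by ring
        _ = _ := by rw [e]
  have hend1 : ∀ k, k + 1 = n → ∃ C, ∀ᶠ x : ℝ in 𝓝[<] 1,
      ‖J k (x : ℂ) / (x - q (k + 1))‖ ≤ C * |x - 1| ^ (-(1 / 2) : ℝ) := by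
    intro k hk
    have hw := fun p : ℂ => eventually_weight_le (p := p)
    choose c hc0 hc using hw
    set P := (Finset.range (n + 1)).image q with hP
    set d := ‖(1 : ℂ) - q n‖ / 2 with hd
    have hdpos := norm_pos_iff.2 (sub_ne_zero.2 (Ne.symm hqn))
    have hd0 : 0 < d := half_pos hdpos
    have h1 : ∀ᶠ x : ℝ in 𝓝 1, d < ‖(x : ℂ) - q n‖ := by
      have : ContinuousAt (fun x : ℝ => ‖(x : ℂ) - q n‖) 1 := by fun_prop
      refine this.eventually_const_lt ?_
      beta_reduce
      rw [ofReal_one, hd]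
      linarith
    have h2 : ∀ᶠ x : ℝ in 𝓝[<] 1, ∀ p ∈ P.erase 0, ‖(x : ℂ) - p‖ ^ (-(1 / 2) : ℝ) ≤
        c p * |x - 1| ^ (-(1 / 2) : ℝ) := by
      rw [eventually_all_finset]; exact fun p _ => hc p
    have h3 : ∀ᶠ x : ℝ in 𝓝[<] 1, ∀ j ∈ Finset.range (n + 1), (x : ℂ) ≠ q j := by
      rw [eventually_all_finset]
      intro j _
      by_cases hj : q j = 1
      · filter_upwards [self_mem_nhdsWithin] with x hx e
        rw [hj] at e
        exact (ne_of_lt hx) (by exact_mod_cast e)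
      · have : ContinuousAt (fun x : ℝ => (x : ℂ)) 1 := by fun_prop
        have h2 : ∀ᶠ x : ℝ in 𝓝 1, (x : ℂ) ≠ q j :=
          this.eventually_ne (by rw [ofReal_one]; exact Ne.symm hj)
        exact h2.filter_mono nhdsWithin_le_nhds
    refine ⟨C₁ * (1 + ∑ p ∈ P.erase 0, c p) * d⁻¹, ?_⟩
    filter_upwards [h1.filter_mono nhdsWithin_le_nhds, h2, h3, Ioo_mem_nhdsLT (zero_lt_one' ℝ)]
      with x e1 e2 e3 e4
    have hx1 : |x - 1| ≤ 1 := by rw [abs_le]; constructor <;> linarith [e4.1, e4.2]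
    have hx0 : 0 < |x - 1| := abs_pos.2 (by linarith [e4.2])
    have hpow : 1 ≤ |x - 1| ^ (-(1 / 2) : ℝ) :=
      one_le_rpow_of_pos_of_le_one_of_nonpos hx0 hx1 (by norm_num)
    have e5 := hb₁ k (by omega) x e4 (fun j hj => e3 j (Finset.mem_range.2 (by omega)))
    have e6 : poleWeight P x ≤ (1 + ∑ p ∈ P.erase 0, c p) * |x - 1| ^ (-(1 / 2) : ℝ) := by
      rw [poleWeight, add_mul, one_mul, sum_mul]
      exact add_le_add hpow (sum_le_sum e2)
    rw [div_eq_mul_inv, norm_mul, norm_inv, hk]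
    calc _ ≤ (C₁ * ((1 + ∑ p ∈ P.erase 0, c p) * |x - 1| ^ (-(1 / 2) : ℝ))) * d⁻¹ := by
          have e7 := e5.trans (mul_le_mul_of_nonneg_left e6 hC₁)
          exact mul_le_mul e7 (inv_anti₀ hd0 e1.le) (by positivity) ((norm_nonneg _).trans e7)
      _ = _ := by ring
  -- the neighbourhoods of the end points
  choose! B₀ hB₀ using hend0
  have hδa : ∀ᶠ δ : ℝ in 𝓝[>] 0, ∀ x ∈ Ioo 0 δ, ∀ k ∈ Finset.range n,
      ‖J k (x : ℂ) / (x - q (k + 1))‖ ≤ B₀ k * |x - 0| ^ (-(1 / 2) : ℝ) := by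
    have : ∀ᶠ x : ℝ in 𝓝[>] 0, ∀ k ∈ Finset.range n,
        ‖J k (x : ℂ) / (x - q (k + 1))‖ ≤ B₀ k * |x - 0| ^ (-(1 / 2) : ℝ) := by
      rw [eventually_all_finset]; exact fun k hk => hB₀ k (Finset.mem_range.1 hk)
    obtain ⟨b, hb, hsub⟩ := (mem_nhdsGT_iff_exists_Ioo_subset).1 this
    filter_upwards [Ioo_mem_nhdsGT hb] with δ hδ x hx
    exact hsub ⟨hx.1, hx.2.trans hδ.2⟩
  choose! B₁ hB₁ using hend1
  have hδb : ∀ᶠ δ : ℝ in 𝓝[>] 0, ∀ x ∈ Ioo (1 - δ) 1, ∀ k ∈ Finset.range n, k + 1 = n →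
      ‖J k (x : ℂ) / (x - q (k + 1))‖ ≤ B₁ k * |x - 1| ^ (-(1 / 2) : ℝ) := by
    have : ∀ᶠ x : ℝ in 𝓝[<] 1, ∀ k ∈ Finset.range n, k + 1 = n →
        ‖J k (x : ℂ) / (x - q (k + 1))‖ ≤ B₁ k * |x - 1| ^ (-(1 / 2) : ℝ) := by
      rw [eventually_all_finset]
      intro k _
      by_cases hkn : k + 1 = n
      · filter_upwards [hB₁ k hkn] with x hx _ using hx
      · exact Eventually.of_forall fun x h => absurd h hkn
    obtain ⟨b, hb, hsub⟩ := (mem_nhdsLT_iff_exists_Ioo_subset).1 this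
    have hb' : (0 : ℝ) < 1 - b := sub_pos.2 hb
    filter_upwards [Ioo_mem_nhdsGT hb'] with δ hδ x hx
    exact hsub ⟨by linarith [hx.1, hδ.2], hx.2⟩
  have hL1 : Tendsto (fun x : ℝ => J n x) (𝓝[<] 1) (𝓝 L) := by
    have := hL.comp ((tendsto_ofReal_sector_pole (κ := 1) hη one_pos).mono_left
      (nhdsWithin_mono (1 : ℝ) (s := Iio 1) fun y hy => ne_of_lt hy))
    exact this
  have hev : ∀ᶠ ε : ℝ in 𝓝[>] 0,
      iteratedIntegral (perturbedSegment z ε) (fun k => partialSum z (k + 1)) n 1 = L := by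
    have hε1 : ∀ᶠ ε : ℝ in 𝓝[>] 0, ∀ a ∈ A, 0 < a - ε ∧ a + ε < 1 ∧ A.card * ε < η * (a - ε) := by
      rw [eventually_all_finset]
      intro a ha
      obtain ⟨h1, h2⟩ := hAmem a ha
      refine Eventually.filter_mono nhdsWithin_le_nhds ?_
      have c1 : ContinuousAt (fun ε : ℝ => a - ε) 0 := by fun_prop
      have c2 : ContinuousAt (fun ε : ℝ => a + ε) 0 := by fun_prop
      have c3 : ContinuousAt (fun ε : ℝ => A.card * ε - η * (a - ε)) 0 := by fun_prop
      filter_upwards [c1.eventually_const_lt (u := 0) (by simpa using h1),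
        c2.eventually_lt_const (u := 1) (by simpa using h2),
        c3.eventually_lt_const (u := 0) (by simpa using mul_pos hη h1)] with ε e1 e2 e3
      exact ⟨e1, e2, by linarith⟩
    filter_upwards [hε1, self_mem_nhdsWithin] with ε hε hε0
    have hε0' : (0 : ℝ) < ε := hε0
    have hδc : ∀ᶠ δ : ℝ in 𝓝[>] 0, ∀ a ∈ A, δ < a - ε ∧ δ < 1 - a - ε := by
      rw [eventually_all_finset]
      intro a ha
      obtain ⟨h1, h2, -⟩ := hε a ha
      filter_upwards [Ioo_mem_nhdsGT h1, Ioo_mem_nhdsGT (show (0 : ℝ) < 1 - a - ε by linarith)]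
        with δ e1 e2 using ⟨e1.2, e2.2⟩
    obtain ⟨δ, hδ1, hδ2, hδ3, hδ4⟩ := (hδa.and (hδb.and (hδc.and
      (Ioo_mem_nhdsGT (show (0 : ℝ) < 1 / 2 by norm_num))))).exists
    have e1 : perturbedSegment z ε = fun x => s * bumpPath A ε x := rfl
    have e2 : (fun k => partialSum z (k + 1)) = fun k => s * q (k + 1) := by
      funext k; simp only [hqdef]; rw [mul_div_cancel₀ _ hs]
    rw [e1, e2, iteratedIntegral_const_mul hs]
    have hpath := fun x : ℝ => bumpPath_mem_sector (A := A) hη hε0' (fun a ha => (hε a ha).2.2)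
      (x := x)
    have havoid : ∀ x ∈ Ioo (0 : ℝ) 1, ∀ j ≤ n, bumpPath A ε x ≠ q j := by
      intro x hx j hj e
      by_cases hsct : bumpPath A ε x ∈ sector 1 η
      · exact hq.free j hj (e ▸ hsct)
      · obtain ⟨h1, h2⟩ := (hpath x hx.1).2 hsct
        exact h2 (hpoleA j hj x hx (h1 ▸ e))
    refine iteratedIntegral_eq_primitive (q := fun k => q (k + 1)) (J := J) hδ4.1 hδ4.2
      (continuous_bumpPath A ε) (bumpEnds A ε).finite_toSet.countable
      (fun x hx => (hasDerivAt_bumpPath (fun h => hx.2 h)).differentiableAt)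
      (intervalIntegrable_deriv_bumpPath hε0' fun a ha =>
        ⟨(hε a ha).1.le, (hε a ha).2.1.le⟩) ?_ ?_ ?_ ?_ ?_ ?_ ?_ ?_ hL1
    · intro x hx
      refine bumpPath_eq_self fun a ha => ?_
      have := hδ3 a ha
      nlinarith [hx.1, hx.2]
    · intro x hx
      refine bumpPath_eq_self fun a ha => ?_
      have := hδ3 a ha
      nlinarith [hx.1, hx.2]
    · exact fun x hx => hJ.zero _ (hpath x hx.1).1 (havoid x hx)
    · exact fun k hk x hx => hJ.deriv k hk _ (hpath x hx.1).1 (havoid x hx)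
    · exact fun k hk x hx => havoid x hx (k + 1) (by omega)
    · exact fun k hk => (hJ.lim k hk).comp (tendsto_ofReal_sector hη)
    · exact fun k hk => ⟨B₀ k, fun x hx => hδ1 x hx k (Finset.mem_range.2 hk)⟩
    · exact fun k hk => ⟨B₁ k, fun x hx => hδ2 x hx k (Finset.mem_range.2 (by omega)) hk⟩
  rw [M, Nat.add_sub_cancel]
  congr 1
  exact Tendsto.limUnder_eq (tendsto_const_nhds.congr' (hev.mono fun ε hε => hε.symm))

end MFunction

section Words

variable {ι : Type*} [Fintype ι] [DecidableEq ι] {A : Type*} [Fintype A]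

/-- The product of the matrices `F (α 0), …, F (α (n - 1))`. -/
def wordProd (F : A → Mat(ι)) {n : ℕ} (α : Fin n → A) : Mat(ι) :=
  (List.ofFn fun r => F (α r)).prod

theorem wordProd_zero (F : A → Mat(ι)) (α : Fin 0 → A) : wordProd F α = 1 := by
  simp [wordProd]

theorem wordProd_succ (F : A → Mat(ι)) {n : ℕ} (α : Fin (n + 1) → A) :
    wordProd F α = wordProd F (fun r : Fin n => α r.castSucc) * F (α (Fin.last n)) := by
  rw [wordProd, List.ofFn_succ', List.concat_eq_append, List.prod_append, List.prod_singleton,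
    wordProd]

theorem sum_words_succ {B : Type*} [AddCommMonoid B] {n : ℕ} (g : (Fin (n + 1) → A) → B) :
    ∑ β, g β = ∑ α : Fin n → A, ∑ a, g (Fin.snoc α a) := by
  rw [← (Fin.snocEquiv fun _ : Fin (n + 1) => A).sum_comp g, Fintype.sum_prod_type, sum_comm]
  rfl

theorem partialSum_castSucc {n : ℕ} (z : Fin (n + 1) → ℂ) {j : ℕ} (hj : j ≤ n) :
    partialSum (fun r : Fin n => z r.castSucc) j = partialSum z j := by
  simp only [partialSum, Fin.sum_univ_castSucc]
  rw [if_neg (by simp; omega), add_zero]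
  simp

/-- The matrices `F a` have weight `z a ≠ 0` with respect to the eigenvalues `lam`. -/
structure Weighted (lam : ι → ℂ) (z : A → ℂ) (F : A → Mat(ι)) : Prop where
  ne_zero : ∀ a, z a ≠ 0
  weight : ∀ a i k, F a i k ≠ 0 → lam i - lam k = z a

variable {lam : ι → ℂ} {z : A → ℂ} {F : A → Mat(ι)}

theorem Weighted.sum_eq_zero (h : Weighted lam z F) (a b : ι) (hab : lam a = lam b) :
    (∑ c, F c) a b = 0 := by
  rw [Matrix.sum_apply]
  refine Finset.sum_eq_zero fun c _ => ?_
  by_contra hne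
  have := h.weight c a b hne
  rw [hab, sub_self] at this
  exact h.ne_zero c this.symm

theorem Weighted.wordProd_weight (h : Weighted lam z F) {n : ℕ} (α : Fin n → A) (i k : ι)
    (hne : wordProd F α i k ≠ 0) : lam i - lam k = partialSum (fun r => z (α r)) n := by
  induction n generalizing k with
  | zero =>
    rw [wordProd_zero] at hne
    have : i = k := by
      by_contra hik; exact hne (one_apply_ne hik)
    rw [this, sub_self, partialSum_zero]
  | succ n ih =>
    rw [wordProd_succ, Matrix.mul_apply] at hne
    obtain ⟨l, -, hl⟩ := Finset.exists_ne_zero_of_sum_ne_zero hne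
    have h1 := ih _ l (left_ne_zero_of_mul hl)
    have h2 := h.weight _ l k (right_ne_zero_of_mul hl)
    rw [partialSum_castSucc (fun r => z (α r)) le_rfl] at h1
    rw [partialSum_succ _ (Nat.lt_succ_self n), ← h1, show (⟨n, Nat.lt_succ_self n⟩ : Fin (n + 1)) =
      Fin.last n from rfl, ← h2]
    ring

theorem Weighted.partialSum_mem (h : Weighted lam z F) {n : ℕ} (α : Fin n → A) (i k : ι)
    (hne : wordProd F α i k ≠ 0) {j : ℕ} (hj : j ≤ n) :
    partialSum (fun r => z (α r)) j ∈ rowPoles lam i := by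
  induction n generalizing k with
  | zero =>
    rw [Nat.le_zero.1 hj, ← h.wordProd_weight α i k hne]
    exact Finset.mem_image.2 ⟨k, Finset.mem_univ k, rfl⟩
  | succ n ih =>
    rcases Nat.lt_or_ge n j with hnj | hnj
    · have : j = n + 1 := by omega
      rw [this, ← h.wordProd_weight α i k hne]
      exact Finset.mem_image.2 ⟨k, Finset.mem_univ k, rfl⟩
    · rw [wordProd_succ, Matrix.mul_apply] at hne
      obtain ⟨l, -, hl⟩ := Finset.exists_ne_zero_of_sum_ne_zero hne
      have := ih _ l (left_ne_zero_of_mul hl) hnj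
      rwa [partialSum_castSucc (fun r => z (α r)) hnj] at this

theorem Weighted.goodPoles (h : Weighted lam z F) {η : ℝ} (hη : 0 < η) {i : ι}
    (hP : ∀ p ∈ rowPoles lam i, p ∉ sector 1 η) {n : ℕ} (α : Fin n → A) (k : ι)
    (hne : wordProd F α i k ≠ 0) : GoodPoles (partialSum fun r => z (α r)) η n where
  pos := hη
  zero := partialSum_zero _
  ne := fun j hj e => by
    rw [partialSum_succ _ hj] at e
    exact h.ne_zero _ (by simpa using e)
  free := fun j hj => hP _ (h.partialSum_mem α i k hne hj)

theorem Weighted.goodPoles_initSegment (h : Weighted lam z F) {η : ℝ} (hη : 0 < η) {i : ι}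
    (hP : ∀ p ∈ rowPoles lam i, p ∉ sector 1 η) {n : ℕ} (β : Fin (n + 1) → A) (k : ι)
    (hne : wordProd F β i k ≠ 0) :
    GoodPoles (partialSum fun r : Fin n => z (β r.castSucc)) η n := by
  rw [wordProd_succ, Matrix.mul_apply] at hne
  obtain ⟨l, -, hl⟩ := Finset.exists_ne_zero_of_sum_ne_zero hne
  exact h.goodPoles hη hP (fun r : Fin n => β r.castSucc) l (left_ne_zero_of_mul hl)

/-- A choice of iterated primitives for all words. -/
def IsWordPrimitive (z : A → ℂ) (η : ℝ) (J : ∀ n : ℕ, (Fin n → A) → ℕ → ℂ → ℂ) : Prop :=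
  ∀ n (α : Fin n → A), GoodPoles (partialSum fun r => z (α r)) η n →
    IsPrimitive (partialSum fun r => z (α r)) η n (J n α)

theorem exists_wordPrimitive (z : A → ℂ) (η : ℝ) :
    ∃ J : ∀ n : ℕ, (Fin n → A) → ℕ → ℂ → ℂ, IsWordPrimitive z η J := by
  have : ∀ n (α : Fin n → A), ∃ J, GoodPoles (partialSum fun r => z (α r)) η n →
      IsPrimitive (partialSum fun r => z (α r)) η n J := by
    intro n α
    by_cases hg : GoodPoles (partialSum fun r => z (α r)) η n
    · obtain ⟨J, hJ, -⟩ := hg.exists_primitive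
      exact ⟨J, fun _ => hJ⟩
    · exact ⟨0, fun h => absurd h hg⟩
  choose J hJ using this
  exact ⟨J, hJ⟩

theorem sum_words_mul (F : A → Mat(ι)) {n : ℕ} (c : (Fin n → A) → ℂ) (i k : ι) :
    ∑ β : Fin (n + 1) → A, c (fun r => β r.castSucc) * wordProd F β i k =
      ∑ l, (∑ α, c α * wordProd F α i l) * (∑ a, F a) l k := by
  rw [sum_words_succ]
  have h1 : ∀ (α : Fin n → A) (a : A),
      c (fun r => (Fin.snoc α a : Fin (n + 1) → A) r.castSucc) *
        wordProd F (Fin.snoc α a : Fin (n + 1) → A) i k =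
      ∑ l, c α * wordProd F α i l * F a l k := by
    intro α a
    rw [wordProd_succ]
    simp only [Fin.snoc_castSucc, Fin.snoc_last, Matrix.mul_apply, mul_sum, mul_assoc]
  simp only [h1, Matrix.sum_apply]
  rw [sum_congr rfl fun α _ => sum_comm, sum_comm]
  exact sum_congr rfl fun l _ => (Finset.sum_mul_sum _ _ _ _).symm

/-- The coefficients of a graded row solution, as sums over words. -/
theorem GradedSolution.eq_sum_words (h : Weighted lam z F) {η : ℝ} (hη : 0 < η) {i : ι}
    (hP : ∀ p ∈ rowPoles lam i, p ∉ sector 1 η) {Ψ : ℂ → ι → ℂ} {Φ : ℕ → ℂ → ι → ℂ}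
    (hΦ : GradedSolution (rowPoles lam i) (rowResidue lam (∑ a, F a) i) 1 η (Pi.single i 1) Ψ Φ)
    {J : ∀ n : ℕ, (Fin n → A) → ℕ → ℂ → ℂ} (hJ : IsWordPrimitive z η J) (n : ℕ) {w : ℂ}
    (hw : w ∈ raySector 1 η) (hwP : w ∉ rowPoles lam i) (k : ι) :
    Φ n w k = (-1) ^ n * ∑ α : Fin n → A, J n α n w * wordProd F α i k := by
  induction n generalizing w k with
  | zero =>
    have h1 := eq_of_hasDerivAt_zero_sector (Or.inl rfl) hη hP (D := Φ 0) hΦ.deriv_zero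
      hΦ.base_zero hw hwP
    have h2 : ∀ α : Fin 0 → A, J 0 α 0 w = 1 := by
      intro α
      refine (hJ 0 α ⟨hη, partialSum_zero _, by simp, ?_⟩).zero w hw ?_
      · intro j hj
        rw [Nat.le_zero.1 hj, partialSum_zero]
        exact fun h => by simpa using h.1
      · intro j hj e
        rw [Nat.le_zero.1 hj, partialSum_zero] at e
        have := hw.1
        rw [e] at this
        simp at this
    simp only [h1, h2, wordProd_zero, pow_zero, one_mul, Finset.univ_unique, Finset.sum_singleton]
    rw [Matrix.one_apply, Pi.single_apply]
    simp only [eq_comm]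
  | succ n ih =>
    have hoff : ∀ (β : Fin (n + 1) → A), wordProd F β i k ≠ 0 → ∀ w ∉ rowPoles lam i, ∀ j ≤ n + 1,
        w ≠ partialSum (fun r => z (β r)) j := by
      intro β hβ w hw j hj e
      exact hw (e ▸ h.partialSum_mem β i k hβ hj)
    have hterm : ∀ (β : Fin (n + 1) → A), ∀ w ∈ raySector 1 η, w ∉ rowPoles lam i →
        HasDerivAt (fun w => J (n + 1) β (n + 1) w * wordProd F β i k)
          ((w - (lam i - lam k))⁻¹ *
            (J n (fun r => β r.castSucc) n w * wordProd F β i k)) w := by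
      intro β w hw hwP
      by_cases hβ : wordProd F β i k = 0
      · simp only [hβ, mul_zero]; exact hasDerivAt_const w _
      · have hg := h.goodPoles hη hP β k hβ
        have hg' := h.goodPoles_initSegment hη hP β k hβ
        have hp := hJ (n + 1) β hg
        have h1 := hp.deriv n (by omega) w hw (hoff β hβ w hwP)
        have h2 := hp.unique (hJ n _ hg') hg hg' (m := n) (by omega) le_rfl
          (fun j hj => (partialSum_castSucc (fun r => z (β r)) hj).symm) hw (hoff β hβ w hwP)
          (fun j hj => by
            rw [partialSum_castSucc (fun r => z (β r)) hj]
            exact hoff β hβ w hwP j (by omega))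
        refine (h1.mul_const _).congr_deriv ?_
        rw [h2, ← h.wordProd_weight β i k hβ, div_eq_inv_mul]
        ring
    have key := eq_of_hasDerivAt_zero_sector (Or.inl rfl) hη hP
      (D := fun w => Φ (n + 1) w k -
        (-1) ^ (n + 1) * ∑ β : Fin (n + 1) → A, J (n + 1) β (n + 1) w * wordProd F β i k) (v := 0)
      (fun w hw hwP => by
        have h1 := hasDerivAt_pi.1 (hΦ.deriv_succ n w hw hwP) k
        have h2 : HasDerivAt (fun w => ∑ β : Fin (n + 1) → A,
            J (n + 1) β (n + 1) w * wordProd F β i k) _ w :=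
          HasDerivAt.fun_sum fun β _ => hterm β w hw hwP
        refine (h1.sub (h2.const_mul ((-1) ^ (n + 1)))).congr_deriv ?_
        rw [← mul_sum, sum_words_mul F (fun α => J n α n w), fuchs_row_apply]
        simp only [fun l => ih hw hwP l, mul_assoc, ← mul_sum]
        ring)
      (by
        have h1 : Tendsto (fun w => Φ (n + 1) w k) (𝓝[raySector 1 η] 0) (𝓝 0) :=
          (tendsto_pi_nhds.1 (hΦ.base_succ n)) k
        have h2 : Tendsto (fun w => ∑ β : Fin (n + 1) → A,
            J (n + 1) β (n + 1) w * wordProd F β i k) (𝓝[raySector 1 η] 0)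
            (𝓝 (∑ _β : Fin (n + 1) → A, 0)) := by
          refine tendsto_finsetSum _ fun β _ => ?_
          by_cases hβ : wordProd F β i k = 0
          · simp only [hβ, mul_zero]; exact tendsto_const_nhds
          · have := ((hJ (n + 1) β (h.goodPoles hη hP β k hβ)).lim n (by omega)).mul_const
              (wordProd F β i k)
            rwa [zero_mul] at this
        have h3 := h1.sub (h2.const_mul ((-1) ^ (n + 1)))
        simpa using h3) hw hwP
    exact sub_eq_zero.1 key

open Classical in
/-- The degree `n` term of the Stokes matrix of the ray `r`, as a sum over words. -/
def wordTerm (z : A → ℂ) (F : A → Mat(ι)) (r : Set ℂ) (n : ℕ) : Mat(ι) :=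
  ∑ α : Fin n → A with (∑ j, z (α j)) ∈ r, M n (fun j => z (α j)) • wordProd F α

open Classical in
theorem wordTerm_apply (r : Set ℂ) (n : ℕ) (i j : ι) : wordTerm z F r n i j =
      ∑ α : Fin n → A with (∑ j, z (α j)) ∈ r, M n (fun j => z (α j)) * wordProd F α i j := by
  simp only [wordTerm, Matrix.sum_apply, Matrix.smul_apply, smul_eq_mul]

open Classical in
theorem Weighted.wordTerm_eq_zero (h : Weighted lam z F) {r : Set ℂ} (n : ℕ) {i j : ι}
    (hij : lam i - lam j ∉ r) : wordTerm z F r n i j = 0 := by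
  rw [wordTerm_apply]
  refine Finset.sum_eq_zero fun α hα => ?_
  by_cases h0 : wordProd F α i j = 0
  · rw [h0, mul_zero]
  · have := h.wordProd_weight α i j h0
    rw [partialSum_self] at this
    exact absurd (this ▸ (mem_filter.1 hα).2) hij

open Classical in
theorem Weighted.wordTerm_eq_sum (h : Weighted lam z F) {r : Set ℂ} (n : ℕ) {i j : ι}
    (hij : lam i - lam j ∈ r) : wordTerm z F r n i j =
      ∑ α : Fin n → A, M n (fun j => z (α j)) * wordProd F α i j := by
  rw [wordTerm_apply]
  refine Finset.sum_subset (Finset.subset_univ _) fun α _ hα => ?_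
  by_cases h0 : wordProd F α i j = 0
  · rw [h0, mul_zero]
  · have := h.wordProd_weight α i j h0
    rw [partialSum_self] at this
    exact absurd (mem_filter.2 ⟨Finset.mem_univ _, this ▸ hij⟩) hα

theorem mul_mem_sector_iff {κ η p : ℝ} (hp : 0 < p) {w : ℂ} :
    (p : ℂ) * w ∈ sector κ η ↔ w ∈ sector κ η := by
  refine ⟨fun h => ?_, fun h => smul_mem_sector h hp⟩
  have := smul_mem_sector h (inv_pos.2 hp)
  have hpc : (p : ℂ) ≠ 0 := by exact_mod_cast hp.ne'
  rwa [Complex.ofReal_inv, inv_mul_cancel_left₀ hpc] at this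

theorem neBot_sector_pole {κ η p : ℝ} (hη : 0 < η) (hp : 0 < p) :
    (𝓝[raySector κ η \ {(p : ℂ)}] (p : ℂ)).NeBot :=
  (tendsto_ofReal_sector_pole (κ := κ) hη hp).neBot

/-- The iterated primitive of a word tends to the value of `M` at the end point. -/
theorem Weighted.tendsto_primitive (h : Weighted lam z F) {η : ℝ} (hη : 0 < η) {i : ι}
    (hP : ∀ p ∈ rowPoles lam i, p ∉ sector 1 η)
    {J : ∀ n : ℕ, (Fin n → A) → ℕ → ℂ → ℂ} (hJ : IsWordPrimitive z η J) {n : ℕ}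
    (β : Fin (n + 1) → A) {k : ι} (hβ : wordProd F β i k ≠ 0) {p : ℝ} (hp : 0 < p)
    (hpk : lam i - lam k = p) :
    ∃ L, Tendsto (J n (fun r => β r.castSucc) n) (𝓝[raySector 1 η \ {(p : ℂ)}] p) (𝓝 L) ∧
      M (n + 1) (fun r => z (β r)) = (-1) ^ n * (2 * π * I) * L := by
  have hpc : (p : ℂ) ≠ 0 := by exact_mod_cast hp.ne'
  have hs : partialSum (fun r => z (β r)) (n + 1) = p := by
    rw [← h.wordProd_weight β i k hβ, hpk]
  have hcancel : ∀ j, (p : ℂ) * (partialSum (fun r => z (β r)) j / p) =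
      partialSum (fun r => z (β r)) j := fun j => by field_simp
  obtain ⟨J', L, hg, hJ', hL, hM⟩ := M_eq_primitive (fun r => z (β r)) (fun r => h.ne_zero _) hη
    (by rw [hs]; exact hpc) (fun j hj => by
      rw [hs, ← mul_mem_sector_iff hp, hcancel]
      exact hP _ (h.partialSum_mem β i k hβ (by omega)))
  refine ⟨L, ?_, hM⟩
  rw [hs] at hg hJ'
  have hsc := hJ'.scale hp
  simp only [hcancel] at hsc
  have hg0 := h.goodPoles_initSegment hη hP β k hβ
  have hg1 : GoodPoles (partialSum fun r => z (β r)) η n :=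
    let g := h.goodPoles hη hP β k hβ
    ⟨g.pos, g.zero, fun k hk => g.ne k (by omega), fun j hj => g.free j (by omega)⟩
  have hmap : Tendsto (fun w : ℂ => ((p⁻¹ : ℝ) : ℂ) * w) (𝓝[raySector 1 η \ {(p : ℂ)}] p)
      (𝓝[raySector 1 η \ {(1 : ℂ)}] 1) := by
    refine tendsto_nhdsWithin_iff.2 ⟨?_, ?_⟩
    · have : Continuous fun w : ℂ => ((p⁻¹ : ℝ) : ℂ) * w := by fun_prop
      have h := this.tendsto (p : ℂ)
      rw [Complex.ofReal_inv, inv_mul_cancel₀ hpc] at h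
      rw [Complex.ofReal_inv]
      exact h.mono_left nhdsWithin_le_nhds
    · filter_upwards [self_mem_nhdsWithin] with w hw
      obtain ⟨⟨h1, h2, h3⟩, hne⟩ := hw
      have hp' := inv_pos.2 hp
      refine ⟨⟨?_, ?_, ?_⟩, fun e => hne ?_⟩
      · simp only [re_ofReal_mul]; positivity
      · simp only [im_ofReal_mul]; rw [one_mul] at h2 ⊢; positivity
      · simp only [re_ofReal_mul, im_ofReal_mul]
        have := mul_lt_mul_of_pos_left h3 hp'
        nlinarith
      · rw [mem_singleton_iff] at e ⊢
        have e2 := congrArg (fun x => (p : ℂ) * x) e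
        simp only [Complex.ofReal_inv, mul_inv_cancel_left₀ hpc, mul_one] at e2
        exact e2
  refine (hL.comp hmap).congr' ?_
  have hoff : ∀ᶠ w in 𝓝[raySector 1 η \ {(p : ℂ)}] (p : ℂ), w ∉ (rowPoles lam i).erase p := by
    refine Eventually.filter_mono nhdsWithin_le_nhds ?_
    exact ((rowPoles lam i).erase p).finite_toSet.isClosed.compl_mem_nhds (by simp)
  filter_upwards [self_mem_nhdsWithin, hoff] with w hw hwP
  have hwoff : ∀ j ≤ n, w ≠ partialSum (fun r => z (β r)) j := by
    intro j hj e
    apply hwP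
    rw [Finset.mem_erase]
    exact ⟨hw.2, e ▸ h.partialSum_mem β i k hβ (by omega)⟩
  exact (hsc.unique (hJ n _ hg0) hg1 hg0 le_rfl le_rfl
    (fun j hj => (partialSum_castSucc (fun r => z (β r)) hj).symm) hw.1 hwoff
    (fun j hj => by rw [partialSum_castSucc (fun r => z (β r)) hj]; exact hwoff j hj))

/-- The Stokes matrix of the positive reals as a sum over words. -/
theorem Weighted.exists_stokesMatrix (h : Weighted lam z F) {η : ℝ}
    (hfree : SectorFree lam (∑ a, F a) η) :
    ∃ Ψ S, RowFamily lam (∑ a, F a) 1 η Ψ ∧ IsStokesMatrix lam (∑ a, F a) η Ψ S ∧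
      ∀ i j, Summable (fun n => ‖wordTerm z F (ray 1) (n + 1) i j‖) ∧
        HasSum (fun n => wordTerm z F (ray 1) (n + 1) i j) (S i j) := by
  have hη := hfree.pos
  set f := ∑ a, F a with hf
  have hP := fun i => hfree.poles (Or.inl rfl) i
  have hgr := fun i => exists_gradedSolution (rowPoles lam i) (rowResidue lam f i)
    (rowResidue_of_notMem lam f i) (rowResidue_mul_self lam f hfree.diag i) (Or.inl rfl) hη (hP i)
    (rowResidue_zero_base lam f hfree.diag i)
  choose Ψ Φ hΦ using hgr
  obtain ⟨J, hJ⟩ := exists_wordPrimitive z η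
  have hpole := fun i => (hΦ i).pole
  choose! Θ Θs hΘ hΘ0 hΘs hsumm hsum using hpole
  have hray : ∀ w : ℂ, w ∈ ray 1 ↔ ∃ p : ℝ, 0 < p ∧ w = p := by
    intro w; simp [ray]
  -- the terms
  have hterm : ∀ i j, ∀ p : ℝ, 0 < p → lam i - lam j = p → ∀ n,
      wordTerm z F (ray 1) (n + 1) i j = 2 * π * I * ∑ l, Θs i p n l * f l j := by
    intro i j p hp hij n
    have hnb := neBot_sector_pole (κ := 1) hη hp
    have hoff : ∀ᶠ w in 𝓝[raySector 1 η \ {(p : ℂ)}] (p : ℂ), w ∉ rowPoles lam i := by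
      have : ∀ᶠ w in 𝓝[raySector 1 η \ {(p : ℂ)}] (p : ℂ), w ∉ (rowPoles lam i).erase p := by
        refine Eventually.filter_mono nhdsWithin_le_nhds ?_
        exact ((rowPoles lam i).erase p).finite_toSet.isClosed.compl_mem_nhds (by simp)
      filter_upwards [this, self_mem_nhdsWithin] with w h1 h2 h3
      exact h1 (Finset.mem_erase.2 ⟨h2.2, h3⟩)
    have hcomp : ∀ l, Tendsto (fun w => Φ i n w l * f l j)
        (𝓝[raySector 1 η \ {(p : ℂ)}] (p : ℂ)) (𝓝 (Θs i p n l * f l j)) := by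
      intro l
      by_cases hfl : f l j = 0
      · simp only [hfl, mul_zero]; exact tendsto_const_nhds
      refine Tendsto.mul_const _ ?_
      have hlp : ¬ lam i - lam l = p := fun e => hfl (hfree.diag l j (by
        linear_combination hij - e))
      rcases n with _ | n
      · exact (tendsto_pi_nhds.1 (hΘ0 i p hp)) l
      · refine ((tendsto_pi_nhds.1 (hΘs i p hp n)) l).congr fun w => ?_
        rw [Pi.sub_apply, Pi.smul_apply, rowResidue_apply, if_neg hlp, smul_zero, sub_zero]
    have hlim1 := tendsto_finsetSum Finset.univ fun l _ => hcomp l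
    have hβ : ∀ β : Fin (n + 1) → A, ∃ L, Tendsto
        (fun w => J n (fun r => β r.castSucc) n w * wordProd F β i j)
        (𝓝[raySector 1 η \ {(p : ℂ)}] (p : ℂ)) (𝓝 (L * wordProd F β i j)) ∧
        M (n + 1) (fun r => z (β r)) * wordProd F β i j =
          (-1) ^ n * (2 * π * I) * (L * wordProd F β i j) := by
      intro β
      by_cases h0 : wordProd F β i j = 0
      · refine ⟨0, ?_, ?_⟩ <;> simp only [h0, mul_zero]
        exact tendsto_const_nhds
      · obtain ⟨L, hL, hM⟩ := h.tendsto_primitive hη (hP i) hJ β h0 hp hij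
        exact ⟨L, hL.mul_const _, by rw [hM]; ring⟩
    choose L hL hM using hβ
    have hlim2 := (tendsto_finsetSum Finset.univ fun β _ => hL β).const_mul ((-1) ^ n)
    have heq := tendsto_nhds_unique (hlim2.congr' (by
      filter_upwards [hoff, self_mem_nhdsWithin] with w hw1 hw2
      have e := fun l => (hΦ i).eq_sum_words h hη (hP i) hJ n hw2.1 hw1 l
      rw [sum_words_mul F (fun α => J n α n w) i j, ← hf, mul_sum]
      refine sum_congr rfl fun l _ => ?_
      rw [← mul_assoc, ← e])) hlim1
    rw [h.wordTerm_eq_sum (n + 1) ((hray _).2 ⟨p, hp, hij⟩), ← heq]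
    simp only [hM, ← mul_sum]
    ring
  classical
  set S : Mat(ι) := fun i j => if (∃ p : ℝ, 0 < p ∧ lam i - lam j = p) then
    2 * π * I * ∑ l, Θ i (lam i - lam j).re l * f l j else 0 with hS
  refine ⟨Ψ, S, fun i => (hΦ i).sol, ⟨fun i j hij => ?_, fun i p hp => ⟨Θ i p, hΘ i p hp, ?_⟩⟩, ?_⟩
  · simp only [hS]
    rw [if_neg]
    rintro ⟨p, hp, e⟩
    exact hij p hp e
  · intro j hij
    simp only [hS]
    rw [if_pos ⟨p, hp, hij⟩, hij, ofReal_re]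
  · intro i j
    by_cases hij : ∃ p : ℝ, 0 < p ∧ lam i - lam j = p
    · obtain ⟨p, hp, e⟩ := hij
      have hSij : S i j = 2 * π * I * ∑ l, Θ i p l * f l j := by
        simp only [hS]
        rw [if_pos ⟨p, hp, e⟩, e, ofReal_re]
      simp only [hterm i j p hp e, hSij]
      constructor
      · refine Summable.of_nonneg_of_le (fun n => norm_nonneg _) (fun n => ?_)
          ((hsumm i p hp).mul_left (‖(2 * π * I : ℂ)‖ * ∑ l, ‖f l j‖))
        rw [norm_mul, mul_assoc ‖(2 * π * I : ℂ)‖, sum_mul]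
        refine mul_le_mul_of_nonneg_left ?_ (norm_nonneg _)
        refine (norm_sum_le _ _).trans (sum_le_sum fun l _ => ?_)
        rw [norm_mul, mul_comm]
        exact mul_le_mul_of_nonneg_left (norm_le_pi_norm _ l) (norm_nonneg _)
      · refine HasSum.mul_left _ (hasSum_sum fun l _ => HasSum.mul_right _ ?_)
        exact (Pi.hasSum.1 (hsum i p hp)) l
    · have h0 : ∀ n, wordTerm z F (ray 1) n i j = 0 := fun n =>
        h.wordTerm_eq_zero n (fun hr => hij ((hray _).1 hr))
      have hSij : S i j = 0 := by simp only [hS]; rw [if_neg hij]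
      simp only [h0, hSij, norm_zero]
      exact ⟨summable_zero, hasSum_zero⟩

end Words

section Scaling

theorem partialSum_div {n : ℕ} (z : Fin n → ℂ) (c : ℂ) (j : ℕ) :
    partialSum (fun i => z i / c) j = partialSum z j / c := by
  simp only [partialSum, Finset.sum_div]
  exact sum_congr rfl fun i _ => by split_ifs <;> simp

theorem M_div {n : ℕ} (z : Fin n → ℂ) {c : ℂ} (hc : c ≠ 0) : M n (fun i => z i / c) = M n z := by
  have hq : ∀ j, partialSum (fun i => z i / c) j / partialSum (fun i => z i / c) n =
      partialSum z j / partialSum z n := by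
    intro j; rw [partialSum_div, partialSum_div, div_div_div_cancel_right₀ hc]
  have hI : interiorPoints (fun i => z i / c) = interiorPoints z := by
    unfold interiorPoints; simp only [hq]
  have hp : ∀ ε, perturbedSegment (fun i => z i / c) ε = fun x => c⁻¹ * perturbedSegment z ε x := by
    intro ε; funext x
    simp only [perturbedSegment, hI, partialSum_div]
    ring
  have hk : (fun k => partialSum (fun i => z i / c) (k + 1)) = fun k => c⁻¹ * partialSum z (k + 1) := by
    funext k; rw [partialSum_div]; ring
  simp only [M, hp, hk, iteratedIntegral_const_mul (inv_ne_zero hc)]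

theorem mem_ray_div {ζ w : ℂ} (hζ : ζ ≠ 0) : w / ζ ∈ ray 1 ↔ w ∈ ray ζ := by
  simp only [ray, mem_ofPred_eq, mul_one]
  refine exists_congr fun c => and_congr Iff.rfl ?_
  rw [div_eq_iff hζ]

theorem mem_halfAt_mul {ζ u t : ℂ} (hζ : ζ ≠ 0) : t ∈ halfAt (ζ * u) ↔ t / ζ ∈ halfAt u := by
  have e : t * conj (ζ * u) = ((‖ζ‖ ^ 2 : ℝ) : ℂ) * (t / ζ * conj u) := by
    rw [map_mul, ← normSq_eq_norm_sq, ← Complex.mul_conj]; field_simp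
  have hn : 0 < ‖ζ‖ ^ 2 := by have := norm_pos_iff.2 hζ; positivity
  simp only [halfAt, mem_ofPred_eq, e, re_ofReal_mul]
  exact mul_pos_iff_of_pos_left hn

variable {ι : Type*} [Fintype ι] [DecidableEq ι] {A : Type*} [Fintype A]

theorem wordTerm_div (z : A → ℂ) (F : A → Mat(ι)) {ζ : ℂ} (hζ : ζ ≠ 0) (n : ℕ) :
    wordTerm (fun a => z a / ζ) F (ray 1) n = wordTerm z F (ray ζ) n := by
  classical
  unfold wordTerm
  refine sum_congr (Finset.filter_congr fun α _ => ?_) fun α _ => ?_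
  · rw [← Finset.sum_div, mem_ray_div hζ]
  · rw [M_div (fun j => z (α j)) hζ]

theorem sector_mono {κ η η' : ℝ} (h : η' ≤ η) : sector κ η' ⊆ sector κ η := fun _ hw =>
  ⟨hw.1, hw.2.1, hw.2.2.trans_le (mul_le_mul_of_nonneg_right h hw.1.le)⟩

theorem exists_sector_avoiding (W : Finset ℂ) :
    ∃ η > 0, ∀ κ, IsSign κ → ∀ w ∈ W, w ∉ sector κ η := by
  have h1 : ∀ w ∈ W, ∃ η > 0, ∀ κ, IsSign κ → w ∉ sector κ η := by
    intro w _
    by_cases hre : 0 < w.re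
    · by_cases him : w.im = 0
      · exact ⟨1, one_pos, fun κ _ h => by have := h.2.1; rw [him, mul_zero] at this; linarith⟩
      · refine ⟨|w.im| / w.re, div_pos (abs_pos.2 him) hre, fun κ hκ h => ?_⟩
        have h2 := h.2.2
        have h3 := h.2.1
        have h4 : |κ * w.im| = |w.im| := by
          rw [abs_mul]; rcases hκ with h | h <;> rw [h] <;> norm_num
        rw [abs_of_pos h3] at h4
        rw [div_mul_cancel₀ _ hre.ne', h4] at h2
        exact lt_irrefl _ h2
    · exact ⟨1, one_pos, fun κ _ h => hre h.1⟩
  choose! η hη hη' using h1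
  rcases W.eq_empty_or_nonempty with rfl | hne
  · exact ⟨1, one_pos, by simp⟩
  · refine ⟨W.inf' hne η, (Finset.lt_inf'_iff _).2 hη, fun κ hκ w hw h => ?_⟩
    exact hη' w hw κ hκ (sector_mono (Finset.inf'_le _ hw) h)

theorem exists_direction_mul {ζ : ℂ} (hζ : ζ ≠ 0) {κ η : ℝ} (hκ : IsSign κ) {y₁ y₂ : ℝ}
    (h₁ : 0 < y₁) (h₂ : 0 < y₂) (h₁' : y₁ < η) (h₂' : y₂ < η) {ω : ℂ} (hω : ω ≠ 0)
    (hω' : ω / ζ ∉ sector κ η) :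
    ∃ d ∈ halfAt (ζ * dir κ y₁) ∩ halfAt (ζ * dir κ y₂), (ω * conj d).re < 0 := by
  obtain ⟨d, hd, hneg⟩ := exists_direction hκ h₁ h₂ h₁' h₂' (div_ne_zero hω hζ) hω'
  rw [← mul_div_cancel_left₀ d hζ] at hd
  refine ⟨ζ * d, ⟨(mem_halfAt_mul hζ).2 hd.1, (mem_halfAt_mul hζ).2 hd.2⟩, ?_⟩
  have e : ω * conj (ζ * d) = ((‖ζ‖ ^ 2 : ℝ) : ℂ) * (ω / ζ * conj d) := by
    rw [map_mul, ← normSq_eq_norm_sq, ← Complex.mul_conj]; field_simp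
  have hn : 0 < ‖ζ‖ ^ 2 := by have := norm_pos_iff.2 hζ; positivity
  rw [e, re_ofReal_mul]
  exact mul_neg_of_pos_of_neg hn hneg

/-- Row solutions in the directions adjacent to the ray of `ζ`, and the Stokes matrix that relates
them. -/
structure CanonicalRows (lam : ι → ℂ) (f : Mat(ι)) (ζ : ℂ) (η : ℝ)
    (X : ℝ → ℝ → ℂ → Mat(ι)) (S : Mat(ι)) : Prop where
  pos : 0 < η
  free : ∀ κ, IsSign κ → ∀ a b, (lam a - lam b) / ζ ∉ sector κ η
  equation : ∀ κ, IsSign κ → ∀ y ∈ Ioo 0 η, RowEquation lam f (halfAt (ζ * dir κ y)) (X κ y)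
  asymptotic : ∀ κ, IsSign κ → ∀ y ∈ Ioo 0 η, RowAsymptotic lam (𝓝[halfAt (ζ * dir κ y)] 0) (X κ y)
  isUnit : ∀ κ, IsSign κ → ∀ y ∈ Ioo 0 η, ∀ t ∈ halfAt (ζ * dir κ y), IsUnit (X κ y t)
  jump : ∀ y ∈ Ioo 0 η, ∀ y' ∈ Ioo 0 η, ∀ t ∈ halfAt (ζ * dir (-1) y) ∩ halfAt (ζ * dir 1 y'),
    X 1 y' t = (1 + S) * X (-1) y t

theorem Weighted.exists_canonicalRows {lam : ι → ℂ} {z : A → ℂ} {F : A → Mat(ι)}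
    (h : Weighted lam z F) {ζ : ℂ} (hζ : ζ ≠ 0) : ∃ η X S, CanonicalRows lam (∑ a, F a) ζ η X S ∧
      ∀ i j, Summable (fun n => ‖wordTerm z F (ray ζ) (n + 1) i j‖) ∧
        HasSum (fun n => wordTerm z F (ray ζ) (n + 1) i j) (S i j) := by
  set lam' : ι → ℂ := fun a => lam a / ζ with hlam'
  set f := ∑ a, F a with hf
  have h' : Weighted lam' (fun a => z a / ζ) F :=
    ⟨fun a => div_ne_zero (h.ne_zero a) hζ, fun a i k hne => by
      simp only [hlam']; rw [← sub_div, h.weight a i k hne]⟩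
  obtain ⟨η, hη, hfree⟩ := exists_sector_avoiding
    (Finset.univ.image fun p : ι × ι => lam' p.1 - lam' p.2)
  have hSF : SectorFree lam' f η :=
    ⟨hη, h'.sum_eq_zero, fun κ hκ a b => hfree κ hκ _ (Finset.mem_image.2 ⟨(a, b), by simp, rfl⟩)⟩
  obtain ⟨ΨL, S, hL, hS, hsum⟩ := h'.exists_stokesMatrix hSF
  obtain ⟨ΨR, hR⟩ := hSF.exists_rowFamily (Or.inr rfl)
  classical
  set Ψ : ℝ → ι → ℂ → ι → ℂ := fun κ => if κ = 1 then ΨL else ΨR with hΨ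
  have hΨ1 : Ψ 1 = ΨL := by simp [hΨ]
  have hΨ2 : Ψ (-1) = ΨR := by simp only [hΨ]; rw [if_neg (by norm_num)]
  have hfam : ∀ κ, IsSign κ → RowFamily lam' f κ η (Ψ κ) := by
    rintro κ (rfl | rfl)
    · rw [hΨ1]; exact hL
    · rw [hΨ2]; exact hR
  have hexp : ∀ i t, lam' i / (t / ζ) = lam i / t := by
    intro i t; simp only [hlam']; rw [div_div_div_cancel_right₀ hζ]
  refine ⟨η, fun κ y t => laplaceRows lam' (Ψ κ) (dir κ y) (t / ζ), S, ⟨hη, ?_, ?_, ?_, ?_, ?_⟩, ?_⟩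
  · intro κ hκ a b
    have := hSF.free κ hκ a b
    simpa only [hlam', ← sub_div] using this
  · intro κ hκ y hy t ht i k
    have ht' := (mem_halfAt_mul hζ).1 ht
    have ht0 : t ≠ 0 := ne_zero_of_mem_halfAt ht
    have h1 := (hfam κ hκ).rowEquation hSF hκ hy.1 hy.2 (t / ζ) ht' i k
    have h2 : HasDerivAt (fun t : ℂ => t / ζ) (1 / ζ) t := (hasDerivAt_id t).div_const ζ
    refine (h1.comp t h2).congr_deriv ?_
    simp only [hlam']
    field_simp
  · intro κ hκ y hy i k
    have h1 := (hfam κ hκ).rowAsymptotic_halfAt hSF hκ hy.1 hy.2 i k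
    have h2 : Tendsto (fun t : ℂ => t / ζ) (𝓝[halfAt (ζ * dir κ y)] 0) (𝓝[halfAt (dir κ y)] 0) := by
      refine tendsto_nhdsWithin_iff.2 ⟨?_, ?_⟩
      · have : Continuous fun t : ℂ => t / ζ := by fun_prop
        have h := this.tendsto 0
        rw [zero_div] at h
        exact h.mono_left nhdsWithin_le_nhds
      · filter_upwards [self_mem_nhdsWithin] with t ht using (mem_halfAt_mul hζ).1 ht
    refine (h1.comp h2).congr fun t => ?_
    simp only [Function.comp, hexp]
  · intro κ hκ y hy t ht
    exact (hfam κ hκ).isUnit_laplaceRows hSF hκ hy.1 hy.2 ((mem_halfAt_mul hζ).1 ht)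
  · rintro y hy y' hy' t ⟨ht1, ht2⟩
    rw [mem_halfAt_mul hζ] at ht1 ht2
    have hre : 0 < (t / ζ).re := by
      have e1 := mem_halfAt_dir.1 ht1
      have e2 := mem_halfAt_dir.1 ht2
      have := mul_pos hy'.1 e1
      have := mul_pos hy.1 e2
      have hyy : 0 < y + y' := add_pos hy.1 hy'.1
      by_contra hneg
      have := mul_nonneg hyy.le (neg_nonneg.2 (not_lt.1 hneg))
      nlinarith
    simp only [hΨ1, hΨ2]
    rw [hL.laplaceRows_eq_real hSF (Or.inl rfl) hy'.1 hy'.2 hre ht2,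
      hR.laplaceRows_eq_real hSF (Or.inr rfl) hy.1 hy.2 hre ht1,
      RowFamily.laplaceRows_jump hSF hL hR hS hre]
  · simpa only [wordTerm_div z F hζ] using hsum

theorem exists_canonicalRows_of_diag {lam : ι → ℂ} {f : Mat(ι)}
    (hf : ∀ a b, lam a = lam b → f a b = 0) {ζ : ℂ} (hζ : ζ ≠ 0) :
    ∃ η X S, CanonicalRows lam f ζ η X S := by
  classical
  have hW : Weighted (A := {p : ι × ι // lam p.1 ≠ lam p.2}) lam
      (fun p => lam p.1.1 - lam p.1.2) (fun p => Matrix.single p.1.1 p.1.2 (f p.1.1 p.1.2)) := by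
    refine ⟨fun p => sub_ne_zero.2 p.2, fun p i k hne => ?_⟩
    by_cases hik : p.1.1 = i ∧ p.1.2 = k
    · rw [hik.1, hik.2]
    · exact absurd (Matrix.single_apply_of_ne _ _ _ _ _ hik) hne
  obtain ⟨η, X, S, h, -⟩ := hW.exists_canonicalRows hζ
  have e : (∑ p : {p : ι × ι // lam p.1 ≠ lam p.2},
      Matrix.single p.1.1 p.1.2 (f p.1.1 p.1.2)) = f := by
    ext i k
    rw [Matrix.sum_apply]
    by_cases hik : lam i = lam k
    · rw [hf i k hik]
      refine Finset.sum_eq_zero fun p _ => Matrix.single_apply_of_ne _ _ _ _ _ ?_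
      rintro ⟨h1, h2⟩
      exact p.2 (by rw [h1, h2, hik])
    · rw [sum_eq_single ⟨(i, k), hik⟩]
      · simp
      · intro p _ hp
        refine Matrix.single_apply_of_ne _ _ _ _ _ ?_
        rintro ⟨h1, h2⟩
        exact hp (Subtype.ext (Prod.ext h1 h2))
      · intro h; exact absurd (Finset.mem_univ _) h
  rw [e] at h
  exact ⟨η, X, S, h⟩

theorem radial_le_nhdsWithin {u d : ℂ} (hd : d ∈ halfAt u) : radial d ≤ 𝓝[halfAt u] 0 := by
  refine tendsto_nhdsWithin_iff.2 ⟨?_, ?_⟩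
  · have : Continuous fun τ : ℝ => (τ : ℂ) * d := by fun_prop
    have h := this.tendsto 0
    simp only [ofReal_zero, zero_mul] at h
    exact h.mono_left nhdsWithin_le_nhds
  · filter_upwards [self_mem_nhdsWithin] with τ hτ using ofReal_mul_mem_halfAt hd hτ

theorem CanonicalRows.mul_col {lam : ι → ℂ} {f : Mat(ι)} {ζ : ℂ} {η : ℝ}
    {X : ℝ → ℝ → ℂ → Mat(ι)} {S : Mat(ι)} (h : CanonicalRows lam f ζ η X S)
    (hζ : ζ ≠ 0) {κ : ℝ} (hκ : IsSign κ) {y : ℝ} (hy : y ∈ Ioo 0 η)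
    {Y : ℂ → Mat(ι)} (hY : ColEquation lam f (halfAt (ζ * dir κ y)) Y)
    (hY' : ColAsymptotic lam (𝓝[halfAt (ζ * dir κ y)] 0) Y) {t : ℂ}
    (ht : t ∈ halfAt (ζ * dir κ y)) : X κ y t * Y t = 1 :=
  mul_eq_one_of_asymptotic (convex_halfAt _) (fun _ hd _ hτ => ofReal_mul_mem_halfAt hd hτ)
    (h.equation κ hκ y hy) hY
    (fun _ hd i k => (h.asymptotic κ hκ y hy i k).mono_left (radial_le_nhdsWithin hd))
    (fun _ hd i k => (hY' i k).mono_left (radial_le_nhdsWithin hd))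
    (fun a b hab => by
      simpa only [inter_self] using
        exists_direction_mul hζ hκ hy.1 hy.1 hy.2 hy.2 (sub_ne_zero.2 hab) (h.free κ hκ a b)) ht

/-- A vector solution that is small with respect to a generic exponential vanishes. -/
theorem CanonicalRows.col_eq_zero {lam : ι → ℂ} {f : Mat(ι)} {ζ : ℂ} {η : ℝ}
    {X : ℝ → ℝ → ℂ → Mat(ι)} {S : Mat(ι)} (h : CanonicalRows lam f ζ η X S)
    (hζ : ζ ≠ 0) {κ : ℝ} (hκ : IsSign κ) {y : ℝ} (hy : y ∈ Ioo 0 η) {μ : ℂ}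
    (hμ : ∀ a, (lam a - μ) / ζ ∉ sector κ η)
    {φ : ℂ → Matrix ι Unit ℂ} (hφ : ColEquation lam f (halfAt (ζ * dir κ y)) φ)
    (hφ' : ∀ a, Tendsto (fun t => φ t a () * exp (μ / t)) (𝓝[halfAt (ζ * dir κ y)] 0) (𝓝 0))
    {t : ℂ} (ht : t ∈ halfAt (ζ * dir κ y)) : φ t = 0 := by
  set U := halfAt (ζ * dir κ y) with hU
  have hX := h.equation κ hκ y hy
  have key : ∀ a, Tendsto (fun s => exp (-((lam a - μ) / s)) * (X κ y t * φ t) a ())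
      (𝓝[U] 0) (𝓝 0) := by
    intro a
    have h1 : Tendsto (fun s => ∑ j, (exp (-(lam a / s)) * X κ y s a j) *
        (φ s j () * exp (μ / s))) (𝓝[U] 0)
        (𝓝 (∑ j, (1 : Mat(ι)) a j * 0)) :=
      tendsto_finsetSum _ fun j _ => (h.asymptotic κ hκ y hy a j).mul (hφ' j)
    simp only [mul_zero, Finset.sum_const_zero] at h1
    refine h1.congr' ?_
    filter_upwards [self_mem_nhdsWithin] with s hs
    rw [hX.mul_col_eq (convex_halfAt _) hφ ht hs, Matrix.mul_apply, mul_sum]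
    refine sum_congr rfl fun j _ => ?_
    rw [sub_div, neg_sub, sub_eq_add_neg, exp_add]
    ring
  have hzero : X κ y t * φ t = 0 := by
    ext a b
    rw [Matrix.zero_apply, show b = () from rfl]
    by_cases haμ : lam a = μ
    · have h1 := (key a).mono_left (radial_le_nhdsWithin ht)
      simp only [haμ, sub_self, zero_div, neg_zero, exp_zero, one_mul] at h1
      exact tendsto_nhds_unique tendsto_const_nhds h1
    · obtain ⟨d, hd, hneg⟩ := exists_direction_mul hζ hκ hy.1 hy.1 hy.2 hy.2
        (sub_ne_zero.2 haμ) (hμ a)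
      exact eq_zero_of_tendsto_radial hneg ((key a).mono_left (radial_le_nhdsWithin hd.1))
  obtain ⟨u, hu⟩ := h.isUnit κ hκ y hy t ht
  have h2 : (↑u⁻¹ : Mat(ι)) * (X κ y t * φ t) = φ t := by
    rw [← hu, ← Matrix.mul_assoc, Units.inv_mul, Matrix.one_mul]
  rw [← h2, hzero, Matrix.mul_zero]

theorem CanonicalRows.mono {lam : ι → ℂ} {f : Mat(ι)} {ζ : ℂ} {η η' : ℝ}
    {X : ℝ → ℝ → ℂ → Mat(ι)} {S : Mat(ι)} (h : CanonicalRows lam f ζ η X S)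
    (h0 : 0 < η') (hle : η' ≤ η) : CanonicalRows lam f ζ η' X S :=
  have hsub : ∀ {y : ℝ}, y ∈ Ioo 0 η' → y ∈ Ioo 0 η := fun hy => ⟨hy.1, hy.2.trans_le hle⟩
  ⟨h0, fun κ hκ a b hm => h.free κ hκ a b (sector_mono hle hm),
    fun κ hκ y hy => h.equation κ hκ y (hsub hy), fun κ hκ y hy => h.asymptotic κ hκ y (hsub hy),
    fun κ hκ y hy => h.isUnit κ hκ y (hsub hy),
    fun y hy y' hy' => h.jump y (hsub hy) y' (hsub hy')⟩

end Scaling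

section Rays

theorem halfPlane_ray {u : ℂ} (hu : u ≠ 0) : halfPlane (ray u) = halfAt u := by
  ext t
  have hn : 0 < ‖u‖ ^ 2 := by have := norm_pos_iff.2 hu; positivity
  constructor
  · rintro ⟨w, ⟨c, hc, rfl⟩, v, hv, rfl⟩
    have e : (c * u * v) * conj u = ((c * ‖u‖ ^ 2 : ℝ) : ℂ) * v := by
      rw [← normSq_eq_norm_sq]; push_cast; rw [← Complex.mul_conj]; ring
    rw [halfAt, mem_ofPred_eq, e, re_ofReal_mul]
    positivity
  · intro ht
    refine ⟨u, ⟨1, one_pos, by simp⟩, t / u, ?_, by field_simp⟩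
    have h1 := (mem_halfAt_mul (u := 1) hu).1 (by rwa [mul_one])
    simpa [halfAt] using h1

theorem ray_ofReal_mul {u : ℂ} {c : ℝ} (hc : 0 < c) : ray (c * u) = ray u := by
  have hcc : (c : ℂ) ≠ 0 := by exact_mod_cast hc.ne'
  ext w
  constructor
  · rintro ⟨d, hd, rfl⟩
    exact ⟨d * c, mul_pos hd hc, by push_cast; ring⟩
  · rintro ⟨d, hd, rfl⟩
    exact ⟨d / c, div_pos hd hc, by push_cast; field_simp⟩

theorem rotate_ray (θ : ℝ) (u : ℂ) : rotate θ (ray u) = ray (exp (θ * I) * u) := by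
  ext w
  constructor
  · rintro ⟨x, ⟨c, hc, rfl⟩, rfl⟩
    exact ⟨c, hc, by ring⟩
  · rintro ⟨c, hc, rfl⟩
    exact ⟨c * u, ⟨c, hc, rfl⟩, by ring⟩

theorem exp_mul_I_eq {κ : ℝ} (hκ : IsSign κ) {θ : ℝ} (hθ : θ ∈ Ioo 0 (π / 2)) :
    exp ((κ * θ : ℝ) * I) = (Real.cos θ : ℂ) * dir κ (tan θ) := by
  have hcos : Real.cos θ ≠ 0 := (Real.cos_pos_of_mem_Ioo ⟨by linarith [hθ.1, pi_pos], hθ.2⟩).ne'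
  rw [Complex.exp_mul_I, ← Complex.ofReal_cos, ← Complex.ofReal_sin]
  apply Complex.ext
  · simp only [Complex.add_re, ofReal_re, Complex.mul_re, Complex.I_re, Complex.I_im,
      ofReal_im, dir]
    rcases hκ with h | h <;> rw [h] <;> simp
  · simp only [add_im, ofReal_re, Complex.mul_im, Complex.I_re, Complex.I_im,
      ofReal_im, dir]
    rw [Real.tan_eq_sin_div_cos]
    rcases hκ with h | h <;> rw [h] <;> simp <;> field_simp

theorem halfPlane_rotate {ζ : ℂ} (hζ : ζ ≠ 0) {κ : ℝ} (hκ : IsSign κ) {θ : ℝ}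
    (hθ : θ ∈ Ioo 0 (π / 2)) : halfPlane (rotate (κ * θ) (ray ζ)) = halfAt (ζ * dir κ (tan θ)) := by
  have hcos : 0 < Real.cos θ := Real.cos_pos_of_mem_Ioo ⟨by linarith [hθ.1, pi_pos], hθ.2⟩
  rw [rotate_ray, exp_mul_I_eq hκ hθ, mul_assoc, ray_ofReal_mul hcos, mul_comm,
    halfPlane_ray (mul_ne_zero hζ (dir_ne_zero _ _))]

end Rays

section Components

/-- The components of an element of an invariant subspace, with respect to distinct systems of
eigenvalues of a family of operators, belong to the subspace. -/
theorem mem_of_sum_mem {V I K : Type*} [AddCommGroup V] [Module ℂ V] (W : Submodule ℂ V)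
    (T : I → Module.End ℂ V) (hT : ∀ i, ∀ w ∈ W, T i w ∈ W) (χ : K → I → ℂ) (s : Finset K) :
    ∀ v : K → V, Set.InjOn χ s → (∀ c ∈ s, ∀ i, T i (v c) = χ c i • v c) → ∑ c ∈ s, v c ∈ W →
      ∀ c ∈ s, v c ∈ W := by
  classical
  induction s using Finset.induction_on with
  | empty => simp
  | insert a s ha ih =>
    intro v hχ hv hsum
    have hs : ∀ c ∈ s, v c ∈ W := by
      intro c hc
      have hne : χ c ≠ χ a := fun h =>
        ha (hχ (by simp [hc]) (by simp) h ▸ hc)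
      obtain ⟨i, hi⟩ := Function.ne_iff.1 hne
      have h1 := ih (fun c => (χ c i - χ a i) • v c) (hχ.mono (by simp))
        (fun c hc j => by
          rw [map_smul, hv c (Finset.mem_insert_of_mem hc) j, smul_comm]) ?_ c hc
      · exact (W.smul_mem_iff (sub_ne_zero.2 hi)).1 h1
      · have h2 := W.sub_mem (hT i _ hsum) (W.smul_mem (χ a i) hsum)
        rw [map_sum, sum_insert ha, sum_insert ha, hv a (by simp), smul_add,
          add_sub_add_left_eq_sub, smul_sum, ← sum_sub_distrib] at h2
        convert h2 using 1
        exact sum_congr rfl fun c hc => by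
          rw [hv c (Finset.mem_insert_of_mem hc), sub_smul]
    intro c hc
    rcases Finset.mem_insert.1 hc with rfl | hc
    · rw [sum_insert ha] at hsum
      exact (W.add_mem_iff_left (W.sum_mem hs)).1 hsum
    · exact hs c hc

end Components

section Derivations

variable {N : ℕ}

/-- The ideal of polynomials vanishing on `G`. -/
def vanishing (G : AlgGroup N) : Ideal (Poly[N]) where
  carrier := {p | ∀ g : G.toSubgroup, polyEval p (mat g) = 0}
  zero_mem' := by intro g; simp [polyEval]
  add_mem' := by intro p q hp hq g; have := hp g; have := hq g; simp_all [polyEval]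
  smul_mem' := by intro c p hp g; have := hp g; simp_all [polyEval]

theorem mem_iff_vanishing {G : AlgGroup N} (g : GL (Fin N) ℂ) :
    g ∈ G.toSubgroup ↔ ∀ p ∈ vanishing G, polyEval p (g : Mat[N]) = 0 := by
  refine ⟨fun hg p hp => hp ⟨g, hg⟩, fun h => ?_⟩
  obtain ⟨P, hP⟩ := G.isZariskiClosed
  exact (hP g).2 fun p hp => h p fun g' => (hP g').1 g'.2 p hp

/-- The left invariant vector field on matrices with value `X` at `1`, as a derivation. -/
def invDerivation (X : Mat[N]) : Derivation ℂ (Poly[N]) (Poly[N]) :=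
  MvPolynomial.mkDerivation ℂ fun ij =>
    ∑ k, MvPolynomial.X (ij.1, k) * MvPolynomial.C (X k ij.2)

theorem invDerivation_X (X : Mat[N]) (ij : Fin N × Fin N) : invDerivation X (MvPolynomial.X ij) =
      ∑ k, MvPolynomial.X (ij.1, k) * MvPolynomial.C (X k ij.2) :=
  MvPolynomial.mkDerivation_X _ _ _

theorem derivation_sum_apply {A K : Type*} [CommRing A] [Algebra ℂ A] (s : Finset K)
    (D : K → Derivation ℂ A A) (a : A) : (∑ i ∈ s, D i) a = ∑ i ∈ s, D i a := by
  classical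
  induction s using Finset.induction_on with
  | empty => simp
  | insert b s hb ih => rw [sum_insert hb, sum_insert hb, Derivation.add_apply, ih]

theorem leftInvDeriv_eq (X : Mat[N]) (p : Poly[N]) : leftInvDeriv X p = invDerivation X p := by
  have h : (∑ ij : Fin N × Fin N, (∑ k, MvPolynomial.X (ij.1, k) * MvPolynomial.C (X k ij.2)) •
      pderiv (R := ℂ) ij) = invDerivation X := by
    refine derivation_ext fun ij => ?_
    rw [invDerivation_X, derivation_sum_apply, sum_eq_single ij]
    · simp
    · intro b _ hb
      rw [Derivation.smul_apply, MvPolynomial.pderiv_X_of_ne (Ne.symm hb), smul_zero]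
    · simp
  rw [← h, leftInvDeriv, derivation_sum_apply]
  exact sum_congr rfl fun ij _ => by rw [Derivation.smul_apply, smul_eq_mul, mul_comm]

theorem invDerivation_add (X Y : Mat[N]) :
    invDerivation (X + Y) = invDerivation X + invDerivation Y := by
  refine derivation_ext fun ij => ?_
  simp [invDerivation_X, mul_add, sum_add_distrib]

theorem invDerivation_smul (c : ℂ) (X : Mat[N]) : invDerivation (c • X) = c • invDerivation X := by
  refine derivation_ext fun ij => ?_
  rw [Derivation.smul_apply, invDerivation_X, invDerivation_X, smul_sum]
  refine sum_congr rfl fun k _ => ?_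
  rw [Matrix.smul_apply, smul_eq_mul, map_mul, smul_eq_C_mul]
  ring

theorem invDerivation_commutator (A B : Mat[N]) (p : Poly[N]) : invDerivation (A * B - B * A) p =
      invDerivation A (invDerivation B p) - invDerivation B (invDerivation A p) := by
  rw [← Derivation.commutator_apply]
  congr 1
  have h2 : ∀ (A B : Mat[N]) ij,
      invDerivation A (invDerivation B (MvPolynomial.X ij)) =
        ∑ k, MvPolynomial.X (ij.1, k) * MvPolynomial.C ((A * B) k ij.2) := by
    intro A B ij
    simp only [invDerivation_X, map_sum, Derivation.leibniz, derivation_C,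
      smul_eq_mul, mul_zero, zero_add, Matrix.mul_apply, mul_sum, map_mul]
    rw [sum_comm]
    exact sum_congr rfl fun k _ => sum_congr rfl fun l _ => by ring
  refine derivation_ext fun ij => ?_
  rw [Derivation.commutator_apply, h2, h2, invDerivation_X, ← sum_sub_distrib]
  exact sum_congr rfl fun k _ => by rw [Matrix.sub_apply, map_sub, mul_sub]

theorem totalDegree_invDerivation_le (X : Mat[N]) (p : Poly[N]) :
    (invDerivation X p).totalDegree ≤ p.totalDegree := by
  classical
  conv_lhs => rw [p.as_sum, map_sum]
  refine (MvPolynomial.totalDegree_finsetSum _ _).trans (Finset.sup_le fun s hs => ?_)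
  rw [invDerivation, MvPolynomial.mkDerivation_monomial]
  refine (MvPolynomial.totalDegree_smul_le _ _).trans ?_
  refine (MvPolynomial.totalDegree_finsetSum _ _).trans (Finset.sup_le fun i hi => ?_)
  have h1 : (∑ k, MvPolynomial.X (i.1, k) * MvPolynomial.C (X k i.2) :
      Poly[N]).totalDegree ≤ 1 := by
    refine (MvPolynomial.totalDegree_finsetSum _ _).trans (Finset.sup_le fun k _ => ?_)
    refine (MvPolynomial.totalDegree_mul _ _).trans ?_
    simp [MvPolynomial.totalDegree_X]
  beta_reduce
  rw [smul_eq_mul]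
  refine (MvPolynomial.totalDegree_mul _ _).trans ?_
  have h2 := MvPolynomial.le_totalDegree hs
  have hsi : 1 ≤ s i := Nat.one_le_iff_ne_zero.2 (Finsupp.mem_support_iff.1 hi)
  have h3 : (s - Finsupp.single i 1).degree + 1 = s.degree := by
    conv_rhs => rw [← tsub_add_cancel_of_le (Finsupp.single_le_iff.2 hsi)]
    rw [map_add, Finsupp.degree_single]
  have h4 := MvPolynomial.totalDegree_monomial_le (R := ℂ) (s - Finsupp.single i 1) (s i : ℂ)
  have h5 : s.degree ≤ p.totalDegree := h2
  have h6 : (monomial (s - Finsupp.single i 1) (s i : ℂ)).totalDegree ≤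
    (s - Finsupp.single i 1).degree := h4
  omega

theorem mem_lieAlg_iff {G : AlgGroup N} {X : Mat[N]} :
    X ∈ lieAlg G ↔ ∀ p ∈ vanishing G, polyEval (invDerivation X p) 1 = 0 := by
  refine forall₂_congr fun p _ => ?_
  rw [← leftInvDeriv_eq, polyEval_leftInvDeriv, Matrix.one_mul]

theorem invDerivation_mem {G : AlgGroup N} {X : Mat[N]} (hX : X ∈ lieAlg G)
    {p : Poly[N]} (hp : p ∈ vanishing G) : invDerivation X p ∈ vanishing G := fun g => by
  rw [← leftInvDeriv_eq]
  exact leftInvDeriv_vanish G ⟨X, hX⟩ p hp g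

theorem lieAlg_commutator_mem {G : AlgGroup N} {X Y : Mat[N]}
    (hX : X ∈ lieAlg G) (hY : Y ∈ lieAlg G) : X * Y - Y * X ∈ lieAlg G := by
  refine mem_lieAlg_iff.2 fun p hp => ?_
  rw [invDerivation_commutator]
  have h1 := invDerivation_mem hX (invDerivation_mem hY hp) 1
  have h2 := invDerivation_mem hY (invDerivation_mem hX hp) 1
  simp only [mat, OneMemClass.coe_one, Units.val_one] at h1 h2
  rw [polyEval, map_sub]
  exact (congrArg₂ _ h1 h2).trans (sub_zero 0)

theorem lieAlg_mono {G H : AlgGroup N} (h : H.toSubgroup ≤ G.toSubgroup) : lieAlg H ≤ lieAlg G :=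
  fun _ hX p hp => hX p fun g => hp ⟨g, h g.2⟩

/-- The polynomial `A ↦ p(QAR)`. -/
def sandwich (Q R : Mat[N]) (p : Poly[N]) : Poly[N] :=
  MvPolynomial.bind₁ (fun ij => ∑ k, ∑ l,
    MvPolynomial.C (Q ij.1 k * R l ij.2) * MvPolynomial.X (k, l)) p

theorem polyEval_sandwich (Q R : Mat[N]) (p : Poly[N])
    (A : Mat[N]) : polyEval (sandwich Q R p) A = polyEval p (Q * A * R) := by
  simp only [polyEval, sandwich]
  rw [← MvPolynomial.aeval_eq_eval, ← MvPolynomial.aeval_eq_eval, MvPolynomial.aeval_bind₁]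
  congr 2
  funext ij
  simp only [map_sum, map_mul, MvPolynomial.aeval_X, MvPolynomial.aeval_C, Matrix.mul_apply,
    sum_mul, Algebra.algebraMap_self, RingHom.id_apply]
  rw [sum_comm]
  exact sum_congr rfl fun k _ => sum_congr rfl fun l _ => by ring

theorem hasDerivAt_one_add_smul (X : Mat[N]) (i j : Fin N) :
    HasDerivAt (fun u : ℂ => (1 + u • X) i j) (X i j) 0 := by
  simpa using ((hasDerivAt_id (0 : ℂ)).mul_const (X i j)).const_add
    ((1 : Mat[N]) i j)

theorem sandwich_mem_lieAlg {G G' : AlgGroup N} {Q R X : Mat[N]} (hQR : Q * R = 1)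
    (h : ∀ p ∈ vanishing G, sandwich Q R p ∈ vanishing G') (hX : X ∈ lieAlg G') :
    Q * X * R ∈ lieAlg G := by
  intro p hp
  have h0 := hX _ (h p hp)
  have d1 := hasDerivAt_polyEval (sandwich Q R p) _ _ 0 (hasDerivAt_one_add_smul X)
  have d2 := hasDerivAt_polyEval p _ _ 0 (hasDerivAt_one_add_smul (Q * X * R))
  have e : ∀ u : ℂ, polyEval (sandwich Q R p) (1 + u • X) = polyEval p (1 + u • (Q * X * R)) := by
    intro u
    rw [polyEval_sandwich, mul_add, add_mul, mul_one, hQR, Matrix.mul_smul, Matrix.smul_mul]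
  simp only [e] at d1
  have := d1.unique d2
  simp only [zero_smul, add_zero] at this
  rw [← this, h0]

/-- The group `P⁻¹GP`. -/
def AlgGroup.conj (G : AlgGroup N) (P : GL (Fin N) ℂ) : AlgGroup N where
  toSubgroup := G.toSubgroup.comap (MulAut.conj P).toMonoidHom
  isZariskiClosed := by
    obtain ⟨S, hS⟩ := G.isZariskiClosed
    refine ⟨sandwich (P : Mat[N]) (P⁻¹ : GL (Fin N) ℂ) '' S,
      fun g => ?_⟩
    simp only [Set.forall_mem_image, polyEval_sandwich]
    exact hS _

theorem AlgGroup.mem_conj {G : AlgGroup N} {P g : GL (Fin N) ℂ} :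
    g ∈ (G.conj P).toSubgroup ↔ P * g * P⁻¹ ∈ G.toSubgroup := Iff.rfl

theorem mem_lieAlg_conj {G : AlgGroup N} {P : GL (Fin N) ℂ} {X : Mat[N]} :
    X ∈ lieAlg (G.conj P) ↔ (P : Mat[N]) * X * (P⁻¹ : GL (Fin N) ℂ) ∈ lieAlg G := by
  constructor
  · refine sandwich_mem_lieAlg (Units.mul_inv P) fun p hp g => ?_
    rw [polyEval_sandwich]
    exact hp ⟨P * g * P⁻¹, AlgGroup.mem_conj.1 g.2⟩
  · intro hX
    have := sandwich_mem_lieAlg (G := G.conj P) (Units.inv_mul P) (fun p hp g => ?_) hX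
    · simpa [mul_assoc] using this
    · rw [polyEval_sandwich]
      exact hp ⟨P⁻¹ * g * P, by rw [AlgGroup.mem_conj]; simp [mul_assoc]⟩

end Derivations

section Differential

theorem hasDerivAt_mul_entry {l m n : Type*} [Fintype m] {A : ℂ → Matrix l m ℂ}
    {B : ℂ → Matrix m n ℂ} {A' : Matrix l m ℂ} {B' : Matrix m n ℂ} {t : ℂ}
    (hA : ∀ i j, HasDerivAt (fun u => A u i j) (A' i j) t)
    (hB : ∀ i j, HasDerivAt (fun u => B u i j) (B' i j) t) (i : l) (j : n) :
    HasDerivAt (fun u => (A u * B u) i j) ((A' * B t + A t * B') i j) t := by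
  simp only [Matrix.add_apply, Matrix.mul_apply, ← sum_add_distrib]
  exact HasDerivAt.fun_sum fun k _ => (hA i k).mul (hB k j)

theorem hasDerivAt_const_mul_entry {l m n : Type*} [Fintype m] (A : Matrix l m ℂ)
    {B : ℂ → Matrix m n ℂ} {B' : Matrix m n ℂ} {t : ℂ}
    (hB : ∀ i j, HasDerivAt (fun u => B u i j) (B' i j) t) (i : l) (j : n) :
    HasDerivAt (fun u => (A * B u) i j) ((A * B') i j) t := by
  simpa using hasDerivAt_mul_entry (A := fun _ => A) (A' := 0)
    (fun i j => hasDerivAt_const t (A i j)) hB i j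

theorem hasDerivAt_mul_const_entry {l m n : Type*} [Fintype m] {A : ℂ → Matrix l m ℂ}
    (B : Matrix m n ℂ) {A' : Matrix l m ℂ} {t : ℂ}
    (hA : ∀ i j, HasDerivAt (fun u => A u i j) (A' i j) t) (i : l) (j : n) :
    HasDerivAt (fun u => (A u * B) i j) ((A' * B) i j) t := by
  simpa using hasDerivAt_mul_entry (B := fun _ => B) (B' := 0) hA
    (fun i j => hasDerivAt_const t (B i j)) i j

variable {N m : ℕ} {G : AlgGroup N}

theorem mat_mul (g h : G.toSubgroup) : mat (g * h) = mat g * mat h := rfl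

theorem mat_one : mat (1 : G.toSubgroup) = 1 := rfl

theorem det_mat_ne_zero (g : G.toSubgroup) : (mat g).det ≠ 0 :=
  ((isUnit_iff_isUnit_det _).1
    (Units.isUnit (g : GL (Fin N) ℂ))).ne_zero

theorem mat_mul_inv (g : G.toSubgroup) : mat g * mat g⁻¹ = 1 := by
  rw [← mat_mul, mul_inv_cancel, mat_one]

theorem mat_inv_mul (g : G.toSubgroup) : mat g⁻¹ * mat g = 1 := by
  rw [← mat_mul, inv_mul_cancel, mat_one]

theorem mat_injective : Function.Injective (mat : G.toSubgroup → _) :=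
  fun _ _ h => Subtype.ext (Units.ext h)

theorem polyEval_det (A : Mat[N]) :
    polyEval (Matrix.mvPolynomialX (Fin N) (Fin N) ℂ).det A = A.det := by
  rw [polyEval, RingHom.map_det, Matrix.mvPolynomialX_mapMatrix_eval]

/-- The differential at `1` of a polynomial. -/
def polyDiff (p : Poly[N]) : Mat[N] →ₗ[ℂ] ℂ :=
  ∑ ij : Fin N × Fin N,
    polyEval (pderiv ij p) 1 • Matrix.entryLinearMap ℂ ℂ ij.1 ij.2

theorem polyDiff_apply (p : Poly[N]) (X : Mat[N]) :
    polyDiff p X = ∑ ij : Fin N × Fin N, polyEval (pderiv ij p) 1 * X ij.1 ij.2 := by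
  simp [polyDiff, LinearMap.sum_apply]

theorem IsRegular.exists_differential {φ : G.toSubgroup → ℂ} (h : IsRegular G φ) :
    ∃ D : Mat[N] →ₗ[ℂ] ℂ, ∀ (γ : ℂ → G.toSubgroup) (t : ℂ) (X : Mat[N]), γ t = 1 →
      (∀ i j, HasDerivAt (fun u => mat (γ u) i j) (X i j) t) →
      HasDerivAt (fun u => φ (γ u)) (D X) t := by
  obtain ⟨p, k, hp⟩ := h
  set q := (Matrix.mvPolynomialX (Fin N) (Fin N) ℂ).det ^ k with hq
  have hqe : ∀ A, polyEval q A = A.det ^ k := fun A => by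
    rw [hq, ← polyEval_det, polyEval, polyEval, map_pow]
  refine ⟨polyDiff p - polyEval p 1 • polyDiff q, fun γ t X h1 hγ => ?_⟩
  have dp := hasDerivAt_polyEval p _ _ t hγ
  have dq := hasDerivAt_polyEval q _ _ t hγ
  have hne : polyEval q (mat (γ t)) ≠ 0 := by
    rw [hqe]; exact pow_ne_zero _ (det_mat_ne_zero _)
  have hd := dp.div dq hne
  have e : (fun u => φ (γ u)) = fun u =>
      polyEval p (mat (γ u)) / polyEval q (mat (γ u)) := by
    funext u
    rw [hqe, ← hp, mul_div_cancel_left₀ _ (pow_ne_zero _ (det_mat_ne_zero _))]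
  rw [e]
  refine hd.congr_deriv ?_
  rw [h1, mat_one, hqe, Matrix.det_one, one_pow, LinearMap.sub_apply, LinearMap.smul_apply,
    polyDiff_apply, polyDiff_apply, smul_eq_mul]
  ring

theorem RationalRep.exists_differential (ρ : RationalRep G m) : ∃ D : Mat[N] →ₗ[ℂ] Mat[m],
      (∀ X : lieAlg G, ρ.diff X = D X) ∧ ∀ (γ : ℂ → G.toSubgroup) (t : ℂ) (X : Mat[N]), γ t = 1 →
        (∀ i j, HasDerivAt (fun u => mat (γ u) i j) (X i j) t) → ∀ i j,
        HasDerivAt (fun u => (ρ.toHom (γ u) : Mat[m]) i j) (D X i j) t := by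
  choose D hD using fun i j => (ρ.isRegular i j).exists_differential
  refine ⟨⟨⟨fun X => Matrix.of fun i j => D i j X, fun X Y => ?_⟩, fun c X => ?_⟩, fun X => ?_,
    fun γ t X h1 hγ i j => hD i j γ t X h1 hγ⟩
  · ext i j; simp
  · ext i j; simp
  · ext i j
    have h0 : expG X 0 = 1 := mat_injective (by
      rw [mat_expG, zero_smul, NormedSpace.exp_zero, mat_one])
    refine (hD i j (expG X) 0 X h0 fun k l => ?_).deriv
    have := hasDerivAt_exp_entry (X : Mat[N]) 0 k l
    simpa [mat_expG, NormedSpace.exp_zero] using this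

/-- The differential of a rational representation, as a linear map. -/
def RationalRep.diffLinear (ρ : RationalRep G m) : lieAlg G →ₗ[ℂ] Mat[m] where
  toFun := ρ.diff
  map_add' X Y := by
    obtain ⟨D, hD, -⟩ := ρ.exists_differential
    rw [hD, hD, hD, Submodule.coe_add, map_add]
  map_smul' c X := by
    obtain ⟨D, hD, -⟩ := ρ.exists_differential
    rw [hD, hD, Submodule.coe_smul, map_smul, RingHom.id_apply]

theorem RationalRep.diffLinear_apply (ρ : RationalRep G m) (X : lieAlg G) :
    ρ.diffLinear X = ρ.diff X := rfl

theorem RationalRep.coe_mul (ρ : RationalRep G m) (g h : G.toSubgroup) :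
    (ρ.toHom (g * h) : Mat[m]) = (ρ.toHom g : Mat[m]) * (ρ.toHom h : Mat[m]) := by
  rw [map_mul, Units.val_mul]

theorem RationalRep.coe_one (ρ : RationalRep G m) : (ρ.toHom 1 : Mat[m]) = 1 := by
  rw [map_one, Units.val_one]

theorem RationalRep.hasDerivAt (ρ : RationalRep G m) {γ : ℂ → G.toSubgroup} {t : ℂ} {X : lieAlg G}
    (h : ∀ i j, HasDerivAt (fun u => mat (γ u) i j)
      (((X : Mat[N]) * mat (γ t)) i j) t) (i j : Fin m) :
    HasDerivAt (fun u => (ρ.toHom (γ u) : Mat[m]) i j)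
      ((ρ.diff X * (ρ.toHom (γ t) : Mat[m])) i j) t := by
  obtain ⟨D, hD, hγ⟩ := ρ.exists_differential
  have h1 := hγ (fun u => γ u * (γ t)⁻¹) t X (mul_inv_cancel _) fun i j => by
    have := hasDerivAt_mul_const_entry (mat (γ t)⁻¹) h i j
    rwa [mul_assoc, mat_mul_inv, mul_one] at this
  have h2 := hasDerivAt_mul_const_entry (ρ.toHom (γ t) : Mat[m]) h1 i j
  rw [← hD] at h2
  simpa only [← ρ.coe_mul, inv_mul_cancel_right] using h2

theorem hasDerivAt_mat_expG (X : lieAlg G) (s : ℂ) (i j : Fin N) :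
    HasDerivAt (fun u => mat (expG X u) i j) (((X : Mat[N]) * mat (expG X s)) i j) s := by
  have h := hasDerivAt_exp_entry (X : Mat[N]) s i j
  refine h.congr_deriv ?_
  let _ : NormedRing (Mat[N]) := Matrix.linftyOpNormedRing
  let _ : NormedAlgebra ℂ (Mat[N]) := Matrix.linftyOpNormedAlgebra
  let _ : NormedAlgebra ℚ (Mat[N]) := NormedAlgebra.restrictScalars ℚ ℂ _
  have hc : Commute (X : Mat[N])
      (NormedSpace.exp (s • (X : Mat[N]))) :=
    ((Commute.refl _).smul_right s).exp_right
  rw [mat_expG, hc.eq]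

theorem expG_zero (X : lieAlg G) : expG X 0 = 1 := mat_injective (by
  rw [mat_expG, zero_smul, NormedSpace.exp_zero, mat_one])

theorem hasDerivAt_mat_expG_zero (X : lieAlg G) (i j : Fin N) :
    HasDerivAt (fun u => mat (expG X u) i j) ((X : Mat[N]) i j) 0 := by
  simpa [expG_zero, mat_one] using hasDerivAt_mat_expG X 0 i j

theorem expG_inv (X : lieAlg G) (s : ℂ) : (expG X s)⁻¹ = expG X (-s) := by
  refine inv_eq_of_mul_eq_one_right (mat_injective ?_)
  rw [mat_mul, mat_expG, mat_expG, neg_smul, Matrix.exp_neg, mat_one]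
  exact Matrix.mul_nonsing_inv _ ((isUnit_iff_isUnit_det _).1
    (Matrix.isUnit_exp (s • (X : Mat[N]))))

theorem hasDerivAt_mat_expG_inv (X : lieAlg G) (i j : Fin N) :
    HasDerivAt (fun u => mat (expG X u)⁻¹ i j) ((-(X : Mat[N])) i j) 0 := by
  simp only [expG_inv]
  have h0 : HasDerivAt (fun s => mat (expG X s) i j)
    ((X : Mat[N]) i j) (-0) := by
      rw [neg_zero]; exact hasDerivAt_mat_expG_zero X i j
  have h1 := h0.comp (0 : ℂ) (hasDerivAt_neg (0 : ℂ))
  rw [mul_neg_one] at h1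
  exact h1

theorem linearMap_apply_eq_sum (D : Mat[N] →ₗ[ℂ] Mat[m]) (M : Mat[N]) (i j : Fin m) :
    D M i j = ∑ k, ∑ l, M k l * D (Matrix.single k l 1) i j := by
  conv_lhs => rw [Matrix.matrix_eq_sum_single M]
  simp only [map_sum, Matrix.sum_apply]
  refine sum_congr rfl fun k _ => sum_congr rfl fun l _ => ?_
  rw [show Matrix.single k l (M k l) = M k l • Matrix.single k l (1 : ℂ) by
    rw [Matrix.smul_single, smul_eq_mul, mul_one], map_smul, Matrix.smul_apply, smul_eq_mul]

theorem hasDerivAt_linearMap_entry (D : Mat[N] →ₗ[ℂ] Mat[m]) {A : ℂ → Mat[N]} {A' : Mat[N]} {t : ℂ}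
    (hA : ∀ i j, HasDerivAt (fun u => A u i j) (A' i j) t) (i j : Fin m) :
    HasDerivAt (fun u => D (A u) i j) (D A' i j) t := by
  rw [linearMap_apply_eq_sum D, funext fun u => linearMap_apply_eq_sum D (A u) i j]
  exact HasDerivAt.fun_sum fun k _ => HasDerivAt.fun_sum fun l _ => (hA k l).mul_const _

theorem RationalRep.diff_commutator (ρ : RationalRep G m) (h X : lieAlg G) :
    ρ.diff h * ρ.diff X - ρ.diff X * ρ.diff h =
      ρ.diff ⟨h * X - X * h, lieAlg_commutator_mem h.2 X.2⟩ := by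
  obtain ⟨D, hD, hγ⟩ := ρ.exists_differential
  have hAd : ∀ g : G.toSubgroup, (ρ.toHom g : Mat[m]) * ρ.diff X =
      D (mat g * X * mat g⁻¹) * (ρ.toHom g : Mat[m]) := by
    intro g
    have h1 := hγ (fun u => g * expG X u * g⁻¹) 0 _ (by simp [expG_zero])
      fun i j => hasDerivAt_mul_const_entry (mat g⁻¹)
        (hasDerivAt_const_mul_entry (mat g) (hasDerivAt_mat_expG_zero X)) i j
    have h2 := hasDerivAt_const_mul_entry (ρ.toHom g : Mat[m])
      (hγ (expG X) 0 X (expG_zero X) (hasDerivAt_mat_expG_zero X))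
    have h3 := hasDerivAt_mul_const_entry (ρ.toHom g : Mat[m]) h1
    ext i j
    rw [hD]
    refine (h2 i j).unique ?_
    simpa only [← ρ.coe_mul, inv_mul_cancel_right] using h3 i j
  have hM := hasDerivAt_mul_entry
    (hasDerivAt_mul_const_entry (X : Mat[N])
      (hasDerivAt_mat_expG_zero h)) (hasDerivAt_mat_expG_inv h)
  have hρ := hγ (expG h) 0 h (expG_zero h) (hasDerivAt_mat_expG_zero h)
  have hL := hasDerivAt_mul_const_entry (ρ.diff X) hρ
  have hR := hasDerivAt_mul_entry (hasDerivAt_linearMap_entry D hM) hρ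
  have e1 : ρ.diff ⟨h * X - X * h, lieAlg_commutator_mem h.2 X.2⟩ = D (h * X - X * h) := hD _
  rw [sub_eq_iff_eq_add, e1, hD h]
  ext i j
  refine (hL i j).unique ?_
  simp only [hAd]
  simpa [expG_zero, mat_one, hD X, ρ.coe_one, sub_eq_add_neg] using hR i j

end Differential

section Torus

theorem exists_joint_eigenbasis {I : Type*} {m : ℕ} (A : I → Mat[m])
    (hc : ∀ i j, Commute (A i) (A j)) (hA : ∀ i, ∃ n, 0 < n ∧ A i ^ n = 1) :
    ∃ (P : GL (Fin m) ℂ) (μ : I → Fin m → ℂ),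
      ∀ i, A i * (P : Mat[m]) = P * Matrix.diagonal (μ i) := by
  set T : I → Module.End ℂ (Fin m → ℂ) := fun i => Matrix.toLin' (A i) with hT
  have hss : ∀ i, (T i).IsSemisimple := by
    intro i
    obtain ⟨n, hn, h1⟩ := hA i
    refine Module.End.isSemisimple_of_squarefree_aeval_eq_zero
      (Polynomial.separable_X_pow_sub_C (1 : ℂ) (by exact_mod_cast hn.ne') one_ne_zero).squarefree ?_
    rw [map_sub, map_pow, Polynomial.aeval_X, Polynomial.aeval_C, map_one, hT]
    simp only [← Matrix.toLin'_pow, h1, Matrix.toLin'_one]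
    exact sub_self _
  have htop := Module.End.iSup_iInf_maxGenEigenspace_eq_top_of_iSup_maxGenEigenspace_eq_top_of_commute
    T (fun i j _ => by
      change T i * T j = T j * T i
      simp only [hT, Module.End.mul_eq_comp, ← Matrix.toLin'_mul, (hc i j).eq])
    fun i => Module.End.iSup_maxGenEigenspace_eq_top _
  simp only [(hss _).isFinitelySemisimple.maxGenEigenspace_eq_eigenspace] at htop
  set s : Set (Fin m → ℂ) := {v | ∀ i, ∃ μ : ℂ, T i v = μ • v} with hs
  have hspan : (⊤ : Submodule ℂ (Fin m → ℂ)) ≤ Submodule.span ℂ s := by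
    rw [← htop]
    refine iSup_le fun χ v hv => Submodule.subset_span fun i => ⟨χ i, ?_⟩
    exact Module.End.mem_eigenspace_iff.1 ((Submodule.mem_iInf _).1 hv i)
  set b₀ := Module.Basis.ofSpan hspan with hb₀
  set b := b₀.reindex (b₀.indexEquiv (Pi.basisFun ℂ (Fin m))) with hb
  have hbs : ∀ k, b k ∈ s := by
    intro k
    rw [hb, Module.Basis.reindex_apply]
    exact Module.Basis.ofSpan_subset hspan ⟨_, rfl⟩
  have hU : IsUnit (Matrix.of fun i j => b j i) := by
    rw [← Matrix.linearIndependent_cols_iff_isUnit]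
    exact b.linearIndependent
  choose μ hμ using fun k => hbs k
  refine ⟨hU.unit, fun i k => μ k i, fun i => ?_⟩
  ext x k
  rw [mul_diagonal]
  have := congrFun (hμ k i) x
  simp only [hT, Matrix.toLin'_apply, Matrix.mulVec, dotProduct, Pi.smul_apply, smul_eq_mul] at this
  rw [Matrix.mul_apply, mul_comm]
  exact this

/-- A Laurent polynomial on `(ℂ^*)^k`. -/
def IsLaurent {k : ℕ} (ψ : (Fin k → ℂˣ) → ℂ) : Prop :=
  ∃ (p : MvPolynomial (Fin k) ℂ) (d : ℕ), ∀ x : Fin k → ℂˣ,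
    (∏ a, (x a : ℂ)) ^ d * ψ x = eval (fun a => (x a : ℂ)) p

theorem IsLaurent.const {k : ℕ} (c : ℂ) : IsLaurent fun _ : Fin k → ℂˣ => c :=
  ⟨MvPolynomial.C c, 0, fun x => by simp⟩

theorem eval_prod_X {k : ℕ} (x : Fin k → ℂˣ) :
    eval (fun a => (x a : ℂ)) (∏ a, MvPolynomial.X a) = ∏ a, (x a : ℂ) := by
  simp [map_prod]

theorem IsLaurent.add {k : ℕ} {φ ψ : (Fin k → ℂˣ) → ℂ} (hφ : IsLaurent φ) (hψ : IsLaurent ψ) :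
    IsLaurent fun x => φ x + ψ x := by
  obtain ⟨p, d, hp⟩ := hφ
  obtain ⟨q, e, hq⟩ := hψ
  refine ⟨(∏ a, MvPolynomial.X a) ^ e * p + (∏ a, MvPolynomial.X a) ^ d * q, d + e, fun x => ?_⟩
  rw [map_add, map_mul, map_mul, map_pow, map_pow, eval_prod_X, ← hp, ← hq]
  ring

theorem IsLaurent.mul {k : ℕ} {φ ψ : (Fin k → ℂˣ) → ℂ} (hφ : IsLaurent φ) (hψ : IsLaurent ψ) :
    IsLaurent fun x => φ x * ψ x := by
  obtain ⟨p, d, hp⟩ := hφ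
  obtain ⟨q, e, hq⟩ := hψ
  refine ⟨p * q, d + e, fun x => ?_⟩
  rw [map_mul, ← hp, ← hq]
  ring

theorem infinite_rootsOfUnity : {z : ℂ | ∃ n, 0 < n ∧ z ^ n = 1}.Infinite := by
  have hp : ∀ n : ℕ, IsPrimitiveRoot (exp (2 * π * I / ((n + 1 : ℕ) : ℂ)))
    (n + 1) := fun n => Complex.isPrimitiveRoot_exp (n + 1) n.succ_ne_zero
  refine Set.infinite_of_injective_forall_mem
    (f := fun n : ℕ => exp (2 * π * I / ((n + 1 : ℕ) : ℂ))) ?_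
    fun n => ⟨n + 1, n.succ_pos, (hp n).pow_eq_one⟩
  intro a b hab
  have h1 := (hp a).eq_orderOf
  have h2 := (hp b).eq_orderOf
  beta_reduce at hab
  rw [hab, ← h2] at h1
  omega

theorem IsLaurent.eq_zero {k : ℕ} {ψ : (Fin k → ℂˣ) → ℂ} (hψ : IsLaurent ψ)
    (h : ∀ x : Fin k → ℂˣ, (∃ n, 0 < n ∧ x ^ n = 1) → ψ x = 0) (x : Fin k → ℂˣ) : ψ x = 0 := by
  obtain ⟨p, d, hp⟩ := hψ
  have h0 : p = 0 := by
    refine MvPolynomial.funext_set (fun _ => {z : ℂ | ∃ n, 0 < n ∧ z ^ n = 1})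
      (fun _ => infinite_rootsOfUnity) fun z hz => ?_
    choose n hn hz using fun i => hz i (Set.mem_univ i)
    have hne : ∀ i, z i ≠ 0 := fun i h0 => by
      have := hz i
      rw [h0, zero_pow (hn i).ne'] at this
      exact zero_ne_one this
    have h1 := hp fun i => Units.mk0 (z i) (hne i)
    rw [h, mul_zero] at h1
    · simpa using h1.symm
    · refine ⟨∏ i, n i, Finset.prod_pos fun i _ => hn i, ?_⟩
      funext i
      ext
      simp only [Pi.pow_apply, Units.val_pow_eq_pow_val, Units.val_mk0, Pi.one_apply, Units.val_one]
      rw [← Finset.mul_prod_erase _ _ (Finset.mem_univ i), pow_mul, hz i, one_pow]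
  have h2 := hp x
  rw [h0, map_zero] at h2
  exact (mul_eq_zero.1 h2).resolve_left
    (pow_ne_zero _ (Finset.prod_ne_zero_iff.2 fun a _ => (x a).ne_zero))

variable {N m : ℕ} {G H : AlgGroup N}

theorem IsRegular.add {φ ψ : G.toSubgroup → ℂ} (hφ : IsRegular G φ) (hψ : IsRegular G ψ) :
    IsRegular G fun g => φ g + ψ g := by
  obtain ⟨p, k, hp⟩ := hφ
  obtain ⟨q, l, hq⟩ := hψ
  set D := (Matrix.mvPolynomialX (Fin N) (Fin N) ℂ).det with hD
  refine ⟨D ^ l * p + D ^ k * q, k + l, fun g => ?_⟩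
  have h1 : polyEval (D ^ l * p + D ^ k * q) (mat g) =
      polyEval D (mat g) ^ l * polyEval p (mat g) +
        polyEval D (mat g) ^ k * polyEval q (mat g) := by simp [polyEval]
  rw [h1, hD, polyEval_det, ← hp, ← hq]
  ring

theorem IsRegular.const_mul {φ : G.toSubgroup → ℂ} (c : ℂ) (hφ : IsRegular G φ) :
    IsRegular G fun g => c * φ g := by
  obtain ⟨p, k, hp⟩ := hφ
  refine ⟨MvPolynomial.C c * p, k, fun g => ?_⟩
  have h1 : polyEval (MvPolynomial.C c * p) (mat g) = c * polyEval p (mat g) := by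
    simp [polyEval]
  rw [h1, ← hp]
  ring

theorem IsRegular.sum {K : Type*} (s : Finset K) {φ : K → G.toSubgroup → ℂ}
    (h : ∀ i, IsRegular G (φ i)) : IsRegular G fun g => ∑ i ∈ s, φ i g := by
  classical
  induction s using Finset.induction_on with
  | empty => exact ⟨0, 0, fun g => by simp [polyEval]⟩
  | insert a s ha ih => simpa only [sum_insert ha] using (h a).add ih

theorem RationalRep.isRegular_conj (ρ : RationalRep G m) (Q R : Mat[m]) (a b : Fin m) :
    IsRegular G fun g => (Q * (ρ.toHom g : Mat[m]) * R) a b := by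
  simp only [Matrix.mul_apply, sum_mul]
  refine IsRegular.sum _ fun j => IsRegular.sum _ fun i => ?_
  simpa only [mul_comm, mul_left_comm, mul_assoc] using
    ((ρ.isRegular i j).const_mul (R j b)).const_mul (Q a i)

/-- The matrices of a torus in a rational representation are simultaneously diagonalisable. -/
theorem IsTorus.exists_eigenbasis (hH : IsTorus H) (hHG : H.toSubgroup ≤ G.toSubgroup)
    (ρ : RationalRep G m) : ∃ P : GL (Fin m) ℂ,
      ∀ h : G.toSubgroup, (h : GL (Fin N) ℂ) ∈ H.toSubgroup → ∀ a b, a ≠ b →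
        ((P⁻¹ : GL (Fin m) ℂ) * (ρ.toHom h : Mat[m]) * (P : Mat[m])) a b = 0 := by
  obtain ⟨k, e, he, -⟩ := hH
  set j : (Fin k → ℂˣ) →* G.toSubgroup := (Subgroup.inclusion hHG).comp e.toMonoidHom with hj
  set r : (Fin k → ℂˣ) →* GL (Fin m) ℂ := ρ.toHom.comp j with hr
  obtain ⟨P, μ, hP⟩ := exists_joint_eigenbasis
    (fun x : {x : Fin k → ℂˣ // ∃ n, 0 < n ∧ x ^ n = 1} => (r x : Mat[m]))
    (fun x y => by
      change (r x : Mat[m]) * r y = r y * r x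
      rw [← Units.val_mul, ← Units.val_mul, ← map_mul, ← map_mul, mul_comm])
    (fun x => by
      obtain ⟨n, hn, h1⟩ := x.2
      exact ⟨n, hn, by rw [← Units.val_pow_eq_pow_val, ← map_pow, h1, map_one, Units.val_one]⟩)
  have hpoly : ∀ p : Poly[N],
      IsLaurent fun x => polyEval p (mat (j x)) := by
    intro p
    induction p using MvPolynomial.induction_on with
    | C c => simpa [polyEval] using IsLaurent.const c
    | add p q hp hq => simpa [polyEval] using hp.add hq
    | mul_X p ij hp =>
      have h1 : IsLaurent fun x => mat (j x) ij.1 ij.2 := he ij.1 ij.2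
      simpa [polyEval] using hp.mul h1
  refine ⟨P, fun h hh a b hab => ?_⟩
  obtain ⟨p, d, hp⟩ := ρ.isRegular_conj (P⁻¹ : GL (Fin m) ℂ) P a b
  beta_reduce at hp
  have hz := (hpoly p).eq_zero (fun x hx => by
    have h1 := hP ⟨x, hx⟩
    rw [← hp]
    have h2 : (ρ.toHom (j x) : Mat[m]) * (P : Mat[m]) =
      P * Matrix.diagonal (μ ⟨x, hx⟩) := h1
    rw [mul_assoc, h2, ← mul_assoc, Units.inv_mul, one_mul, diagonal_apply_ne _ hab,
      mul_zero]) (e.symm ⟨h, hh⟩)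
  have hjh : j (e.symm ⟨h, hh⟩) = h := by
    apply Subtype.ext
    simp [hj]
  rw [hjh, ← hp] at hz
  exact (mul_eq_zero.1 hz).resolve_left (pow_ne_zero _ (det_mat_ne_zero _))

/-- The inclusion of Lie algebras of an inclusion of groups. -/
def lieIncl (hHG : H.toSubgroup ≤ G.toSubgroup) : lieAlg H →ₗ[ℂ] lieAlg G :=
  Submodule.inclusion (lieAlg_mono hHG)

theorem coe_lieIncl (hHG : H.toSubgroup ≤ G.toSubgroup) (X : lieAlg H) :
    (lieIncl hHG X : Mat[N]) = X := rfl

/-- The columns of `P` are eigenvectors of `Lie(H)`, of weights `lam`, in the representation `ρ`,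
and `ρ(exp(sh))` acts on them through the exponentials of the weights. -/
structure WeightBasis (hHG : H.toSubgroup ≤ G.toSubgroup) (ρ : RationalRep G m)
    (P : GL (Fin m) ℂ) (lam : Fin m → Dual[H]) : Prop where
  diff : ∀ h : lieAlg H, ((P⁻¹ : GL (Fin m) ℂ) * ρ.diff (lieIncl hHG h) *
    (P : Mat[m])) = Matrix.diagonal fun a => lam a h
  map_exp : ∀ (h : lieAlg H) (s : ℂ), ((P⁻¹ : GL (Fin m) ℂ) *
    (ρ.toHom (expG (lieIncl hHG h) s) : Mat[m]) *
    (P : Mat[m])) = Matrix.diagonal fun a => exp (s * lam a h)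

theorem IsTorus.exists_weightBasis (hH : IsTorus H) (hHG : H.toSubgroup ≤ G.toSubgroup)
    (ρ : RationalRep G m) : ∃ P lam, WeightBasis hHG ρ P lam := by
  obtain ⟨P, hP⟩ := hH.exists_eigenbasis hHG ρ
  set Q : Mat[m] := ((P⁻¹ : GL (Fin m) ℂ) :
    Mat[m]) with hQ
  have hPQ : (P : Mat[m]) * Q = 1 := Units.mul_inv P
  have hQP : Q * (P : Mat[m]) = 1 := Units.inv_mul P
  have hE : ∀ (h : lieAlg H) (s : ℂ) (a b : Fin m), a ≠ b →
      (Q * (ρ.toHom (expG (lieIncl hHG h) s) : Mat[m]) * P) a b = 0 :=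
    fun h s => hP _ (expG h s).2
  have hd : ∀ (h : lieAlg H) (s : ℂ) (a b : Fin m), HasDerivAt
      (fun s => (Q * (ρ.toHom (expG (lieIncl hHG h) s) : Mat[m]) * P) a b)
      ((Q * ρ.diff (lieIncl hHG h) * P * (Q * (ρ.toHom (expG (lieIncl hHG h) s) :
        Mat[m]) * P)) a b) s := by
    intro h s a b
    have h1 := hasDerivAt_mul_const_entry (P : Mat[m])
      (hasDerivAt_const_mul_entry Q (ρ.hasDerivAt (hasDerivAt_mat_expG (lieIncl hHG h) s))) a b
    refine h1.congr_deriv (congrFun (congrFun ?_ a) b)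
    calc Q * (ρ.diff (lieIncl hHG h) * ρ.toHom (expG (lieIncl hHG h) s)) * P
        = Q * ρ.diff (lieIncl hHG h) * 1 * ρ.toHom (expG (lieIncl hHG h) s) * P := by
          simp only [mul_assoc, one_mul]
      _ = _ := by rw [← hPQ]; simp only [mul_assoc]
  have h0 : ∀ h : lieAlg H, (Q * (ρ.toHom (expG (lieIncl hHG h) 0) : Mat[m]) *
      (P : Mat[m])) = 1 := fun h => by
    rw [expG_zero, ρ.coe_one, mul_one, hQP]
  have hoff : ∀ (h : lieAlg H) (a b : Fin m), a ≠ b →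
      (Q * ρ.diff (lieIncl hHG h) * P : Mat[m]) a b = 0 := by
    intro h a b hab
    have h1 := hd h 0 a b
    rw [h0, mul_one] at h1
    simp only [hE h _ a b hab] at h1
    exact h1.unique (hasDerivAt_const _ _)
  set lam : Fin m → Dual[H] := fun a =>
    { toFun := fun h => (Q * ρ.diff (lieIncl hHG h) * P : Mat[m]) a a
      map_add' := fun h h' => by
        simp only [← ρ.diffLinear_apply, map_add, mul_add, add_mul, Matrix.add_apply]
      map_smul' := fun c h => by
        simp only [← ρ.diffLinear_apply, map_smul, Matrix.mul_smul, Matrix.smul_mul,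
          Matrix.smul_apply, RingHom.id_apply] } with hlam
  have hdiag : ∀ h : lieAlg H, Q * ρ.diff (lieIncl hHG h) * P =
      Matrix.diagonal fun a => lam a h := by
    intro h
    ext a b
    by_cases hab : a = b
    · subst hab; rw [Matrix.diagonal_apply_eq]; rfl
    · rw [hoff h a b hab, diagonal_apply_ne _ hab]
  refine ⟨P, lam, hdiag, fun h s => ?_⟩
  ext a b
  by_cases hab : a = b
  · subst hab
    rw [Matrix.diagonal_apply_eq]
    set g : ℂ → ℂ := fun s =>
      (Q * (ρ.toHom (expG (lieIncl hHG h) s) : Mat[m]) * P) a a with hg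
    have hg' : ∀ s, HasDerivAt (fun s => g s * exp (-(s * lam a h))) 0 s := by
      intro s
      have h1 := hd h s a a
      rw [hdiag, diagonal_mul] at h1
      have h2 : HasDerivAt (fun s : ℂ => exp (-(s * lam a h)))
          (exp (-(s * lam a h)) * -(1 * lam a h)) s :=
        (((hasDerivAt_id s).mul_const (lam a h)).fun_neg).cexp
      refine (h1.mul h2).congr_deriv ?_
      ring
    have hc := is_const_of_deriv_eq_zero (fun s => (hg' s).differentiableAt)
      (fun s => (hg' s).deriv) s 0
    have hg0 : g 0 = 1 := by rw [hg]; simp only [h0, Matrix.one_apply_eq]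
    beta_reduce at hc
    rw [hg0, zero_mul, neg_zero, exp_zero, one_mul, Complex.exp_neg] at hc
    exact (mul_inv_eq_one₀ (Complex.exp_ne_zero _)).1 hc
  · rw [hE h s a b hab, diagonal_apply_ne _ hab]

end Torus

section RowsInGroup

variable {N : ℕ}

theorem sandwich_X (d : Fin N → ℂ) (ij : Fin N × Fin N) :
    sandwich (Matrix.diagonal d) 1 (MvPolynomial.X ij) = d ij.1 • MvPolynomial.X ij := by
  rw [sandwich, MvPolynomial.bind₁_X_right, sum_eq_single ij.1, sum_eq_single ij.2]
  · simp [smul_eq_C_mul]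
  · intro b _ hb; simp [one_apply_ne hb]
  · simp
  · intro b _ hb; simp [diagonal_apply_ne _ (Ne.symm hb)]
  · simp

theorem sandwich_mul (Q R : Mat[N]) (p q : Poly[N]) :
    sandwich Q R (p * q) = sandwich Q R p * sandwich Q R q := map_mul _ _ _

theorem sandwich_C (Q R : Mat[N]) (c : ℂ) :
    sandwich Q R (MvPolynomial.C c) = MvPolynomial.C c := MvPolynomial.algHom_C _ _

theorem invDerivation_sandwich (Q X : Mat[N]) (p : Poly[N]) :
    invDerivation X (sandwich Q 1 p) = sandwich Q 1 (invDerivation X p) := by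
  induction p using MvPolynomial.induction_on with
  | C c => rw [sandwich_C, derivation_C]; exact (map_zero _).symm
  | add p q hp hq =>
    have h : ∀ p q, sandwich Q 1 (p + q) = sandwich Q 1 p + sandwich Q 1 q := map_add _
    rw [h, map_add, hp, hq, map_add, h]
  | mul_X p ij hp =>
    have h : ∀ p q, sandwich Q 1 (p + q) = sandwich Q 1 p + sandwich Q 1 q := map_add _
    have hX : ∀ ij : Fin N × Fin N, sandwich Q 1 (MvPolynomial.X ij) =
        ∑ k, MvPolynomial.C (Q ij.1 k) * MvPolynomial.X (k, ij.2) := by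
      intro ij
      rw [sandwich, MvPolynomial.bind₁_X_right]
      refine sum_congr rfl fun k _ => ?_
      rw [sum_eq_single ij.2 (fun b _ hb => by simp [one_apply_ne hb]) (by simp)]
      simp
    have hs : ∀ g : Fin N → Poly[N],
      sandwich Q 1 (∑ k, g k) = ∑ k, sandwich Q 1 (g k) := fun g => map_sum _ _ _
    have hDX : invDerivation X (sandwich Q 1 (MvPolynomial.X ij)) =
        sandwich Q 1 (invDerivation X (MvPolynomial.X ij)) := by
      rw [hX, invDerivation_X, hs]
      simp only [sandwich_mul, sandwich_C, hX, map_sum, Derivation.leibniz,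
        derivation_C, invDerivation_X, smul_eq_mul, mul_zero, add_zero, mul_sum,
        sum_mul]
      rw [sum_comm]
      exact sum_congr rfl fun k _ => sum_congr rfl fun l _ => by ring
    rw [sandwich_mul, Derivation.leibniz, Derivation.leibniz, hp, hDX, h, smul_eq_mul, smul_eq_mul,
      smul_eq_mul, smul_eq_mul, sandwich_mul, sandwich_mul]

/-- The operators on polynomials given by a diagonal matrix acting on the right (as a derivation)
and by its exponentials acting on the left. -/
def weightOp (lam : Fin N → ℂ) : Option ℂ → Module.End ℂ (Poly[N])
  | none => (invDerivation (Matrix.diagonal lam)).toLinearMap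
  | some s => (MvPolynomial.bind₁ (fun ij => ∑ k, ∑ l, MvPolynomial.C
      (Matrix.diagonal (fun a => exp (s * lam a)) ij.1 k * (1 : Matrix _ _ ℂ) l ij.2) *
        MvPolynomial.X (k, l))).toLinearMap

theorem weightOp_none (lam : Fin N → ℂ) (p : Poly[N]) :
    weightOp lam none p = invDerivation (Matrix.diagonal lam) p := rfl

theorem weightOp_some (lam : Fin N → ℂ) (s : ℂ) (p : Poly[N]) : weightOp lam (some s) p =
      sandwich (Matrix.diagonal fun a => exp (s * lam a)) 1 p := rfl

/-- The eigenvalues of the operators `weightOp` of right weight `c.1` and left weight `c.2`. -/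
def weightChar (c : ℂ × ℂ) : Option ℂ → ℂ
  | none => c.1
  | some s => exp (s * c.2)

theorem weightChar_injective : Function.Injective weightChar := by
  rintro ⟨r, l⟩ ⟨r', l'⟩ h
  have h1 : r = r' := congrFun h none
  have h2 : (fun s => exp (s * l)) = fun s => exp (s * l') :=
    funext fun s => congrFun h (some s)
  have hd : ∀ l : ℂ, HasDerivAt (fun s => exp (s * l)) l 0 := fun l => by
    simpa using ((hasDerivAt_id (0 : ℂ)).mul_const l).cexp
  have h3 := hd l
  rw [h2] at h3
  rw [h1, h3.unique (hd l')]

theorem exists_weight_monomial (lam : Fin N → ℂ) (s : Fin N × Fin N →₀ ℕ) (c : ℂ) :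
    ∃ w : ℂ × ℂ, ∀ i, weightOp lam i (monomial s c) = weightChar w i • monomial s c := by
  refine MvPolynomial.induction_on_monomial (motive := fun p => ∃ w : ℂ × ℂ, ∀ i,
    weightOp lam i p = weightChar w i • p) (fun a => ⟨0, ?_⟩) (fun p ij hp => ?_) s c
  · rintro (_ | s)
    · rw [weightOp_none, derivation_C]; simp [weightChar]
    · rw [weightOp_some, sandwich_C]; simp [weightChar]
  · obtain ⟨w, hw⟩ := hp
    refine ⟨w + (lam ij.2, lam ij.1), ?_⟩
    rintro (_ | s)
    · have h1 := hw none
      rw [weightOp_none] at h1 ⊢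
      rw [Derivation.leibniz, h1, invDerivation_X, sum_eq_single ij.2
        (fun b _ hb => by simp [diagonal_apply_ne _ hb]) (by simp),
        Matrix.diagonal_apply_eq]
      simp only [weightChar, Prod.fst_add, smul_eq_mul, smul_eq_C_mul, map_add]
      ring
    · have h1 := hw (some s)
      rw [weightOp_some] at h1 ⊢
      rw [sandwich_mul, h1, sandwich_X]
      simp only [weightChar, Prod.snd_add, smul_eq_C_mul, mul_add, exp_add,
        map_mul]
      ring

/-- An element of a subspace of polynomials which is stable under the operators `weightOp` is a
sum of weight vectors of the subspace. -/
theorem exists_sum_weights (lam : Fin N → ℂ) (W : Submodule ℂ (Poly[N]))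
    (hW : ∀ i, ∀ w ∈ W, weightOp lam i w ∈ W) {p : Poly[N]} (hp : p ∈ W) :
    ∃ (s : Finset (ℂ × ℂ)) (v : ℂ × ℂ → Poly[N]), p = ∑ c ∈ s, v c ∧
      ∀ c ∈ s, v c ∈ W ∧ ∀ i, weightOp lam i (v c) = weightChar c i • v c := by
  classical
  choose w hw using fun s => exists_weight_monomial lam s (p.coeff s)
  set v : ℂ × ℂ → Poly[N] := fun c =>
    ∑ s ∈ p.support with w s = c, monomial s (p.coeff s) with hv
  have hsum : p = ∑ c ∈ p.support.image w, v c := by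
    rw [hv, Finset.sum_fiberwise_of_maps_to fun s hs => Finset.mem_image_of_mem w hs]
    exact p.as_sum
  have heig : ∀ c i, weightOp lam i (v c) = weightChar c i • v c := by
    intro c i
    rw [hv]
    simp only [map_sum, smul_sum]
    refine sum_congr rfl fun s hs => ?_
    rw [hw, (mem_filter.1 hs).2]
  exact ⟨p.support.image w, v, hsum, fun c hc => ⟨mem_of_sum_mem W _ hW weightChar _ v
    weightChar_injective.injOn (fun c _ => heig c) (hsum ▸ hp) c hc, heig c⟩⟩

theorem tendsto_polyEval {α : Type*} {l : Filter α} {K : α → Mat[N]}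
    {A : Mat[N]} (h : ∀ i j, Tendsto (fun t => K t i j) l (𝓝 (A i j))) (p : Poly[N]) :
    Tendsto (fun t => polyEval p (K t)) l (𝓝 (polyEval p A)) :=
  (p.continuous_eval.tendsto _).comp (tendsto_pi_nhds.2 fun ij => h ij.1 ij.2)

theorem hasDerivAt_polyEval_row {lam : Fin N → ℂ} {f : Mat[N]} {U : Set ℂ}
    {R : ℂ → Mat[N]} (hR : RowEquation lam f U R) (p : Poly[N]) {t : ℂ} (ht : t ∈ U) :
    HasDerivAt (fun u => polyEval p (R u))
      (-(polyEval (invDerivation (Matrix.diagonal lam) p) (R t) / t ^ 2 +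
        polyEval (invDerivation f p) (R t) / t)) t := by
  have h := hasDerivAt_polyEval p R
    (R t * (-(t ^ 2)⁻¹ • Matrix.diagonal lam + (-t⁻¹) • f)) t fun i j => by
      refine (hR t ht i j).congr_deriv ?_
      simp only [mul_add, Matrix.mul_smul, Matrix.add_apply, Matrix.smul_apply, smul_eq_mul,
        mul_diagonal]
      ring
  refine h.congr_deriv ?_
  rw [← polyEval_leftInvDeriv, leftInvDeriv_eq, invDerivation_add, invDerivation_smul,
    invDerivation_smul]
  simp only [polyEval, Derivation.add_apply, Derivation.smul_apply, map_add, MvPolynomial.smul_eval]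
  ring

/-- The polynomials of degree at most `d` and left weight `l` that vanish on `G`. -/
def vanishingPart (G : AlgGroup N) (lam : Fin N → ℂ) (d : ℕ) (l : ℂ) : Submodule ℂ (Poly[N]) :=
  (vanishing G).restrictScalars ℂ ⊓ MvPolynomial.restrictTotalDegree _ ℂ d ⊓
    ⨅ s : ℂ, Module.End.eigenspace (weightOp lam (some s)) (exp (s * l))

theorem mem_vanishingPart {G : AlgGroup N} {lam : Fin N → ℂ} {d : ℕ} {l : ℂ}
    {p : Poly[N]} : p ∈ vanishingPart G lam d l ↔ (p ∈ vanishing G ∧ p.totalDegree ≤ d) ∧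
        ∀ s, weightOp lam (some s) p = exp (s * l) • p := by
  simp only [vanishingPart, Submodule.mem_inf, Submodule.restrictScalars_mem,
    MvPolynomial.mem_restrictTotalDegree, Submodule.mem_iInf, Module.End.mem_eigenspace_iff]

theorem invDerivation_mem_vanishingPart {G : AlgGroup N} {lam : Fin N → ℂ} {d : ℕ} {l : ℂ}
    {X : Mat[N]} (hX : X ∈ lieAlg G) {p : Poly[N]}
    (hp : p ∈ vanishingPart G lam d l) : invDerivation X p ∈ vanishingPart G lam d l := by
  rw [mem_vanishingPart] at hp ⊢
  refine ⟨⟨invDerivation_mem hX hp.1.1, (totalDegree_invDerivation_le _ _).trans hp.1.2⟩,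
    fun s => ?_⟩
  have h := hp.2 s
  rw [weightOp_some] at h ⊢
  rw [← invDerivation_sandwich, h, Derivation.map_smul]

theorem fg_vanishingPart (G : AlgGroup N) (lam : Fin N → ℂ) (d : ℕ) (l : ℂ) :
    (vanishingPart G lam d l).FG :=
  Submodule.FG.of_le (Module.Finite.iff_fg.1 inferInstance)
    (inf_le_left.trans inf_le_right : _ ≤ MvPolynomial.restrictTotalDegree (Fin N × Fin N) ℂ d)

variable {G : AlgGroup N} {lam : Fin N → ℂ} {X₀ : Mat[N]}

theorem exists_weight_generators (hZ : Matrix.diagonal lam ∈ lieAlg G) (d : ℕ) (l : ℂ) :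
    ∃ s : Finset (Poly[N]), Submodule.span ℂ s = vanishingPart G lam d l ∧
      ∀ q ∈ s, ∃ r : ℂ, invDerivation (Matrix.diagonal lam) q = r • q := by
  set T : Set (Poly[N]) := {q | q ∈ vanishingPart G lam d l ∧
    ∃ r : ℂ, invDerivation (Matrix.diagonal lam) q = r • q} with hT
  have hspan : Submodule.span ℂ T = vanishingPart G lam d l := by
    refine le_antisymm (Submodule.span_le.2 fun q hq => hq.1) fun q hq => ?_
    obtain ⟨s, v, rfl, hv⟩ := exists_sum_weights lam (vanishingPart G lam d l) (by
      rintro (_ | s) w hw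
      · exact invDerivation_mem_vanishingPart hZ hw
      · rw [(mem_vanishingPart.1 hw).2 s]
        exact Submodule.smul_mem _ _ hw) hq
    exact Submodule.sum_mem _ fun c hc =>
      Submodule.subset_span ⟨(hv c hc).1, c.1, (hv c hc).2 none⟩
  obtain ⟨s, hsT, hs⟩ := (Submodule.fg_span_iff_fg_span_finset_subset T).1
    (hspan ▸ fg_vanishingPart G lam d l)
  exact ⟨s, by rw [← hs, hspan], fun q hq => (hsT hq).2⟩

theorem eventually_polyEval_eq_zero_of_weight (hZ : Matrix.diagonal lam ∈ lieAlg G)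
    (hX₀ : X₀ ∈ lieAlg G) {ζ : ℂ} (hζ : ζ ≠ 0) {d : ℕ} {l : ℂ} :
    ∀ᶠ y in 𝓝[>] (0 : ℝ), ∀ κ, IsSign κ → ∀ R : ℂ → Mat[N],
      RowEquation lam (Matrix.diagonal lam * X₀ - X₀ * Matrix.diagonal lam)
        (halfAt (ζ * dir κ y)) R → RowAsymptotic lam (𝓝[halfAt (ζ * dir κ y)] 0) R →
      ∀ p ∈ vanishingPart G lam d l, ∀ t ∈ halfAt (ζ * dir κ y), polyEval p (R t) = 0 := by
  classical
  set f := Matrix.diagonal lam * X₀ - X₀ * Matrix.diagonal lam with hf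
  obtain ⟨s, hs, hr⟩ := exists_weight_generators (G := G) hZ d l
  choose! r hr using hr
  have hmem : ∀ q : s, (q : Poly[N]) ∈ vanishingPart G lam d l :=
    fun q => hs ▸ Submodule.subset_span q.2
  have hc : ∀ q : s, ∃ c : s → ℂ, ∑ b, c b • (b : Poly[N]) =
      invDerivation X₀ (q : Poly[N]) := by
    intro q
    have h1 := invDerivation_mem_vanishingPart hX₀ (hmem q)
    rw [← hs, show (s : Set (Poly[N])) = Set.range (Subtype.val : s → _) by
      simp] at h1
    exact (Submodule.mem_span_range_iff_exists_fun ℂ).1 h1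
  choose c hc using hc
  set F : Matrix s s ℂ := fun a b => -(c a b * (r b - r a)) with hF
  obtain ⟨η, X, S, hX⟩ := exists_canonicalRows_of_diag (lam := fun a : s => -r a) (f := F)
    (fun a b hab => by rw [hF]; simp only; rw [neg_inj.1 hab]; simp) hζ
  obtain ⟨η', hη', hav⟩ := exists_sector_avoiding
    (Finset.univ.image fun a : s => (-r a - -l) / ζ)
  have hmin : 0 < min η η' := lt_min hX.pos hη'
  filter_upwards [Ioo_mem_nhdsGT hmin] with y hy κ hκ R hR hR' p hp t ht
  have hX' := hX.mono hmin (min_le_left _ _)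
  have hDf : ∀ a : s, invDerivation f (a : Poly[N]) =
      ∑ b, (c a b * (r b - r a)) • (b : Poly[N]) := by
    intro a
    rw [hf, invDerivation_commutator, ← hc a, hr a a.2, Derivation.map_smul, ← hc a, map_sum,
      smul_sum, ← sum_sub_distrib]
    refine sum_congr rfl fun b _ => ?_
    rw [Derivation.map_smul, hr b b.2, smul_smul, smul_smul, ← sub_smul]
    congr 1
    ring
  have hzero := hX'.col_eq_zero hζ hκ hy (μ := -l)
    (fun a hm => hav κ hκ _ (Finset.mem_image.2 ⟨a, Finset.mem_univ a, rfl⟩)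
      (sector_mono (min_le_right _ _) hm))
    (φ := fun u => Matrix.of fun a _ => polyEval (a : Poly[N]) (R u))
    (fun u hu a k => by
      refine (hasDerivAt_polyEval_row hR (a : Poly[N]) hu).congr_deriv ?_
      rw [hr a a.2, hDf a, Matrix.mul_apply]
      simp only [polyEval, MvPolynomial.smul_eval, map_sum, of_apply, hF, neg_mul,
        Finset.sum_neg_distrib]
      ring)
    (fun a => by
      have hK := tendsto_polyEval (K := fun u => Matrix.of fun i k =>
        exp (-(lam i / u)) * R u i k) (A := 1) (fun i k => hR' i k)
        (a : Poly[N])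
      have h1 := (mem_vanishingPart.1 (hmem a)).1.1 1
      rw [mat_one] at h1
      rw [h1] at hK
      refine hK.congr fun u => ?_
      have h2 := congrArg (fun q => polyEval q (Matrix.of fun i k =>
        exp (-(lam i / u)) * R u i k)) ((mem_vanishingPart.1 (hmem a)).2 u⁻¹)
      simp only [weightOp_some, polyEval_sandwich] at h2
      have e : (Matrix.diagonal fun a => exp (u⁻¹ * lam a)) * (Matrix.of fun i k =>
          exp (-(lam i / u)) * R u i k) * 1 = R u := by
        ext i k
        rw [mul_one, diagonal_mul, of_apply, ← mul_assoc, ← exp_add,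
          div_eq_inv_mul, add_neg_cancel, exp_zero, one_mul]
      rw [e] at h2
      rw [of_apply, h2]
      simp only [polyEval, MvPolynomial.smul_eval]
      rw [mul_right_comm, ← exp_add, neg_div, div_eq_inv_mul, add_neg_cancel,
        exp_zero, one_mul]) ht
  rw [← hs] at hp
  refine Submodule.span_induction (p := fun q _ => polyEval q (R t) = 0) (fun q hq => ?_) ?_ ?_ ?_ hp
  · exact congrFun (congrFun hzero ⟨q, hq⟩) ()
  · simp [polyEval]
  · intro q q' _ _ h h'; simp_all [polyEval]
  · intro a q _ h; simp_all [polyEval]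

theorem mat_expG_diagonal {G : AlgGroup N} {lam : Fin N → ℂ} (hZ : Matrix.diagonal lam ∈ lieAlg G)
    (s : ℂ) : mat (expG (⟨_, hZ⟩ : lieAlg G) s) = Matrix.diagonal fun a => exp (s * lam a) := by
  rw [mat_expG, ← Matrix.diagonal_smul, Matrix.exp_diagonal]
  congr 1
  funext a
  rw [Pi.coe_exp, Complex.exp_eq_exp_ℂ]
  rfl

/-- The canonical row solutions take their values in the group. -/
theorem eventually_polyEval_eq_zero (hZ : Matrix.diagonal lam ∈ lieAlg G)
    (hX₀ : X₀ ∈ lieAlg G) {ζ : ℂ} (hζ : ζ ≠ 0) :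
    ∀ᶠ y in 𝓝[>] (0 : ℝ), ∀ κ, IsSign κ → ∀ R : ℂ → Mat[N],
      RowEquation lam (Matrix.diagonal lam * X₀ - X₀ * Matrix.diagonal lam)
        (halfAt (ζ * dir κ y)) R → RowAsymptotic lam (𝓝[halfAt (ζ * dir κ y)] 0) R →
      ∀ p ∈ vanishing G, ∀ t ∈ halfAt (ζ * dir κ y), polyEval p (R t) = 0 := by
  classical
  obtain ⟨gen, hgen⟩ := (inferInstance : IsNoetherianRing (Poly[N])).noetherian
    (vanishing G)
  have hdec : ∀ p ∈ vanishing G, ∃ (s : Finset (ℂ × ℂ)) (v : ℂ × ℂ → Poly[N]),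
      p = ∑ c ∈ s, v c ∧ ∀ c ∈ s, v c ∈ vanishingPart G lam (v c).totalDegree c.2 := by
    intro p hp
    obtain ⟨s, v, h1, h2⟩ := exists_sum_weights lam ((vanishing G).restrictScalars ℂ) (by
      rintro (_ | s) w hw
      · exact invDerivation_mem hZ hw
      · intro g
        rw [weightOp_some, polyEval_sandwich]
        have h3 := hw (expG ⟨_, hZ⟩ s * g)
        rwa [mat_mul, mat_expG_diagonal, ← mul_one (_ * _)] at h3) hp
    exact ⟨s, v, h1, fun c hc => mem_vanishingPart.2
      ⟨⟨(h2 c hc).1, le_rfl⟩, fun t => (h2 c hc).2 (some t)⟩⟩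
  have hev : ∀ᶠ y in 𝓝[>] (0 : ℝ), ∀ q ∈ gen, ∀ κ, IsSign κ →
      ∀ R : ℂ → Mat[N],
      RowEquation lam (Matrix.diagonal lam * X₀ - X₀ * Matrix.diagonal lam)
        (halfAt (ζ * dir κ y)) R → RowAsymptotic lam (𝓝[halfAt (ζ * dir κ y)] 0) R →
      ∀ t ∈ halfAt (ζ * dir κ y), polyEval q (R t) = 0 := by
    rw [Filter.eventually_all_finset]
    intro q hq
    obtain ⟨s, v, rfl, hv⟩ := hdec q (hgen ▸ Submodule.subset_span hq)
    have := (Filter.eventually_all_finset s).2 fun c (hc : c ∈ s) =>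
      eventually_polyEval_eq_zero_of_weight (G := G) hZ hX₀ hζ (d := (v c).totalDegree) (l := c.2)
    filter_upwards [this] with y hy κ hκ R hR hR' t ht
    rw [polyEval, map_sum]
    exact Finset.sum_eq_zero fun c hc => hy c hc κ hκ R hR hR' _ (hv c hc) t ht
  filter_upwards [hev] with y hy κ hκ R hR hR' p hp t ht
  have hle : vanishing G ≤ RingHom.ker (eval fun ij : Fin N × Fin N =>
      R t ij.1 ij.2) := by
    rw [← hgen]
    exact Submodule.span_le.2 fun q hq => hy q hq κ hκ R hR hR' t ht
  exact hle hp

end RowsInGroup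

section LeadingTerm

variable {N : ℕ}

theorem differentiable_eval {σ : Type*} [Fintype σ] (p : MvPolynomial σ ℂ) :
    Differentiable ℂ fun x : σ → ℂ => eval x p := by
  induction p using MvPolynomial.induction_on with
  | C a => simp
  | add p q hp hq => simpa using hp.fun_add hq
  | mul_X p i hp => simpa using hp.fun_mul (differentiable_apply i)

/-- A limit of rescaled differences `c (g - 1)`, with `g → 1` in `G`, is tangent to `G`. -/
theorem mem_lieAlg_of_tendsto {G : AlgGroup N} {α : Type*} {l : Filter α} [l.NeBot]
    {g : α → G.toSubgroup} {c : α → ℂ} {X : Mat[N]}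
    (hg : ∀ i j, Tendsto (fun n => (mat (g n) - 1) i j) l (𝓝 0))
    (hX : ∀ i j, Tendsto (fun n => c n * (mat (g n) - 1) i j) l (𝓝 (X i j))) : X ∈ lieAlg G := by
  intro p hp
  set x₀ : Fin N × Fin N → ℂ := fun ij => (1 : Mat[N]) ij.1 ij.2 with hx₀
  set v : Fin N × Fin N → ℂ := fun ij => X ij.1 ij.2 with hv
  have hF := (differentiable_eval p x₀).hasFDerivAt
  set F' := fderiv ℂ (fun x : Fin N × Fin N → ℂ => eval x p) x₀ with hF'
  have hd : F' v = ∑ ij : Fin N × Fin N, polyEval (pderiv ij p) 1 * X ij.1 ij.2 := by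
    have h1 : HasDerivAt (fun u : ℂ => x₀ + u • v) v 0 := by
      simpa using ((hasDerivAt_id (0 : ℂ)).smul_const v).const_add x₀
    have hF0 : HasFDerivAt (fun x : Fin N × Fin N → ℂ => eval x p) F'
      (x₀ + (0 : ℂ) • v) := by simpa using hF
    have h2 := hF0.comp_hasDerivAt (0 : ℂ) h1
    have h3 := hasDerivAt_polyEval p _ _ 0 (hasDerivAt_one_add_smul X)
    rw [zero_smul, add_zero] at h3
    exact h2.unique h3
  rw [← hd]
  have h := (hF.hasFDerivWithinAt (s := Set.univ)).lim (l := l) (c := c)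
    (d := fun n ij => (mat (g n) - 1) ij.1 ij.2) (v := v)
    (tendsto_pi_nhds.2 fun ij => hg ij.1 ij.2) (by simp)
    (tendsto_pi_nhds.2 fun ij => hX ij.1 ij.2)
  refine tendsto_nhds_unique h (tendsto_const_nhds.congr fun n => ?_)
  have e : x₀ + (fun ij : Fin N × Fin N => (mat (g n) - 1) ij.1 ij.2) =
      fun ij => mat (g n) ij.1 ij.2 := by
    funext ij; simp [hx₀]
  have h1 : eval (fun ij : Fin N × Fin N => mat (g n) ij.1 ij.2) p = 0 :=
    hp (g n)
  have h2 : eval x₀ p = 0 := hp 1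
  rw [e, h1, h2, sub_zero, smul_zero]

theorem tendsto_exp_of_re_neg {v : ℂ} (hv : v.re < 0) :
    Tendsto (fun T : ℝ => exp (T * v)) atTop (𝓝 0) := by
  rw [tendsto_zero_iff_norm_tendsto_zero]
  simp only [Complex.norm_exp, re_ofReal_mul]
  exact Real.tendsto_exp_atBot.comp (tendsto_id.atTop_mul_const_of_neg hv)

theorem exists_generic_direction {U : Set ℂ} (hU : IsOpen U) {d₀ : ℂ} (hd₀ : d₀ ∈ U) (h0 : d₀ ≠ 0)
    (V : Finset ℂ) (hV : ∀ v ∈ V, v ≠ 0) : ∃ d ∈ U, ∀ v ∈ V, (v * conj d).re ≠ 0 := by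
  have hcont : Continuous fun ε : ℝ => d₀ * (1 + ε * I) := by fun_prop
  have h1 : ∀ᶠ ε : ℝ in 𝓝[>] (0 : ℝ), d₀ * (1 + ε * I) ∈ U :=
    (hcont.continuousAt.eventually_mem (hU.mem_nhds (by simpa using hd₀))).filter_mono
      nhdsWithin_le_nhds
  have h2 : ∀ᶠ ε : ℝ in 𝓝[>] (0 : ℝ), ∀ v ∈ V,
      (v * conj (d₀ * (1 + ε * I))).re ≠ 0 := by
    rw [Filter.eventually_all_finset]
    intro v hv
    set w := v * conj d₀ with hw
    have hw0 : w ≠ 0 := mul_ne_zero (hV v hv) ((map_ne_zero _).2 h0)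
    have e : ∀ ε : ℝ, (v * conj (d₀ * (1 + ε * I))).re = w.re + ε * w.im := by
      intro ε
      have : v * conj (d₀ * (1 + ε * I)) = w * (1 - ε * I) := by
        simp only [map_mul, map_add, map_one, Complex.conj_ofReal, Complex.conj_I, hw]; ring
      rw [this]; simp; ring
    simp only [e]
    by_cases hre : w.re = 0
    · have him : w.im ≠ 0 := fun him => hw0 (Complex.ext hre him)
      filter_upwards [self_mem_nhdsWithin] with ε hε
      rw [hre, zero_add]
      exact mul_ne_zero (ne_of_gt hε) him
    · have hc : Continuous fun ε : ℝ => w.re + ε * w.im := by fun_prop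
      exact (hc.continuousAt.eventually_ne (by simpa using hre)).filter_mono nhdsWithin_le_nhds
  obtain ⟨ε, hε⟩ := (h1.and h2).exists
  exact ⟨_, hε.1, hε.2⟩

/-- If `g ∈ G` has an off-diagonal part with weights in a half-plane, then the leading term of
`exp(sZ) g exp(-sZ)` is an eigenvector of `ad(Z)` in the Lie algebra. -/
theorem exists_eigenvector_of_ne_one {G : AlgGroup N} {lam : Fin N → ℂ}
    (hZ : Matrix.diagonal lam ∈ lieAlg G) (g : G.toSubgroup) {U : Set ℂ} (hU : IsOpen U) {d₀ : ℂ}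
    (hd₀ : d₀ ∈ U) (h0 : d₀ ≠ 0) (hw : ∀ a b, mat g a b ≠ (1 : Mat[N]) a b → lam a ≠ lam b ∧
      ∀ d ∈ U, 0 ≤ ((lam a - lam b) * conj d).re) (hne : mat g ≠ 1) :
    ∃ a b, mat g a b ≠ (1 : Mat[N]) a b ∧ ∃ X ∈ lieAlg G, X ≠ 0 ∧
      Matrix.diagonal lam * X - X * Matrix.diagonal lam = (lam a - lam b) • X := by
  classical
  set C := mat g with hC
  set B : Finset (Fin N × Fin N) := Finset.univ.filter fun ab =>
    C ab.1 ab.2 ≠ (1 : Mat[N]) ab.1 ab.2 with hB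
  have memB : ∀ a b, (a, b) ∈ B ↔ C a b ≠ (1 : Mat[N]) a b := by
    intro a b; simp [hB]
  set w : Fin N × Fin N → ℂ := fun ab => lam ab.1 - lam ab.2 with hwdef
  have hBne : B.Nonempty := by
    by_contra hemp
    rw [Finset.not_nonempty_iff_eq_empty] at hemp
    refine hne (Matrix.ext fun a b => ?_)
    by_contra h
    have := (memB a b).2 h
    rw [hemp] at this
    exact absurd this (Finset.notMem_empty _)
  obtain ⟨d, hd, hgen⟩ := exists_generic_direction hU hd₀ h0
    ((Finset.image (fun x : (Fin N × Fin N) × (Fin N × Fin N) => w x.1 - w x.2) Finset.univ ∪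
      Finset.image w Finset.univ).filter fun v => v ≠ 0) (fun v hv => (mem_filter.1 hv).2)
  obtain ⟨x₀, hx₀, hmin⟩ := B.exists_min_image (fun x => (w x * conj d).re) hBne
  have hx₀w := hw x₀.1 x₀.2 ((memB _ _).1 hx₀)
  have hw0 : w x₀ ≠ 0 := sub_ne_zero.2 hx₀w.1
  have hpos : 0 < (w x₀ * conj d).re :=
    lt_of_le_of_ne (hx₀w.2 d hd) (Ne.symm (hgen _ (mem_filter.2
      ⟨Finset.mem_union_right _ (Finset.mem_image_of_mem _ (Finset.mem_univ _)), hw0⟩)))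
  have hlt : ∀ x ∈ B, w x ≠ w x₀ → ((w x₀ - w x) * conj d).re < 0 := by
    intro x hx hxw
    have h1 := hmin x hx
    have h2 := hgen (w x₀ - w x) (mem_filter.2 ⟨Finset.mem_union_left _
      (Finset.mem_image.2 ⟨(x₀, x), Finset.mem_univ _, rfl⟩), sub_ne_zero.2 (Ne.symm hxw)⟩)
    refine lt_of_le_of_ne ?_ h2
    rw [sub_mul, sub_re]
    linarith
  set X : Mat[N] := Matrix.of fun a b =>
    if (a, b) ∈ B ∧ w (a, b) = w x₀ then C a b else 0 with hX
  set gT : ℝ → G.toSubgroup := fun T => expG (⟨_, hZ⟩ : lieAlg G) (-(T * conj d)) * g *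
    expG (⟨_, hZ⟩ : lieAlg G) (T * conj d) with hgT
  have hent : ∀ (T : ℝ) (a b : Fin N), (mat (gT T) - 1) a b =
      if (a, b) ∈ B then exp (T * (-w (a, b) * conj d)) * C a b else 0 := by
    intro T a b
    rw [hgT]
    simp only [mat_mul, mat_expG_diagonal, Matrix.sub_apply, mul_diagonal,
      diagonal_mul, ← hC]
    have e : exp (-(↑T * conj d) * lam a) * C a b *
        exp (↑T * conj d * lam b) =
        exp (T * (-w (a, b) * conj d)) * C a b := by
      rw [mul_right_comm, ← exp_add]
      congr 2
      simp only [hwdef]; ring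
    rw [e]
    split_ifs with hab
    · have hne' : a ≠ b := fun h => (hw a b ((memB a b).1 hab)).1 (by rw [h])
      rw [one_apply_ne hne', sub_zero]
    · rw [memB, not_not] at hab
      rw [hab]
      by_cases hab' : a = b
      · subst hab'; simp [hwdef]
      · rw [one_apply_ne hab', mul_zero, sub_zero]
  refine ⟨x₀.1, x₀.2, (memB _ _).1 hx₀, X, ?_, ?_, ?_⟩
  · refine mem_lieAlg_of_tendsto (l := atTop) (g := gT)
      (c := fun T => exp (T * (w x₀ * conj d))) (fun a b => ?_) fun a b => ?_
    · simp only [hent]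
      split_ifs with hab
      · have : (-w (a, b) * conj d).re < 0 := by
          have := hmin _ hab
          rw [neg_mul, Complex.neg_re]
          linarith
        simpa using (tendsto_exp_of_re_neg this).mul_const (C a b)
      · exact tendsto_const_nhds
    · simp only [hent, hX, of_apply]
      by_cases hab : (a, b) ∈ B
      · have e : ∀ T : ℝ, exp (T * (w x₀ * conj d)) *
            (exp (T * (-w (a, b) * conj d)) * C a b) =
            exp (T * ((w x₀ - w (a, b)) * conj d)) * C a b := by
          intro T
          rw [← mul_assoc, ← exp_add]
          congr 2
          ring
        simp only [if_pos hab, e]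
        by_cases hww : w (a, b) = w x₀
        · rw [if_pos ⟨hab, hww⟩, hww]
          simp
        · rw [if_neg fun h => hww h.2]
          simpa using (tendsto_exp_of_re_neg (hlt _ hab hww)).mul_const (C a b)
      · simp [hab]
  · intro hX0
    have h1 := congrFun (congrFun hX0 x₀.1) x₀.2
    rw [hX, of_apply, if_pos ⟨hx₀, rfl⟩, Matrix.zero_apply] at h1
    have h2 := (memB _ _).1 hx₀
    rw [h1, one_apply_ne (fun h => hx₀w.1 (by rw [h]))] at h2
    exact h2 rfl
  · ext a b
    rw [Matrix.sub_apply, diagonal_mul, mul_diagonal, Matrix.smul_apply, smul_eq_mul,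
      hX, of_apply]
    split_ifs with h
    · have h1 : lam a - lam b = lam x₀.1 - lam x₀.2 := h.2
      rw [← h1]; ring
    · ring

end LeadingTerm

section Inverse

variable {ι : Type*} [Fintype ι] [DecidableEq ι]

theorem differentiableAt_det {A : ℂ → Mat(ι)} {t : ℂ}
    (hA : ∀ i j, DifferentiableAt ℂ (fun u => A u i j) t) :
    DifferentiableAt ℂ (fun u => (A u).det) t := by
  simp only [Matrix.det_apply]
  exact DifferentiableAt.fun_sum fun σ _ => (DifferentiableAt.fun_finsetProd fun i _ =>
    hA (σ i) i).const_smul (Equiv.Perm.sign σ)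

theorem hasDerivAt_inv_entry {A : ℂ → Mat(ι)} {A' : Mat(ι)} {t : ℂ}
    (hA : ∀ i j, HasDerivAt (fun u => A u i j) (A' i j) t) (hU : IsUnit (A t)) (i j : ι) :
    HasDerivAt (fun u => (A u)⁻¹ i j) ((-((A t)⁻¹ * A' * (A t)⁻¹)) i j) t := by
  have hdet := differentiableAt_det fun i j => (hA i j).differentiableAt
  have h0 : (A t).det ≠ 0 := ((isUnit_iff_isUnit_det _).1 hU).ne_zero
  have hadj : ∀ i j, DifferentiableAt ℂ (fun u => (A u).adjugate i j) t := by
    intro i j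
    simp only [Matrix.adjugate_apply]
    refine differentiableAt_det fun k l => ?_
    by_cases hk : k = j
    · subst hk; simp
    · simpa [Matrix.updateRow_ne hk] using (hA k l).differentiableAt
  have hdiff : ∀ i j, DifferentiableAt ℂ (fun u => (A u)⁻¹ i j) t := by
    intro i j
    simp only [Matrix.inv_def, Matrix.smul_apply, Ring.inverse_eq_inv', smul_eq_mul]
    exact (hdet.fun_inv h0).fun_mul (hadj i j)
  set B' : Mat(ι) := Matrix.of fun i j => deriv (fun u => (A u)⁻¹ i j) t with hB'
  have hB : ∀ i j, HasDerivAt (fun u => (A u)⁻¹ i j) (B' i j) t := fun i j => (hdiff i j).hasDerivAt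
  have hprod := hasDerivAt_mul_entry hB hA
  have hev : ∀ᶠ u in 𝓝 t, (A u)⁻¹ * A u = 1 := by
    filter_upwards [hdet.continuousAt.eventually_ne h0] with u hu
    exact Matrix.nonsing_inv_mul _ (isUnit_iff_ne_zero.2 hu)
  have hz : B' * A t + (A t)⁻¹ * A' = 0 := by
    ext k l
    refine (hprod k l).unique ((hasDerivAt_const t ((1 : Mat(ι)) k l)).congr_of_eventuallyEq ?_)
    filter_upwards [hev] with u hu
    rw [hu]
  have hBA : B' = -((A t)⁻¹ * A' * (A t)⁻¹) := by
    have h1 := congrArg (· * (A t)⁻¹) (eq_neg_of_add_eq_zero_left hz)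
    beta_reduce at h1
    rwa [mul_assoc, Matrix.mul_nonsing_inv _ (isUnit_iff_ne_zero.2 h0), mul_one,
      Matrix.neg_mul] at h1
  rw [← hBA]
  exact hB i j

theorem ColEquation.inv {lam : ι → ℂ} {f : Mat(ι)} {U : Set ℂ} {Y : ℂ → Mat(ι)}
    (h : ColEquation lam f U Y) (hU : ∀ t ∈ U, IsUnit (Y t)) :
    RowEquation lam f U fun t => (Y t)⁻¹ := by
  intro t ht i k
  have hY := Matrix.mul_nonsing_inv _ ((isUnit_iff_isUnit_det _).1 (hU t ht))
  refine (hasDerivAt_inv_entry (A' := ((t ^ 2)⁻¹ • Matrix.diagonal lam + t⁻¹ • f) * Y t)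
    (fun i j => (h t ht i j).congr_deriv ?_) (hU t ht) i k).congr_deriv ?_
  · simp only [add_mul, Matrix.smul_mul, Matrix.add_apply, Matrix.smul_apply, smul_eq_mul,
      diagonal_mul]
    ring
  · rw [mul_assoc, mul_assoc, hY, mul_one, mul_add, Matrix.mul_smul, Matrix.mul_smul]
    simp only [Matrix.neg_apply, Matrix.add_apply, Matrix.smul_apply, smul_eq_mul,
      mul_diagonal]
    ring

theorem RowEquation.inv {lam : ι → ℂ} {f : Mat(ι)} {U : Set ℂ} {X : ℂ → Mat(ι)}
    (h : RowEquation lam f U X) (hU : ∀ t ∈ U, IsUnit (X t)) :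
    ColEquation lam f U fun t => (X t)⁻¹ := by
  intro t ht i k
  have hX := Matrix.nonsing_inv_mul _ ((isUnit_iff_isUnit_det _).1 (hU t ht))
  refine (hasDerivAt_inv_entry (A' := X t * -((t ^ 2)⁻¹ • Matrix.diagonal lam + t⁻¹ • f))
    (fun i j => (h t ht i j).congr_deriv ?_) (hU t ht) i k).congr_deriv ?_
  · simp only [mul_neg, mul_add, Matrix.mul_smul, Matrix.add_apply, Matrix.smul_apply, smul_eq_mul,
      mul_diagonal, Matrix.neg_apply]
    ring
  · rw [← mul_assoc, hX, one_mul, neg_mul, neg_neg, add_mul, Matrix.smul_mul, Matrix.smul_mul]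
    simp only [Matrix.add_apply, Matrix.smul_apply, smul_eq_mul, diagonal_mul]
    ring

theorem tendsto_inv_one {α : Type*} {l : Filter α} {K : α → Mat(ι)}
    (h : Tendsto K l (𝓝 1)) : Tendsto (fun t => (K t)⁻¹) l (𝓝 1) := by
  have h1 : Tendsto (fun t => (K t).det) l (𝓝 1) := by
    simpa [comp_def] using ((continuous_id.matrix_det).tendsto (1 : Mat(ι))).comp h
  have h2 : Tendsto (fun t => (K t).adjugate) l (𝓝 1) := by
    simpa [comp_def] using ((continuous_id.matrix_adjugate).tendsto (1 : Mat(ι))).comp h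
  simpa only [Matrix.inv_def, Ring.inverse_eq_inv', inv_one, one_smul] using
    (h1.inv₀ one_ne_zero).smul h2

theorem inv_diagonal_exp (v : ι → ℂ) : (Matrix.diagonal fun a => exp (v a))⁻¹ =
    Matrix.diagonal fun a => exp (-v a) := by
  refine Matrix.inv_eq_right_inv ?_
  rw [Matrix.diagonal_mul_diagonal]
  simp only [← exp_add, add_neg_cancel, exp_zero, Matrix.diagonal_one]

theorem tendsto_matrix_iff {α m n : Type*} {l : Filter α} {K : α → Matrix m n ℂ}
    {A : Matrix m n ℂ} : Tendsto K l (𝓝 A) ↔ ∀ i j, Tendsto (fun t => K t i j) l (𝓝 (A i j)) :=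
  tendsto_pi_nhds.trans (forall_congr' fun _ => tendsto_pi_nhds)

theorem colAsymptotic_iff {lam : ι → ℂ} {l : Filter ℂ} {Y : ℂ → Mat(ι)} : ColAsymptotic lam l Y ↔
      Tendsto (fun t => Y t * Matrix.diagonal fun a => exp (lam a / t)) l (𝓝 1) := by
  simp only [ColAsymptotic, tendsto_matrix_iff, mul_diagonal]

theorem rowAsymptotic_iff {lam : ι → ℂ} {l : Filter ℂ} {X : ℂ → Mat(ι)} : RowAsymptotic lam l X ↔
      Tendsto (fun t => (Matrix.diagonal fun a => exp (-(lam a / t))) * X t) l (𝓝 1) := by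
  simp only [RowAsymptotic, tendsto_matrix_iff, diagonal_mul]

theorem ColAsymptotic.inv {lam : ι → ℂ} {l : Filter ℂ} {Y : ℂ → Mat(ι)}
    (h : ColAsymptotic lam l Y) : RowAsymptotic lam l fun t => (Y t)⁻¹ := by
  rw [rowAsymptotic_iff]
  simpa only [Matrix.mul_inv_rev, inv_diagonal_exp] using tendsto_inv_one (colAsymptotic_iff.1 h)

theorem RowAsymptotic.inv {lam : ι → ℂ} {l : Filter ℂ} {X : ℂ → Mat(ι)}
    (h : RowAsymptotic lam l X) : ColAsymptotic lam l fun t => (X t)⁻¹ := by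
  rw [colAsymptotic_iff]
  simpa only [Matrix.mul_inv_rev, inv_diagonal_exp, neg_neg] using
    tendsto_inv_one (rowAsymptotic_iff.1 h)

end Inverse

section CanonicalSolutions

variable {N m : ℕ} {G H : AlgGroup N}

/-- The matrix `P⁻¹AP`. -/
def eig (P : GL (Fin m) ℂ) (A : Mat[m]) : Mat[m] :=
  (P⁻¹ : GL (Fin m) ℂ) * A * (P : Mat[m])

variable (P : GL (Fin m) ℂ)

theorem eig_mul (A B : Mat[m]) : eig P (A * B) = eig P A * eig P B := by
  have h : (P : Mat[m]) * (P⁻¹ : GL (Fin m) ℂ) = 1 :=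
    Units.mul_inv P
  calc eig P (A * B) = (P⁻¹ : GL (Fin m) ℂ) * A *
        ((P : Mat[m]) * (P⁻¹ : GL (Fin m) ℂ)) * B *
          (P : Mat[m]) := by
        rw [h, mul_one]; simp only [eig, mul_assoc]
    _ = _ := by simp only [eig, mul_assoc]

theorem eig_one : eig P 1 = 1 := by rw [eig, mul_one]; exact Units.inv_mul P

theorem eig_inv_eig (A : Mat[m]) : eig P⁻¹ (eig P A) = A := by
  have h : (P : Mat[m]) * (P⁻¹ : GL (Fin m) ℂ) = 1 :=
    Units.mul_inv P
  rw [eig, eig, inv_inv, ← mul_assoc, ← mul_assoc, h, one_mul, mul_assoc, h, mul_one]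

theorem eig_injective : Function.Injective (eig P) :=
  Function.LeftInverse.injective (eig_inv_eig P)

theorem eig_eig_inv (A : Mat[m]) : eig P (eig P⁻¹ A) = A := by
  simpa using eig_inv_eig P⁻¹ A

/-- Conjugation by `P`, as a linear map. -/
def eigLinear : Mat[m] →ₗ[ℂ] Mat[m] where
  toFun := eig P
  map_add' A B := by simp only [eig, mul_add, add_mul]
  map_smul' c A := by simp only [eig, Matrix.mul_smul, Matrix.smul_mul, RingHom.id_apply]

theorem eigLinear_apply (A : Mat[m]) : eigLinear P A = eig P A := rfl

theorem eig_add (A B : Mat[m]) : eig P (A + B) = eig P A + eig P B :=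
  map_add (eigLinear P) A B

theorem eig_sub (A B : Mat[m]) : eig P (A - B) = eig P A - eig P B :=
  map_sub (eigLinear P) A B

theorem eig_smul (c : ℂ) (A : Mat[m]) : eig P (c • A) = c • eig P A :=
  map_smul (eigLinear P) c A

theorem continuous_eig : Continuous (eig P) :=
  (continuous_const.matrix_mul continuous_id).matrix_mul continuous_const

theorem hasDerivAt_eig_entry {A : ℂ → Mat[m]} {A' : Mat[m]}
    {t : ℂ} (hA : ∀ i j, HasDerivAt (fun u => A u i j) (A' i j) t) (i j : Fin m) :
    HasDerivAt (fun u => eig P (A u) i j) (eig P A' i j) t :=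
  hasDerivAt_mul_const_entry _ (hasDerivAt_const_mul_entry _ hA) i j

variable {P}

/-- The tautological representation. -/
def stdRep (G : AlgGroup N) : RationalRep G N where
  toHom := G.toSubgroup.subtype
  isRegular i j := ⟨MvPolynomial.X (i, j), 0, fun g => by simp [polyEval, mat]⟩

theorem stdRep_diff (X : lieAlg G) : (stdRep G).diff X = X := by
  ext i j
  exact (hasDerivAt_mat_expG_zero X i j).deriv

theorem coe_stdRep (g : G.toSubgroup) : ((stdRep G).toHom g : Mat[N]) = mat g := rfl

theorem IsRegular.tendsto {φ : G.toSubgroup → ℂ} (h : IsRegular G φ) {α : Type*} {l : Filter α}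
    {g : α → G.toSubgroup} (hg : Tendsto (fun t => mat (g t)) l (𝓝 1)) :
    Tendsto (fun t => φ (g t)) l (𝓝 (φ 1)) := by
  obtain ⟨p, k, hp⟩ := h
  have e : ∀ g, φ g = polyEval p (mat g) / (mat g).det ^ k := fun g => by
    rw [← hp, mul_div_cancel_left₀ _ (pow_ne_zero _ (det_mat_ne_zero _))]
  simp only [e, mat_one]
  have h1 : Tendsto (fun t => (mat (g t)).det) l (𝓝 (1 : Mat[N]).det) :=
    ((continuous_id.matrix_det).tendsto (1 : Mat[N])).comp hg
  exact (tendsto_polyEval (tendsto_matrix_iff.1 hg) p).div (h1.pow k) (by simp)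

variable {hHG : H.toSubgroup ≤ G.toSubgroup} {ρ : RationalRep G m}
  {lam : Fin m → Dual[H]} {Z : lieAlg H} {f : lieAlg G} {r : Set ℂ}
  {Y : ℂ → G.toSubgroup}

theorem IsCanonicalSolution.colEquation (hY : IsCanonicalSolution G (lieIncl hHG Z) f r Y)
    (hw : WeightBasis hHG ρ P lam) : ColEquation (fun a => lam a Z) (eig P (ρ.diff f)) (halfPlane r)
      fun t => eig P (ρ.toHom (Y t)) := by
  intro t ht i j
  have h1 := ρ.hasDerivAt (X := (t ^ 2)⁻¹ • lieIncl hHG Z + t⁻¹ • f) (hY.1 t ht)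
  refine (hasDerivAt_eig_entry P h1 i j).congr_deriv ?_
  have hd : eig P (ρ.diff (lieIncl hHG Z)) = Matrix.diagonal fun a => lam a Z := hw.diff Z
  rw [eig_mul, ← ρ.diffLinear_apply, map_add, map_smul, map_smul, eig_add, eig_smul,
    eig_smul, ρ.diffLinear_apply, ρ.diffLinear_apply, hd]
  simp only [add_mul, Matrix.smul_mul, Matrix.add_apply, Matrix.smul_apply, smul_eq_mul,
    diagonal_mul]
  ring

theorem IsCanonicalSolution.colAsymptotic (hY : IsCanonicalSolution G (lieIncl hHG Z) f r Y)
    (hw : WeightBasis hHG ρ P lam) : ColAsymptotic (fun a => lam a Z) (𝓝[halfPlane r] 0)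
      fun t => eig P (ρ.toHom (Y t)) := by
  have h1 : Tendsto (fun t => mat (Y t * expG (lieIncl hHG Z) t⁻¹)) (𝓝[halfPlane r] 0)
    (𝓝 1) := hY.2
  have h2 : Tendsto (fun t => (ρ.toHom (Y t * expG (lieIncl hHG Z) t⁻¹) :
      Mat[m])) (𝓝[halfPlane r] 0) (𝓝 1) := by
    refine tendsto_matrix_iff.2 fun i j => ?_
    have := (ρ.isRegular i j).tendsto h1
    rwa [ρ.coe_one] at this
  have h3 := ((continuous_eig P).tendsto 1).comp h2
  rw [eig_one] at h3
  refine colAsymptotic_iff.2 (h3.congr fun t => ?_)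
  have he : eig P (ρ.toHom (expG (lieIncl hHG Z) t⁻¹)) =
    Matrix.diagonal fun a => exp (t⁻¹ * lam a Z) := hw.map_exp Z t⁻¹
  simp only [Function.comp, ρ.coe_mul, eig_mul, he, div_eq_inv_mul]

theorem isUnit_eig_rep (P : GL (Fin m) ℂ) (g : G.toSubgroup) : IsUnit (eig P (ρ.toHom g)) :=
  ((Units.isUnit _).mul (Units.isUnit _)).mul (Units.isUnit _)

end CanonicalSolutions

section Uniqueness

variable {N : ℕ} {G H : AlgGroup N} {hHG : H.toSubgroup ≤ G.toSubgroup}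
  {P : GL (Fin N) ℂ} {lam : Fin N → Dual[H]}
  {Z : lieAlg H} {f : lieAlg G}

theorem WeightBasis.eig_coe (hw : WeightBasis hHG (stdRep G) P lam) (Z : lieAlg H) :
    eig P (Z : Mat[N]) = Matrix.diagonal fun a => lam a Z := by
  have h := hw.diff Z
  rwa [stdRep_diff, coe_lieIncl] at h

theorem diagonal_mem_lieAlg_conj (hw : WeightBasis hHG (stdRep G) P lam) :
    Matrix.diagonal (fun a => lam a Z) ∈ lieAlg (G.conj P) := by
  rw [mem_lieAlg_conj]
  have h2 : eig P⁻¹ (Matrix.diagonal fun a => lam a Z) = Z := by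
    rw [← hw.eig_coe, eig_inv_eig]
  simp only [eig, inv_inv] at h2
  rw [h2]
  exact lieAlg_mono hHG Z.2

theorem eig_mem_lieAlg_conj (X : lieAlg G) : eig P (X : Mat[N]) ∈ lieAlg (G.conj P) := by
  rw [mem_lieAlg_conj]
  have h2 := eig_inv_eig P (X : Mat[N])
  rw [eig, inv_inv] at h2
  rw [h2]
  exact X.2

theorem inv_eig_stdRep (g : G.toSubgroup) : (eig P ((stdRep G).toHom g))⁻¹ = eig P (mat g⁻¹) := by
  refine Matrix.inv_eq_left_inv ?_
  rw [coe_stdRep, ← eig_mul, mat_inv_mul, eig_one]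

/-- Canonical solutions on two half-planes agree on the intersection, if no eigenvalue of `ad(Z)` is
in the closed cone dual to the intersection. -/
theorem IsCanonicalSolution.eq_of_cone (hw : WeightBasis hHG (stdRep G) P lam) {r₁ r₂ : Set ℂ}
    {u₁ u₂ : ℂ} (hr₁ : halfPlane r₁ = halfAt u₁) (hr₂ : halfPlane r₂ = halfAt u₂)
    {Y₁ Y₂ : ℂ → G.toSubgroup} (h₁ : IsCanonicalSolution G (lieIncl hHG Z) f r₁ Y₁)
    (h₂ : IsCanonicalSolution G (lieIncl hHG Z) f r₂ Y₂)
    (hcone : ∀ (w : ℂ) (X : lieAlg G), w ≠ 0 → X ≠ 0 → (Z : Mat[N]) * X - X * (Z : Mat[N]) =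
        w • (X : Mat[N]) → ∃ d ∈ halfAt u₁ ∩ halfAt u₂, (w * conj d).re < 0)
    {t : ℂ} (ht : t ∈ halfAt u₁ ∩ halfAt u₂) : Y₁ t = Y₂ t := by
  set U := halfAt u₁ ∩ halfAt u₂ with hU
  have hZc := diagonal_mem_lieAlg_conj (Z := Z) hw
  have hrow : RowEquation (fun a => lam a Z) (eig P ((stdRep G).diff f)) U
      fun t => (eig P ((stdRep G).toHom (Y₂ t)))⁻¹ := fun t ht =>
    (hr₂ ▸ h₂.colEquation hw).inv (fun _ _ => isUnit_eig_rep P _) t ht.2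
  have hcol : ColEquation (fun a => lam a Z) (eig P ((stdRep G).diff f)) U
      fun t => eig P ((stdRep G).toHom (Y₁ t)) := fun t ht => (hr₁ ▸ h₁.colEquation hw) t ht.1
  have hra := (hr₂ ▸ h₂.colAsymptotic hw).inv
  have hca := hr₁ ▸ h₁.colAsymptotic hw
  set g : G.toSubgroup := (Y₂ t)⁻¹ * Y₁ t with hg
  have hgm : (eig P ((stdRep G).toHom (Y₂ t)))⁻¹ * eig P ((stdRep G).toHom (Y₁ t)) =
      eig P (mat g) := by
    rw [inv_eig_stdRep, coe_stdRep, ← eig_mul, hg, mat_mul]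
  have hlim : ∀ d ∈ U, ∀ a b, Tendsto (fun s => exp (-((lam a Z - lam b Z) / s)) *
      eig P (mat g) a b) (radial d) (𝓝 ((1 : Mat[N]) a b)) := by
    intro d hd a b
    have := hrow.tendsto_mul_col ((convex_halfAt u₁).inter (convex_halfAt u₂))
      (fun d hd τ hτ => ⟨ofReal_mul_mem_halfAt hd.1 hτ, ofReal_mul_mem_halfAt hd.2 hτ⟩) hcol hd
      (fun i k => (hra i k).mono_left (radial_le_nhdsWithin hd.2))
      (fun i k => (hca i k).mono_left (radial_le_nhdsWithin hd.1)) ht a b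
    rwa [hgm] at this
  have hgc : P⁻¹ * (g : GL (Fin N) ℂ) * P ∈ (G.conj P).toSubgroup := by
    rw [AlgGroup.mem_conj]
    simp [mul_assoc]
  have hweights : ∀ a b, eig P (mat g) a b ≠ (1 : Mat[N]) a b →
      lam a Z ≠ lam b Z ∧ ∀ d ∈ U, 0 ≤ ((lam a Z - lam b Z) * conj d).re := by
    intro a b hab
    have h1 : lam a Z ≠ lam b Z := by
      intro h
      have := hlim t ht a b
      simp only [h, sub_self, zero_div, neg_zero, exp_zero, one_mul] at this
      exact hab (tendsto_nhds_unique tendsto_const_nhds this)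
    refine ⟨h1, fun d hd => ?_⟩
    by_contra hneg
    have h2 := hlim d hd a b
    rw [one_apply_ne fun h => h1 (by rw [h])] at h2 hab
    exact hab (eq_zero_of_tendsto_radial (not_le.1 hneg) h2)
  have hone : eig P (mat g) = 1 := by
    by_contra hne
    obtain ⟨a, b, hab, X, hX, hX0, heig⟩ := exists_eigenvector_of_ne_one hZc
      (⟨_, hgc⟩ : (G.conj P).toSubgroup) ((isOpen_halfAt u₁).inter (isOpen_halfAt u₂)) ht
      (ne_zero_of_mem_halfAt ht.1) hweights hne
    rw [mem_lieAlg_conj] at hX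
    have e2 : (P : Mat[N]) * X * (P⁻¹ : GL (Fin N) ℂ) =
      eig P⁻¹ X := by rw [eig, inv_inv]
    rw [e2] at hX
    have hZe : eig P⁻¹ (Matrix.diagonal fun a => lam a Z) = Z := by
      rw [← hw.eig_coe, eig_inv_eig]
    obtain ⟨d, hd, hneg⟩ := hcone (lam a Z - lam b Z) ⟨_, hX⟩
      (sub_ne_zero.2 (hweights a b hab).1) (fun h => hX0 (eig_injective P⁻¹ (by
        rw [show eig P⁻¹ X = 0 from congrArg Subtype.val h]; simp [eig])))
      (by
        rw [← hZe, ← eig_mul, ← eig_mul, ← eig_sub, heig, eig_smul])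
    exact absurd ((hweights a b hab).2 d hd) (not_le.2 hneg)
  have h1 : g = 1 := mat_injective (eig_injective P (by rw [hone, mat_one, eig_one]))
  exact (inv_mul_eq_one.1 h1).symm

theorem eventually_exists_canonicalSolution (hw : WeightBasis hHG (stdRep G) P lam)
    {X₀ : lieAlg G} (hf : (f : Mat[N]) = (Z : Mat[N]) * X₀ - X₀ * (Z : Mat[N]))
    {ζ : ℂ} (hζ : ζ ≠ 0) : ∀ᶠ y in 𝓝[>] (0 : ℝ), ∀ κ, IsSign κ → ∃ Y : ℂ → G.toSubgroup,
      ∀ r, halfPlane r = halfAt (ζ * dir κ y) → IsCanonicalSolution G (lieIncl hHG Z) f r Y := by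
  classical
  set D := Matrix.diagonal fun a => lam a Z with hD
  have hZe : eig P (Z : Mat[N]) = D := hw.eig_coe Z
  have hfe : eig P (f : Mat[N]) =
      D * eig P (X₀ : Mat[N]) - eig P (X₀ : Mat[N]) * D := by
    rw [hf, eig_sub, eig_mul, eig_mul, hZe]
  obtain ⟨η, X, S, hX⟩ := exists_canonicalRows_of_diag (lam := fun a => lam a Z)
    (f := eig P (f : Mat[N])) (fun a b hab => by
      rw [hfe, Matrix.sub_apply, hD, diagonal_mul, mul_diagonal, hab]; ring) hζ
  filter_upwards [Ioo_mem_nhdsGT hX.pos, eventually_polyEval_eq_zero (G := G.conj P)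
    (diagonal_mem_lieAlg_conj (Z := Z) hw) (eig_mem_lieAlg_conj X₀) hζ] with y hy hvan κ hκ
  set U := halfAt (ζ * dir κ y) with hU
  have hrow := hX.equation κ hκ y hy
  have hmem : ∀ t ∈ U, ∃ g : G.toSubgroup, eig P (mat g) = (X κ y t)⁻¹ := by
    intro t ht
    obtain ⟨v, hv⟩ := hX.isUnit κ hκ y hy t ht
    have hvG : v ∈ (G.conj P).toSubgroup := by
      rw [mem_iff_vanishing]
      intro p hp
      rw [hv]
      exact hvan κ hκ _ (hfe ▸ hrow) (hX.asymptotic κ hκ y hy) p hp t ht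
    refine ⟨⟨P * v⁻¹ * P⁻¹, AlgGroup.mem_conj.1 (inv_mem hvG)⟩, ?_⟩
    have e : mat (⟨P * v⁻¹ * P⁻¹, AlgGroup.mem_conj.1 (inv_mem hvG)⟩ : G.toSubgroup) =
      eig P⁻¹ (v⁻¹ : GL (Fin N) ℂ) := by rw [eig, inv_inv]; rfl
    rw [e, eig_eig_inv, Matrix.coe_units_inv, hv]
  choose! Y hY using hmem
  refine ⟨Y, fun r hr => ⟨?_, ?_⟩⟩
  · rw [hr]
    intro t ht i j
    have hcol := hrow.inv (hX.isUnit κ hκ y hy) t ht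
    have hcol' : ∀ i j, HasDerivAt (fun u => eig P (mat (Y u)) i j)
        (eig P (((t ^ 2)⁻¹ • (Z : Mat[N]) + t⁻¹ • (f : Mat[N])) *
          mat (Y t)) i j) t := by
      intro i j
      refine ((hcol i j).congr_of_eventuallyEq ?_).congr_deriv ?_
      · filter_upwards [(isOpen_halfAt _).mem_nhds ht] with u hu
        rw [hY u hu]
      · rw [eig_mul, hY t ht, eig_add, eig_smul, eig_smul, hZe, hD]
        beta_reduce
        simp only [add_mul, Matrix.smul_mul, Matrix.add_apply, Matrix.smul_apply, smul_eq_mul,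
          diagonal_mul]
        ring
    have := hasDerivAt_eig_entry P⁻¹ hcol' i j
    simpa only [eig_inv_eig, coe_lieIncl] using this
  · rw [hr]
    have hcol := colAsymptotic_iff.1 (hX.asymptotic κ hκ y hy).inv
    have h2 := ((continuous_eig P⁻¹).tendsto 1).comp hcol
    rw [eig_one] at h2
    refine h2.congr' ?_
    filter_upwards [self_mem_nhdsWithin] with t ht
    have he : eig P (NormedSpace.exp (t⁻¹ • (Z : Mat[N]))) =
        Matrix.diagonal fun a => exp (t⁻¹ * lam a Z) := hw.map_exp Z t⁻¹
    simp only [Function.comp, div_eq_inv_mul]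
    rw [← hY t ht, ← he, ← eig_mul, eig_inv_eig, coe_lieIncl]

end Uniqueness

section Roots

variable {N m : ℕ} {G H : AlgGroup N} {hHG : H.toSubgroup ≤ G.toSubgroup}
  {P : GL (Fin N) ℂ} {lam : Fin N → Dual[H]}
  {Z : lieAlg H} {f : lieAlg G}

/-- The operator `ad(h)` on matrices. -/
def adMatrix (h : lieAlg H) : Module.End ℂ (Mat[N]) :=
  LinearMap.mulLeft ℂ (h : Mat[N]) -
    LinearMap.mulRight ℂ (h : Mat[N])

theorem adMatrix_apply (h : lieAlg H) (X : Mat[N]) :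
    adMatrix h X = (h : Mat[N]) * X - X * (h : Mat[N]) := rfl

theorem mem_rootSpace {α : Dual[H]} {X : lieAlg G} : X ∈ rootSpace G H α ↔
      ∀ h : lieAlg H, adMatrix h (X : Mat[N]) = α h • (X : Matrix _ _ ℂ) := Iff.rfl

theorem IsRootDecomposition.unique {X : lieAlg G} {c c' : Dual[H] →₀ lieAlg G}
    (h : IsRootDecomposition G H X c) (h' : IsRootDecomposition G H X c') : c = c' := by
  classical
  have hsum : ∀ c : Dual[H] →₀ lieAlg G, IsRootDecomposition G H X c →
      ∀ s, c.support ⊆ s → ∑ α ∈ s, c α = X := fun c h s hs => by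
    rw [← h.2]; exact (Finsupp.sum_of_support_subset c hs (fun _ Y => Y) fun _ _ => rfl).symm
  set s := c.support ∪ c'.support with hs
  have h0 : ∀ α ∈ s, ((c α - c' α : lieAlg G) : Mat[N]) ∈
      (⊥ : Submodule ℂ (Mat[N])) := by
    refine mem_of_sum_mem ⊥ (fun h : lieAlg H => adMatrix h)
      (fun h w hw => by rw [(Submodule.mem_bot ℂ).1 hw, map_zero]; exact Submodule.zero_mem _)
      (fun (α : Dual[H]) h => α h) s _
      (fun α _ β _ hαβ => LinearMap.ext (congrFun hαβ)) (fun α _ x => ?_) ?_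
    · exact mem_rootSpace.1 (Submodule.sub_mem _ (h.1 α) (h'.1 α)) x
    · rw [← Submodule.coe_sum, sum_sub_distrib, hsum c h s Finset.subset_union_left,
        hsum c' h' s Finset.subset_union_right, sub_self]
      exact Submodule.zero_mem _
  ext1 α
  by_cases hα : α ∈ s
  · exact sub_eq_zero.1 (Subtype.ext ((Submodule.mem_bot ℂ).1 (h0 α hα)))
  · rw [hs, Finset.mem_union, not_or, Finsupp.notMem_support_iff, Finsupp.notMem_support_iff] at hα
    rw [hα.1, hα.2]

theorem IsRootDecomposition.rootComponent_eq {X : lieAlg G}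
    {c : Dual[H] →₀ lieAlg G} (h : IsRootDecomposition G H X c)
    (α : Dual[H]) : rootComponent G H X α = c α := by
  have hex : ∃ c, IsRootDecomposition G H X c := ⟨c, h⟩
  rw [rootComponent, dif_pos hex, hex.choose_spec.unique h]

theorem WeightBasis.eig_adMatrix (hw : WeightBasis hHG (stdRep G) P lam) (h : lieAlg H)
    (X : Mat[N]) (a b : Fin N) : eig P (adMatrix h X) a b = (lam a h - lam b h) * eig P X a b := by
  rw [adMatrix_apply, eig_sub, eig_mul, eig_mul, hw.eig_coe, Matrix.sub_apply, diagonal_mul,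
    mul_diagonal]
  ring

theorem WeightBasis.exists_rootDecomposition (hw : WeightBasis hHG (stdRep G) P lam)
    (X : lieAlg G) : ∃ c, IsRootDecomposition G H X c := by
  classical
  set M := eig P (X : Mat[N]) with hM
  set v : Dual[H] → Mat[N] := fun α =>
    eig P⁻¹ (Matrix.of fun a b => if lam a - lam b = α then M a b else 0) with hv
  set s : Finset (Dual[H]) :=
    Finset.univ.image fun ab : Fin N × Fin N => lam ab.1 - lam ab.2 with hs
  have hev : ∀ α, eig P (v α) = Matrix.of fun a b => if lam a - lam b = α then M a b else 0 :=
    fun α => eig_eig_inv P _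
  have heig : ∀ α (h : lieAlg H), adMatrix h (v α) = α h • v α := by
    intro α h
    refine eig_injective P (Matrix.ext fun a b => ?_)
    rw [hw.eig_adMatrix, eig_smul, Matrix.smul_apply, hev, of_apply, smul_eq_mul]
    split_ifs with hab
    · rw [← hab, LinearMap.sub_apply]
    · simp
  have hsum : ∑ α ∈ s, v α = X := by
    refine eig_injective P (Matrix.ext fun a b => ?_)
    rw [← eigLinear_apply, map_sum, Matrix.sum_apply]
    simp only [eigLinear_apply, hev, of_apply]
    rw [Finset.sum_ite_eq, if_pos (Finset.mem_image.2 ⟨(a, b), Finset.mem_univ _, rfl⟩)]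
  have hz : ∀ α ∉ s, v α = 0 := by
    intro α hα
    refine eig_injective P (Matrix.ext fun a b => ?_)
    rw [hev, of_apply, if_neg fun h => hα (Finset.mem_image.2 ⟨(a, b), Finset.mem_univ _, h⟩)]
    simp [eig]
  have hmem : ∀ α, v α ∈ lieAlg G := by
    intro α
    by_cases hα : α ∈ s
    · exact mem_of_sum_mem (lieAlg G) (fun h : lieAlg H => adMatrix h)
        (fun h w hw => lieAlg_commutator_mem (lieAlg_mono hHG h.2) hw)
        (fun α h => α h) s v (fun α _ β _ hαβ => LinearMap.ext (congrFun hαβ))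
        (fun α _ h => heig α h) (hsum ▸ X.2) α hα
    · rw [hz α hα]; exact Submodule.zero_mem _
  refine ⟨Finsupp.onFinset s (fun α => ⟨v α, hmem α⟩) fun α hα => ?_, fun α => ?_, ?_⟩
  · by_contra h
    exact hα (Subtype.ext (hz α h))
  · exact mem_rootSpace.2 fun h => heig α h
  · rw [Finsupp.onFinset_sum _ fun _ => rfl]
    refine Subtype.ext ?_
    rw [Submodule.coe_sum]
    exact hsum

theorem WeightBasis.exists_rootDecomposition_commutator (hw : WeightBasis hHG (stdRep G) P lam)
    {X₀ : lieAlg G} (hf : (f : Mat[N]) = (Z : Mat[N]) * X₀ - X₀ * (Z : Mat[N])) :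
    ∃ c, IsRootDecomposition G H f c ∧ ∀ α, α Z = 0 → c α = 0 := by
  obtain ⟨c, hc⟩ := hw.exists_rootDecomposition X₀
  refine ⟨Finsupp.onFinset c.support (fun α => α Z • c α) fun α hα => ?_, ⟨fun α => ?_, ?_⟩,
    fun α hα => ?_⟩
  · exact Finsupp.mem_support_iff.2 fun h => hα (by rw [h, smul_zero])
  · exact Submodule.smul_mem _ _ (hc.1 α)
  · rw [Finsupp.onFinset_sum _ fun _ => rfl]
    refine Subtype.ext ?_
    rw [hf, ← adMatrix_apply, ← hc.2, Finsupp.sum, Submodule.coe_sum, Submodule.coe_sum, map_sum]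
    exact sum_congr rfl fun α _ => (mem_rootSpace.1 (hc.1 α) Z).symm
  · rw [Finsupp.onFinset_apply, hα, zero_smul]

theorem WeightBasis.finite_rootsZ (hw : WeightBasis hHG (stdRep G) P lam) :
    (rootsZ G H Z).Finite := by
  refine (Set.finite_range fun ab : Fin N × Fin N => lam ab.1 - lam ab.2).subset ?_
  rintro α ⟨⟨-, hα⟩, -⟩
  obtain ⟨X, hX, hX0⟩ := Submodule.exists_mem_ne_zero_of_ne_bot hα
  have hne : eig P (X : Mat[N]) ≠ 0 := fun h => hX0 (Subtype.ext
    (eig_injective P (by rw [h]; simp [eig])))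
  obtain ⟨a, ha⟩ := Function.ne_iff.1 hne
  obtain ⟨b, hab⟩ := Function.ne_iff.1 ha
  refine ⟨(a, b), LinearMap.ext fun h => ?_⟩
  have h1 := hw.eig_adMatrix h X a b
  rw [mem_rootSpace.1 hX h, eig_smul, Matrix.smul_apply, smul_eq_mul] at h1
  exact (mul_right_cancel₀ hab h1).symm

variable {ρ : RationalRep G m} {Q : GL (Fin m) ℂ}
  {mu : Fin m → Dual[H]}

theorem WeightBasis.weight_of_mem_rootSpace (hρ : WeightBasis hHG ρ Q mu)
    {α : Dual[H]} {X : lieAlg G} (hX : X ∈ rootSpace G H α) {i k : Fin m}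
    (hne : eig Q (ρ.diff X) i k ≠ 0) : mu i Z - mu k Z = α Z := by
  have h1 := ρ.diff_commutator (lieIncl hHG Z) X
  have h2 : (⟨_, lieAlg_commutator_mem (lieIncl hHG Z).2 X.2⟩ : lieAlg G) = α Z • X :=
    Subtype.ext (mem_rootSpace.1 hX Z)
  rw [h2, ← ρ.diffLinear_apply (α Z • X), map_smul, ρ.diffLinear_apply] at h1
  have h3 := congrFun (congrFun (congrArg (eig Q) h1) i) k
  have hd : eig Q (ρ.diff (lieIncl hHG Z)) = Matrix.diagonal fun a => mu a Z := hρ.diff Z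
  rw [eig_sub, eig_mul, eig_mul, hd, Matrix.sub_apply, diagonal_mul, mul_diagonal,
    eig_smul, Matrix.smul_apply, smul_eq_mul, mul_comm (eig Q _ i k), ← sub_mul] at h3
  exact mul_right_cancel₀ hne h3

theorem weighted_rootComponent [Fintype (rootsZ G H Z)] (hρ : WeightBasis hHG ρ Q mu)
    {c : Dual[H] →₀ lieAlg G} (hc : IsRootDecomposition G H f c) :
    Weighted (fun a => mu a Z) (fun α : rootsZ G H Z => (α : Dual[H]) Z)
      fun α => eig Q (ρ.diff (rootComponent G H f α)) :=
  ⟨fun α => α.2.2, fun α _ _ hne => hρ.weight_of_mem_rootSpace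
    (hc.rootComponent_eq (α : Dual[H]) ▸ hc.1 α) hne⟩

theorem sum_eig_rootComponent [Fintype (rootsZ G H Z)] (Q : GL (Fin m) ℂ)
    {c : Dual[H] →₀ lieAlg G} (hc : IsRootDecomposition G H f c) (hc0 : ∀ α, α Z = 0 → c α = 0) :
    ∑ α : rootsZ G H Z, eig Q (ρ.diff (rootComponent G H f α)) = eig Q (ρ.diff f) := by
  classical
  have h1 : ∑ α : rootsZ G H Z, rootComponent G H f α = f := by
    conv_rhs => rw [← hc.2, Finsupp.sum]
    simp only [hc.rootComponent_eq]
    have hsub : ∀ α ∈ c.support, α ∈ rootsZ G H Z := by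
      intro α hα
      rw [Finsupp.mem_support_iff] at hα
      refine ⟨⟨fun h0 => hα (hc0 _ (by rw [h0, LinearMap.zero_apply])), fun hbot => ?_⟩,
        fun h0 => hα (hc0 _ h0)⟩
      have := hc.1 α
      rw [hbot] at this
      exact hα ((Submodule.mem_bot ℂ).1 this)
    rw [Finset.sum_set_coe (rootsZ G H Z) (f := fun α => c α)]
    exact (Finset.sum_subset (fun α hα => Set.mem_toFinset.2 (hsub α hα)) fun α _ hα =>
      Finsupp.notMem_support_iff.1 hα).symm
  simp only [← eigLinear_apply, ← ρ.diffLinear_apply, ← map_sum]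
  rw [h1]

theorem eig_list_prod (Q : GL (Fin m) ℂ)
    (l : List (Mat[m])) : eig Q l.prod = (l.map (eig Q)).prod := by
  induction l with
  | nil => simp [eig_one]
  | cons a l ih => rw [List.prod_cons, eig_mul, ih, List.map_cons, List.prod_cons]

theorem eig_stokesTerm [Fintype (rootsZ G H Z)] (Q : GL (Fin m) ℂ)
    (ℓ : Set ℂ) (n : ℕ) : eig Q (stokesTerm Z f ℓ ρ n) =
      wordTerm (fun α : rootsZ G H Z => (α : Dual[H]) Z)
        (fun α => eig Q (ρ.diff (rootComponent G H f α))) ℓ n := by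
  classical
  have hset : {α : Fin n → rootsZ G H Z | (∑ i, (α i : Dual[H])) Z ∈ ℓ} =
      ((Finset.univ.filter fun α : Fin n → rootsZ G H Z =>
        ∑ i, (α i : Dual[H]) Z ∈ ℓ : Finset _) : Set _) := by
    ext α
    simp [LinearMap.sum_apply]
  rw [stokesTerm, hset, finsum_mem_coe_finset, ← eigLinear_apply, map_sum, wordTerm]
  refine sum_congr (by congr) fun α _ => ?_
  rw [map_smul, eigLinear_apply, eig_list_prod, List.map_ofFn, wordProd]
  rfl

end Roots

section StokesFactor

variable {N m : ℕ} {G H : AlgGroup N} {hHG : H.toSubgroup ≤ G.toSubgroup}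
  {P : GL (Fin N) ℂ} {lam : Fin N → Dual[H]}
  {Z : lieAlg H} {f : lieAlg G} {ζ : ℂ}

theorem self_mem_halfAt_mul (hζ : ζ ≠ 0) (κ y : ℝ) : ζ ∈ halfAt (ζ * dir κ y) := by
  rw [mem_halfAt_mul hζ, div_self hζ, mem_halfAt_dir]
  simp

/-- The eigenvalues of `ad(Z)` avoid a closed sector free of Stokes rays. -/
theorem not_mem_sector_of_not_isStokesRay {Z' : lieAlg G} (hζ : ζ ≠ 0) {κ : ℝ}
    (hκ : IsSign κ) {θ₀ : ℝ} (hθ₀ : θ₀ ∈ Ioo 0 (π / 2))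
    (hns : ∀ θ ∈ Ioc 0 θ₀, ¬ IsStokesRay G Z' (rotate (κ * θ) (ray ζ))) {w : ℂ} {X : lieAlg G}
    (hw : w ≠ 0) (hX : X ≠ 0) (hwX : (Z' : Mat[N]) * X - X * (Z' : Mat[N]) =
      w • (X : Mat[N])) (hre : 0 < (w / ζ).re) (him : 0 < κ * (w / ζ).im) :
    tan θ₀ * (w / ζ).re < κ * (w / ζ).im := by
  by_contra hle
  rw [not_lt] at hle
  set q := κ * (w / ζ).im / (w / ζ).re with hq
  have hq0 : 0 < q := div_pos him hre
  have hθ : arctan q ∈ Ioo 0 (π / 2) :=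
    ⟨Real.arctan_pos.2 hq0, Real.arctan_lt_pi_div_two q⟩
  have hqle : arctan q ≤ θ₀ := by
    rw [← Real.arctan_tan (by linarith [hθ₀.1, pi_pos]) hθ₀.2]
    exact Real.arctan_mono ((div_le_iff₀ hre).2 hle)
  refine hns _ ⟨hθ.1, hqle⟩ ⟨w, hw, ?_, X, hX, hwX⟩
  have hcos : 0 < Real.cos (arctan q) := Real.cos_arctan_pos q
  rw [rotate_ray, exp_mul_I_eq hκ hθ, mul_assoc, ray_ofReal_mul hcos, Real.tan_arctan]
  have hκκ := hκ.mul_self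
  have e : w = ((w / ζ).re : ℂ) * (dir κ q * ζ) := by
    have h1 : w / ζ = ((w / ζ).re : ℂ) * dir κ q := by
      apply Complex.ext
      · simp [dir]
      · simp only [dir, im_ofReal_mul, hq]
        rw [← mul_div_assoc, ← mul_assoc, hκκ, one_mul, mul_div_cancel₀ _ hre.ne']
    rw [← mul_assoc, ← h1, div_mul_cancel₀ _ hζ]
  rw [e, ray_ofReal_mul hre]

theorem eq_of_isCanonicalSolution (hw : WeightBasis hHG (stdRep G) P lam) (hζ : ζ ≠ 0) {κ : ℝ}
    (hκ : IsSign κ) {θ₁ θ₂ : ℝ} (hθ₁ : θ₁ ∈ Ioo 0 (π / 2)) (hθ₂ : θ₂ ∈ Ioo 0 (π / 2))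
    (hns₁ : ∀ θ ∈ Ioc 0 θ₁, ¬ IsStokesRay G (lieIncl hHG Z) (rotate (κ * θ) (ray ζ)))
    (hns₂ : ∀ θ ∈ Ioc 0 θ₂, ¬ IsStokesRay G (lieIncl hHG Z) (rotate (κ * θ) (ray ζ)))
    {Y₁ Y₂ : ℂ → G.toSubgroup}
    (h₁ : IsCanonicalSolution G (lieIncl hHG Z) f (rotate (κ * θ₁) (ray ζ)) Y₁)
    (h₂ : IsCanonicalSolution G (lieIncl hHG Z) f (rotate (κ * θ₂) (ray ζ)) Y₂) : Y₁ ζ = Y₂ ζ := by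
  have ht₁ := Real.tan_pos_of_pos_of_lt_pi_div_two hθ₁.1 hθ₁.2
  have ht₂ := Real.tan_pos_of_pos_of_lt_pi_div_two hθ₂.1 hθ₂.2
  refine h₁.eq_of_cone hw (halfPlane_rotate hζ hκ hθ₁) (halfPlane_rotate hζ hκ hθ₂) h₂
    (fun w X hw0 hX hwX => ?_) ⟨self_mem_halfAt_mul hζ _ _, self_mem_halfAt_mul hζ _ _⟩
  obtain ⟨η, hη₁, hη₂, hη⟩ : ∃ η, tan θ₁ < η ∧ tan θ₂ < η ∧ w / ζ ∉ sector κ η := by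
    by_cases hpos : 0 < (w / ζ).re ∧ 0 < κ * (w / ζ).im
    · have e₁ := not_mem_sector_of_not_isStokesRay hζ hκ hθ₁ hns₁ hw0 hX hwX hpos.1 hpos.2
      have e₂ := not_mem_sector_of_not_isStokesRay hζ hκ hθ₂ hns₂ hw0 hX hwX hpos.1 hpos.2
      refine ⟨κ * (w / ζ).im / (w / ζ).re, (lt_div_iff₀ hpos.1).2 e₁, (lt_div_iff₀ hpos.1).2 e₂,
        fun h => ?_⟩
      have h3 := h.2.2
      rw [div_mul_cancel₀ _ hpos.1.ne'] at h3
      exact lt_irrefl _ h3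
    · exact ⟨max (tan θ₁) (tan θ₂) + 1, by linarith [le_max_left (tan θ₁) (tan θ₂)],
        by linarith [le_max_right (tan θ₁) (tan θ₂)], fun h => hpos ⟨h.1, h.2.1⟩⟩
  exact exists_direction_mul hζ hκ ht₁ ht₂ hη₁ hη₂ hw0 hη

theorem IsStokesFactor.unique (hw : WeightBasis hHG (stdRep G) P lam) (hζ : ζ ≠ 0)
    {S S' : G.toSubgroup} (hS : IsStokesFactor G (lieIncl hHG Z) f (ray ζ) S)
    (hS' : IsStokesFactor G (lieIncl hHG Z) f (ray ζ) S') : S = S' := by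
  obtain ⟨θp, hθp, θm, hθm, hns, Yp, Ym, hYp, hYm, h⟩ := hS
  obtain ⟨θp', hθp', θm', hθm', hns', Yp', Ym', hYp', hYm', h'⟩ := hS'
  have hp : Yp ζ = Yp' ζ := by
    rw [← neg_one_mul] at hYp hYp'
    refine eq_of_isCanonicalSolution hw hζ (Or.inr rfl) hθp hθp' (fun θ hθ => ?_) (fun θ hθ => ?_)
      hYp hYp' <;> rw [neg_one_mul]
    · exact hns _ ⟨by linarith [hθ.2], by linarith [hθ.1, hθm.1]⟩ (by linarith [hθ.1])
    · exact hns' _ ⟨by linarith [hθ.2], by linarith [hθ.1, hθm'.1]⟩ (by linarith [hθ.1])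
  have hm : Ym ζ = Ym' ζ := by
    rw [← one_mul θm] at hYm
    rw [← one_mul θm'] at hYm'
    refine eq_of_isCanonicalSolution hw hζ (Or.inl rfl) hθm hθm' (fun θ hθ => ?_) (fun θ hθ => ?_)
      hYm hYm' <;> rw [one_mul]
    · exact hns _ ⟨by linarith [hθ.1, hθp.1], hθ.2⟩ hθ.1.ne'
    · exact hns' _ ⟨by linarith [hθ.1, hθp'.1], hθ.2⟩ hθ.1.ne'
  have hmem : ∀ θ ∈ Ioo 0 (π / 2), ∀ θ' ∈ Ioo 0 (π / 2),
      ζ ∈ halfPlane (rotate (-θ) (ray ζ)) ∩ halfPlane (rotate θ' (ray ζ)) := by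
    intro θ hθ θ' hθ'
    rw [← neg_one_mul, ← one_mul θ', halfPlane_rotate hζ (Or.inr rfl) hθ,
      halfPlane_rotate hζ (Or.inl rfl) hθ']
    exact ⟨self_mem_halfAt_mul hζ _ _, self_mem_halfAt_mul hζ _ _⟩
  have e := h ζ (hmem _ hθp _ hθm)
  rw [hp, hm, h' ζ (hmem _ hθp' _ hθm')] at e
  exact (mul_left_cancel e).symm

theorem not_isStokesRay_rotate (hw : WeightBasis hHG (stdRep G) P lam) (hζ : ζ ≠ 0) {η : ℝ}
    (hη : ∀ κ, IsSign κ → ∀ a b, (lam a Z - lam b Z) / ζ ∉ sector κ η) {κ : ℝ}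
    (hκ : IsSign κ) {θ : ℝ} (hθ : θ ∈ Ioo 0 (π / 2)) (hθη : tan θ < η) :
    ¬ IsStokesRay G (lieIncl hHG Z) (rotate (κ * θ) (ray ζ)) := by
  rintro ⟨w, hw0, hr, X, hX, hwX⟩
  have hne : eig P (X : Mat[N]) ≠ 0 := fun h => hX (Subtype.ext
    (eig_injective P (by rw [h]; simp [eig])))
  obtain ⟨a, ha⟩ := Function.ne_iff.1 hne
  obtain ⟨b, hab⟩ := Function.ne_iff.1 ha
  have h1 := hw.eig_adMatrix Z X a b
  rw [show adMatrix Z (X : Mat[N]) = w • (X : Mat[N]) from hwX,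
    eig_smul, Matrix.smul_apply, smul_eq_mul] at h1
  have hwab := mul_right_cancel₀ hab h1
  refine hη κ hκ a b ?_
  rw [← hwab]
  have hcos : 0 < Real.cos θ := Real.cos_pos_of_mem_Ioo ⟨by linarith [hθ.1, pi_pos], hθ.2⟩
  rw [rotate_ray, exp_mul_I_eq hκ hθ, mul_assoc, ray_ofReal_mul hcos] at hr
  obtain ⟨c, hc, hcw⟩ : w ∈ ray (dir κ (tan θ) * ζ) := hr ▸ ⟨1, one_pos, by simp⟩
  have e : w / ζ = (c : ℂ) * dir κ (tan θ) := by rw [hcw]; field_simp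
  have hκκ := hκ.mul_self
  have htan := Real.tan_pos_of_pos_of_lt_pi_div_two hθ.1 hθ.2
  have him : κ * (w / ζ).im = c * tan θ := by
    rw [e, im_ofReal_mul, dir]
    linear_combination c * tan θ * hκκ
  have hre : (w / ζ).re = c := by rw [e, re_ofReal_mul, dir, mul_one]
  refine ⟨by rwa [hre], by rw [him]; positivity, ?_⟩
  rw [him, hre, mul_comm]
  exact mul_lt_mul_of_pos_right hθη hc

theorem IsCanonicalSolution.inv_mul_eq (hw : WeightBasis hHG (stdRep G) P lam) {r₁ r₂ : Set ℂ}
    {u₁ u₂ : ℂ} (hr₁ : halfPlane r₁ = halfAt u₁) (hr₂ : halfPlane r₂ = halfAt u₂)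
    {Y₁ Y₂ : ℂ → G.toSubgroup} (h₁ : IsCanonicalSolution G (lieIncl hHG Z) f r₁ Y₁)
    (h₂ : IsCanonicalSolution G (lieIncl hHG Z) f r₂ Y₂) {t t' : ℂ}
    (ht : t ∈ halfAt u₁ ∩ halfAt u₂) (ht' : t' ∈ halfAt u₁ ∩ halfAt u₂) :
    (Y₂ t)⁻¹ * Y₁ t = (Y₂ t')⁻¹ * Y₁ t' := by
  refine mat_injective (eig_injective P ?_)
  have hrow : RowEquation (fun a => lam a Z) (eig P ((stdRep G).diff f)) (halfAt u₁ ∩ halfAt u₂)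
      fun t => (eig P ((stdRep G).toHom (Y₂ t)))⁻¹ := fun t ht =>
    (hr₂ ▸ h₂.colEquation hw).inv (fun _ _ => isUnit_eig_rep P _) t ht.2
  have hcol : ColEquation (fun a => lam a Z) (eig P ((stdRep G).diff f)) (halfAt u₁ ∩ halfAt u₂)
      fun t => eig P ((stdRep G).toHom (Y₁ t)) := fun t ht => (hr₁ ▸ h₁.colEquation hw) t ht.1
  have := hrow.mul_col_eq ((convex_halfAt u₁).inter (convex_halfAt u₂)) hcol ht ht'
  simp only [inv_eig_stdRep] at this
  simpa only [coe_stdRep, ← eig_mul, ← mat_mul] using this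

theorem exists_isStokesFactor_rep (hw : WeightBasis hHG (stdRep G) P lam)
    {X₀ : lieAlg G} (hf : (f : Mat[N]) = (Z : Mat[N]) * X₀ - X₀ * (Z : Mat[N])) (hζ : ζ ≠ 0)
    {ρ : RationalRep G m} {Q : GL (Fin m) ℂ} {mu : Fin m → Dual[H]} (hρ : WeightBasis hHG ρ Q mu) :
    ∃ S : G.toSubgroup, IsStokesFactor G (lieIncl hHG Z) f (ray ζ) S ∧
      (∀ i j, Summable fun n : ℕ => ‖stokesTerm Z f (ray ζ) ρ (n + 1) i j‖) ∧
      HasSum (fun n : ℕ => stokesTerm Z f (ray ζ) ρ (n + 1)) ((ρ.toHom S : Mat[m]) - 1) := by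
  classical
  obtain ⟨c, hc, hc0⟩ := hw.exists_rootDecomposition_commutator hf
  have : Fintype (rootsZ G H Z) := (hw.finite_rootsZ (Z := Z)).fintype
  obtain ⟨η, X, T, hX, hT⟩ := (weighted_rootComponent (Z := Z) hρ hc).exists_canonicalRows hζ
  rw [sum_eig_rootComponent Q hc hc0] at hX
  obtain ⟨η', hη', hav⟩ := exists_sector_avoiding
    (Finset.univ.image fun ab : Fin N × Fin N => (lam ab.1 Z - lam ab.2 Z) / ζ)
  have hev : ∀ {η : ℝ}, 0 < η → ∀ᶠ y in 𝓝[>] (0 : ℝ), y ∈ Ioo 0 η := fun h => Ioo_mem_nhdsGT h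
  obtain ⟨y, ⟨hy, hy'⟩, hY⟩ := (((hev hX.pos).and (hev hη')).and
    (eventually_exists_canonicalSolution hw hf hζ)).exists
  set θ := arctan y with hθdef
  have hθ : θ ∈ Ioo 0 (π / 2) := ⟨Real.arctan_pos.2 hy.1, Real.arctan_lt_pi_div_two y⟩
  have htan : tan θ = y := Real.tan_arctan y
  have hhalf : ∀ κ, IsSign κ →
      halfPlane (rotate (κ * θ) (ray ζ)) = halfAt (ζ * dir κ y) := fun κ hκ => by
    rw [halfPlane_rotate hζ hκ hθ, htan]
  obtain ⟨Yp, hYp⟩ := hY (-1) (Or.inr rfl)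
  obtain ⟨Ym, hYm⟩ := hY 1 (Or.inl rfl)
  replace hYp := hYp _ (hhalf _ (Or.inr rfl))
  replace hYm := hYm _ (hhalf _ (Or.inl rfl))
  have hself := fun κ => self_mem_halfAt_mul hζ κ y
  set S : G.toSubgroup := (Ym ζ)⁻¹ * Yp ζ with hS
  have hfac : IsStokesFactor G (lieIncl hHG Z) f (ray ζ) S := by
    refine ⟨θ, hθ, θ, hθ, fun φ hφ hφ0 => ?_, Yp, Ym, by rwa [← neg_one_mul],
      by rwa [← one_mul θ], fun t ht => ?_⟩
    · have hns := fun (κ : ℝ) (hκ : IsSign κ) (ψ : ℝ) (h0 : 0 < ψ) (hle : ψ ≤ θ) =>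
        not_isStokesRay_rotate hw hζ (η := η') (fun κ hκ a b => hav κ hκ _
          (Finset.mem_image.2 ⟨(a, b), Finset.mem_univ _, rfl⟩)) hκ (θ := ψ)
          ⟨h0, hle.trans_lt hθ.2⟩ (lt_of_le_of_lt (by
            rw [← htan]
            exact Real.strictMonoOn_tan.monotoneOn ⟨by linarith [pi_pos], hle.trans_lt hθ.2⟩
              ⟨by linarith [hθ.1, pi_pos], hθ.2⟩ hle) hy'.2)
      rcases lt_or_gt_of_ne hφ0 with h | h
      · have := hns (-1) (Or.inr rfl) (-φ) (by linarith) (by linarith [hφ.1])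
        rwa [neg_one_mul, neg_neg] at this
      · have := hns 1 (Or.inl rfl) φ h hφ.2
        rwa [one_mul] at this
    · rw [← neg_one_mul θ, hhalf _ (Or.inr rfl)] at ht
      nth_rewrite 1 [← one_mul θ] at ht
      rw [hhalf _ (Or.inl rfl)] at ht
      rw [hS, ← hYp.inv_mul_eq hw (hhalf _ (Or.inr rfl)) (hhalf _ (Or.inl rfl)) hYm ht
        ⟨hself _, hself _⟩, mul_inv_cancel_left]
  have hcol : ∀ κ, IsSign κ → ∀ Y,
      IsCanonicalSolution G (lieIncl hHG Z) f (rotate (κ * θ) (ray ζ)) Y →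
      X κ y ζ * eig Q (ρ.toHom (Y ζ)) = 1 := fun κ hκ Y hY =>
    hX.mul_col hζ hκ hy (hhalf κ hκ ▸ hY.colEquation hρ) (hhalf κ hκ ▸ hY.colAsymptotic hρ) (hself κ)
  have hρS : eig Q (ρ.toHom S) = 1 + T := by
    have e1 : eig Q (ρ.toHom (Ym ζ)⁻¹) = X 1 y ζ := by
      calc eig Q (ρ.toHom (Ym ζ)⁻¹)
          = X 1 y ζ * eig Q (ρ.toHom (Ym ζ)) * eig Q (ρ.toHom (Ym ζ)⁻¹) := by
            rw [hcol 1 (Or.inl rfl) Ym hYm, one_mul]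
        _ = X 1 y ζ := by
            rw [mul_assoc, ← eig_mul, ← ρ.coe_mul, mul_inv_cancel, ρ.coe_one, eig_one, mul_one]
    rw [hS, ρ.coe_mul, eig_mul, e1, hX.jump y hy y hy ζ ⟨hself _, hself _⟩, mul_assoc,
      hcol (-1) (Or.inr rfl) Yp hYp, mul_one]
  have hterm : ∀ n, stokesTerm Z f (ray ζ) ρ n = eig Q⁻¹
      (wordTerm (fun α : rootsZ G H Z => (α : Dual[H]) Z)
        (fun α => eig Q (ρ.diff (rootComponent G H f α))) (ray ζ) n) := fun n => by
    rw [← eig_stokesTerm, eig_inv_eig]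
  refine ⟨S, hfac, fun i j => ?_, ?_⟩
  · simp only [hterm, eig, Matrix.mul_apply, sum_mul]
    refine Summable.of_nonneg_of_le (fun _ => norm_nonneg _) (fun n => (norm_sum_le _ _).trans
      (sum_le_sum fun k _ => norm_sum_le _ _)) ?_
    refine summable_sum fun k _ => summable_sum fun l _ => ?_
    simp only [norm_mul]
    exact ((hT l k).1.mul_left _).mul_right _
  · have h1 : HasSum (fun n : ℕ => wordTerm (fun α : rootsZ G H Z =>
        (α : Dual[H]) Z) (fun α => eig Q (ρ.diff (rootComponent G H f α)))
          (ray ζ) (n + 1)) T :=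
      Pi.hasSum.2 fun i => Pi.hasSum.2 fun j => (hT i j).2
    have h2 := h1.map (eigLinear Q⁻¹) (continuous_eig Q⁻¹)
    have h3 : eigLinear Q⁻¹ T = (ρ.toHom S : Mat[m]) - 1 := by
      rw [eigLinear_apply, eq_sub_iff_add_eq, ← eig_inv_eig Q (ρ.toHom S : Mat[m]),
        hρS, eig_add, eig_one, add_comm]
    rw [h3] at h2
    exact h2.congr_fun fun n => by rw [hterm]; rfl

theorem IsTorus.stokesFactor (hH : IsTorus H) (hHG : H.toSubgroup ≤ G.toSubgroup) (Z : lieAlg H)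
    {X₀ : lieAlg G} (hf : (f : Mat[N]) = (Z : Mat[N]) * X₀ - X₀ * (Z : Mat[N])) (hζ : ζ ≠ 0) :
    (∃! S : G.toSubgroup, IsStokesFactor G (lieIncl hHG Z) f (ray ζ) S) ∧
    ∀ S : G.toSubgroup, IsStokesFactor G (lieIncl hHG Z) f (ray ζ) S →
      ∀ (m : ℕ) (ρ : RationalRep G m),
        (∀ i j, Summable fun n : ℕ => ‖stokesTerm Z f (ray ζ) ρ (n + 1) i j‖) ∧
        (ρ.toHom S : Mat[m]) = 1 + ∑' n : ℕ, stokesTerm Z f (ray ζ) ρ (n + 1) := by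
  obtain ⟨P, lam, hw⟩ := hH.exists_weightBasis hHG (stdRep G)
  constructor
  · obtain ⟨S, hS, -⟩ := exists_isStokesFactor_rep hw hf hζ hw
    exact ⟨S, hS, fun S' h => h.unique hw hζ hS⟩
  · intro S hS m ρ
    obtain ⟨Q, mu, hρ⟩ := hH.exists_weightBasis hHG ρ
    obtain ⟨S', hS', hsum, hsum'⟩ := exists_isStokesFactor_rep hw hf hζ hρ
    refine ⟨hsum, ?_⟩
    rw [hS.unique hw hζ hS', hsum'.tsum_eq, add_sub_cancel]

end StokesFactor

end StokesFactors

end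

theorem theorem4p1 {N : ℕ} (G H : StokesFactors.AlgGroup N)
    (hHG : H.toSubgroup ≤ G.toSubgroup) (hH : StokesFactors.IsTorus H)
    (Z f : StokesFactors.lieAlg G)
    (hZ : Module.End.IsSemisimple (Matrix.toLin' (Z : Matrix (Fin N) (Fin N) ℂ)))
    (hZH : (Z : Matrix (Fin N) (Fin N) ℂ) ∈ StokesFactors.lieAlg H)
    (hf : ∃ X : StokesFactors.lieAlg G, (f : Matrix (Fin N) (Fin N) ℂ) =
      (Z : Matrix (Fin N) (Fin N) ℂ) * (X : Matrix (Fin N) (Fin N) ℂ) -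
        (X : Matrix (Fin N) (Fin N) ℂ) * (Z : Matrix (Fin N) (Fin N) ℂ))
    (ℓ : Set ℂ) (hℓ : StokesFactors.IsStokesRay G Z ℓ) :
    (∃! S : G.toSubgroup, StokesFactors.IsStokesFactor G Z f ℓ S) ∧
    ∀ S : G.toSubgroup, StokesFactors.IsStokesFactor G Z f ℓ S →
      ∀ (m : ℕ) (ρ : StokesFactors.RationalRep G m),
        (∀ i j, Summable fun n : ℕ =>
          ‖StokesFactors.stokesTerm (⟨Z, hZH⟩ : StokesFactors.lieAlg H) f ℓ ρ (n + 1) i j‖) ∧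
        (ρ.toHom S : Matrix (Fin m) (Fin m) ℂ) =
          1 + ∑' n : ℕ,
            StokesFactors.stokesTerm (⟨Z, hZH⟩ : StokesFactors.lieAlg H) f ℓ ρ (n + 1) := by
  obtain ⟨ζ, hζ, rfl, -⟩ := hℓ
  obtain ⟨X₀, hX₀⟩ := hf
  exact hH.stokesFactor hHG ⟨Z, hZH⟩ hX₀ hζ
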